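/- Write $D_0=\{z\in\mathbb C:|z|>1\}$. A basic map of logarithmic capacity $c>0$ is an injective holomorphic map $F:D_0\to D_0$ with $F(z)/z\to e^c$ as $z\to\infty$. It has regularity $\Lambda\in[0,\infty)$ if, for all $|z|>1$, $$\left|\log\left(\frac{F(z)}z\right)-c\,\frac{z+1}{z-1}\right|\le\frac{\Lambda c^{3/2}|z|}{|z-1|(|z|-1)},$$ where the branch of $\log(F(z)/z)$ is the one that is continuous on $D_0$ with limit $c$ at $\infty$. Given $\eta\in\mathbb R$ and $\sigma>0$, an ALE$(\eta)$ process with basic map $F$ and regularization parameter $\sigma$ is a process $(\Phi_n)_{n\ge0}$ of maps on $D_0$ of the form $\Phi_0(z)=z$, $\Phi_n=\Phi_{n-1}\circ F_n$, $F_n(z)=e^{i\Theta_n}F(e^{-i\Theta_n}z)$, where $(\Theta_n)_{n\ge1}$ are real random variables on a probability space such that, for all $n\ge1$ and all Borel sets $B\subseteq\mathbb R$, almost surely, $$\mathbb P(\Theta_n\in B\mid\Theta_1,\dots,\Theta_{n-1})=\frac1{2\pi}\int_0^{2\pi}1_B(\theta)h_n(\theta)\,d\theta,\qquad h_n(\theta)=\frac{|\Phi_{n-1}'(e^{\sigma+i\theta})|^{-\eta}}{\frac1{2\pi}\int_0^{2\pi}|\Phi_{n-1}'(e^{\sigma+it})|^{-\eta}\,dt}.$$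 **Theorem.** Let $\Lambda\in[0,\infty)$, $m\in\mathbb N$ and $T\in[0,\infty)$. (i) For all $\eta\in(-\infty,1)$ and $\varepsilon\in(0,1/2)$ there is a constant $C=C(\eta,\varepsilon,\Lambda,m,T)<\infty$ with the following property. Let $c\in(0,1]$, let $F$ be a basic map of logarithmic capacity $c$ and regularity $\Lambda$, let $\sigma$ satisfy $e^\sigma\ge1+c^{1/2-\varepsilon}$, and let $(\Phi_n)_{n\ge0}$ be an ALE$(\eta)$ process with basic map $F$ and regularization parameter $\sigma$. Then there is an event $\Omega_1$ of probability exceeding $1-c^m$ on which, for all integers $0\le n\le T/c$ and all $|z|\ge1+c^{1/2-\varepsilon}$, $$|\Phi_n(z)-e^{cn}z|\le C\left(c^{1/2-\varepsilon}+\frac{c^{1-\varepsilon}}{(e^\sigma-1)^2}\right).$$ (ii) For all $\varepsilon\in(0,1/5)$ there is a constant $C=C(\varepsilon,\Lambda,m,T)<\infty$ with the following property. Let $c\in(0,1]$, let $F$ be a basic map of logarithmic capacity $c$ and regularity $\Lambda$, let $\sigma$ satisfy $e^\sigma\ge1+c^{1/5-\varepsilon}$, and let $(\Phi_n)_{n\ge0}$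 be an ALE$(1)$ process with basic map $F$ and regularization parameter $\sigma$. Then there is an event $\Omega_1$ of probability exceeding $1-c^m$ on which, for all integers $0\le n\le T/c$ and all $|z|\ge1+c^{1/5-\varepsilon}$, $$|\Phi_n(z)-e^{cn}z|\le C\left(c^{1/2-\varepsilon}\left(\frac{|z|}{|z|-1}\right)^{1/2}+\frac{c^{1-\varepsilon}}{(e^\sigma-1)^3}\right).$$ -/

import Mathlib

open Filter Topology MeasureTheory ProbabilityTheory

universe u

noncomputable section

namespace ALE

/-- The exterior `{|z| > 1}` of the closed unit disk. -/
def exteriorDisk : Set ℂ := {z | 1 < ‖z‖}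

/-- `F` (only its values on `{|z| > 1}` matter) is a basic map of logarithmic capacity `c`:
a univalent holomorphic map from `{|z| > 1}` into `{|z| > 1}`, fixing `∞`, with `c > 0` and
`F'(∞) = lim F(z)/z = e^c`. -/
structure IsBasicMap (F : ℂ → ℂ) (c : ℝ) : Prop where
  capacity_pos : 0 < c
  differentiableOn : DifferentiableOn ℂ F exteriorDisk
  injOn : Set.InjOn F exteriorDisk
  mapsTo : Set.MapsTo F exteriorDisk exteriorDisk
  tendsto_div : Tendsto (fun z => F z / z) (Bornology.cobounded ℂ) (𝓝 ((Real.exp c : ℝ) : ℂ))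

/-- `F` (of capacity `c`) has regularity `Λ`. The function `L` is the branch of `log (F(z)/z)`
that is continuous on `{|z| > 1}` with limit `c` at `∞`; there is only one such branch, because
`{|z| > 1}` is connected. -/
def HasRegularity (F : ℂ → ℂ) (c Λ : ℝ) : Prop :=
  ∃ L : ℂ → ℂ, ContinuousOn L exteriorDisk ∧
    (∀ z ∈ exteriorDisk, Complex.exp (L z) = F z / z) ∧
    Tendsto L (Bornology.cobounded ℂ) (𝓝 (c : ℂ)) ∧
    ∀ z ∈ exteriorDisk,
      ‖L z - c * ((z + 1) / (z - 1))‖ ≤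
        Λ * c ^ (3 / 2 : ℝ) * ‖z‖ / (‖z - 1‖ * (‖z‖ - 1))

/-- The basic map rotated by the angle `t`: `z ↦ e^{it} F(e^{-it} z)`. -/
def rotate (F : ℂ → ℂ) (t : ℝ) (z : ℂ) : ℂ :=
  Complex.exp (t * Complex.I) * F (Complex.exp (-(t * Complex.I)) * z)

/-- The map `Φ_n` built from the attachment angles `θ 0, θ 1, …`, where `θ k` is the angle of the
`(k + 1)`-st particle: `Φ_0 = id` and `Φ_{n+1} = Φ_n ∘ F_{n+1}` with `F_{n+1}` the basic map
rotated by `θ n`. -/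
def clusterMap (F : ℂ → ℂ) (θ : ℕ → ℝ) : ℕ → ℂ → ℂ
  | 0 => fun z => z
  | n + 1 => fun z => clusterMap F θ n (rotate F (θ n) z)

/-- The unnormalized density `|Φ_n'(e^{σ + it})|^{-η}` of the angle of the `(n + 1)`-st particle. -/
def weight (F : ℂ → ℂ) (η σ : ℝ) (θ : ℕ → ℝ) (n : ℕ) (t : ℝ) : ℝ :=
  ‖deriv (clusterMap F θ n) (Complex.exp (σ + t * Complex.I))‖ ^ (-η)

/-- The normalizing constant `(2π)⁻¹ ∫_0^{2π} |Φ_n'(e^{σ + it})|^{-η} dt`. -/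
def partitionConst (F : ℂ → ℂ) (η σ : ℝ) (θ : ℕ → ℝ) (n : ℕ) : ℝ :=
  (2 * Real.pi)⁻¹ * ∫ t in (0 : ℝ)..2 * Real.pi, weight F η σ θ n t

/-- The attachment density, with respect to `dt / 2π` on `[0, 2π]`, of the angle of the
`(n + 1)`-st particle. -/
def density (F : ℂ → ℂ) (η σ : ℝ) (θ : ℕ → ℝ) (n : ℕ) (t : ℝ) : ℝ :=
  weight F η σ θ n t / partitionConst F η σ θ n

/-- The σ-algebra generated by the first `n` angles `Θ 0, …, Θ (n - 1)`. -/
abbrev pastAngles {Ω : Type u} (Θ : ℕ → Ω → ℝ) (n : ℕ) : MeasurableSpace Ω :=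
  ⨆ j : Fin n, MeasurableSpace.comap (Θ j) Real.measurableSpace

/-- `Θ` is the sequence of attachment angles of an ALE(η) process with basic map `F` and
regularization parameter `σ`: given the first `n` angles, the next one has density
`density F η σ` with respect to `dt / 2π` on `[0, 2π]`. The process itself is
`n ↦ clusterMap F (fun k => Θ k ω) n`. -/
structure IsALE {Ω : Type u} [MeasurableSpace Ω] (μ : Measure Ω) (F : ℂ → ℂ) (η σ : ℝ)
    (Θ : ℕ → Ω → ℝ) : Prop where
  measurable : ∀ n, Measurable (Θ n)
  condProb : ∀ (n : ℕ) (B : Set ℝ), MeasurableSet B →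
    μ⟦Θ n ⁻¹' B | pastAngles Θ n⟧ =ᵐ[μ] fun ω =>
      (2 * Real.pi)⁻¹ *
        ∫ t in (0 : ℝ)..2 * Real.pi, B.indicator (density F η σ (fun k => Θ k ω) n) t

end ALE

end

/-!
The map `Φ_n` is compared with `e^{cn} z` through the deviation `f_n(z) = Φ_n(z) - e^{cn} z`, which
is analytic on `{|z| > 1}` and bounded at `∞`, hence a Laurent series `∑ a_k z^{-k}`.

*Linearisation.* Attaching one particle changes `f_n` on average, to first order in `c`, by
`c (z f_n'(z) - η z f_n'(e^σ z))`: the first term is transport of the cluster boundary, the second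
is the response of the attachment density to the boundary. On `z^{-k}` this generator acts as the
multiplier `-k (1 - η e^{-σ(k+1)})`, which is not positive because `η ≤ 1`, and which pushes
fluctuations away from the unit circle at positive speed if `η < 1`. Duhamel's formula therefore writes
`f_n(z)`, and likewise `z f_n'(z)`, as a sum over the steps of the centred effect of the new
particle, plus a drift collecting the nonlinear corrections, each propagated by a kernel and
integrated over a circle on which the kernel is bounded by a multiple of the reciprocal of the distance
of its argument to `1` (`evolved_succ_sub`, `exists_stepBound`).

*Fluctuations.* The centred effects are bounded martingale differences, so a Bernstein inequality
(`measure_stoppedSum_ge_le`) controls their sum at each point of evaluation. Since the bounds on the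
differences rely on a bound `B` on `f_j'` for the earlier steps `j`, the differences are cut off
outside the set of pasts obeying `B`. Analyticity reduces all points of evaluation to a mesh
of polynomial size, by the maximum principle and Cauchy's estimate.

*Bootstrap.* On the good event, a bound `B` on `f_j'` for `j < n` yields a bound on `f_n'`. If the
new bound is at most `B`, induction on `n` gives `B` for all times (`exists_event`), and a last use
of Duhamel's formula gives the bound on `f_n` itself. Very close to the unit circle the induction
has to be started from something else: univalence of `Φ_n` gives the deterministic bound
`|f_n'(z)| ≤ C / (|z| - 1)` (`norm_deviation_le`). The profile `B` is the expected size of `f_n'`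
multiplied by a weight which grows like a large power of the inverse distance, so as to dominate the
deterministic bound there (`boundProfile`, `exists_event_norm_le`).

The cases `η < 1` and `η = 1` differ only in whether fluctuations are transported away from the
unit circle, in a time comparable with their distance to it, or persist for a time of order one
(`timeScale`).
-/

noncomputable section

namespace ALE

open Real (circleAverage)

/-! ### Laurent series on the exterior disk -/

lemma isOpen_exteriorDisk : IsOpen exteriorDisk := isOpen_lt continuous_const continuous_norm

lemma mem_exteriorDisk {z : ℂ} : z ∈ exteriorDisk ↔ 1 < ‖z‖ := Iff.rfl

lemma ne_zero_of_mem_exteriorDisk {z : ℂ} (hz : z ∈ exteriorDisk) : z ≠ 0 := by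
  rintro rfl
  simp only [mem_exteriorDisk, norm_zero] at hz
  linarith

lemma norm_circleMap {ρ : ℝ} (hρ : 0 ≤ ρ) (φ : ℝ) : ‖circleMap 0 ρ φ‖ = ρ := by
  simp [abs_of_nonneg hρ]

lemma circleMap_mem_exteriorDisk {ρ : ℝ} (hρ : 1 < ρ) (φ : ℝ) : circleMap 0 ρ φ ∈ exteriorDisk := by
  simp only [mem_exteriorDisk, norm_circleMap (by linarith : (0:ℝ) ≤ ρ)]
  exact hρ

lemma hasSum_circleAverage {F : ℕ → ℂ → ℂ} {u : ℕ → ℝ} {g : ℂ → ℂ} {ρ : ℝ}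
    (hF : ∀ k, Continuous (fun φ => F k (circleMap 0 ρ φ))) (hu : Summable u)
    (hb : ∀ k φ, ‖F k (circleMap 0 ρ φ)‖ ≤ u k)
    (hs : ∀ φ, HasSum (fun k => F k (circleMap 0 ρ φ)) (g (circleMap 0 ρ φ))) :
    HasSum (fun k => circleAverage (F k) 0 ρ) (circleAverage g 0 ρ) := by
  simp only [Real.circleAverage_def]
  refine HasSum.const_smul _ ?_
  refine intervalIntegral.hasSum_integral_of_dominated_convergence (fun k _ => u k)
    (fun k => (hF k).aestronglyMeasurable) (fun k => .of_forall fun t _ => hb k t)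
    (.of_forall fun t _ => hu) ?_ (.of_forall fun t _ => hs t)
  exact intervalIntegrable_const

lemma circleAverage_pow_mul_inv_pow {ρ : ℝ} (hρ : 0 < ρ) (k l : ℕ) :
    circleAverage (fun w : ℂ => w ^ k * (w⁻¹) ^ l) 0 ρ = if k = l then 1 else 0 := by
  have hρ' : (ρ : ℂ) ≠ 0 := by exact_mod_cast hρ.ne'
  split_ifs with h
  · subst h
    rw [Real.circleAverage_congr_sphere (f₂ := fun _ => (1:ℂ))]
    · exact Real.circleAverage_const _ _ _
    · intro w hw
      have : w ≠ 0 := by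
        rintro rfl
        simp at hw
        exact (abs_pos.2 hρ.ne').ne hw
      simp only [inv_pow]
      field_simp
  · rw [Real.circleAverage_def]
    have h1 : ∀ φ : ℝ, (circleMap 0 ρ φ) ^ k * ((circleMap 0 ρ φ)⁻¹) ^ l
        = ((ρ : ℂ) ^ k * ((ρ : ℂ)⁻¹) ^ l) * Complex.exp ((((k : ℂ) - l) * Complex.I) * φ) := by
      intro φ
      simp only [circleMap, zero_add, mul_inv, mul_pow, ← Complex.exp_nat_mul, ← Complex.exp_neg]
      rw [show (ρ : ℂ) ^ k * Complex.exp (k * (φ * Complex.I))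
        * ((ρ : ℂ)⁻¹ ^ l * Complex.exp (l * -(φ * Complex.I)))
        = ((ρ : ℂ) ^ k * (ρ : ℂ)⁻¹ ^ l) * (Complex.exp (k * (φ * Complex.I))
        * Complex.exp (l * -(φ * Complex.I))) by ring, ← Complex.exp_add]
      congr 2
      ring
    simp only [h1]
    have h2 : ((k : ℂ) - l) * Complex.I ≠ 0 := by
      refine mul_ne_zero (sub_ne_zero.2 ?_) Complex.I_ne_zero
      exact_mod_cast h
    rw [intervalIntegral.integral_const_mul, integral_exp_mul_complex h2]
    have h3 : Complex.exp (((k : ℂ) - l) * Complex.I * ((2 * Real.pi : ℝ) : ℂ)) = 1 := by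
      rw [Complex.exp_eq_one_iff]
      exact ⟨(k : ℤ) - l, by push_cast; ring⟩
    rw [h3]
    simp

/-- `f z = ∑ a k z⁻ᵏ` on the exterior disk. -/
def HasLaurent (f : ℂ → ℂ) (a : ℕ → ℂ) : Prop :=
  ∀ z ∈ exteriorDisk, HasSum (fun k => a k * (z⁻¹) ^ k) (f z)

lemma HasLaurent.summable_norm {f : ℂ → ℂ} {a : ℕ → ℂ} (h : HasLaurent f a) {r : ℝ} (hr : 1 < r) :
    Summable (fun k => ‖a k‖ * (r⁻¹) ^ k) := by
  have h1 : (r : ℂ) ∈ exteriorDisk := by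
    simp [exteriorDisk, abs_of_pos (by linarith : (0:ℝ) < r), hr]
  refine ((h _ h1).summable.norm).congr fun k => ?_
  simp [abs_of_pos (by linarith : (0:ℝ) < r)]

lemma HasLaurent.circleAverage_mul_pow {f : ℂ → ℂ} {a : ℕ → ℂ} (h : HasLaurent f a) {ρ : ℝ}
    (hρ : 1 < ρ) (k : ℕ) : circleAverage (fun w => f w * w ^ k) 0 ρ = a k := by
  have hρ0 : 0 < ρ := by linarith
  have hn := norm_circleMap hρ0.le
  have h0 : ∀ φ, circleMap 0 ρ φ ≠ 0 := fun φ =>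
    ne_zero_of_mem_exteriorDisk (circleMap_mem_exteriorDisk hρ φ)
  have h1 := hasSum_circleAverage (F := fun l w => a l * (w ^ k * (w⁻¹) ^ l))
    (u := fun l => ‖a l‖ * (ρ⁻¹) ^ l * ρ ^ k) (g := fun w => f w * w ^ k) (ρ := ρ)
    (fun l => by
      have : Continuous fun φ => (circleMap 0 ρ φ)⁻¹ := (continuous_circleMap 0 ρ).inv₀ h0
      exact continuous_const.mul (((continuous_circleMap 0 ρ).pow k).mul (this.pow l)))
    ((h.summable_norm hρ).mul_right _)
    (fun l φ => by
      rw [norm_mul, norm_mul, norm_pow, norm_pow, norm_inv, hn]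
      exact le_of_eq (by ring))
    (fun φ => by
      refine ((h _ (circleMap_mem_exteriorDisk hρ φ)).mul_right ((circleMap 0 ρ φ) ^ k)).congr_fun ?_
      intro l
      ring)
  have h2 : ∀ l, circleAverage (fun w : ℂ => a l * (w ^ k * (w⁻¹) ^ l)) 0 ρ
      = if l = k then a k else 0 := by
    intro l
    have := Real.circleAverage_fun_smul (a := a l) (f := fun w : ℂ => w ^ k * (w⁻¹) ^ l)
      (c := 0) (R := ρ)
    simp only [smul_eq_mul] at this
    rw [this, circleAverage_pow_mul_inv_pow hρ0]
    by_cases hkl : l = k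
    · subst hkl; simp
    · simp [hkl, Ne.symm hkl]
  simp only [h2] at h1
  exact h1.unique (hasSum_ite_eq k (a k))

lemma HasLaurent.unique {f : ℂ → ℂ} {a b : ℕ → ℂ} (h : HasLaurent f a) (h' : HasLaurent f b) :
    a = b := by
  ext k
  rw [← h.circleAverage_mul_pow one_lt_two, h'.circleAverage_mul_pow one_lt_two]

lemma HasLaurent.continuous_circle {f : ℂ → ℂ} (hf : ContinuousOn f exteriorDisk) {ρ : ℝ}
    (hρ : 1 < ρ) : Continuous (fun φ => f (circleMap 0 ρ φ)) :=
  hf.comp_continuous (continuous_circleMap 0 ρ) (circleMap_mem_exteriorDisk hρ)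

/-- Multiplying the Laurent coefficients by `γ` amounts to averaging over a circle against the
kernel `∑ γ k uᵏ`. -/
lemma HasLaurent.hasSum_multiplier {f : ℂ → ℂ} {a : ℕ → ℂ} (h : HasLaurent f a)
    (hf : ContinuousOn f exteriorDisk) {ρ : ℝ} (hρ : 1 < ρ) {z : ℂ} (hz : z ≠ 0) {γ : ℕ → ℂ}
    (hγ : Summable fun k => ‖γ k‖ * (ρ / ‖z‖) ^ k) :
    HasSum (fun k => γ k * a k * (z⁻¹) ^ k)
      (circleAverage (fun w => f w * ∑' k, γ k * (w / z) ^ k) 0 ρ) := by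
  have hρ0 : 0 < ρ := by linarith
  have hn := norm_circleMap hρ0.le
  have hc := HasLaurent.continuous_circle hf hρ
  obtain ⟨M, hM⟩ : ∃ M, ∀ φ, ‖f (circleMap 0 ρ φ)‖ ≤ M := by
    obtain ⟨M, hM⟩ := (isCompact_sphere (0:ℂ) ρ).exists_bound_of_continuousOn
      (hf.mono fun w hw => by
        simp only [mem_sphere_iff_norm, sub_zero] at hw
        simp [exteriorDisk, hw, hρ])
    exact ⟨M, fun φ => hM _ (by simp [abs_of_pos hρ0])⟩
  have h1 := hasSum_circleAverage
    (F := fun k w => (γ k * (z⁻¹) ^ k) * (f w * w ^ k))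
    (u := fun k => ‖γ k‖ * (ρ / ‖z‖) ^ k * M)
    (g := fun w => f w * ∑' k, γ k * (w / z) ^ k) (ρ := ρ)
    (fun k => continuous_const.mul (hc.mul ((continuous_circleMap 0 ρ).pow k)))
    (hγ.mul_right _)
    (fun k φ => by
      rw [norm_mul, norm_mul, norm_mul, norm_pow, norm_pow, norm_inv, hn, div_pow, div_eq_mul_inv,
        ← inv_pow]
      have : 0 ≤ ‖γ k‖ * ‖z‖⁻¹ ^ k * ρ ^ k := by positivity
      nlinarith [mul_le_mul_of_nonneg_left (hM φ) this])
    (fun φ => by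
      have : Summable fun k => γ k * (circleMap 0 ρ φ / z) ^ k := by
        refine Summable.of_norm (hγ.congr fun k => ?_)
        rw [norm_mul, norm_pow, norm_div, hn]
      refine (this.hasSum.mul_left (f (circleMap 0 ρ φ))).congr_fun fun k => ?_
      rw [div_pow, inv_pow]
      ring)
  refine h1.congr_fun fun k => ?_
  have := Real.circleAverage_fun_smul (a := γ k * (z⁻¹) ^ k) (f := fun w : ℂ => f w * w ^ k)
    (c := 0) (R := ρ)
  simp only [smul_eq_mul] at this
  rw [this, h.circleAverage_mul_pow hρ]
  ring

/-- `f` is holomorphic on the exterior disk, including the point at infinity: `f z = g z⁻¹` with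
`g` holomorphic on the unit disk. -/
def IsExt (f : ℂ → ℂ) : Prop :=
  ∃ g : ℂ → ℂ, DifferentiableOn ℂ g (Metric.ball 0 1) ∧ ∀ z ∈ exteriorDisk, f z = g z⁻¹

lemma inv_mem_ball {z : ℂ} (hz : z ∈ exteriorDisk) : z⁻¹ ∈ Metric.ball (0:ℂ) 1 := by
  rw [mem_ball_zero_iff, norm_inv]
  exact inv_lt_one_of_one_lt₀ hz

lemma hasDerivAt_of_eq_inv {f g : ℂ → ℂ} (hg : DifferentiableOn ℂ g (Metric.ball 0 1))
    (h : ∀ z ∈ exteriorDisk, f z = g z⁻¹) {z : ℂ} (hz : z ∈ exteriorDisk) :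
    HasDerivAt f (-(z⁻¹ ^ 2 * deriv g z⁻¹)) z := by
  have h0 := ne_zero_of_mem_exteriorDisk hz
  have h1 : HasDerivAt g (deriv g z⁻¹) z⁻¹ :=
    (hg.differentiableAt (Metric.isOpen_ball.mem_nhds (inv_mem_ball hz))).hasDerivAt
  have h2 := h1.comp z (hasDerivAt_inv h0)
  refine (h2.congr_of_eventuallyEq ?_).congr_deriv (by rw [inv_pow]; ring)
  filter_upwards [isOpen_exteriorDisk.mem_nhds hz] with w hw using h w hw

lemma IsExt.differentiableOn {f : ℂ → ℂ} (hf : IsExt f) : DifferentiableOn ℂ f exteriorDisk := by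
  obtain ⟨g, hg, h⟩ := hf
  exact fun z hz => (hasDerivAt_of_eq_inv hg h hz).differentiableAt.differentiableWithinAt

lemma IsExt.deriv {f : ℂ → ℂ} (hf : IsExt f) : IsExt (deriv f) := by
  obtain ⟨g, hg, h⟩ := hf
  refine ⟨fun ζ => -(ζ ^ 2 * _root_.deriv g ζ), ?_, fun z hz => (hasDerivAt_of_eq_inv hg h hz).deriv⟩
  exact ((differentiableOn_id.pow 2).mul (hg.deriv Metric.isOpen_ball)).neg

lemma IsExt.norm_le {f : ℂ → ℂ} (hf : IsExt f) {ρ M : ℝ} (hρ : 1 < ρ)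
    (hM : ∀ w : ℂ, ‖w‖ = ρ → ‖f w‖ ≤ M) {z : ℂ} (hz : ρ ≤ ‖z‖) : ‖f z‖ ≤ M := by
  obtain ⟨g, hg, h⟩ := hf
  have hz1 : z ∈ exteriorDisk := lt_of_lt_of_le hρ hz
  have hρ0 : 0 < ρ := by linarith
  rw [h z hz1]
  refine Complex.norm_le_of_forall_mem_frontier_norm_le (U := Metric.ball 0 ρ⁻¹)
    Metric.isBounded_ball (hg.diffContOnCl_ball ?_) ?_ ?_
  · exact Metric.closedBall_subset_ball (inv_lt_one_of_one_lt₀ hρ)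
  · intro w hw
    rw [frontier_ball _ (inv_pos.2 hρ0).ne', mem_sphere_zero_iff_norm] at hw
    have hw' : ‖w⁻¹‖ = ρ := by rw [norm_inv, hw, inv_inv]
    have := hM _ hw'
    rwa [h _ (by rw [mem_exteriorDisk, hw']; exact hρ), inv_inv] at this
  · rw [closure_ball _ (inv_pos.2 hρ0).ne', mem_closedBall_zero_iff, norm_inv]
    exact inv_anti₀ hρ0 hz

lemma IsExt.exists_hasLaurent {f : ℂ → ℂ} (hf : IsExt f) :
    ∃ a, HasLaurent f a ∧ HasLaurent (fun z => z * _root_.deriv f z) (fun k => -k * a k) := by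
  obtain ⟨g, hg, h⟩ := hf
  set a : ℕ → ℂ := fun n => ((n.factorial : ℂ))⁻¹ * iteratedDeriv n g 0 with ha
  refine ⟨a, ?_, ?_⟩
  · intro z hz
    rw [h z hz]
    refine (Complex.hasSum_taylorSeries_on_ball hg (inv_mem_ball hz)).congr_fun fun k => ?_
    simp only [sub_zero, smul_eq_mul, ha]
    ring
  · intro z hz
    have h0 := ne_zero_of_mem_exteriorDisk hz
    have h1 := Complex.hasSum_taylorSeries_on_ball (hg.deriv Metric.isOpen_ball) (inv_mem_ball hz)
    rw [← hasSum_nat_add_iff' 1]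
    have h2 := h1.mul_left (-z⁻¹)
    beta_reduce
    rw [(hasDerivAt_of_eq_inv hg h hz).deriv]
    have h3 : z * -(z⁻¹ ^ 2 * _root_.deriv g z⁻¹) - ∑ i ∈ Finset.range 1, -(i:ℂ) * a i * z⁻¹ ^ i
        = -z⁻¹ * _root_.deriv g z⁻¹ := by
      simp
      field_simp
    rw [h3]
    refine h2.congr_fun fun k => ?_
    simp only [sub_zero, smul_eq_mul, ha, ← iteratedDeriv_succ']
    rw [Nat.factorial_succ]
    have : (k.factorial : ℂ) ≠ 0 := by exact_mod_cast k.factorial_ne_zero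
    have : ((k:ℂ) + 1) ≠ 0 := by exact_mod_cast k.succ_ne_zero
    rw [pow_succ]
    push_cast
    field_simp

/-- Removable singularity at infinity. -/
lemma isExt_of_bounded {f : ℂ → ℂ} (hf : DifferentiableOn ℂ f exteriorDisk) {M : ℝ}
    (hM : ∀ z : ℂ, 2 ≤ ‖z‖ → ‖f z‖ ≤ M) : IsExt f := by
  set g : ℂ → ℂ := fun ζ => f ζ⁻¹ with hg
  have hm : ∀ ζ ∈ Metric.ball (0:ℂ) 1 \ {0}, ζ⁻¹ ∈ exteriorDisk := by
    intro ζ hζ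
    have h1 : ‖ζ‖ < 1 := mem_ball_zero_iff.1 hζ.1
    have h2 : 0 < ‖ζ‖ := norm_pos_iff.2 hζ.2
    rw [mem_exteriorDisk, norm_inv]
    exact (one_lt_inv₀ h2).2 h1
  have hd : DifferentiableOn ℂ g (Metric.ball 0 1 \ {0}) :=
    hf.comp (differentiableOn_inv.mono fun ζ hζ => hζ.2) hm
  refine ⟨Function.update g 0 (limUnder (𝓝[≠] 0) g),
    Complex.differentiableOn_update_limUnder_of_isLittleO (Metric.ball_mem_nhds _ one_pos) hd ?_, ?_⟩
  · refine Filter.IsBoundedUnder.isLittleO_sub_self_inv ⟨M + ‖g 0‖, ?_⟩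
    rw [Filter.eventually_map, eventually_nhdsWithin_iff]
    filter_upwards [Metric.ball_mem_nhds (0:ℂ) (by norm_num : (0:ℝ) < 1 / 2)] with ζ hζ hne
    refine (norm_sub_le _ _).trans (add_le_add_left (hM _ ?_) _)
    have h1 : ‖ζ‖ < 1 / 2 := mem_ball_zero_iff.1 hζ
    have h2 : 0 < ‖ζ‖ := norm_pos_iff.2 hne
    rw [norm_inv, le_inv_comm₀ two_pos h2]
    linarith
  · intro z hz
    rw [Function.update_of_ne (inv_ne_zero (ne_zero_of_mem_exteriorDisk hz))]
    simp [hg]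

lemma tendsto_comp_inv_cobounded {g : ℂ → ℂ} (hg : DifferentiableOn ℂ g (Metric.ball 0 1)) :
    Tendsto (fun z => g z⁻¹) (Bornology.cobounded ℂ) (𝓝 (g 0)) :=
  ((hg.continuousOn.continuousAt (Metric.ball_mem_nhds _ one_pos)).tendsto).comp
    tendsto_inv₀_cobounded

lemma eventually_mem_exteriorDisk : ∀ᶠ z in Bornology.cobounded ℂ, z ∈ exteriorDisk :=
  tendsto_norm_cobounded_atTop.eventually_gt_atTop 1

lemma IsExt.exists_eq_and_tendsto {f : ℂ → ℂ} (hf : IsExt f) {l : ℂ}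
    (h : Tendsto f (Bornology.cobounded ℂ) (𝓝 l)) :
    ∃ g : ℂ → ℂ, DifferentiableOn ℂ g (Metric.ball 0 1) ∧ (∀ z ∈ exteriorDisk, f z = g z⁻¹) ∧
      g 0 = l := by
  obtain ⟨g, hg, hfg⟩ := hf
  refine ⟨g, hg, hfg, tendsto_nhds_unique (tendsto_comp_inv_cobounded hg) (h.congr' ?_)⟩
  filter_upwards [eventually_mem_exteriorDisk] with z hz using hfg z hz

lemma IsExt.tendsto_deriv {f : ℂ → ℂ} (hf : IsExt f) :
    Tendsto (_root_.deriv f) (Bornology.cobounded ℂ) (𝓝 0) := by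
  obtain ⟨g, hg, h⟩ := hf
  have hd : DifferentiableOn ℂ (fun ζ => -(ζ ^ 2 * _root_.deriv g ζ)) (Metric.ball 0 1) :=
    ((differentiableOn_id.pow 2).mul (hg.deriv Metric.isOpen_ball)).neg
  have h1 := tendsto_comp_inv_cobounded hd
  simp only [ne_eq, OfNat.ofNat_ne_zero, not_false_eq_true, zero_pow, zero_mul, neg_zero] at h1
  refine h1.congr' ?_
  filter_upwards [eventually_mem_exteriorDisk] with z hz
  exact (hasDerivAt_of_eq_inv hg h hz).deriv.symm

/-- The mean value property at infinity. -/
lemma IsExt.circleAverage_eq_of_tendsto {f : ℂ → ℂ} (hf : IsExt f) {l : ℂ}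
    (h : Tendsto f (Bornology.cobounded ℂ) (𝓝 l)) {w : ℂ} (hw : w ∈ exteriorDisk) :
    circleAverage (fun ζ => f (ζ⁻¹ * w)) 0 1 = l := by
  obtain ⟨g, hg, hfg, rfl⟩ := hf.exists_eq_and_tendsto h
  have hsph : ∀ ζ ∈ Metric.sphere (0:ℂ) |1|, f (ζ⁻¹ * w) = g (ζ * w⁻¹) := fun ζ hζ => by
    have hζ1 : ‖ζ‖ = 1 := by simpa using hζ
    rw [hfg _ (by rw [mem_exteriorDisk, norm_mul, norm_inv, hζ1, inv_one, one_mul]; exact hw),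
      mul_inv, inv_inv]
  rw [Real.circleAverage_congr_sphere hsph]
  have hd : DiffContOnCl ℂ (fun ζ : ℂ => g (ζ * w⁻¹)) (Metric.ball 0 |1|) := by
    rw [abs_one]
    refine DifferentiableOn.diffContOnCl ?_
    rw [closure_ball _ one_ne_zero]
    refine hg.comp (by fun_prop) fun ζ hζ => ?_
    have hζ1 : ‖ζ‖ ≤ 1 := by simpa using hζ
    have h1 := mem_ball_zero_iff.1 (inv_mem_ball hw)
    rw [mem_ball_zero_iff, norm_mul]
    nlinarith [norm_nonneg ζ, norm_nonneg w⁻¹]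
  rw [hd.circleAverage, zero_mul]

/-- Cauchy's estimate: a bound on `{1 + x < |z|}` controls the derivative at distance `y`. -/
lemma norm_deriv_le_of_norm_le {f : ℂ → ℂ} (hf : DifferentiableOn ℂ f exteriorDisk) {x y M : ℝ}
    (hx : 0 < x) (hy : 0 < y) (hM : ∀ z : ℂ, 1 + x ≤ ‖z‖ → ‖f z‖ ≤ M) {z : ℂ}
    (hz : 1 + x + y ≤ ‖z‖) : ‖deriv f z‖ ≤ M / y := by
  have hsub : ∀ w ∈ Metric.closedBall z y, 1 + x ≤ ‖w‖ := by
    intro w hw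
    have h1 : ‖w - z‖ ≤ y := by simpa [dist_eq_norm] using hw
    have h2 := norm_sub_norm_le z w
    rw [norm_sub_rev] at h2
    linarith
  refine Complex.norm_deriv_le_of_forall_mem_sphere_norm_le hy (hf.diffContOnCl_ball ?_) ?_
  · intro w hw
    exact lt_of_lt_of_le (by linarith) (hsub w hw)
  · intro w hw
    exact hM w (hsub w (Metric.sphere_subset_closedBall hw))

/-! ### Averages of the Cauchy kernel -/

lemma norm_mul_lt_one {v ζ : ℂ} (hv : ‖v‖ < 1) (hζ : ‖ζ‖ ≤ 1) : ‖v * ζ‖ < 1 := by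
  rw [norm_mul]
  nlinarith [norm_nonneg v, norm_nonneg ζ]

lemma re_one_sub_pos {v ζ : ℂ} (hv : ‖v‖ < 1) (hζ : ‖ζ‖ ≤ 1) : 0 < (1 - v * ζ).re := by
  have h := norm_mul_lt_one hv hζ
  have := Complex.re_le_norm (v * ζ)
  simp only [Complex.sub_re, Complex.one_re]
  linarith

lemma one_sub_norm_le_norm_one_sub {v ζ : ℂ} (hζ : ‖ζ‖ ≤ 1) :
    1 - ‖v‖ ≤ ‖1 - v * ζ‖ := by
  have h1 := norm_sub_norm_le (1:ℂ) (v * ζ)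
  have h2 : ‖v * ζ‖ ≤ ‖v‖ := by
    rw [norm_mul]
    exact mul_le_of_le_one_right (norm_nonneg _) hζ
  rw [norm_one] at h1
  linarith

lemma continuous_one_sub_circle (v : ℂ) :
    Continuous (fun φ : ℝ => 1 - v * circleMap 0 1 φ) := by fun_prop

lemma norm_unit_circle (φ : ℝ) : ‖circleMap 0 1 φ‖ = 1 := norm_circleMap zero_le_one φ

lemma one_sub_circle_ne_zero {v : ℂ} (hv : ‖v‖ < 1) (φ : ℝ) : 1 - v * circleMap 0 1 φ ≠ 0 := by
  intro h
  have := re_one_sub_pos hv (norm_unit_circle φ).le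
  rw [h] at this
  simp at this

lemma circleIntegrable_of_continuous {E : Type*} [NormedAddCommGroup E] {f : ℂ → E} {ρ : ℝ}
    (h : Continuous fun φ => f (circleMap 0 ρ φ)) : CircleIntegrable f 0 ρ :=
  h.intervalIntegrable _ _

lemma circleAverage_le_circleAverage {f g : ℂ → ℝ} {ρ : ℝ}
    (hf : Continuous fun φ => f (circleMap 0 ρ φ)) (hg : Continuous fun φ => g (circleMap 0 ρ φ))
    (h : ∀ φ, f (circleMap 0 ρ φ) ≤ g (circleMap 0 ρ φ)) :
    circleAverage f 0 ρ ≤ circleAverage g 0 ρ := by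
  rw [Real.circleAverage_def, Real.circleAverage_def, smul_eq_mul, smul_eq_mul]
  refine mul_le_mul_of_nonneg_left ?_ (by positivity)
  exact intervalIntegral.integral_mono (by positivity) (hf.intervalIntegrable _ _)
    (hg.intervalIntegrable _ _) h

lemma norm_circleAverage_le {f : ℂ → ℂ} {g : ℂ → ℝ} {ρ : ℝ}
    (hg : Continuous fun φ => g (circleMap 0 ρ φ))
    (h : ∀ φ, ‖f (circleMap 0 ρ φ)‖ ≤ g (circleMap 0 ρ φ)) :
    ‖circleAverage f 0 ρ‖ ≤ circleAverage g 0 ρ := by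
  rw [Real.circleAverage_def, Real.circleAverage_def, smul_eq_mul, norm_smul, Real.norm_eq_abs,
    abs_of_nonneg (by positivity)]
  refine mul_le_mul_of_nonneg_left ?_ (by positivity)
  exact intervalIntegral.norm_integral_le_of_norm_le (by positivity)
    (.of_forall fun t _ => h t) (hg.intervalIntegrable _ _)

lemma circleAverage_const_mul (a : ℝ) (f : ℂ → ℝ) (ρ : ℝ) :
    circleAverage (fun w => a * f w) 0 ρ = a * circleAverage f 0 ρ := by
  have := Real.circleAverage_fun_smul (a := a) (f := f) (c := 0) (R := ρ)
  simpa only [smul_eq_mul] using this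

lemma circleAverage_re {f : ℂ → ℂ} {ρ : ℝ} (h : Continuous fun φ => f (circleMap 0 ρ φ)) :
    circleAverage (fun w => (f w).re) 0 ρ = (circleAverage f 0 ρ).re := by
  have := Complex.reCLM.circleAverage_comp_comm (circleIntegrable_of_continuous h)
  simpa [Function.comp_def] using this

/-- The mean of `|1 - vζ|⁻ˢ` over the unit circle stays bounded as `|v| → 1` when `s < 1`, since
`Re u⁻ˢ ≥ cos (πs/2) |u|⁻ˢ` on the right half-plane. -/
lemma circleAverage_rpow_le {v : ℂ} (hv : ‖v‖ < 1) {s : ℝ} (hs0 : 0 ≤ s) (hs1 : s < 1) :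
    circleAverage (fun ζ => ‖1 - v * ζ‖ ^ (-s)) 0 1 ≤ (Real.cos (Real.pi / 2 * s))⁻¹ := by
  have hcos : 0 < Real.cos (Real.pi / 2 * s) := by
    apply Real.cos_pos_of_mem_Ioo
    constructor <;> nlinarith [Real.pi_pos]
  have hslit : ∀ ζ : ℂ, ‖ζ‖ ≤ 1 → 1 - v * ζ ∈ Complex.slitPlane := fun ζ hζ =>
    Or.inl (re_one_sub_pos hv hζ)
  have hcont : ContinuousOn (fun ζ : ℂ => (1 - v * ζ) ^ (-(s:ℂ))) (Metric.closedBall 0 1) := by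
    refine ContinuousOn.cpow (by fun_prop) continuousOn_const fun ζ hζ => ?_
    exact hslit ζ (by simpa using hζ)
  have hd : DiffContOnCl ℂ (fun ζ : ℂ => (1 - v * ζ) ^ (-(s:ℂ))) (Metric.ball 0 |1|) := by
    rw [abs_one]
    refine ⟨?_, by rw [closure_ball _ one_ne_zero]; exact hcont⟩
    refine DifferentiableOn.cpow (by fun_prop) (by fun_prop) fun ζ hζ => ?_
    exact hslit ζ (by simpa using (Metric.ball_subset_closedBall hζ))
  have hm := hd.circleAverage
  simp only [mul_zero, sub_zero, Complex.one_cpow] at hm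
  have hc : Continuous fun φ => (1 - v * circleMap 0 1 φ) ^ (-(s:ℂ)) :=
    hcont.comp_continuous (continuous_circleMap 0 1) fun φ => by simp
  have h1 := circleAverage_re (f := fun ζ => (1 - v * ζ) ^ (-(s:ℂ))) hc
  rw [hm, Complex.one_re] at h1
  rw [← one_div, le_div_iff₀ hcos, mul_comm, ← circleAverage_const_mul]
  refine le_trans ?_ h1.le
  have hn : Continuous fun φ => ‖1 - v * circleMap 0 1 φ‖ ^ (-s) := by
    refine Continuous.rpow_const (continuous_one_sub_circle v).norm fun φ => Or.inl ?_
    exact norm_ne_zero_iff.2 (one_sub_circle_ne_zero hv φ)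
  refine circleAverage_le_circleAverage
    (f := fun ζ => Real.cos (Real.pi / 2 * s) * ‖1 - v * ζ‖ ^ (-s)) (continuous_const.mul hn)
    (g := fun ζ => ((1 - v * ζ) ^ (-(s:ℂ))).re) (Complex.continuous_re.comp hc) fun φ => ?_
  have hre := re_one_sub_pos hv (norm_unit_circle φ).le
  rw [← Complex.ofReal_neg, Complex.cpow_ofReal_re, mul_comm]
  refine mul_le_mul_of_nonneg_left ?_ (Real.rpow_nonneg (norm_nonneg _) _)
  have harg := Complex.abs_arg_lt_pi_div_two_iff.2 (Or.inl hre)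
  rw [← Real.cos_abs (Complex.arg _ * _), abs_mul, abs_neg, abs_of_nonneg hs0]
  refine Real.cos_le_cos_of_nonneg_of_le_pi (by positivity) ?_ ?_
  · nlinarith [Real.pi_pos]
  · exact mul_le_mul_of_nonneg_right harg.le hs0

/-- The constant in the bound `(1 - |v|)⁻ᵟ` for the mean of `|1 - vζ|⁻¹`. -/
def cauchyConst (δ : ℝ) : ℝ := (Real.cos (Real.pi / 2 * (1 - δ)))⁻¹

lemma cauchyConst_pos {δ : ℝ} (h0 : 0 < δ) (h1 : δ < 1) : 0 < cauchyConst δ := by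
  refine inv_pos.2 (Real.cos_pos_of_mem_Ioo ?_)
  constructor <;> nlinarith [Real.pi_pos]

lemma one_le_cauchyConst {δ : ℝ} (h0 : 0 < δ) (h1 : δ < 1) : 1 ≤ cauchyConst δ :=
  (one_le_inv₀ (inv_pos.1 (cauchyConst_pos h0 h1))).2 (Real.cos_le_one _)

lemma continuous_norm_one_sub_inv {v : ℂ} (hv : ‖v‖ < 1) :
    Continuous fun φ => ‖1 - v * circleMap 0 1 φ‖⁻¹ :=
  (continuous_one_sub_circle v).norm.inv₀ fun φ => norm_ne_zero_iff.2 (one_sub_circle_ne_zero hv φ)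

lemma circleAverage_inv_le {v : ℂ} (hv : ‖v‖ < 1) {δ : ℝ} (h0 : 0 < δ) (h1 : δ < 1) :
    circleAverage (fun ζ => ‖1 - v * ζ‖⁻¹) 0 1 ≤ cauchyConst δ * (1 - ‖v‖) ^ (-δ) := by
  have h2 := circleAverage_rpow_le hv (s := 1 - δ) (by linarith) (by linarith)
  have hv' : 0 < 1 - ‖v‖ := by linarith
  calc circleAverage (fun ζ => ‖1 - v * ζ‖⁻¹) 0 1
      ≤ circleAverage (fun ζ => (1 - ‖v‖) ^ (-δ) * ‖1 - v * ζ‖ ^ (-(1 - δ))) 0 1 := by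
        refine circleAverage_le_circleAverage (continuous_norm_one_sub_inv hv) ?_ fun φ => ?_
        · refine continuous_const.mul ?_
          refine Continuous.rpow_const (continuous_one_sub_circle v).norm fun φ => Or.inl ?_
          exact norm_ne_zero_iff.2 (one_sub_circle_ne_zero hv φ)
        · have hpos : 0 < ‖1 - v * circleMap 0 1 φ‖ :=
            norm_pos_iff.2 (one_sub_circle_ne_zero hv φ)
          rw [← Real.rpow_neg_one, show (-1 : ℝ) = -δ + -(1 - δ) by ring, Real.rpow_add hpos]
          refine mul_le_mul_of_nonneg_right ?_ (Real.rpow_nonneg hpos.le _)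
          exact Real.rpow_le_rpow_of_nonpos hv'
            (one_sub_norm_le_norm_one_sub (norm_unit_circle φ).le) (by linarith)
    _ ≤ _ := by
        rw [circleAverage_const_mul, mul_comm]
        exact mul_le_mul_of_nonneg_right h2 (Real.rpow_nonneg hv'.le _)

/-- The Poisson kernel has mean one. -/
lemma circleAverage_inv_sq {v : ℂ} (hv : ‖v‖ < 1) :
    circleAverage (fun ζ => ‖1 - v * ζ‖⁻¹ ^ 2) 0 1 = (1 - ‖v‖ ^ 2)⁻¹ := by
  have hne : ∀ ζ : ℂ, ‖ζ‖ ≤ 1 → 1 - v * ζ ≠ 0 := fun ζ hζ h => by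
    have := re_one_sub_pos hv hζ
    rw [h] at this
    simp at this
  have hd : DiffContOnCl ℂ (fun ζ : ℂ => (1 + v * ζ) / (1 - v * ζ)) (Metric.ball 0 |1|) := by
    rw [abs_one]
    refine DifferentiableOn.diffContOnCl ?_
    rw [closure_ball _ one_ne_zero]
    exact DifferentiableOn.div (by fun_prop) (by fun_prop) fun ζ hζ => hne ζ (by simpa using hζ)
  have hm := hd.circleAverage
  have hc : Continuous fun φ => (1 + v * circleMap 0 1 φ) / (1 - v * circleMap 0 1 φ) := by
    refine Continuous.div (by fun_prop) (by fun_prop) fun φ => hne _ (norm_unit_circle φ).le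
  have h1 := circleAverage_re (f := fun ζ => (1 + v * ζ) / (1 - v * ζ)) hc
  rw [hm] at h1
  have hv2 : 0 < 1 - ‖v‖ ^ 2 := by nlinarith [norm_nonneg v]
  have h2 : circleAverage (fun ζ => ((1 + v * ζ) / (1 - v * ζ)).re) 0 1
      = circleAverage (fun ζ => (1 - ‖v‖ ^ 2) * ‖1 - v * ζ‖⁻¹ ^ 2) 0 1 := by
    refine Real.circleAverage_congr_sphere fun ζ hζ => ?_
    have hζ1 : ‖ζ‖ = 1 := by simpa using hζ
    have h3 : ‖v‖ ^ 2 = (v * ζ).re ^ 2 + (v * ζ).im ^ 2 := by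
      rw [← sq_abs ‖v‖, abs_norm, show ‖v‖ = ‖v * ζ‖ by rw [norm_mul, hζ1, mul_one],
        ← Complex.normSq_eq_norm_sq, Complex.normSq_apply]
      ring
    have h4 : ‖1 - v * ζ‖⁻¹ ^ 2 = (Complex.normSq (1 - v * ζ))⁻¹ := by
      rw [inv_pow, Complex.normSq_eq_norm_sq]
    simp only [h3, h4, Complex.div_re, Complex.add_re, Complex.one_re, Complex.sub_re,
      Complex.add_im, Complex.one_im, Complex.sub_im]
    ring
  rw [h2, circleAverage_const_mul] at h1
  simp only [mul_zero, add_zero, sub_zero, div_one, Complex.one_re] at h1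
  exact eq_inv_of_mul_eq_one_right h1

/-! ### Kernels with coefficients of bounded variation -/

lemma one_sub_mul_tsum {b : ℕ → ℂ} {v : ℂ} (hb : Summable fun k => b k * v ^ k) :
    (1 - v) * ∑' k, b k * v ^ k = b 0 + ∑' k, (b (k + 1) - b k) * v ^ (k + 1) := by
  have h1 := hb.tsum_eq_zero_add
  have hb1 : Summable fun k => b (k + 1) * v ^ (k + 1) := (summable_nat_add_iff 1).2 hb
  have hb2 : Summable fun k => b k * v ^ (k + 1) :=
    (hb.mul_right v).congr fun k => by rw [pow_succ]; ring
  have h2 : v * ∑' k, b k * v ^ k = ∑' k, b k * v ^ (k + 1) := by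
    rw [← tsum_mul_left]
    exact tsum_congr fun k => by rw [pow_succ]; ring
  rw [sub_mul, one_mul, h2, h1, ← add_sub_assoc', ← hb1.tsum_sub hb2]
  simp only [pow_zero, mul_one, sub_mul]

lemma natCast_mul_pow_le {r : ℝ} (h0 : 0 ≤ r) (h1 : r < 1) (k : ℕ) : k * r ^ k ≤ (1 - r)⁻¹ := by
  calc (k : ℝ) * r ^ k = ∑ _i ∈ Finset.range k, r ^ k := by simp
    _ ≤ ∑ i ∈ Finset.range k, r ^ i :=
        Finset.sum_le_sum fun i hi => pow_le_pow_of_le_one h0 h1.le (Finset.mem_range.1 hi).le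
    _ ≤ ∑' i, r ^ i :=
        (summable_geometric_of_lt_one h0 h1).sum_le_tsum _ fun i _ => pow_nonneg h0 i
    _ = (1 - r)⁻¹ := tsum_geometric_of_lt_one h0 h1

lemma summable_natCast_pow_mul {γ : ℕ → ℝ} (hγ : ∀ k, |γ k| ≤ 1) {r : ℝ} (h0 : 0 ≤ r) (h1 : r < 1)
    (d : ℕ) : Summable fun k : ℕ => ‖(((k:ℝ) ^ d * γ k : ℝ) : ℂ)‖ * r ^ k := by
  refine Summable.of_nonneg_of_le (fun k => by positivity) (fun k => ?_)
    (summable_pow_mul_geometric_of_norm_lt_one d (r := r) (by rwa [Real.norm_of_nonneg h0]))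
  rw [Complex.norm_real, Real.norm_eq_abs, abs_mul, abs_of_nonneg (by positivity : (0:ℝ) ≤ k ^ d)]
  have : (0:ℝ) ≤ k ^ d := by positivity
  have h3 : (0:ℝ) ≤ r ^ k := by positivity
  calc (k:ℝ) ^ d * |γ k| * r ^ k ≤ k ^ d * 1 * r ^ k := by gcongr; exact hγ k
    _ = _ := by ring

/-- Summation by parts: coefficients of bounded variation give a kernel no larger than a multiple of
the Cauchy kernel, and an extra factor `k` costs `(1 - |v|)⁻¹`. -/
lemma norm_tsum_kernel_le {γ : ℕ → ℝ} (hγ : ∀ k, |γ k| ≤ 1)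
    (hs : Summable fun k => |γ (k + 1) - γ k|) {V : ℝ} (hV : ∑' k, |γ (k + 1) - γ k| ≤ V) {v : ℂ}
    (hv : ‖v‖ < 1) {d : ℕ} (hd : d ≤ 1) :
    ‖∑' k : ℕ, (((k:ℝ) ^ d * γ k : ℝ) : ℂ) * v ^ k‖
      ≤ (1 + V) * (1 - ‖v‖)⁻¹ ^ d * ‖1 - v‖⁻¹ := by
  have h1v : 0 < 1 - ‖v‖ := by linarith
  have hsum : Summable fun k : ℕ => (((k:ℝ) ^ d * γ k : ℝ) : ℂ) * v ^ k := by
    refine Summable.of_norm ((summable_natCast_pow_mul hγ (norm_nonneg v) hv d).congr fun k => ?_)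
    rw [norm_mul, norm_pow]
  have hpos : 0 < ‖1 - v‖ := by
    have := one_sub_norm_le_norm_one_sub (v := v) (ζ := 1) (by simp)
    rw [mul_one] at this
    linarith
  have key := one_sub_mul_tsum hsum
  rw [← div_eq_mul_inv, le_div_iff₀ hpos, mul_comm ‖tsum _‖, ← norm_mul, key]
  have hgeo := summable_geometric_of_lt_one (norm_nonneg v) hv
  interval_cases d
  · simp only [pow_zero, one_mul, mul_one]
    refine (norm_add_le _ _).trans ?_
    refine add_le_add (by simpa using hγ 0) (le_trans ?_ hV)
    refine tsum_of_norm_bounded hs.hasSum fun k => ?_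
    rw [norm_mul, norm_pow, ← Complex.ofReal_sub, Complex.norm_real, Real.norm_eq_abs]
    exact mul_le_of_le_one_right (abs_nonneg _) (pow_le_one₀ (norm_nonneg v) hv.le)
  · simp only [pow_one]
    have hb : HasSum (fun k => ‖v‖ ^ k + |γ (k + 1) - γ k| * (1 - ‖v‖)⁻¹)
        ((1 - ‖v‖)⁻¹ + (∑' k, |γ (k + 1) - γ k|) * (1 - ‖v‖)⁻¹) := by
      have := hgeo.hasSum
      rw [tsum_geometric_of_lt_one (norm_nonneg v) hv] at this
      exact this.add (hs.hasSum.mul_right _)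
    have h2 := tsum_of_norm_bounded (f := fun k : ℕ => ((((k + 1 : ℕ):ℝ) * γ (k + 1) : ℝ)
      - (((k:ℝ) * γ k : ℝ) : ℂ)) * v ^ (k + 1)) hb fun k => ?_
    · simp only [Nat.cast_zero, zero_mul, Complex.ofReal_zero, zero_add]
      refine h2.trans ?_
      have := mul_le_mul_of_nonneg_right hV (inv_pos.2 h1v).le
      linarith
    · rw [norm_mul, norm_pow, ← Complex.ofReal_sub, Complex.norm_real, Real.norm_eq_abs]
      have h3 : ((k + 1 : ℕ):ℝ) * γ (k + 1) - k * γ k = γ (k + 1) + k * (γ (k + 1) - γ k) := by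
        push_cast; ring
      rw [h3]
      have hvk : ‖v‖ ^ (k + 1) ≤ ‖v‖ ^ k := pow_le_pow_of_le_one (norm_nonneg v) hv.le k.le_succ
      have hk := natCast_mul_pow_le (norm_nonneg v) hv k
      calc |γ (k + 1) + k * (γ (k + 1) - γ k)| * ‖v‖ ^ (k + 1)
          ≤ (|γ (k + 1)| + k * |γ (k + 1) - γ k|) * ‖v‖ ^ k := by
            refine mul_le_mul ((abs_add_le _ _).trans ?_) hvk (by positivity) (by positivity)
            rw [abs_mul, Nat.abs_cast]
        _ = |γ (k + 1)| * ‖v‖ ^ k + |γ (k + 1) - γ k| * (k * ‖v‖ ^ k) := by ring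
        _ ≤ 1 * ‖v‖ ^ k + |γ (k + 1) - γ k| * (1 - ‖v‖)⁻¹ := by
            gcongr
            exact hγ _
        _ = _ := by ring

/-! ### The multiplier of the linearised dynamics -/

/-- The rate `λ_k = k (1 - η q^(k+1))` at which the linearised dynamics damps the coefficient of
`z⁻ᵏ`. -/
def rate (η q : ℝ) (k : ℕ) : ℝ := k * (1 - η * q ^ (k + 1))

lemma le_rate {η q : ℝ} (h0 : 0 ≤ q) (h1 : q ≤ 1) (k : ℕ) :
    min 1 (1 - η) * k ≤ rate η q k := by
  rw [rate, mul_comm]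
  refine mul_le_mul_of_nonneg_left ?_ k.cast_nonneg
  have hq : 0 ≤ q ^ (k + 1) := pow_nonneg h0 _
  have hq1 : q ^ (k + 1) ≤ 1 := pow_le_one₀ h0 h1
  rcases le_or_gt 0 η with h | h
  · exact (min_le_right _ _).trans (by nlinarith)
  · exact (min_le_left _ _).trans (by nlinarith)

lemma rate_nonneg {η q : ℝ} (hη : η ≤ 1) (h0 : 0 ≤ q) (h1 : q ≤ 1) (k : ℕ) : 0 ≤ rate η q k :=
  le_trans (mul_nonneg (le_min zero_le_one (by linarith)) k.cast_nonneg) (le_rate h0 h1 k)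

lemma rate_le {η q : ℝ} (h0 : 0 ≤ q) (h1 : q ≤ 1) (k : ℕ) : rate η q k ≤ (1 + |η|) * k := by
  rw [rate, mul_comm]
  refine mul_le_mul_of_nonneg_right ?_ k.cast_nonneg
  have hq : 0 ≤ q ^ (k + 1) := pow_nonneg h0 _
  have hq1 : q ^ (k + 1) ≤ 1 := pow_le_one₀ h0 h1
  nlinarith [abs_nonneg η, neg_abs_le η]

lemma abs_rate_succ_sub_le {η q : ℝ} (h0 : 0 ≤ q) (h1 : q < 1) (k : ℕ) :
    |rate η q (k + 1) - rate η q k| ≤ 1 + |η| := by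
  have h2 : rate η q (k + 1) - rate η q k = 1 - η * (q ^ (k + 1) * (q - k * (1 - q))) := by
    simp only [rate, pow_succ]
    push_cast
    ring
  have hk := natCast_mul_pow_le h0 h1 k
  have h1q : 0 < 1 - q := by linarith
  have hk2 : k * q ^ k * (1 - q) ≤ 1 := by
    have := mul_le_mul_of_nonneg_right hk h1q.le
    rwa [inv_mul_cancel₀ h1q.ne'] at this
  have hq : 0 ≤ q ^ k := pow_nonneg h0 _
  have hq1 : q ^ k ≤ 1 := pow_le_one₀ h0 h1.le
  have h3 : |q ^ (k + 1) * (q - k * (1 - q))| ≤ 1 := by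
    rw [abs_le]
    have e : q ^ (k + 1) * (q - k * (1 - q)) = q ^ k * q * q - q * (k * q ^ k * (1 - q)) := by
      rw [pow_succ]; ring
    have hkk : 0 ≤ k * q ^ k * (1 - q) := by positivity
    rw [e]
    have : q ^ k * q * q ≤ 1 := by
      have : q * q ≤ 1 := by nlinarith
      nlinarith
    have h5 : 0 ≤ q ^ k * q * q := by positivity
    constructor <;> nlinarith
  rw [h2]
  refine (abs_sub _ _).trans ?_
  rw [abs_one, abs_mul]
  nlinarith [abs_nonneg η]

lemma abs_exp_neg_sub_le {x y m : ℝ} (hx : m ≤ x) (hy : m ≤ y) :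
    |Real.exp (-x) - Real.exp (-y)| ≤ |x - y| * Real.exp (-m) := by
  wlog h : x ≤ y generalizing x y
  · rw [abs_sub_comm, abs_sub_comm x y]
    exact this hy hx (le_of_not_ge h)
  rw [abs_of_nonneg (sub_nonneg.2 (Real.exp_le_exp.2 (by linarith))), abs_sub_comm,
    abs_of_nonneg (by linarith)]
  have h1 : Real.exp (-y) = Real.exp (-x) * Real.exp (-(y - x)) := by
    rw [← Real.exp_add]; congr 1; ring
  have h2 := Real.add_one_le_exp (-(y - x))
  have h3 : Real.exp (-x) ≤ Real.exp (-m) := Real.exp_le_exp.2 (by linarith)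
  rw [h1]
  nlinarith [Real.exp_pos (-x), Real.exp_pos (-m)]

lemma inv_one_sub_exp_neg_le {y : ℝ} (hy : 0 < y) : (1 - Real.exp (-y))⁻¹ ≤ 1 + y⁻¹ := by
  have h1 := Real.add_one_le_exp y
  have h2 : Real.exp (-y) ≤ (1 + y)⁻¹ := by
    rw [Real.exp_neg]
    exact inv_anti₀ (by linarith) (by linarith)
  have h3 : y * (1 + y)⁻¹ ≤ 1 - Real.exp (-y) := by
    have : (1 + y) * (1 + y)⁻¹ = 1 := mul_inv_cancel₀ (by linarith)
    nlinarith
  have h4 : 0 < y * (1 + y)⁻¹ := by positivity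
  calc (1 - Real.exp (-y))⁻¹ ≤ (y * (1 + y)⁻¹)⁻¹ := inv_anti₀ h4 h3
    _ = 1 + y⁻¹ := by
      rw [mul_inv, inv_inv]
      field_simp
      ring

/-- The multiplier sequence at time `t`, with half of its guaranteed exponential decay removed. -/
def reducedMultiplier (η q t : ℝ) (k : ℕ) : ℝ :=
  Real.exp (-(t * (rate η q k - min 1 (1 - η) / 2 * k)))

lemma abs_reducedMultiplier_le {η q t : ℝ} (hη : η ≤ 1) (h0 : 0 ≤ q) (h1 : q ≤ 1) (ht : 0 ≤ t)
    (k : ℕ) : |reducedMultiplier η q t k| ≤ 1 := by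
  rw [reducedMultiplier, abs_of_pos (Real.exp_pos _), Real.exp_le_one_iff, neg_nonpos]
  refine mul_nonneg ht (sub_nonneg.2 (le_trans ?_ (le_rate h0 h1 k)))
  have : 0 ≤ min 1 (1 - η) := le_min zero_le_one (by linarith)
  have : (0:ℝ) ≤ k := k.cast_nonneg
  nlinarith [mul_nonneg ‹0 ≤ min 1 (1 - η)› this]

/-- The multipliers have bounded variation, uniformly in the regularization. For `η < 1` this comes
from their exponential decay, for `η = 1` from monotonicity. -/
lemma exists_variation_bound {η : ℝ} (hη : η ≤ 1) (T : ℝ) :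
    ∃ V, 0 ≤ V ∧ ∀ q t, 0 ≤ q → q < 1 → 0 ≤ t → t ≤ T →
      (Summable fun k => |reducedMultiplier η q t (k + 1) - reducedMultiplier η q t k|) ∧
      ∑' k, |reducedMultiplier η q t (k + 1) - reducedMultiplier η q t k| ≤ V := by
  rcases hη.lt_or_eq with hlt | rfl
  · set a := min 1 (1 - η) with ha
    have ha0 : 0 < a := lt_min one_pos (by linarith)
    have ha1 : a ≤ 1 := min_le_left _ _
    refine ⟨(2 + |η|) * (|T| + 2 * a⁻¹), by positivity, fun q t h0 h1 ht htT => ?_⟩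
    rcases ht.eq_or_lt with rfl | htpos
    · simp only [reducedMultiplier, zero_mul, neg_zero, Real.exp_zero, sub_self, abs_zero,
        tsum_zero]
      exact ⟨summable_zero, by positivity⟩
    set r := Real.exp (-(t * (a / 2))) with hr
    have hr1 : r < 1 := by
      rw [hr, Real.exp_lt_one_iff, neg_lt_zero]
      positivity
    have hr0 : 0 ≤ r := (Real.exp_pos _).le
    have hb : ∀ k, |reducedMultiplier η q t (k + 1) - reducedMultiplier η q t k|
        ≤ t * (2 + |η|) * r ^ k := by
      intro k
      have hl := le_rate (η := η) h0 h1.le k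
      have hl1 := le_rate (η := η) h0 h1.le (k + 1)
      rw [← ha] at hl hl1
      have hk : (0:ℝ) ≤ k := k.cast_nonneg
      push_cast at hl1
      have h2 := abs_exp_neg_sub_le (x := t * (rate η q (k + 1) - a / 2 * ((k + 1 : ℕ) : ℝ)))
        (y := t * (rate η q k - a / 2 * k)) (m := t * (a / 2 * k))
        (mul_le_mul_of_nonneg_left (by push_cast; nlinarith) ht)
        (mul_le_mul_of_nonneg_left (by nlinarith) ht)
      have h3 : Real.exp (-(t * (a / 2 * k))) = r ^ k := by
        rw [hr, ← Real.exp_nat_mul]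
        congr 1
        ring
      rw [h3] at h2
      refine h2.trans (mul_le_mul_of_nonneg_right ?_ (by positivity))
      rw [← mul_sub, abs_mul, abs_of_nonneg ht]
      refine mul_le_mul_of_nonneg_left ?_ ht
      have h4 := abs_rate_succ_sub_le (η := η) h0 h1 k
      have h5 : rate η q (k + 1) - a / 2 * ((k + 1 : ℕ) : ℝ) - (rate η q k - a / 2 * k)
          = (rate η q (k + 1) - rate η q k) - a / 2 := by push_cast; ring
      rw [h5]
      refine (abs_sub _ _).trans ?_
      rw [abs_of_nonneg (by positivity : 0 ≤ a / 2)]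
      linarith
    have hg : HasSum (fun k => t * (2 + |η|) * r ^ k) (t * (2 + |η|) * (1 - r)⁻¹) :=
      (hasSum_geometric_of_lt_one hr0 hr1).mul_left _
    have hs := Summable.of_nonneg_of_le (fun k => abs_nonneg _) hb hg.summable
    refine ⟨hs, (hasSum_le hb hs.hasSum hg).trans ?_⟩
    · have h6 := inv_one_sub_exp_neg_le (y := t * (a / 2)) (by positivity)
      calc t * (2 + |η|) * (1 - r)⁻¹ ≤ t * (2 + |η|) * (1 + (t * (a / 2))⁻¹) := by gcongr
        _ = (2 + |η|) * (t + 2 * a⁻¹) := by field_simp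
        _ ≤ _ := by
          gcongr
          exact htT.trans (le_abs_self T)
  · refine ⟨1, zero_le_one, fun q t h0 h1 ht htT => ?_⟩
    have hm : ∀ k, reducedMultiplier 1 q t (k + 1) ≤ reducedMultiplier 1 q t k := by
      intro k
      simp only [reducedMultiplier, sub_self, min_eq_right zero_le_one, zero_div, zero_mul, sub_zero]
      refine Real.exp_le_exp.2 (neg_le_neg (mul_le_mul_of_nonneg_left ?_ ht))
      simp only [rate, one_mul]
      have hq1 : q ^ (k + 1) ≤ 1 := pow_le_one₀ h0 h1.le
      have hq2 : q ^ (k + 1 + 1) ≤ q ^ (k + 1) := pow_le_pow_of_le_one h0 h1.le (Nat.le_succ _)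
      have hk : (0:ℝ) ≤ k := k.cast_nonneg
      push_cast
      nlinarith
    have hb : ∀ n, ∑ k ∈ Finset.range n, |reducedMultiplier 1 q t (k + 1) - reducedMultiplier 1 q t k|
        ≤ 1 := by
      intro n
      have h2 : ∀ k ∈ Finset.range n, |reducedMultiplier 1 q t (k + 1) - reducedMultiplier 1 q t k|
          = reducedMultiplier 1 q t k - reducedMultiplier 1 q t (k + 1) := fun k _ => by
        rw [abs_sub_comm, abs_of_nonneg (sub_nonneg.2 (hm k))]
      rw [Finset.sum_congr rfl h2, Finset.sum_range_sub']
      have h3 := abs_reducedMultiplier_le (η := 1) le_rfl h0 h1.le ht 0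
      have h4 : 0 ≤ reducedMultiplier 1 q t n := (Real.exp_pos _).le
      linarith [le_abs_self (reducedMultiplier 1 q t 0)]
    exact ⟨summable_of_sum_range_le (fun k => abs_nonneg _) hb,
      Real.tsum_le_of_sum_range_le (fun k => abs_nonneg _) hb⟩

/-- The kernel `∑ kᵈ exp (-t λ_k) uᵏ` of the linearised evolution at time `t`; `d = 1` is used to
evaluate `z f'(z)` instead of `f z`. -/
def evolutionKernel (η q : ℝ) (d : ℕ) (t : ℝ) (u : ℂ) : ℂ :=
  ∑' k : ℕ, (((k:ℝ) ^ d * Real.exp (-(t * rate η q k)) : ℝ) : ℂ) * u ^ k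

/-- Half of the guaranteed decay of the multipliers over time `t`, as a contraction factor. -/
def shrink (η t : ℝ) : ℝ := Real.exp (-(t * (min 1 (1 - η) / 2)))

lemma shrink_pos (η t : ℝ) : 0 < shrink η t := Real.exp_pos _

lemma shrink_le_one {η t : ℝ} (hη : η ≤ 1) (ht : 0 ≤ t) : shrink η t ≤ 1 := by
  rw [shrink, Real.exp_le_one_iff, neg_nonpos]
  have : 0 ≤ min 1 (1 - η) := le_min zero_le_one (by linarith)
  positivity

lemma multiplier_eq (η q t : ℝ) (k : ℕ) :
    Real.exp (-(t * rate η q k)) = reducedMultiplier η q t k * shrink η t ^ k := by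
  rw [reducedMultiplier, shrink, ← Real.exp_nat_mul, ← Real.exp_add]
  congr 1
  ring

lemma evolutionKernel_eq (η q : ℝ) (d : ℕ) (t : ℝ) (u : ℂ) :
    evolutionKernel η q d t u
      = ∑' k : ℕ, (((k:ℝ) ^ d * reducedMultiplier η q t k : ℝ) : ℂ) * (shrink η t * u) ^ k := by
  refine tsum_congr fun k => ?_
  rw [multiplier_eq, mul_pow]
  push_cast
  ring

lemma summable_evolutionKernel {η q t r : ℝ} (hη : η ≤ 1) (h0 : 0 ≤ q) (h1 : q ≤ 1) (ht : 0 ≤ t)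
    (d : ℕ) (hr : 0 ≤ r) (hr1 : shrink η t * r < 1) :
    Summable fun k : ℕ => ‖(((k:ℝ) ^ d * Real.exp (-(t * rate η q k)) : ℝ) : ℂ)‖ * r ^ k := by
  refine (summable_natCast_pow_mul (abs_reducedMultiplier_le hη h0 h1 ht)
    (mul_nonneg (shrink_pos η t).le hr) hr1 d).congr fun k => ?_
  rw [multiplier_eq, mul_pow, ← mul_assoc ((k:ℝ) ^ d), Complex.ofReal_mul _ (shrink η t ^ k),
    norm_mul, Complex.norm_real (shrink η t ^ k), norm_pow, Real.norm_of_nonneg (shrink_pos η t).le]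
  ring

lemma exists_kernel_bound {η : ℝ} (hη : η ≤ 1) (T : ℝ) :
    ∃ V, 1 ≤ V ∧ ∀ q t, 0 ≤ q → q < 1 → 0 ≤ t → t ≤ T → ∀ d ≤ 1, ∀ u : ℂ, shrink η t * ‖u‖ < 1 →
      ‖evolutionKernel η q d t u‖
        ≤ V * (1 - shrink η t * ‖u‖)⁻¹ ^ d * ‖1 - shrink η t * u‖⁻¹ := by
  obtain ⟨V, hV0, hV⟩ := exists_variation_bound hη T
  refine ⟨1 + V, by linarith, fun q t h0 h1 ht htT d hd u hu => ?_⟩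
  obtain ⟨hs, hV⟩ := hV q t h0 h1 ht htT
  have hn : ‖(shrink η t : ℂ) * u‖ = shrink η t * ‖u‖ := by
    rw [norm_mul, Complex.norm_real, Real.norm_of_nonneg (shrink_pos η t).le]
  rw [evolutionKernel_eq, ← hn]
  exact norm_tsum_kernel_le (abs_reducedMultiplier_le hη h0 h1.le ht) hs hV (by rwa [hn]) hd

/-! ### Univalence and a priori bounds -/

lemma IsBasicMap.tendsto_cobounded {F : ℂ → ℂ} {c : ℝ} (hF : IsBasicMap F c) :
    Tendsto F (Bornology.cobounded ℂ) (Bornology.cobounded ℂ) := by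
  rw [← tendsto_norm_atTop_iff_cobounded]
  have h1 := hF.tendsto_div.norm
  have h2 : 0 < ‖((Real.exp c : ℝ) : ℂ)‖ := by
    rw [Complex.norm_real]; exact norm_pos_iff.2 (Real.exp_pos c).ne'
  refine (h1.pos_mul_atTop h2 tendsto_norm_cobounded_atTop).congr' ?_
  filter_upwards [tendsto_norm_cobounded_atTop.eventually_gt_atTop 0] with z hz
  rw [← norm_mul, div_mul_cancel₀ _ (norm_pos_iff.1 hz)]

/-- A basic map does not decrease the modulus: Schwarz's lemma for `ζ ↦ 1 / F (1 / ζ)`. -/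
lemma IsBasicMap.norm_le {F : ℂ → ℂ} {c : ℝ} (hF : IsBasicMap F c) {z : ℂ}
    (hz : z ∈ exteriorDisk) : ‖z‖ ≤ ‖F z‖ := by
  set g : ℂ → ℂ := fun ζ => if ζ = 0 then 0 else (F ζ⁻¹)⁻¹ with hg
  have hm : ∀ ζ ∈ Metric.ball (0:ℂ) 1 \ {0}, ζ⁻¹ ∈ exteriorDisk := by
    intro ζ hζ
    rw [mem_exteriorDisk, norm_inv]
    exact (one_lt_inv₀ (norm_pos_iff.2 hζ.2)).2 (mem_ball_zero_iff.1 hζ.1)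
  have hd : DifferentiableOn ℂ g (Metric.ball 0 1) := by
    refine (Complex.differentiableOn_compl_singleton_and_continuousAt_iff (c := 0)
      (Metric.ball_mem_nhds _ one_pos)).1 ⟨?_, ?_⟩
    · refine DifferentiableOn.congr (f := fun ζ => (F ζ⁻¹)⁻¹) ?_ fun ζ hζ => if_neg hζ.2
      refine DifferentiableOn.inv ?_ fun ζ hζ => ?_
      · exact hF.differentiableOn.comp (differentiableOn_inv.mono fun ζ hζ => hζ.2) hm
      · exact ne_zero_of_mem_exteriorDisk (hF.mapsTo (hm ζ hζ))
    · rw [continuousAt_iff_punctured_nhds, show g 0 = 0 by simp [hg]]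
      have : Tendsto (fun ζ : ℂ => (F ζ⁻¹)⁻¹) (𝓝[≠] 0) (𝓝 0) :=
        tendsto_inv₀_cobounded.comp (hF.tendsto_cobounded.comp tendsto_inv₀_nhdsNE_zero)
      refine this.congr' ?_
      filter_upwards [self_mem_nhdsWithin] with ζ hζ
      exact (if_neg hζ).symm
  have hmaps : Set.MapsTo g (Metric.ball 0 1) (Metric.closedBall 0 1) := by
    intro ζ hζ
    rw [mem_closedBall_zero_iff]
    by_cases h0 : ζ = 0
    · simp [hg, h0]
    · have := hF.mapsTo (hm ζ ⟨hζ, h0⟩)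
      simp only [hg, h0, if_false, norm_inv]
      exact inv_le_one_of_one_le₀ (le_of_lt this)
  have h1 := Complex.norm_le_norm_of_mapsTo_ball hd hmaps (by simp [hg])
    (mem_ball_zero_iff.1 (inv_mem_ball hz))
  have hz0 := ne_zero_of_mem_exteriorDisk hz
  simp only [hg, inv_eq_zero, hz0, if_false, inv_inv, norm_inv] at h1
  exact (inv_le_inv₀ (norm_pos_iff.2 (ne_zero_of_mem_exteriorDisk (hF.mapsTo hz)))
    (norm_pos_iff.2 hz0)).1 h1

lemma norm_exp_mul_I (t : ℝ) : ‖Complex.exp (t * Complex.I)‖ = 1 := Complex.norm_exp_ofReal_mul_I t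

lemma norm_exp_neg_mul_I (t : ℝ) : ‖Complex.exp (-(t * Complex.I))‖ = 1 := by
  have := Complex.norm_exp_ofReal_mul_I (-t)
  rwa [Complex.ofReal_neg, neg_mul] at this

lemma rotated_mem_exteriorDisk {z : ℂ} (hz : z ∈ exteriorDisk) (t : ℝ) :
    Complex.exp (-(t * Complex.I)) * z ∈ exteriorDisk := by
  rw [mem_exteriorDisk, norm_mul, norm_exp_neg_mul_I, one_mul]
  exact hz

lemma norm_rotate (F : ℂ → ℂ) (t : ℝ) (z : ℂ) :
    ‖rotate F t z‖ = ‖F (Complex.exp (-(t * Complex.I)) * z)‖ := by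
  rw [rotate, norm_mul, norm_exp_mul_I, one_mul]

lemma IsBasicMap.norm_le_rotate {F : ℂ → ℂ} {c : ℝ} (hF : IsBasicMap F c) (t : ℝ) {z : ℂ}
    (hz : z ∈ exteriorDisk) : ‖z‖ ≤ ‖rotate F t z‖ := by
  have := hF.norm_le (rotated_mem_exteriorDisk hz t)
  rwa [norm_mul, norm_exp_neg_mul_I, one_mul, ← norm_rotate] at this

lemma IsBasicMap.mapsTo_rotate {F : ℂ → ℂ} {c : ℝ} (hF : IsBasicMap F c) (t : ℝ) :
    Set.MapsTo (rotate F t) exteriorDisk exteriorDisk := fun _ hz =>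
  lt_of_lt_of_le hz (hF.norm_le_rotate t hz)

lemma IsBasicMap.differentiableOn_rotate {F : ℂ → ℂ} {c : ℝ} (hF : IsBasicMap F c) (t : ℝ) :
    DifferentiableOn ℂ (rotate F t) exteriorDisk := by
  refine DifferentiableOn.const_mul ?_ _
  exact hF.differentiableOn.comp (by fun_prop) fun z hz => rotated_mem_exteriorDisk hz t

lemma IsBasicMap.injOn_rotate {F : ℂ → ℂ} {c : ℝ} (hF : IsBasicMap F c) (t : ℝ) :
    Set.InjOn (rotate F t) exteriorDisk := by
  intro z hz w hw h
  have h1 := mul_left_cancel₀ (Complex.exp_ne_zero _) h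
  exact mul_left_cancel₀ (Complex.exp_ne_zero _)
    (hF.injOn (rotated_mem_exteriorDisk hz t) (rotated_mem_exteriorDisk hw t) h1)

section Cluster

variable {F : ℂ → ℂ} {c : ℝ} (hF : IsBasicMap F c) (θ : ℕ → ℝ)
include hF

lemma IsBasicMap.differentiableOn_clusterMap (n : ℕ) :
    DifferentiableOn ℂ (clusterMap F θ n) exteriorDisk := by
  induction n with
  | zero => exact differentiableOn_id
  | succ n ih => exact ih.comp (hF.differentiableOn_rotate (θ n)) (hF.mapsTo_rotate (θ n))

lemma IsBasicMap.injOn_clusterMap (n : ℕ) : Set.InjOn (clusterMap F θ n) exteriorDisk := by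
  induction n with
  | zero => exact Set.injOn_id _
  | succ n ih => exact ih.comp (hF.injOn_rotate (θ n)) (hF.mapsTo_rotate (θ n))

end Cluster

/-- `L` is the branch of `log (F z / z)` with limit `c` at infinity, and obeys the regularity
estimate. -/
structure IsLogBranch (F : ℂ → ℂ) (c Λ : ℝ) (L : ℂ → ℂ) : Prop where
  isExt : IsExt L
  eq_mul_exp : ∀ z ∈ exteriorDisk, F z = z * Complex.exp (L z)
  circleAverage_eq : ∀ w ∈ exteriorDisk, circleAverage (fun ζ => L (ζ⁻¹ * w)) 0 1 = c
  re_nonneg : ∀ z ∈ exteriorDisk, 0 ≤ (L z).re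
  norm_sub_le : ∀ z ∈ exteriorDisk, ‖L z - c * ((z + 1) / (z - 1))‖ ≤
        Λ * c ^ (3 / 2 : ℝ) * ‖z‖ / (‖z - 1‖ * (‖z‖ - 1))

lemma norm_sub_one_ge (z : ℂ) : ‖z‖ - 1 ≤ ‖z - 1‖ := by
  have := norm_sub_norm_le z 1
  rwa [norm_one] at this

lemma norm_sub_capacity_le {c Λ : ℝ} (hc : 0 < c) (hc1 : c ≤ 1) (hΛ : 0 ≤ Λ) {l z : ℂ}
    (hz : 2 ≤ ‖z‖) (h : ‖l - c * ((z + 1) / (z - 1))‖ ≤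
      Λ * c ^ (3 / 2 : ℝ) * ‖z‖ / (‖z - 1‖ * (‖z‖ - 1))) :
    ‖l - c‖ ≤ 4 * (1 + Λ) * c / ‖z‖ := by
  have hz0 : 0 < ‖z‖ := by linarith
  have h1 := norm_sub_one_ge z
  have h2 : ‖z‖ / 2 ≤ ‖z - 1‖ := by linarith
  have hz1 : z - 1 ≠ 0 := norm_pos_iff.1 (by linarith)
  have h3 : l - c = (l - c * ((z + 1) / (z - 1))) + c * (2 / (z - 1)) := by
    field_simp
    ring
  have h4 : ‖(c:ℂ) * (2 / (z - 1))‖ ≤ c * (4 / ‖z‖) := by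
    rw [norm_mul, norm_div, Complex.norm_real, Real.norm_of_nonneg hc.le, Complex.norm_ofNat]
    refine mul_le_mul_of_nonneg_left ?_ hc.le
    rw [div_le_div_iff₀ (by linarith) hz0]
    linarith
  have hc32 : c ^ (3 / 2 : ℝ) ≤ c := by
    calc c ^ (3 / 2 : ℝ) ≤ c ^ (1:ℝ) := Real.rpow_le_rpow_of_exponent_ge hc hc1 (by norm_num)
      _ = c := Real.rpow_one c
  have h5 : Λ * c ^ (3 / 2 : ℝ) * ‖z‖ / (‖z - 1‖ * (‖z‖ - 1)) ≤ 4 * Λ * c / ‖z‖ := by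
    have h6 : ‖z‖ / 2 * (‖z‖ / 2) ≤ ‖z - 1‖ * (‖z‖ - 1) :=
      mul_le_mul h2 (by linarith) (by linarith) (by linarith)
    calc Λ * c ^ (3 / 2 : ℝ) * ‖z‖ / (‖z - 1‖ * (‖z‖ - 1))
        ≤ Λ * c * ‖z‖ / (‖z‖ / 2 * (‖z‖ / 2)) := by gcongr
      _ = 4 * Λ * c / ‖z‖ := by field_simp; ring
  rw [h3]
  refine (norm_add_le _ _).trans ((add_le_add (h.trans h5) h4).trans (le_of_eq ?_))
  ring

lemma HasRegularity.exists_logBranch {F : ℂ → ℂ} {c Λ : ℝ} (hF : IsBasicMap F c) (hc1 : c ≤ 1)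
    (hΛ : 0 ≤ Λ) (h : HasRegularity F c Λ) : ∃ L, IsLogBranch F c Λ L := by
  obtain ⟨L, hcont, hexp, hlim, hbd⟩ := h
  have hc := hF.capacity_pos
  have heq : ∀ z ∈ exteriorDisk, F z = z * Complex.exp (L z) := fun z hz => by
    rw [hexp z hz, mul_div_cancel₀ _ (ne_zero_of_mem_exteriorDisk hz)]
  have hdiff : DifferentiableOn ℂ L exteriorDisk := by
    intro z hz
    have hcz := hcont.continuousAt (isOpen_exteriorDisk.mem_nhds hz)
    have hFz : DifferentiableAt ℂ F z :=
      hF.differentiableOn.differentiableAt (isOpen_exteriorDisk.mem_nhds hz)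
    have h0 := ne_zero_of_mem_exteriorDisk hz
    -- near `z`, `L` is `L z` plus the principal logarithm of `exp (L w - L z)`
    have hev : ∀ᶠ w in 𝓝 z, L w = L z + Complex.log (F w / w * Complex.exp (-L z)) := by
      have hsmall : ∀ᶠ w in 𝓝 z, ‖L w - L z‖ < 1 := by
        have : Tendsto (fun w => ‖L w - L z‖) (𝓝 z) (𝓝 0) := by
          have := (hcz.tendsto.sub_const (L z)).norm
          simpa using this
        exact this.eventually_lt_const one_pos
      filter_upwards [hsmall, isOpen_exteriorDisk.mem_nhds hz] with w hw hwe
      have him := Complex.abs_im_le_norm (L w - L z)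
      rw [← hexp w hwe, ← Complex.exp_add, ← sub_eq_add_neg, Complex.log_exp]
      · ring
      · linarith [neg_abs_le (L w - L z).im, Real.pi_gt_three]
      · linarith [le_abs_self (L w - L z).im, Real.pi_gt_three]
    refine (DifferentiableAt.congr_of_eventuallyEq ?_ hev).differentiableWithinAt
    refine (differentiableAt_const _).add (DifferentiableAt.clog ?_ ?_)
    · exact (hFz.div differentiableAt_id h0).mul_const _
    · rw [← hexp z hz, ← Complex.exp_add, add_neg_cancel, Complex.exp_zero]
      exact Complex.one_mem_slitPlane
  have hext : IsExt L := isExt_of_bounded (M := 4 * (1 + Λ) * c + c) hdiff fun z hz => by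
    have h1 := norm_sub_capacity_le hc hc1 hΛ hz (hbd z (lt_of_lt_of_le one_lt_two hz))
    have h2 : 4 * (1 + Λ) * c / ‖z‖ ≤ 4 * (1 + Λ) * c :=
      div_le_self (by positivity) (by linarith)
    calc ‖L z‖ = ‖(L z - c) + c‖ := by rw [sub_add_cancel]
      _ ≤ ‖L z - c‖ + ‖(c:ℂ)‖ := norm_add_le _ _
      _ ≤ _ := by
        rw [Complex.norm_real, Real.norm_of_nonneg hc.le]
        linarith
  refine ⟨L, hext, heq, fun w hw => hext.circleAverage_eq_of_tendsto hlim hw, fun z hz => ?_, hbd⟩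
  have h1 := hF.norm_le hz
  rw [heq z hz, norm_mul, Complex.norm_exp] at h1
  have h2 : 0 < ‖z‖ := norm_pos_iff.2 (ne_zero_of_mem_exteriorDisk hz)
  have h3 : 1 ≤ Real.exp (L z).re := by
    by_contra hlt
    nlinarith
  exact Real.one_le_exp_iff.1 h3

lemma norm_exp_sub_one_le_mul_exp (x : ℂ) : ‖Complex.exp x - 1‖ ≤ ‖x‖ * Real.exp ‖x‖ := by
  simpa using Complex.norm_exp_sub_sum_le_norm_mul_exp x 1

/-- The constant in `‖F z - eᶜ z‖ ≤ C c` for `‖z‖ ≥ 2`. -/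
def farConst (Λ : ℝ) : ℝ := Real.exp 1 * (4 * (1 + Λ)) * Real.exp (4 * (1 + Λ))

lemma farConst_pos {Λ : ℝ} (hΛ : 0 ≤ Λ) : 0 < farConst Λ := by unfold farConst; positivity

section Apriori

variable {F : ℂ → ℂ} {c Λ : ℝ} {L : ℂ → ℂ} (hF : IsBasicMap F c) (hc1 : c ≤ 1)
  (hΛ : 0 ≤ Λ) (hL : IsLogBranch F c Λ L)
include hF hc1 hΛ hL

lemma IsLogBranch.norm_rotate_sub_le (t : ℝ) {z : ℂ} (hz : 2 ≤ ‖z‖) :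
    ‖rotate F t z - (Real.exp c : ℝ) * z‖ ≤ farConst Λ * c := by
  have hc := hF.capacity_pos
  set w := Complex.exp (-(t * Complex.I)) * z with hw
  have hwn : ‖w‖ = ‖z‖ := by rw [hw, norm_mul, norm_exp_neg_mul_I, one_mul]
  have hwe : w ∈ exteriorDisk := by rw [mem_exteriorDisk, hwn]; linarith
  have hz0 : 0 < ‖z‖ := by linarith
  have h1 : rotate F t z - (Real.exp c : ℝ) * z
      = Complex.exp (t * Complex.I) * (w * ((Real.exp c : ℝ) * (Complex.exp (L w - c) - 1))) := by
    have e1 : Complex.exp (t * Complex.I) * w = z := by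
      rw [hw, ← mul_assoc, ← Complex.exp_add, add_neg_cancel, Complex.exp_zero, one_mul]
    have e2 : ((Real.exp c : ℝ) : ℂ) * Complex.exp (L w - c) = Complex.exp (L w) := by
      rw [Complex.ofReal_exp, ← Complex.exp_add]; congr 1; ring
    rw [rotate, ← hw, hL.eq_mul_exp w hwe, mul_sub, e2, mul_one, mul_sub, mul_sub]
    rw [← mul_assoc _ w ((Real.exp c : ℝ) : ℂ), e1, mul_comm z]
  have h2 := norm_sub_capacity_le hc hc1 hΛ (by rwa [hwn]) (hL.norm_sub_le w hwe)
  rw [hwn] at h2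
  have h3 : ‖L w - c‖ ≤ 4 * (1 + Λ) := by
    refine h2.trans ?_
    rw [div_le_iff₀ hz0]
    have : 0 < 4 * (1 + Λ) := by positivity
    nlinarith
  have h4 := norm_exp_sub_one_le_mul_exp (L w - c)
  have h5 : Real.exp c ≤ Real.exp 1 := Real.exp_le_exp.2 hc1
  have h6 : Real.exp ‖L w - c‖ ≤ Real.exp (4 * (1 + Λ)) := Real.exp_le_exp.2 h3
  rw [h1, norm_mul, norm_exp_mul_I, one_mul, norm_mul w, hwn, norm_mul, Complex.norm_real,
    Real.norm_of_nonneg (Real.exp_pos c).le]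
  calc ‖z‖ * (Real.exp c * ‖Complex.exp (L w - c) - 1‖)
      ≤ ‖z‖ * (Real.exp 1 * ((4 * (1 + Λ) * c / ‖z‖) * Real.exp (4 * (1 + Λ)))) := by
        gcongr
        exact h4.trans (by gcongr)
    _ = farConst Λ * c := by
        rw [farConst]
        field_simp

lemma IsLogBranch.norm_clusterMap_sub_le_of_two_le (θ : ℕ → ℝ) (n : ℕ) {z : ℂ} (hz : 2 ≤ ‖z‖) :
    ‖clusterMap F θ n z - (Real.exp (c * n) : ℝ) * z‖
      ≤ n * c * (farConst Λ * Real.exp (c * n)) := by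
  have hc := hF.capacity_pos
  have hf := farConst_pos hΛ
  induction n generalizing z with
  | zero => simp [clusterMap]
  | succ n ih =>
    have hzr : 2 ≤ ‖rotate F (θ n) z‖ :=
      hz.trans (hF.norm_le_rotate (θ n) (lt_of_lt_of_le one_lt_two hz))
    have h1 := ih hzr
    have h2 := hL.norm_rotate_sub_le hF hc1 hΛ (θ n) hz
    have h3 : clusterMap F θ (n + 1) z - (Real.exp (c * (n + 1 : ℕ)) : ℝ) * z
        = (clusterMap F θ n (rotate F (θ n) z) - (Real.exp (c * n) : ℝ) * rotate F (θ n) z)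
          + (Real.exp (c * n) : ℝ) * (rotate F (θ n) z - (Real.exp c : ℝ) * z) := by
      rw [clusterMap, show c * ((n + 1 : ℕ) : ℝ) = c * n + c by push_cast; ring, Real.exp_add]
      push_cast
      ring
    rw [h3]
    refine (norm_add_le _ _).trans ?_
    rw [norm_mul, Complex.norm_real, Real.norm_of_nonneg (Real.exp_pos _).le]
    have h4 : Real.exp (c * n) ≤ Real.exp (c * (n + 1 : ℕ)) :=
      Real.exp_le_exp.2 (by push_cast; nlinarith)
    calc ‖clusterMap F θ n (rotate F (θ n) z) - (Real.exp (c * n) : ℝ) * rotate F (θ n) z‖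
          + Real.exp (c * n) * ‖rotate F (θ n) z - (Real.exp c : ℝ) * z‖
        ≤ n * c * (farConst Λ * Real.exp (c * n)) + Real.exp (c * n) * (farConst Λ * c) := by
          gcongr
      _ = ((n + 1 : ℕ) : ℝ) * c * (farConst Λ * Real.exp (c * n)) := by push_cast; ring
      _ ≤ _ := by gcongr

end Apriori

lemma isPreconnected_norm_gt {M : ℝ} (hM : 0 < M) : IsPreconnected {w : ℂ | M < ‖w‖} := by
  have h1 : {w : ℂ | M < ‖w‖} = Complex.exp '' {z : ℂ | Real.log M < z.re} := by
    ext w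
    constructor
    · intro hw
      have hw0 : w ≠ 0 := norm_pos_iff.1 (hM.trans hw)
      refine ⟨Complex.log w, ?_, Complex.exp_log hw0⟩
      change Real.log M < (Complex.log w).re
      rw [Complex.log_re]
      exact Real.log_lt_log hM hw
    · rintro ⟨z, hz, rfl⟩
      change M < ‖Complex.exp z‖
      rw [Complex.norm_exp]
      exact (Real.log_lt_iff_lt_exp hM).1 hz
  rw [h1]
  exact (convex_halfSpace_re_gt _).isPreconnected.image _ Complex.continuous_exp.continuousOn

/-- An injective holomorphic map of the exterior disk which is close to `b z` for `|z| ≥ 2` covers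
a neighbourhood of infinity by the image of `{|z| > 2}`, so it is bounded on `{1 < |z| < 2}`. -/
lemma norm_le_of_injOn {Φ : ℂ → ℂ} (hd : DifferentiableOn ℂ Φ exteriorDisk)
    (hi : Set.InjOn Φ exteriorDisk) {b C : ℝ} (hb : 1 ≤ b) (hC : 0 ≤ C)
    (h : ∀ z : ℂ, 2 ≤ ‖z‖ → ‖Φ z - b * z‖ ≤ C) {z : ℂ} (hz : z ∈ exteriorDisk) (hz2 : ‖z‖ < 2) :
    ‖Φ z‖ ≤ 2 * b + C := by
  by_contra hgt
  push Not at hgt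
  set M := 2 * b + C with hM
  have hM0 : 0 < M := by positivity
  set U : Set ℂ := {z | 2 < ‖z‖} with hU
  have hUo : IsOpen U := isOpen_lt continuous_const continuous_norm
  have hUe : U ⊆ exteriorDisk := fun w (hw : 2 < ‖w‖) =>
    mem_exteriorDisk.2 (lt_trans one_lt_two hw)
  have hbn : ∀ w : ℂ, ‖(b:ℂ) * w‖ = b * ‖w‖ := fun w => by
    rw [norm_mul, Complex.norm_real, Real.norm_of_nonneg (by linarith)]
  have hlow : ∀ w : ℂ, 2 ≤ ‖w‖ → ‖w‖ - C ≤ ‖Φ w‖ := by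
    intro w hw
    have h1 := norm_sub_norm_le ((b:ℂ) * w) (Φ w)
    rw [norm_sub_rev, hbn] at h1
    nlinarith [h w hw]
  have hopen : IsOpen (Φ '' U) := by
    rw [isOpen_iff_mem_nhds]
    rintro _ ⟨w, hw, rfl⟩
    have han : AnalyticAt ℂ Φ w := (hd.analyticOnNhd isOpen_exteriorDisk) w (hUe hw)
    rcases han.eventually_constant_or_nhds_le_map_nhds with hcst | hle
    · exfalso
      have hev : ∀ᶠ v in 𝓝 w, v = w := by
        filter_upwards [hcst, isOpen_exteriorDisk.mem_nhds (hUe hw)] with v hv hve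
        exact hi hve (hUe hw) hv
      have : (𝓝[≠] w) = ⊥ := by
        rw [← Filter.empty_mem_iff_bot, mem_nhdsWithin_iff_eventually]
        filter_upwards [hev] with v hv hne using hne hv
      exact NeBot.ne inferInstance this
    · exact hle (image_mem_map (hUo.mem_nhds hw))
  set W : Set ℂ := {w | M < ‖w‖} with hW
  have hWo : IsOpen W := isOpen_lt continuous_const continuous_norm
  -- inside `W`, the image is also closed
  have hcl : closure (Φ '' U) ∩ W ⊆ Φ '' U := by
    rintro w ⟨hw, hwW⟩
    obtain ⟨v, hv, hlim⟩ := mem_closure_iff_seq_limit.1 hw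
    choose x hx hxv using hv
    have hbv : ∃ R, ∀ n, ‖x n‖ ≤ R := by
      obtain ⟨R, hR⟩ := hlim.norm.bddAbove_range
      refine ⟨R + C, fun n => ?_⟩
      have := hlow (x n) (le_of_lt (hx n))
      have h2 : ‖v n‖ ≤ R := hR ⟨n, rfl⟩
      rw [hxv n] at this
      linarith
    obtain ⟨R, hR⟩ := hbv
    obtain ⟨y, -, φ, hφ, hy⟩ := (isCompact_closedBall (0:ℂ) R).tendsto_subseq
      (x := x) fun n => by simpa using hR n
    have hy2 : 2 ≤ ‖y‖ := ge_of_tendsto hy.norm (.of_forall fun n => le_of_lt (hx (φ n)))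
    have hcont : ContinuousAt Φ y := hd.continuousOn.continuousAt
      (isOpen_exteriorDisk.mem_nhds (lt_of_lt_of_le one_lt_two hy2))
    have hΦ : Φ y = w := by
      refine tendsto_nhds_unique (hcont.tendsto.comp hy) ?_
      refine (hlim.comp hφ.tendsto_atTop).congr fun n => ?_
      exact (hxv (φ n)).symm
    rcases hy2.lt_or_eq with hlt | heq
    · exact ⟨y, hlt, hΦ⟩
    · exfalso
      have h1 := h y hy2
      have h2 : ‖Φ y‖ ≤ ‖Φ y - b * y‖ + ‖(b:ℂ) * y‖ := by
        simpa using norm_add_le (Φ y - b * y) (b * y)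
      rw [hbn, ← heq] at h2
      have h3 : M < ‖w‖ := hwW
      rw [← hΦ] at h3
      linarith
  have hsub : W ⊆ Φ '' U := by
    refine (isPreconnected_norm_gt hM0).subset_of_closure_inter_subset hopen ?_ hcl
    have hR : ∃ w : ℂ, ‖w‖ = M + C + 3 :=
      ⟨((M + C + 3 : ℝ) : ℂ), by rw [Complex.norm_real, Real.norm_of_nonneg (by positivity)]⟩
    obtain ⟨w, hw⟩ := hR
    refine ⟨Φ w, ?_, w, ?_, rfl⟩
    · have := hlow w (by rw [hw]; linarith)
      change M < ‖Φ w‖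
      linarith
    · change 2 < ‖w‖
      rw [hw]
      linarith
  obtain ⟨w, hw, hwz⟩ := hsub hgt
  have : w = z := hi (hUe hw) hz hwz
  rw [this] at hw
  exact absurd hw (not_lt.2 hz2.le)

/-- The deviation `Φ_n(z) - e^{cn} z` of the cluster from a disk. -/
def deviation (F : ℂ → ℂ) (c : ℝ) (θ : ℕ → ℝ) (n : ℕ) (z : ℂ) : ℂ :=
  clusterMap F θ n z - (Real.exp (c * n) : ℝ) * z

/-- The deterministic bound on the deviation. -/
def aprioriConst (Λ T : ℝ) : ℝ := 4 * Real.exp T + T * (farConst Λ * Real.exp T)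

section Apriori

variable {F : ℂ → ℂ} {c Λ T : ℝ} {L : ℂ → ℂ} (hF : IsBasicMap F c) (hc1 : c ≤ 1)
  (hΛ : 0 ≤ Λ) (hL : IsLogBranch F c Λ L) (θ : ℕ → ℝ) {n : ℕ} (hn : c * n ≤ T)
include hF hc1 hΛ hL hn

lemma norm_deviation_le {z : ℂ} (hz : z ∈ exteriorDisk) :
    ‖deviation F c θ n z‖ ≤ aprioriConst Λ T := by
  have hc := hF.capacity_pos
  have hf := farConst_pos hΛ
  have hcn : 0 ≤ c * n := by positivity
  have hT : 0 ≤ T := hcn.trans hn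
  have hexp : Real.exp (c * n) ≤ Real.exp T := Real.exp_le_exp.2 hn
  have hfar : ∀ z : ℂ, 2 ≤ ‖z‖ → ‖clusterMap F θ n z - (Real.exp (c * n) : ℝ) * z‖
      ≤ T * (farConst Λ * Real.exp T) := fun z hz =>
    (hL.norm_clusterMap_sub_le_of_two_le hF hc1 hΛ θ n hz).trans (by
      rw [mul_comm (n:ℝ) c]; gcongr)
  rw [deviation, aprioriConst]
  rcases le_or_gt 2 ‖z‖ with h2 | h2
  · refine (hfar z h2).trans ?_
    have := Real.exp_pos T
    linarith
  · have h1 := norm_le_of_injOn (hF.differentiableOn_clusterMap θ n) (hF.injOn_clusterMap θ n)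
      (Real.one_le_exp hcn) (by positivity) hfar hz h2
    refine (norm_sub_le _ _).trans ?_
    rw [norm_mul, Complex.norm_real, Real.norm_of_nonneg (Real.exp_pos _).le]
    nlinarith [Real.exp_pos (c * n)]

lemma isExt_deviation : IsExt (deviation F c θ n) := by
  refine isExt_of_bounded (M := aprioriConst Λ T) ?_ fun z hz =>
    norm_deviation_le hF hc1 hΛ hL θ hn (lt_of_lt_of_le one_lt_two hz)
  exact (hF.differentiableOn_clusterMap θ n).sub (by fun_prop)

end Apriori

/-! ### Herglotz' formula -/

lemma hasSum_herglotz {u : ℂ} (hu : ‖u‖ < 1) :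
    ∑' k : ℕ, (if k = 0 then 1 else 2 : ℂ) * u ^ k = (1 + u) / (1 - u) := by
  have h1 : 1 - u ≠ 0 := sub_ne_zero.2 fun h => by rw [← h, norm_one] at hu; exact lt_irrefl _ hu
  have hg := (hasSum_geometric_of_norm_lt_one hu).mul_left 2
  have h2 : HasSum (fun k : ℕ => if k = 0 then (1:ℂ) else 0) 1 := by
    simpa using hasSum_ite_eq 0 (1:ℂ)
  refine ((hg.sub h2).congr_fun fun k => ?_).tsum_eq.trans ?_
  · by_cases hk : k = 0
    · simp only [hk, if_true, pow_zero]; norm_num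
    · simp [hk]
  · field_simp
    ring

/-- Herglotz' formula on the exterior disk: averaging the real part of a holomorphic function
vanishing at infinity against `(w + ζ) / (w - ζ)` recovers the function. -/
lemma circleAverage_herglotz {p : ℂ → ℂ} (hp : IsExt p)
    (h0 : Tendsto p (Bornology.cobounded ℂ) (𝓝 0)) {r : ℝ} (hr : 1 < r) {w : ℂ}
    (hw : w ∈ exteriorDisk) :
    circleAverage (fun ζ => (w + ζ) / (w - ζ) * ((p (r * ζ)).re : ℂ)) 0 1 = p (r * w) := by
  have hr0 : (0:ℝ) < r := by linarith
  have hrw : (r:ℂ) * w ∈ exteriorDisk := by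
    rw [mem_exteriorDisk, norm_mul, Complex.norm_real, Real.norm_of_nonneg hr0.le]
    have : 1 < ‖w‖ := hw
    nlinarith
  have hw0 := ne_zero_of_mem_exteriorDisk hw
  have hrc : (r:ℂ) ≠ 0 := by exact_mod_cast hr0.ne'
  have hlt : ∀ φ, ‖circleMap 0 1 φ / w‖ < 1 := fun φ => by
    rw [norm_div, norm_unit_circle, one_div]
    exact inv_lt_one_of_one_lt₀ hw
  have hne : ∀ φ, w - circleMap 0 1 φ ≠ 0 := fun φ h => by
    have h1 : w = circleMap 0 1 φ := sub_eq_zero.1 h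
    have h2 : 1 < ‖w‖ := hw
    rw [h1, norm_unit_circle] at h2
    exact lt_irrefl _ h2
  have hmem : ∀ φ, (r:ℂ) * circleMap 0 1 φ ∈ exteriorDisk := fun φ => by
    rw [mem_exteriorDisk, norm_mul, norm_unit_circle, Complex.norm_real,
      Real.norm_of_nonneg hr0.le, mul_one]
    exact hr
  have hpc : Continuous fun φ => p (r * circleMap 0 1 φ) :=
    hp.differentiableOn.continuousOn.comp_continuous (by fun_prop) hmem
  have hKc : Continuous fun φ => (w + circleMap 0 1 φ) / (w - circleMap 0 1 φ) :=
    Continuous.div (by fun_prop) (by fun_prop) hne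
  -- the holomorphic half
  have hA : circleAverage (fun ζ => (w + ζ) / (w - ζ) * p (r * ζ)) 0 1 = 2 * p (r * w) := by
    obtain ⟨a, ha, -⟩ := hp.exists_hasLaurent
    have ha0 : a 0 = 0 := by
      have h1 := ha.circleAverage_mul_pow hr 0
      simp only [pow_zero, mul_one] at h1
      have h2 := hp.circleAverage_eq_of_tendsto h0 (w := r) (by
        rw [mem_exteriorDisk, Complex.norm_real, Real.norm_of_nonneg hr0.le]; exact hr)
      have h3 := Real.circleAverage_zero_one_congr_inv (f := fun ζ => p (ζ * r))
      rw [h3] at h2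
      rw [Real.circleAverage_eq_circleAverage_zero_one] at h1
      simp only [add_zero, mul_comm (r:ℂ)] at h1
      rw [← h1, h2]
    have h1 := ha.hasSum_multiplier hp.differentiableOn.continuousOn hr
      (ne_zero_of_mem_exteriorDisk hrw) (γ := fun k => if k = 0 then 1 else 2) (by
        have hq : r / ‖(r:ℂ) * w‖ < 1 := by
          rw [norm_mul, Complex.norm_real, Real.norm_of_nonneg hr0.le, div_mul_cancel_left₀ hr0.ne']
          exact inv_lt_one_of_one_lt₀ hw
        refine Summable.of_nonneg_of_le (fun k => by positivity) (fun k => ?_)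
          ((summable_geometric_of_lt_one (by positivity) hq).mul_left 2)
        refine mul_le_mul_of_nonneg_right ?_ (by positivity)
        split_ifs <;> simp)
    have h2 : HasSum (fun k => (if k = 0 then 1 else 2 : ℂ) * a k * ((r:ℂ) * w)⁻¹ ^ k)
        (2 * p (r * w)) := by
      refine ((ha _ hrw).mul_left 2).congr_fun fun k => ?_
      by_cases hk : k = 0
      · simp [hk, ha0]
      · simp [hk, mul_assoc]
    rw [← h1.unique h2, Real.circleAverage_eq_circleAverage_zero_one (R := r)]
    refine Real.circleAverage_congr_sphere fun ζ hζ => ?_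
    have hζ1 : ‖ζ‖ = 1 := by simpa using hζ
    have hu : ‖(r * ζ + 0) / (r * w)‖ < 1 := by
      rw [add_zero, mul_div_mul_left _ _ hrc, norm_div, hζ1, one_div]
      exact inv_lt_one_of_one_lt₀ hw
    have hwz : w - ζ ≠ 0 := sub_ne_zero.2 fun h => by
      have h2 : 1 < ‖w‖ := hw
      rw [h, hζ1] at h2
      exact lt_irrefl _ h2
    rw [hasSum_herglotz hu, add_zero, mul_div_mul_left _ _ hrc, mul_comm]
    congr 1
    have : 1 - ζ / w ≠ 0 := by
      rw [one_sub_div hw0]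
      exact div_ne_zero hwz hw0
    field_simp
  -- the antiholomorphic half averages to zero
  have hB : circleAverage (fun ζ => (w + ζ) / (w - ζ) * (starRingEnd ℂ) (p (r * ζ))) 0 1 = 0 := by
    obtain ⟨g, hg, hpg, hg0⟩ := hp.exists_eq_and_tendsto h0
    set β := (starRingEnd ℂ) w⁻¹ with hβ
    have hβ1 : ‖β‖ < 1 := by
      rw [hβ, RCLike.norm_conj, norm_inv]
      exact inv_lt_one_of_one_lt₀ hw
    have hd : DiffContOnCl ℂ (fun ζ : ℂ => (1 + β * ζ) / (1 - β * ζ) * g ((r:ℂ)⁻¹ * ζ))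
        (Metric.ball 0 |1|) := by
      rw [abs_one]
      refine DifferentiableOn.diffContOnCl ?_
      rw [closure_ball _ one_ne_zero]
      refine DifferentiableOn.mul (DifferentiableOn.div (by fun_prop) (by fun_prop) ?_) ?_
      · intro ζ hζ h
        have := re_one_sub_pos hβ1 (by simpa using hζ : ‖ζ‖ ≤ 1)
        rw [h] at this
        simp at this
      · refine hg.comp (by fun_prop) fun ζ hζ => ?_
        have hζ1 : ‖ζ‖ ≤ 1 := by simpa using hζ
        have : r⁻¹ < 1 := inv_lt_one_of_one_lt₀ hr
        have h0 : 0 < r⁻¹ := inv_pos.2 hr0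
        rw [mem_ball_zero_iff, norm_mul, norm_inv, Complex.norm_real, Real.norm_of_nonneg hr0.le]
        nlinarith [norm_nonneg ζ]
    have hm := hd.circleAverage
    rw [mul_zero, mul_zero, hg0, mul_zero, ← Real.circleAverage_zero_one_congr_inv] at hm
    have hconj : circleAverage (fun ζ => (w + ζ) / (w - ζ) * (starRingEnd ℂ) (p (r * ζ))) 0 1
        = (starRingEnd ℂ) (circleAverage
          (fun ζ : ℂ => (1 + β * ζ⁻¹) / (1 - β * ζ⁻¹) * g ((r:ℂ)⁻¹ * ζ⁻¹)) 0 1) := by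
      have hci : CircleIntegrable (fun ζ => (starRingEnd ℂ) ((w + ζ) / (w - ζ)) * p (r * ζ)) 0 1 :=
        circleIntegrable_of_continuous ((Complex.continuous_conj.comp hKc).mul hpc)
      have h1 := (Complex.conjCLE : ℂ →L[ℝ] ℂ).circleAverage_comp_comm hci
      have h2 : ∀ ζ ∈ Metric.sphere (0:ℂ) |1|, (1 + β * ζ⁻¹) / (1 - β * ζ⁻¹) * g ((r:ℂ)⁻¹ * ζ⁻¹)
          = (starRingEnd ℂ) ((w + ζ) / (w - ζ)) * p (r * ζ) := by
        intro ζ hζ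
        have hζ1 : ‖ζ‖ = 1 := by simpa using hζ
        have hζ0 : ζ ≠ 0 := norm_pos_iff.1 (by rw [hζ1]; exact one_pos)
        have hζc : ζ⁻¹ = (starRingEnd ℂ) ζ := Complex.inv_eq_conj hζ1
        have hr1 : (r:ℂ) * ζ ∈ exteriorDisk := by
          rw [mem_exteriorDisk, norm_mul, hζ1, Complex.norm_real, Real.norm_of_nonneg hr0.le,
            mul_one]
          exact hr
        rw [hpg _ hr1, mul_inv]
        congr 1
        rw [hβ, hζc, ← map_mul]
        rw [show (1:ℂ) = (starRingEnd ℂ) 1 by simp, ← map_add, ← map_sub, ← map_div₀]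
        congr 1
        have hwz : w - ζ ≠ 0 := sub_ne_zero.2 fun h => by
          have h2 : 1 < ‖w‖ := hw
          rw [h, hζ1] at h2
          exact lt_irrefl _ h2
        have : 1 - w⁻¹ * ζ ≠ 0 := by
          have : 1 - w⁻¹ * ζ = (w - ζ) / w := by field_simp
          rw [this]
          exact div_ne_zero hwz hw0
        rw [div_eq_div_iff this hwz]
        field_simp
      rw [Real.circleAverage_congr_sphere h2]
      refine Eq.trans ?_ h1
      refine Real.circleAverage_congr_sphere fun ζ hζ => ?_
      simp
    rw [hconj]
    rw [hm, map_zero]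
  have hsum : (fun ζ => (w + ζ) / (w - ζ) * ((p (r * ζ)).re : ℂ))
      = fun ζ => (1 / 2 : ℂ) • ((w + ζ) / (w - ζ) * p (r * ζ)
        + (w + ζ) / (w - ζ) * (starRingEnd ℂ) (p (r * ζ))) := by
    ext ζ
    rw [← mul_add, Complex.add_conj, smul_eq_mul]
    push_cast
    ring
  rw [hsum, Real.circleAverage_fun_smul, Real.circleAverage_fun_add, hA, hB, add_zero, smul_eq_mul]
  · ring
  · exact circleIntegrable_of_continuous (hKc.mul hpc)
  · exact circleIntegrable_of_continuous (hKc.mul (Complex.continuous_conj.comp hpc))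

/-- The real part of a holomorphic function vanishing at infinity has mean zero on circles. -/
lemma circleAverage_re_eq_zero {p : ℂ → ℂ} (hp : IsExt p)
    (h0 : Tendsto p (Bornology.cobounded ℂ) (𝓝 0)) {r : ℝ} (hr : 1 < r) :
    circleAverage (fun ζ => (p (r * ζ)).re) 0 1 = 0 := by
  have hr0 : (0:ℝ) < r := by linarith
  have hmem : ∀ φ, (r:ℂ) * circleMap 0 1 φ ∈ exteriorDisk := fun φ => by
    rw [mem_exteriorDisk, norm_mul, norm_unit_circle, Complex.norm_real,
      Real.norm_of_nonneg hr0.le, mul_one]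
    exact hr
  have hpc : Continuous fun φ => p (r * circleMap 0 1 φ) :=
    hp.differentiableOn.continuousOn.comp_continuous (by fun_prop) hmem
  rw [circleAverage_re (f := fun ζ => p (r * ζ)) hpc]
  have h2 := hp.circleAverage_eq_of_tendsto h0 (w := r) (by
    rw [mem_exteriorDisk, Complex.norm_real, Real.norm_of_nonneg hr0.le]; exact hr)
  have h3 := Real.circleAverage_zero_one_congr_inv (f := fun ζ => p (ζ * r))
  rw [h3] at h2
  simp only [mul_comm (r:ℂ)]
  rw [h2, Complex.zero_re]

/-! ### The attachment density near a disk -/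

lemma exists_abs_rpow_sub_le (η : ℝ) : ∃ K, 0 ≤ K ∧ ∀ ψ : ℂ, ‖ψ‖ ≤ 1 / 2 →
    |‖1 + ψ‖ ^ (-η) - 1 + η * ψ.re| ≤ K * ‖ψ‖ ^ 2 := by
  refine ⟨|η| + 4 * η ^ 2 * Real.exp (2 * |η|), by positivity, fun ψ hψ => ?_⟩
  have hψ1 : ‖ψ‖ < 1 := by linarith
  have hne : 1 + ψ ≠ 0 := fun h => by
    have : ψ = -1 := by linear_combination h
    rw [this, norm_neg, norm_one] at hψ1
    exact lt_irrefl _ hψ1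
  set l := Real.log ‖1 + ψ‖ with hl
  have hlog : ‖Complex.log (1 + ψ) - ψ‖ ≤ ‖ψ‖ ^ 2 := by
    refine (Complex.norm_log_one_add_sub_self_le hψ1).trans ?_
    have : (1 - ‖ψ‖)⁻¹ ≤ 2 := by
      rw [inv_le_comm₀ (by linarith) two_pos]
      linarith
    nlinarith [sq_nonneg ‖ψ‖]
  have h1 : |l - ψ.re| ≤ ‖ψ‖ ^ 2 := by
    have := (Complex.abs_re_le_norm (Complex.log (1 + ψ) - ψ)).trans hlog
    rwa [Complex.sub_re, Complex.log_re] at this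
  have hre := Complex.abs_re_le_norm ψ
  have h2 : |l| ≤ 2 * ‖ψ‖ := by
    have : |l| ≤ |l - ψ.re| + |ψ.re| := by
      simpa using abs_add_le (l - ψ.re) ψ.re
    nlinarith [norm_nonneg ψ]
  have h3 : ‖1 + ψ‖ ^ (-η) = Real.exp (-η * l) := by
    rw [Real.rpow_def_of_pos (norm_pos_iff.2 hne), mul_comm]
  set y := -η * l with hy
  have hy1 : |y| ≤ 2 * |η| * ‖ψ‖ := by
    rw [hy, abs_mul, abs_neg]
    nlinarith [abs_nonneg η]
  have h4 : |Real.exp y - 1 - y| ≤ y ^ 2 * Real.exp |y| := by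
    have := Complex.norm_exp_sub_sum_le_norm_mul_exp (y : ℂ) 2
    simp only [Finset.sum_range_succ, Finset.sum_range_zero, pow_zero, Nat.factorial_zero,
      Nat.cast_one, div_one, zero_add, pow_one, Nat.factorial_one] at this
    rw [← Complex.ofReal_exp, ← Complex.ofReal_one, ← Complex.ofReal_add, ← Complex.ofReal_sub,
      Complex.norm_real, Complex.norm_real, Real.norm_eq_abs, Real.norm_eq_abs, sq_abs,
      ← sub_sub] at this
    exact this
  have h5 : Real.exp |y| ≤ Real.exp (2 * |η|) := by
    refine Real.exp_le_exp.2 (hy1.trans ?_)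
    nlinarith [abs_nonneg η]
  have h6 : y ^ 2 ≤ 4 * η ^ 2 * ‖ψ‖ ^ 2 := by
    rw [← sq_abs y]
    calc |y| ^ 2 ≤ (2 * |η| * ‖ψ‖) ^ 2 := by gcongr
      _ = 4 * η ^ 2 * ‖ψ‖ ^ 2 := by rw [mul_pow, mul_pow, sq_abs]; ring
  have h7 : ‖1 + ψ‖ ^ (-η) - 1 + η * ψ.re = (Real.exp y - 1 - y) + -η * (l - ψ.re) := by
    rw [h3, hy]; ring
  rw [h7]
  refine (abs_add_le _ _).trans ?_
  rw [abs_mul, abs_neg]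
  have h8 : y ^ 2 * Real.exp |y| ≤ 4 * η ^ 2 * ‖ψ‖ ^ 2 * Real.exp (2 * |η|) := by gcongr
  have h9 : |η| * |l - ψ.re| ≤ |η| * ‖ψ‖ ^ 2 := by gcongr
  linarith

/-- A density on the unit circle which is uniform up to an error of size `q₁`, and given by
`1 - η Re ψ` up to an error of size `q₂`. -/
structure IsNearUniform (h : ℂ → ℝ) (η : ℝ) (ψ : ℂ → ℂ) (q₁ q₂ : ℝ) : Prop where
  continuous : Continuous fun φ => h (circleMap 0 1 φ)
  nonneg : ∀ φ, 0 ≤ h (circleMap 0 1 φ)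
  le_two : ∀ φ, h (circleMap 0 1 φ) ≤ 2
  average : circleAverage h 0 1 = 1
  abs_sub_one_le : ∀ φ, |h (circleMap 0 1 φ) - 1| ≤ q₁
  abs_sub_linear_le : ∀ φ, |h (circleMap 0 1 φ) - 1 + η * (ψ (circleMap 0 1 φ)).re| ≤ q₂

lemma exists_isNearUniform (η : ℝ) : ∃ K p₀, 0 ≤ K ∧ 0 < p₀ ∧ p₀ ≤ 1 / 2 ∧
    ∀ (ψ : ℂ → ℂ) (p : ℝ), p ≤ p₀ → (Continuous fun φ => ψ (circleMap 0 1 φ)) →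
      (∀ φ, ‖ψ (circleMap 0 1 φ)‖ ≤ p) → circleAverage (fun ζ => (ψ ζ).re) 0 1 = 0 →
      IsNearUniform (fun ζ => ‖1 + ψ ζ‖ ^ (-η) / circleAverage (fun ζ => ‖1 + ψ ζ‖ ^ (-η)) 0 1)
        η ψ (K * p) (K * p ^ 2) := by
  obtain ⟨K, hK, hKb⟩ := exists_abs_rpow_sub_le η
  set K' := 4 * (|η| + 1) * (K + 1) with hK'
  have hK'1 : 1 ≤ K' := by rw [hK']; nlinarith [abs_nonneg η]
  refine ⟨K', 1 / (2 * K'), by positivity, by positivity, ?_, ?_⟩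
  · exact one_div_le_one_div_of_le two_pos (by linarith)
  intro ψ p hp hc hψ hmean
  have hp0 : 0 ≤ p := (norm_nonneg _).trans (hψ 0)
  have hp1 : K' * p ≤ 1 / 2 := by
    calc K' * p ≤ K' * (1 / (2 * K')) := by gcongr
      _ = 1 / 2 := by field_simp
  have hp2 : p ≤ 1 / 2 := by nlinarith
  have hne : ∀ φ, 1 + ψ (circleMap 0 1 φ) ≠ 0 := fun φ h => by
    have h1 : ψ (circleMap 0 1 φ) = -1 := by linear_combination h
    have h2 := hψ φ
    rw [h1, norm_neg, norm_one] at h2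
    linarith
  set N : ℂ → ℝ := fun ζ => ‖1 + ψ ζ‖ ^ (-η) with hN
  set Z := circleAverage N 0 1 with hZ
  have hNc : Continuous fun φ => N (circleMap 0 1 φ) :=
    Continuous.rpow_const (continuous_const.add hc).norm fun φ => Or.inl (norm_ne_zero_iff.2 (hne φ))
  have hN1 : ∀ φ, |N (circleMap 0 1 φ) - 1 + η * (ψ (circleMap 0 1 φ)).re| ≤ K * p ^ 2 := fun φ =>
    (hKb _ ((hψ φ).trans hp2)).trans (by gcongr; exact hψ φ)
  have hZ1 : |Z - 1| ≤ K * p ^ 2 := by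
    have hrc : Continuous fun φ => (ψ (circleMap 0 1 φ)).re := Complex.continuous_re.comp hc
    have h1 : circleAverage (fun ζ => N ζ - 1 + η * (ψ ζ).re) 0 1 = Z - 1 := by
      rw [Real.circleAverage_fun_add, Real.circleAverage_fun_sub, circleAverage_const_mul, hmean,
        Real.circleAverage_const]
      · ring
      · exact circleIntegrable_of_continuous hNc
      · exact circleIntegrable_of_continuous continuous_const
      · exact circleIntegrable_of_continuous (hNc.sub continuous_const)
      · exact circleIntegrable_of_continuous (continuous_const.mul hrc)
    have hcc : Continuous fun φ => N (circleMap 0 1 φ) - 1 + η * (ψ (circleMap 0 1 φ)).re :=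
      (hNc.sub continuous_const).add (continuous_const.mul hrc)
    rw [← h1, abs_le]
    constructor
    · rw [← Real.circleAverage_const (-(K * p ^ 2)) (0:ℂ) 1]
      exact circleAverage_le_circleAverage continuous_const hcc fun φ => (abs_le.1 (hN1 φ)).1
    · rw [← Real.circleAverage_const (K * p ^ 2) (0:ℂ) 1]
      exact circleAverage_le_circleAverage hcc continuous_const fun φ => (abs_le.1 (hN1 φ)).2
  have hKp : K * p ^ 2 ≤ 1 / 4 := by
    have h4 : 4 * (K * p) ≤ K' * p := by
      rw [hK']
      have : 0 ≤ |η| * (K + 1) * p := by positivity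
      nlinarith
    nlinarith
  have hZ2 : 1 / 2 ≤ Z := by linarith [(abs_le.1 hZ1).1]
  have hZ0 : 0 < Z := by linarith
  have hdiff : ∀ φ, |N (circleMap 0 1 φ) / Z - 1 + η * (ψ (circleMap 0 1 φ)).re|
      ≤ K' * p ^ 2 := by
    intro φ
    have h1 := hN1 φ
    set a := N (circleMap 0 1 φ)
    set x := (ψ (circleMap 0 1 φ)).re with hx
    have hxp : |x| ≤ p := (Complex.abs_re_le_norm _).trans (hψ φ)
    have e : a / Z - 1 + η * x = ((a - 1 + η * x) + -(Z - 1) + η * x * (Z - 1)) / Z := by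
      field_simp
      ring
    rw [e, abs_div, abs_of_pos hZ0, div_le_iff₀ hZ0]
    refine (abs_add_le _ _).trans ((add_le_add_left (abs_add_le _ _) _).trans ?_)
    rw [abs_neg, abs_mul, abs_mul]
    have h2 : |η| * |x| * |Z - 1| ≤ |η| * p * (K * p ^ 2) := by gcongr
    have h3 : |η| * p * (K * p ^ 2) ≤ |η| * (K * p ^ 2) := by
      have : 0 ≤ |η| * (K * p ^ 2) := by positivity
      nlinarith
    have h4 : K' * p ^ 2 * (1 / 2) ≤ K' * p ^ 2 * Z := by gcongr
    have h5 : K * p ^ 2 + K * p ^ 2 + |η| * (K * p ^ 2) ≤ K' * p ^ 2 * (1 / 2) := by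
      rw [hK']
      have : 0 ≤ |η| * K * p ^ 2 := by positivity
      have : 0 ≤ |η| * p ^ 2 := by positivity
      have : 0 ≤ p ^ 2 := by positivity
      nlinarith
    linarith
  have hdiff1 : ∀ φ, |N (circleMap 0 1 φ) / Z - 1| ≤ K' * p := by
    intro φ
    have h1 := hN1 φ
    set a := N (circleMap 0 1 φ)
    set x := (ψ (circleMap 0 1 φ)).re with hx
    have hxp : |x| ≤ p := (Complex.abs_re_le_norm _).trans (hψ φ)
    have e : a / Z - 1 = ((a - 1 + η * x) + -(Z - 1) + -(η * x)) / Z := by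
      field_simp
      ring
    rw [e, abs_div, abs_of_pos hZ0, div_le_iff₀ hZ0]
    refine (abs_add_le _ _).trans ((add_le_add_left (abs_add_le _ _) _).trans ?_)
    rw [abs_neg, abs_neg, abs_mul]
    have h2 : |η| * |x| ≤ |η| * p := by gcongr
    have h4 : K' * p * (1 / 2) ≤ K' * p * Z := by gcongr
    have h5 : K * p ^ 2 ≤ K * p * (1 / 2) := by nlinarith [mul_nonneg hK hp0]
    have h6 : K * p + |η| * p ≤ K' * p * (1 / 2) := by
      rw [hK']
      have : 0 ≤ |η| * K * p := by positivity
      have : 0 ≤ K * p := by positivity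
      nlinarith [mul_nonneg (abs_nonneg η) hp0]
    linarith
  refine ⟨hNc.div_const Z, fun φ => ?_, fun φ => ?_, ?_, hdiff1, hdiff⟩
  · exact div_nonneg (Real.rpow_nonneg (norm_nonneg _) _) hZ0.le
  · linarith [(abs_le.1 (hdiff1 φ)).2]
  · simp only [div_eq_inv_mul]
    rw [circleAverage_const_mul]
    exact inv_mul_cancel₀ hZ0.ne'

/-! ### One step of the dynamics -/

/-- The increment `Φ (F_ζ w) - Φ w`, where `F_ζ` attaches a particle at the point `ζ` of the unit
circle. -/
def increment (F Φ : ℂ → ℂ) (w ζ : ℂ) : ℂ := Φ (ζ * F (ζ⁻¹ * w)) - Φ w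

lemma unit_mul_mem_exteriorDisk {ζ w : ℂ} (hζ : ‖ζ‖ = 1) (hw : w ∈ exteriorDisk) :
    ζ⁻¹ * w ∈ exteriorDisk := by
  rw [mem_exteriorDisk, norm_mul, norm_inv, hζ, inv_one, one_mul]
  exact hw

lemma norm_inv_le_of_le {w : ℂ} {g : ℝ} (hg : 0 < g) (hg1 : g ≤ 1) (hw : 1 + g ≤ ‖w‖) :
    ‖w⁻¹‖ ≤ 1 - g / 2 := by
  rw [norm_inv, inv_le_comm₀ (by linarith) (by linarith)]
  refine le_trans ?_ hw
  rw [inv_le_iff_one_le_mul₀ (by linarith)]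
  nlinarith

lemma inv_norm_one_sub_le {w ζ : ℂ} {g : ℝ} (hg : 0 < g) (hg1 : g ≤ 1) (hw : 1 + g ≤ ‖w‖)
    (hζ : ‖ζ‖ ≤ 1) : ‖1 - w⁻¹ * ζ‖⁻¹ ≤ 2 / g := by
  have h1 := one_sub_norm_le_norm_one_sub (v := w⁻¹) hζ
  have h2 := norm_inv_le_of_le hg hg1 hw
  calc ‖1 - w⁻¹ * ζ‖⁻¹ ≤ (g / 2)⁻¹ := inv_anti₀ (by linarith) (by linarith)
    _ = 2 / g := inv_div _ _

section LogBranch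

variable {F : ℂ → ℂ} {c Λ : ℝ} {L : ℂ → ℂ} (hL : IsLogBranch F c Λ L) (hc : 0 < c) (hΛ : 0 ≤ Λ)
  {g R : ℝ} (hg : 0 < g) (hcg : c ^ (1 / 2 : ℝ) ≤ g)
  {w ζ : ℂ} (hw : 1 + g ≤ ‖w‖) (hwR : ‖w‖ ≤ R) (hζ : ‖ζ‖ = 1)

include hg hw hζ in
lemma norm_rotated_sub_one_ge : ‖1 - w⁻¹ * ζ‖ ≤ ‖ζ⁻¹ * w - 1‖ := by
  have hw0 : w ≠ 0 := norm_pos_iff.1 (by linarith)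
  have hζ0 : ζ ≠ 0 := norm_pos_iff.1 (by rw [hζ]; exact one_pos)
  have h1 : ζ⁻¹ * w - 1 = ζ⁻¹ * w * (1 - w⁻¹ * ζ) := by field_simp
  rw [h1, norm_mul, norm_mul, norm_inv, hζ, inv_one, one_mul]
  exact le_mul_of_one_le_left (norm_nonneg _) (by linarith)

include hL hc hΛ hg hw hwR hζ in
lemma IsLogBranch.norm_sub_kernel_le :
    ‖L (ζ⁻¹ * w) - c * ((w + ζ) / (w - ζ))‖
      ≤ Λ * R * (c ^ (3 / 2 : ℝ) / g) * ‖1 - w⁻¹ * ζ‖⁻¹ := by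
  have hwe : w ∈ exteriorDisk := by rw [mem_exteriorDisk]; linarith
  have hζ0 : ζ ≠ 0 := norm_pos_iff.1 (by rw [hζ]; exact one_pos)
  have h1 := hL.norm_sub_le _ (unit_mul_mem_exteriorDisk hζ hwe)
  have hK : (ζ⁻¹ * w + 1) / (ζ⁻¹ * w - 1) = (w + ζ) / (w - ζ) := by
    rw [← mul_div_mul_left (ζ⁻¹ * w + 1) _ hζ0]
    congr 1 <;> field_simp
  rw [hK, norm_mul ζ⁻¹, norm_inv, hζ, inv_one, one_mul] at h1
  refine h1.trans ?_
  have hR : 0 ≤ R := by linarith [norm_nonneg w]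
  have h2 := norm_rotated_sub_one_ge hg hw hζ
  have h3 : 0 < ‖1 - w⁻¹ * ζ‖ := by
    have := one_sub_norm_le_norm_one_sub (v := w⁻¹) hζ.le
    have h4 : ‖w⁻¹‖ < 1 := by rw [norm_inv]; exact inv_lt_one_of_one_lt₀ hwe
    linarith
  calc Λ * c ^ (3 / 2 : ℝ) * ‖w‖ / (‖ζ⁻¹ * w - 1‖ * (‖w‖ - 1))
      ≤ Λ * c ^ (3 / 2 : ℝ) * R / (‖1 - w⁻¹ * ζ‖ * g) := by
        gcongr
        linarith
    _ = _ := by field_simp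

include hg hw hζ in
lemma norm_kernel_le : ‖(w + ζ) / (w - ζ)‖ ≤ 2 * ‖1 - w⁻¹ * ζ‖⁻¹ := by
  have hw0 : w ≠ 0 := norm_pos_iff.1 (by linarith)
  have h1 : (w + ζ) / (w - ζ) = (1 + w⁻¹ * ζ) * (1 - w⁻¹ * ζ)⁻¹ := by
    rw [← mul_div_mul_left _ _ (inv_ne_zero hw0), mul_add, mul_sub, inv_mul_cancel₀ hw0,
      div_eq_mul_inv]
  rw [h1, norm_mul, norm_inv]
  refine mul_le_mul_of_nonneg_right ?_ (inv_nonneg.2 (norm_nonneg _))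
  refine (norm_add_le _ _).trans ?_
  rw [norm_one, norm_mul, norm_inv, hζ, mul_one]
  have : ‖w‖⁻¹ ≤ 1 := inv_le_one_of_one_le₀ (by linarith)
  linarith

include hL hc hΛ hg hcg hw hwR hζ in
lemma IsLogBranch.norm_le :
    ‖L (ζ⁻¹ * w)‖ ≤ (2 + Λ * R) * c * ‖1 - w⁻¹ * ζ‖⁻¹ := by
  have h1 := hL.norm_sub_kernel_le hc hΛ hg hw hwR hζ
  have h2 := norm_kernel_le hg hw hζ
  have hR : 0 ≤ R := by linarith [norm_nonneg w]
  have h3 : c ^ (3 / 2 : ℝ) / g ≤ c := by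
    rw [div_le_iff₀ hg, show (3 / 2 : ℝ) = 1 + 1 / 2 by norm_num, Real.rpow_add hc, Real.rpow_one]
    gcongr
  calc ‖L (ζ⁻¹ * w)‖ = ‖(L (ζ⁻¹ * w) - c * ((w + ζ) / (w - ζ))) + c * ((w + ζ) / (w - ζ))‖ := by
        rw [sub_add_cancel]
    _ ≤ Λ * R * (c ^ (3 / 2 : ℝ) / g) * ‖1 - w⁻¹ * ζ‖⁻¹ + c * (2 * ‖1 - w⁻¹ * ζ‖⁻¹) := by
        refine (norm_add_le _ _).trans (add_le_add h1 ?_)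
        rw [norm_mul, Complex.norm_real, Real.norm_of_nonneg hc.le]
        gcongr
    _ ≤ Λ * R * c * ‖1 - w⁻¹ * ζ‖⁻¹ + c * (2 * ‖1 - w⁻¹ * ζ‖⁻¹) := by gcongr
    _ = _ := by ring

end LogBranch

section Taylor

variable {Φ f : ℂ → ℂ} {b E A R g : ℝ} (hΦ : ∀ z ∈ exteriorDisk, Φ z = b * z + f z)
  (hf : IsExt f) (hb : 1 ≤ b) (hbE : b ≤ E) (hg : 0 < g)
  (hA : ∀ z : ℂ, 1 + g / 2 ≤ ‖z‖ → ‖deriv f z‖ ≤ A)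
  {w u : ℂ} (hw : 1 + g ≤ ‖w‖) (hwR : ‖w‖ ≤ R) (hu0 : 0 ≤ u.re) (hu1 : ‖u‖ ≤ 1)

include hΦ hf hb hbE hg hA hw hwR hu0 hu1

/-- Expansion of `Φ` along the logarithmic segment from `w` to `w exp u`, which stays outside the
circle of radius `|w|`. -/
lemma taylor_exp :
    ‖Φ (w * Complex.exp u) - Φ w‖ ≤ 3 * R * (E + A) * ‖u‖ ∧
    ‖Φ (w * Complex.exp u) - Φ w - u * (w * (b + deriv f w))‖
      ≤ (3 * R * (E + A) + 18 * R ^ 2 * (A / g)) * ‖u‖ ^ 2 := by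
  have hR : 1 ≤ R := by linarith
  have hA0 : 0 ≤ A := (norm_nonneg _).trans (hA w (by linarith))
  have hE : 1 ≤ E := hb.trans hbE
  set γ : ℂ → ℂ := fun τ => w * Complex.exp (τ * u) with hγ
  have hγd : ∀ τ : ℂ, HasDerivAt γ (u * γ τ) τ := fun τ => by
    have := (((hasDerivAt_id τ).mul_const u).cexp).const_mul w
    refine this.congr_deriv ?_
    simp only [hγ, id]
    ring
  have hγn : ∀ τ : ℝ, 0 ≤ τ → τ ≤ 1 → ‖w‖ ≤ ‖γ τ‖ ∧ ‖γ τ‖ ≤ 3 * R := by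
    intro τ h0 h1
    have hre : ((τ:ℂ) * u).re = τ * u.re := by simp
    have hre1 : u.re ≤ 1 := (Complex.re_le_norm u).trans hu1
    simp only [hγ, norm_mul, Complex.norm_exp, hre]
    constructor
    · exact le_mul_of_one_le_right (norm_nonneg _) (Real.one_le_exp (by positivity))
    · have : Real.exp (τ * u.re) ≤ 3 :=
        (Real.exp_le_exp.2 (by nlinarith : τ * u.re ≤ 1)).trans Real.exp_one_lt_three.le
      nlinarith [norm_nonneg w]
  have hγe : ∀ τ : ℝ, 0 ≤ τ → τ ≤ 1 → γ τ ∈ exteriorDisk := fun τ h0 h1 => by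
    have := (hγn τ h0 h1).1
    rw [mem_exteriorDisk]
    linarith
  have hf1 : ∀ z ∈ exteriorDisk, HasDerivAt f (deriv f z) z := fun z hz =>
    (hf.differentiableOn.differentiableAt (isOpen_exteriorDisk.mem_nhds hz)).hasDerivAt
  have hf2 : ∀ z ∈ exteriorDisk, HasDerivAt (deriv f) (deriv (deriv f) z) z := fun z hz =>
    (hf.deriv.differentiableOn.differentiableAt (isOpen_exteriorDisk.mem_nhds hz)).hasDerivAt
  -- the function and its logarithmic derivative along the segment
  set G : ℝ → ℂ := fun τ => b * γ τ + f (γ τ) with hG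
  set D : ℝ → ℂ := fun τ => γ τ * (b + deriv f (γ τ)) with hD
  have hGd : ∀ τ : ℝ, 0 ≤ τ → τ ≤ 1 → HasDerivAt G (u * D τ) τ := by
    intro τ h0 h1
    have h2 := ((hγd τ).const_mul (b:ℂ)).add ((hf1 _ (hγe τ h0 h1)).comp (τ:ℂ) (hγd τ))
    refine h2.comp_ofReal.congr_deriv ?_
    simp only [hD]
    ring
  have hDd : ∀ τ : ℝ, 0 ≤ τ → τ ≤ 1 →
      HasDerivAt D (u * (D τ + γ τ ^ 2 * deriv (deriv f) (γ τ))) τ := by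
    intro τ h0 h1
    have h2 := (hγd τ).mul (((hf2 _ (hγe τ h0 h1)).comp (τ:ℂ) (hγd τ)).const_add (b:ℂ))
    refine h2.comp_ofReal.congr_deriv ?_
    simp only [hD, Function.comp_apply]
    ring
  have hDn : ∀ τ : ℝ, 0 ≤ τ → τ ≤ 1 → ‖D τ‖ ≤ 3 * R * (E + A) := by
    intro τ h0 h1
    obtain ⟨h2, h3⟩ := hγn τ h0 h1
    simp only [hD, norm_mul]
    refine mul_le_mul h3 ((norm_add_le _ _).trans (add_le_add ?_ (hA _ (by linarith))))
      (norm_nonneg _) (by positivity)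
    rw [Complex.norm_real, Real.norm_of_nonneg (by linarith)]
    exact hbE
  set K := 3 * R * (E + A) + 18 * R ^ 2 * (A / g) with hK
  have hDD : ∀ τ : ℝ, 0 ≤ τ → τ ≤ 1 → ‖u * (D τ + γ τ ^ 2 * deriv (deriv f) (γ τ))‖ ≤ ‖u‖ * K := by
    intro τ h0 h1
    obtain ⟨h2, h3⟩ := hγn τ h0 h1
    have h4 : ‖deriv (deriv f) (γ τ)‖ ≤ A / (g / 2) :=
      norm_deriv_le_of_norm_le hf.deriv.differentiableOn (x := g / 2) (by linarith) (by linarith) hA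
        (by linarith)
    rw [norm_mul]
    refine mul_le_mul_of_nonneg_left ((norm_add_le _ _).trans ?_) (norm_nonneg _)
    rw [norm_mul (γ τ ^ 2), norm_pow, hK]
    refine add_le_add (hDn τ h0 h1) ?_
    calc ‖γ τ‖ ^ 2 * ‖deriv (deriv f) (γ τ)‖ ≤ (3 * R) ^ 2 * (A / (g / 2)) := by gcongr
      _ = 18 * R ^ 2 * (A / g) := by field_simp; ring
  have hD0 : D 0 = w * (b + deriv f w) := by simp [hD, hγ]
  have hDsub : ∀ τ : ℝ, 0 ≤ τ → τ ≤ 1 → ‖D τ - D 0‖ ≤ ‖u‖ * K := by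
    intro τ h0 h1
    have hK0 : 0 ≤ ‖u‖ * K := (norm_nonneg _).trans (hDD τ h0 h1)
    have := norm_image_sub_le_of_norm_deriv_le_segment' (f := D) (a := 0) (b := 1) (C := ‖u‖ * K)
      (fun x hx => (hDd x hx.1 hx.2).hasDerivWithinAt) (fun x hx => hDD x hx.1 hx.2.le) τ ⟨h0, h1⟩
    refine this.trans ?_
    nlinarith
  have hend : Φ (w * Complex.exp u) = G 1 ∧ Φ w = G 0 := by
    have h1 := hΦ _ (hγe 1 zero_le_one le_rfl)
    have h0 := hΦ _ (hγe 0 le_rfl zero_le_one)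
    simp only [hγ, Complex.ofReal_one, one_mul, Complex.ofReal_zero, zero_mul, Complex.exp_zero,
      mul_one] at h1 h0
    simp only [hG, hγ, Complex.ofReal_one, one_mul, Complex.ofReal_zero, zero_mul, Complex.exp_zero,
      mul_one]
    exact ⟨h1, h0⟩
  rw [hend.1, hend.2]
  constructor
  · refine norm_image_sub_le_of_norm_deriv_le_segment_01'
      (fun x hx => (hGd x hx.1 hx.2).hasDerivWithinAt) fun x hx => ?_
    rw [norm_mul, mul_comm]
    exact mul_le_mul_of_nonneg_right (hDn x hx.1 hx.2.le) (norm_nonneg _)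
  · have h1 := norm_image_sub_le_of_norm_deriv_le_segment_01' (f := fun τ : ℝ => G τ - τ * (u * D 0))
      (f' := fun τ => u * D τ - u * D 0) (C := K * ‖u‖ ^ 2) (fun x hx => ?_) fun x hx => ?_
    · have e : G 1 - G 0 - u * (w * (b + deriv f w))
          = (G 1 - ((1:ℝ):ℂ) * (u * D 0)) - (G 0 - ((0:ℝ):ℂ) * (u * D 0)) := by
        rw [hD0]
        push_cast
        ring
      rw [e]
      exact h1
    · have h2 : HasDerivAt (fun τ : ℝ => (τ:ℂ) * (u * D 0)) (u * D 0) x := by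
        simpa using ((hasDerivAt_id (x:ℂ)).mul_const (u * D 0)).comp_ofReal
      exact ((hGd x hx.1 hx.2).sub h2).hasDerivWithinAt
    · rw [← mul_sub, norm_mul]
      have := hDsub x hx.1 hx.2.le
      nlinarith [norm_nonneg u]

end Taylor

section Step

variable {F Φ f L : ℂ → ℂ} {c Λ b E A R g : ℝ} (hL : IsLogBranch F c Λ L) (hc : 0 < c)
  (hΛ : 0 ≤ Λ) (hΦ : ∀ z ∈ exteriorDisk, Φ z = b * z + f z)
  (hf : IsExt f) (hb : 1 ≤ b) (hbE : b ≤ E) (hg : 0 < g) (hg1 : g ≤ 1)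
  (hcg : c ^ (1 / 2 : ℝ) ≤ g) (hcg2 : 2 * (2 + Λ * R) * c ≤ g)
  (hA : ∀ z : ℂ, 1 + g / 2 ≤ ‖z‖ → ‖deriv f z‖ ≤ A)
  {w : ℂ} (hw : 1 + g ≤ ‖w‖) (hwR : ‖w‖ ≤ R)

include hL hc hΛ hΦ hf hb hbE hg hg1 hcg hcg2 hA hw hwR

lemma increment_bounds {ζ : ℂ} (hζ : ‖ζ‖ = 1) :
    ‖increment F Φ w ζ‖ ≤ 3 * R * (E + A) * ((2 + Λ * R) * c * ‖1 - w⁻¹ * ζ‖⁻¹) ∧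
    ‖increment F Φ w ζ - L (ζ⁻¹ * w) * (w * (b + deriv f w))‖
      ≤ (3 * R * (E + A) + 18 * R ^ 2 * (A / g)) * ((2 + Λ * R) * c * ‖1 - w⁻¹ * ζ‖⁻¹) ^ 2 := by
  have hwe : w ∈ exteriorDisk := by rw [mem_exteriorDisk]; linarith
  have hζ0 : ζ ≠ 0 := norm_pos_iff.1 (by rw [hζ]; exact one_pos)
  have hζe := unit_mul_mem_exteriorDisk hζ hwe
  have hR : 1 ≤ R := by linarith
  have hA0 : 0 ≤ A := (norm_nonneg _).trans (hA w (by linarith))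
  have hE : 1 ≤ E := hb.trans hbE
  have hu := hL.norm_le hc hΛ hg hcg hw hwR hζ
  have hκ := inv_norm_one_sub_le hg hg1 hw hζ.le
  have hu1 : ‖L (ζ⁻¹ * w)‖ ≤ 1 := by
    refine hu.trans ?_
    calc (2 + Λ * R) * c * ‖1 - w⁻¹ * ζ‖⁻¹ ≤ (2 + Λ * R) * c * (2 / g) := by gcongr
      _ = (2 * (2 + Λ * R) * c) / g := by ring
      _ ≤ 1 := (div_le_one hg).2 hcg2
  have h1 : increment F Φ w ζ = Φ (w * Complex.exp (L (ζ⁻¹ * w))) - Φ w := by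
    rw [increment, hL.eq_mul_exp _ hζe, ← mul_assoc, mul_inv_cancel_left₀ hζ0]
  obtain ⟨h2, h3⟩ := taylor_exp hΦ hf hb hbE hg hA hw hwR (hL.re_nonneg _ hζe) hu1
  rw [h1]
  constructor
  · exact h2.trans (by gcongr)
  · exact h3.trans (by gcongr)

omit hL hcg hcg2 hb hbE hg1 hΛ hc hA hwR in
lemma continuous_increment (hF : IsBasicMap F c) :
    Continuous fun φ => increment F Φ w (circleMap 0 1 φ) := by
  have hwe : w ∈ exteriorDisk := by rw [mem_exteriorDisk]; linarith
  have h0 : ∀ φ, circleMap 0 1 φ ≠ 0 := fun φ => circleMap_ne_center one_ne_zero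
  have h1 : Continuous fun φ => F ((circleMap 0 1 φ)⁻¹ * w) :=
    hF.differentiableOn.continuousOn.comp_continuous
      (((continuous_circleMap 0 1).inv₀ h0).mul continuous_const)
      fun φ => unit_mul_mem_exteriorDisk (norm_unit_circle φ) hwe
  have hΦc : ContinuousOn Φ exteriorDisk := by
    refine ContinuousOn.congr (f := fun z => b * z + f z) ?_ fun z hz => hΦ z hz
    exact (continuousOn_const.mul continuousOn_id).add hf.differentiableOn.continuousOn
  refine (hΦc.comp_continuous ((continuous_circleMap 0 1).mul h1) fun φ => ?_).sub continuous_const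
  have h2 := hF.mapsTo (unit_mul_mem_exteriorDisk (norm_unit_circle φ) hwe)
  change 1 < ‖circleMap 0 1 φ * F ((circleMap 0 1 φ)⁻¹ * w)‖
  rw [norm_mul, norm_unit_circle, one_mul]
  exact h2

lemma norm_increment_le {ζ : ℂ} (hζ : ‖ζ‖ = 1) :
    ‖increment F Φ w ζ‖ ≤ 6 * R * (2 + Λ * R) * (E + A) * (c / g) := by
  have hR : 1 ≤ R := by linarith
  have hA0 : 0 ≤ A := (norm_nonneg _).trans (hA w (by linarith))
  have hE : 1 ≤ E := hb.trans hbE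
  refine (increment_bounds hL hc hΛ hΦ hf hb hbE hg hg1 hcg hcg2 hA hw hwR hζ).1.trans ?_
  have hκ := inv_norm_one_sub_le hg hg1 hw hζ.le
  calc 3 * R * (E + A) * ((2 + Λ * R) * c * ‖1 - w⁻¹ * ζ‖⁻¹)
      ≤ 3 * R * (E + A) * ((2 + Λ * R) * c * (2 / g)) := by gcongr
    _ = _ := by ring

omit hL hc hΛ hΦ hf hb hbE hcg hcg2 hA hwR in
lemma circleAverage_inv_sq_le : circleAverage (fun ζ => ‖1 - w⁻¹ * ζ‖⁻¹ ^ 2) 0 1 ≤ 2 / g := by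
  have h2 := norm_inv_le_of_le hg hg1 hw
  have h0 := norm_nonneg w⁻¹
  rw [circleAverage_inv_sq (by linarith)]
  calc (1 - ‖w⁻¹‖ ^ 2)⁻¹ ≤ (g / 2)⁻¹ := inv_anti₀ (by linarith) (by nlinarith)
    _ = 2 / g := inv_div _ _

lemma circleAverage_increment_sq_le (hF : IsBasicMap F c) :
    circleAverage (fun ζ => ‖increment F Φ w ζ‖ ^ 2) 0 1
      ≤ 2 * (3 * R * (2 + Λ * R) * (E + A)) ^ 2 * (c ^ 2 / g) := by
  have hR : 1 ≤ R := by linarith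
  have hA0 : 0 ≤ A := (norm_nonneg _).trans (hA w (by linarith))
  have hE : 1 ≤ E := hb.trans hbE
  have hw1 : ‖w⁻¹‖ < 1 := by linarith [norm_inv_le_of_le hg hg1 hw]
  calc circleAverage (fun ζ => ‖increment F Φ w ζ‖ ^ 2) 0 1
      ≤ circleAverage (fun ζ => (3 * R * (E + A) * ((2 + Λ * R) * c)) ^ 2
          * ‖1 - w⁻¹ * ζ‖⁻¹ ^ 2) 0 1 := by
        refine circleAverage_le_circleAverage
          ((continuous_increment hΦ hf hg hw hF).norm.pow 2)
          (continuous_const.mul ((continuous_norm_one_sub_inv hw1).pow 2)) fun φ => ?_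
        rw [← mul_pow]
        refine pow_le_pow_left₀ (norm_nonneg _) ?_ 2
        refine (increment_bounds hL hc hΛ hΦ hf hb hbE hg hg1 hcg hcg2 hA hw hwR
          (norm_unit_circle φ)).1.trans (le_of_eq ?_)
        ring
    _ ≤ (3 * R * (E + A) * ((2 + Λ * R) * c)) ^ 2 * (2 / g) := by
        rw [circleAverage_const_mul]
        gcongr
        exact circleAverage_inv_sq_le hg hg1 hw
    _ = _ := by ring

/-- The mean increment agrees with the linearised dynamics up to quadratic errors. The factor `ℓ`
bounds the mean of the Cauchy kernel. -/
lemma norm_mean_increment_sub_le (hF : IsBasicMap F c) {η p q₁ q₂ ℓ r : ℝ} {h : ℂ → ℝ} (hr : 1 < r)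
    (hp : ∀ z : ℂ, r ≤ ‖z‖ → ‖deriv f z‖ ≤ p)
    (hh : IsNearUniform h η (fun ζ => deriv f (r * ζ) / b) q₁ q₂)
    (hℓ : circleAverage (fun ζ => ‖1 - w⁻¹ * ζ‖⁻¹) 0 1 ≤ ℓ) :
    ‖circleAverage (fun ζ => increment F Φ w ζ * h ζ) 0 1
        - c * (w * (b + deriv f w) - η * (w * deriv f (r * w)))‖
      ≤ R * (E + A) * (2 * c * ℓ * q₂ + Λ * R * (c ^ (3 / 2 : ℝ) / g) * ℓ * q₁)
        + |η| * c * R * A * p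
        + (3 * R * (E + A) + 18 * R ^ 2 * (A / g)) * (2 + Λ * R) ^ 2 * 4 * (c ^ 2 / g) := by
  have hR : 1 ≤ R := by linarith
  have hr0 : 0 < r := by linarith
  have hA0 : 0 ≤ A := (norm_nonneg _).trans (hA w (by linarith))
  have hE : 1 ≤ E := hb.trans hbE
  have hb0 : (b:ℂ) ≠ 0 := by exact_mod_cast (by linarith : b ≠ 0)
  have hwe : w ∈ exteriorDisk := by rw [mem_exteriorDisk]; linarith
  have hw1 : ‖w⁻¹‖ < 1 := by linarith [norm_inv_le_of_le hg hg1 hw]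
  have h0 : ∀ φ, circleMap 0 1 φ ≠ 0 := fun φ => circleMap_ne_center one_ne_zero
  have hκc := continuous_norm_one_sub_inv hw1
  have hXc := continuous_increment hΦ hf hg hw hF
  have hhc : Continuous fun φ => ((h (circleMap 0 1 φ) : ℝ) : ℂ) :=
    Complex.continuous_ofReal.comp hh.continuous
  have hLc : Continuous fun φ => L ((circleMap 0 1 φ)⁻¹ * w) :=
    hL.isExt.differentiableOn.continuousOn.comp_continuous
      (((continuous_circleMap 0 1).inv₀ h0).mul continuous_const)
      fun φ => unit_mul_mem_exteriorDisk (norm_unit_circle φ) hwe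
  have hKc : Continuous fun φ => (w + circleMap 0 1 φ) / (w - circleMap 0 1 φ) := by
    refine Continuous.div (by fun_prop) (by fun_prop) fun φ h => ?_
    have h2 : 1 < ‖w‖ := hwe
    rw [sub_eq_zero.1 h, norm_unit_circle] at h2
    exact lt_irrefl _ h2
  have hrm : ∀ φ, (r:ℂ) * circleMap 0 1 φ ∈ exteriorDisk := fun φ => by
    rw [mem_exteriorDisk, norm_mul, norm_unit_circle, Complex.norm_real,
      Real.norm_of_nonneg hr0.le, mul_one]
    exact hr
  have hψc : Continuous fun φ => deriv f (r * circleMap 0 1 φ) :=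
    hf.deriv.differentiableOn.continuousOn.comp_continuous (by fun_prop) hrm
  set D := w * (b + deriv f w) with hD
  have hDn : ‖D‖ ≤ R * (E + A) := by
    rw [hD, norm_mul]
    refine mul_le_mul hwR ((norm_add_le _ _).trans (add_le_add ?_ (hA _ (by linarith))))
      (norm_nonneg _) (by positivity)
    rw [Complex.norm_real, Real.norm_of_nonneg (by linarith)]
    exact hbE
  -- the increment is `L D` up to terms of second order in the capacity
  set e₂ : ℂ → ℂ := fun ζ => (increment F Φ w ζ - L (ζ⁻¹ * w) * D) * h ζ with he₂
  have hI₂ : ‖circleAverage e₂ 0 1‖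
      ≤ (3 * R * (E + A) + 18 * R ^ 2 * (A / g)) * (2 + Λ * R) ^ 2 * 4 * (c ^ 2 / g) := by
    refine (norm_circleAverage_le (g := fun ζ =>
      (3 * R * (E + A) + 18 * R ^ 2 * (A / g)) * ((2 + Λ * R) * c) ^ 2 * 2
        * ‖1 - w⁻¹ * ζ‖⁻¹ ^ 2) (continuous_const.mul (hκc.pow 2)) fun φ => ?_).trans ?_
    · rw [he₂]
      simp only
      rw [norm_mul, Complex.norm_real, Real.norm_of_nonneg (hh.nonneg φ)]
      refine (mul_le_mul (increment_bounds hL hc hΛ hΦ hf hb hbE hg hg1 hcg hcg2 hA hw hwR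
        (norm_unit_circle φ)).2 (hh.le_two φ) (hh.nonneg φ) (by positivity)).trans (le_of_eq ?_)
      ring
    · rw [circleAverage_const_mul]
      calc _ ≤ (3 * R * (E + A) + 18 * R ^ 2 * (A / g)) * ((2 + Λ * R) * c) ^ 2 * 2 * (2 / g) := by
            gcongr
            exact circleAverage_inv_sq_le hg hg1 hw
        _ = _ := by ring
  -- replacing `L` by its leading part costs the regularity error
  set e₁ : ℂ → ℂ := fun ζ => (L (ζ⁻¹ * w) - c * ((w + ζ) / (w - ζ))) * ((h ζ - 1 : ℝ) : ℂ) with he₁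
  have hI₁ : ‖circleAverage e₁ 0 1‖ ≤ Λ * R * (c ^ (3 / 2 : ℝ) / g) * ℓ * q₁ := by
    have hq₁ : 0 ≤ q₁ := (abs_nonneg _).trans (hh.abs_sub_one_le 0)
    refine (norm_circleAverage_le (g := fun ζ =>
      Λ * R * (c ^ (3 / 2 : ℝ) / g) * q₁ * ‖1 - w⁻¹ * ζ‖⁻¹)
      (continuous_const.mul hκc) fun φ => ?_).trans ?_
    · rw [he₁]
      simp only
      rw [norm_mul, Complex.norm_real, Real.norm_eq_abs]
      refine (mul_le_mul (hL.norm_sub_kernel_le hc hΛ hg hw hwR (norm_unit_circle φ))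
        (hh.abs_sub_one_le φ) (abs_nonneg _) (by positivity)).trans (le_of_eq ?_)
      ring
    · rw [circleAverage_const_mul]
      calc _ ≤ Λ * R * (c ^ (3 / 2 : ℝ) / g) * q₁ * ℓ := by gcongr
        _ = _ := by ring
  -- the density is linear in the deviation up to a quadratic error
  set e₀ : ℂ → ℂ := fun ζ => (w + ζ) / (w - ζ)
    * ((h ζ - 1 + η * (deriv f (r * ζ) / b).re : ℝ) : ℂ) with he₀
  have hI₀ : ‖circleAverage e₀ 0 1‖ ≤ 2 * ℓ * q₂ := by
    have hq₂ : 0 ≤ q₂ := (abs_nonneg _).trans (hh.abs_sub_linear_le 0)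
    refine (norm_circleAverage_le (g := fun ζ => 2 * q₂ * ‖1 - w⁻¹ * ζ‖⁻¹)
      (continuous_const.mul hκc) fun φ => ?_).trans ?_
    · rw [he₀]
      simp only
      rw [norm_mul, Complex.norm_real, Real.norm_eq_abs]
      refine (mul_le_mul (norm_kernel_le hg hw (norm_unit_circle φ))
        (hh.abs_sub_linear_le φ) (abs_nonneg _) (by positivity)).trans (le_of_eq ?_)
      ring
    · rw [circleAverage_const_mul]
      calc _ ≤ 2 * q₂ * ℓ := by gcongr
        _ = _ := by ring
  -- the linear part is given by Herglotz' formula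
  have hH := circleAverage_herglotz hf.deriv hf.tendsto_deriv hr hwe
  have hM := hL.circleAverage_eq w hwe
  have hdec : (fun ζ => increment F Φ w ζ * h ζ) = fun ζ =>
      e₂ ζ + D • (L (ζ⁻¹ * w) + (e₁ ζ + ((c:ℂ) • e₀ ζ
        - ((c:ℂ) * η / b) • ((w + ζ) / (w - ζ) * ((deriv f (r * ζ)).re : ℂ))))) := by
    ext ζ
    have hre : (deriv f (r * ζ) / b).re = (deriv f (r * ζ)).re / b := by
      rw [Complex.div_ofReal_re]
    simp only [he₂, he₁, he₀, smul_eq_mul, hre]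
    push_cast
    field_simp
    ring
  have c₂ : CircleIntegrable e₂ 0 1 :=
    circleIntegrable_of_continuous ((hXc.sub (hLc.mul continuous_const)).mul hhc)
  have c₁ : CircleIntegrable e₁ 0 1 := circleIntegrable_of_continuous
    ((hLc.sub (continuous_const.mul hKc)).mul
      (Complex.continuous_ofReal.comp (hh.continuous.sub continuous_const)))
  have c₀ : CircleIntegrable e₀ 0 1 := circleIntegrable_of_continuous
    (hKc.mul (Complex.continuous_ofReal.comp ((hh.continuous.sub continuous_const).add
      (continuous_const.mul (Complex.continuous_re.comp (hψc.div_const _))))))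
  have cH : CircleIntegrable
      (fun ζ => (w + ζ) / (w - ζ) * ((deriv f (r * ζ)).re : ℂ)) 0 1 :=
    circleIntegrable_of_continuous
      (hKc.mul (Complex.continuous_ofReal.comp (Complex.continuous_re.comp hψc)))
  have cL : CircleIntegrable (fun ζ => L (ζ⁻¹ * w)) 0 1 := circleIntegrable_of_continuous hLc
  have c3 : CircleIntegrable (fun ζ => (c:ℂ) • e₀ ζ
      - ((c:ℂ) * η / b) • ((w + ζ) / (w - ζ) * ((deriv f (r * ζ)).re : ℂ))) 0 1 :=
    (c₀.const_fun_smul (a := (c:ℂ))).sub (cH.const_fun_smul (a := (c:ℂ) * η / b))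
  have c4 : CircleIntegrable (fun ζ => e₁ ζ + ((c:ℂ) • e₀ ζ
      - ((c:ℂ) * η / b) • ((w + ζ) / (w - ζ) * ((deriv f (r * ζ)).re : ℂ)))) 0 1 := c₁.add c3
  have c5 : CircleIntegrable (fun ζ => D • (L (ζ⁻¹ * w) + (e₁ ζ + ((c:ℂ) • e₀ ζ
      - ((c:ℂ) * η / b) • ((w + ζ) / (w - ζ) * ((deriv f (r * ζ)).re : ℂ)))))) 0 1 :=
    (cL.add c4).const_fun_smul (a := D)
  rw [hdec, Real.circleAverage_fun_add c₂ c5, Real.circleAverage_fun_smul,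
    Real.circleAverage_fun_add cL c4, Real.circleAverage_fun_add c₁ c3,
    Real.circleAverage_fun_sub (c₀.const_fun_smul) (cH.const_fun_smul),
    Real.circleAverage_fun_smul, Real.circleAverage_fun_smul, hH, hM]
  simp only [smul_eq_mul]
  have hpw : ‖deriv f (r * w)‖ ≤ p := hp _ (by
    rw [norm_mul, Complex.norm_real, Real.norm_of_nonneg hr0.le]
    nlinarith)
  have hp0 : 0 ≤ p := (norm_nonneg _).trans hpw
  have hfin : circleAverage e₂ 0 1 + D * (c + (circleAverage e₁ 0 1 + (c * circleAverage e₀ 0 1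
        - c * η / b * deriv f (r * w)))) - c * (D - η * (w * deriv f (r * w)))
      = circleAverage e₂ 0 1 + D * (circleAverage e₁ 0 1 + c * circleAverage e₀ 0 1)
        - η * c * w * deriv f w * (deriv f (r * w) / b) := by
    rw [hD]
    field_simp
    ring
  rw [hfin]
  have hcross : ‖(η:ℂ) * c * w * deriv f w * (deriv f (r * w) / b)‖ ≤ |η| * c * R * A * p := by
    rw [norm_mul, norm_mul, norm_mul, norm_mul, norm_div, Complex.norm_real, Complex.norm_real,
      Complex.norm_real, Real.norm_of_nonneg hc.le, Real.norm_eq_abs,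
      Real.norm_of_nonneg (by linarith : 0 ≤ b)]
    have : ‖deriv f (r * w)‖ / b ≤ p := (div_le_self (norm_nonneg _) hb).trans hpw
    have h5 : ‖deriv f w‖ ≤ A := hA _ (by linarith)
    gcongr
  refine (norm_sub_le _ _).trans ((add_le_add (norm_add_le _ _) hcross).trans ?_)
  have hlin : ‖D * (circleAverage e₁ 0 1 + c * circleAverage e₀ 0 1)‖
      ≤ R * (E + A) * (2 * c * ℓ * q₂ + Λ * R * (c ^ (3 / 2 : ℝ) / g) * ℓ * q₁) := by
    rw [norm_mul]
    refine mul_le_mul hDn ((norm_add_le _ _).trans ?_) (norm_nonneg _) (by positivity)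
    rw [norm_mul, Complex.norm_real, Real.norm_of_nonneg hc.le]
    have := mul_le_mul_of_nonneg_left hI₀ hc.le
    linarith
  linarith

end Step

/-! ### Duhamel's formula -/

/-- The generator `f ↦ D f - η (z f'(r z))`, `D f = z f'(z)`, of the linearised dynamics; it
multiplies the `k`-th Laurent coefficient by `-rate η r⁻¹ k`. -/
def drift (η r : ℝ) (f : ℂ → ℂ) (w : ℂ) : ℂ := w * deriv f w - η * (w * deriv f (r * w))

lemma IsExt.continuousOn_drift {f : ℂ → ℂ} (hf : IsExt f) {η r : ℝ} (hr : 1 < r) :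
    ContinuousOn (drift η r f) exteriorDisk := by
  have h := hf.deriv.differentiableOn.continuousOn
  have h2 : ContinuousOn (fun w : ℂ => _root_.deriv f (r * w)) exteriorDisk := by
    refine h.comp (by fun_prop) fun w hw => ?_
    rw [mem_exteriorDisk] at hw ⊢
    rw [norm_mul, Complex.norm_real, Real.norm_of_nonneg (by linarith)]
    nlinarith
  exact (continuousOn_id.mul h).sub (continuousOn_const.mul (continuousOn_id.mul h2))

lemma hasLaurent_drift {f : ℂ → ℂ} {a : ℕ → ℂ} {η r : ℝ} (hr : 1 < r)
    (h : HasLaurent (fun z => z * deriv f z) fun k => -k * a k) :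
    HasLaurent (drift η r f) fun k => -(rate η r⁻¹ k : ℝ) * a k := by
  intro z hz
  have hr0 : (r:ℂ) ≠ 0 := by exact_mod_cast (by linarith : r ≠ 0)
  have hrz : (r:ℂ) * z ∈ exteriorDisk := by
    rw [mem_exteriorDisk] at hz ⊢
    rw [norm_mul, Complex.norm_real, Real.norm_of_nonneg (by linarith)]
    nlinarith
  have h1 := (h z hz).sub ((h _ hrz).mul_left (η * (r:ℂ)⁻¹))
  have e : drift η r f z = z * deriv f z - η * (r:ℂ)⁻¹ * (r * z * deriv f (r * z)) := by
    rw [drift]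
    field_simp
  rw [e]
  refine h1.congr_fun fun k => ?_
  simp only [rate]
  push_cast
  rw [mul_inv, mul_pow, pow_succ]
  ring

/-- The `d`-th logarithmic derivative, up to sign, at `z` of the linear evolution over time `t` of
the function with Laurent coefficients `a`. -/
def evolved (η q : ℝ) (d : ℕ) (t : ℝ) (a : ℕ → ℂ) (z : ℂ) : ℂ :=
  ∑' k : ℕ, (((k:ℝ) ^ d * Real.exp (-(t * rate η q k)) : ℝ) : ℂ) * a k * z⁻¹ ^ k

/-- The part of a discrete time step which the exponential of the generator does not capture. -/
def stepError (η q : ℝ) (d : ℕ) (t c : ℝ) (a : ℕ → ℂ) (z : ℂ) : ℂ :=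
  ∑' k : ℕ, (((k:ℝ) ^ d * Real.exp (-(t * rate η q k)) *
    (1 - c * rate η q k - Real.exp (-(c * rate η q k))) : ℝ) : ℂ) * a k * z⁻¹ ^ k

lemma evolved_zero_zero {f : ℂ → ℂ} {a : ℕ → ℂ} (h : HasLaurent f a) (η q : ℝ) {z : ℂ}
    (hz : z ∈ exteriorDisk) : evolved η q 0 0 a z = f z := by
  rw [← (h z hz).tsum_eq, evolved]
  refine tsum_congr fun k => ?_
  simp

lemma evolved_one_zero {f : ℂ → ℂ} {a : ℕ → ℂ}
    (h : HasLaurent (fun z => z * deriv f z) fun k => -k * a k) (η q : ℝ) {z : ℂ}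
    (hz : z ∈ exteriorDisk) : evolved η q 1 0 a z = -(z * deriv f z) := by
  have e := (h z hz).tsum_eq
  beta_reduce at e
  rw [← e, evolved, ← tsum_neg]
  refine tsum_congr fun k => ?_
  simp

section Multiplier

variable {η q t r : ℝ} {d : ℕ} {f : ℂ → ℂ} {a : ℕ → ℂ}

lemma circleAverage_mul_evolutionKernel (h : HasLaurent f a) (hf : ContinuousOn f exteriorDisk)
    (hη : η ≤ 1) (h0 : 0 ≤ q) (h1 : q ≤ 1) (ht : 0 ≤ t) {ρ : ℝ} (hρ : 1 < ρ) {z : ℂ}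
    (hz : z ≠ 0) (hs : shrink η t * (ρ / ‖z‖) < 1) :
    HasSum (fun k : ℕ => (((k:ℝ) ^ d * Real.exp (-(t * rate η q k)) : ℝ) : ℂ) * a k * z⁻¹ ^ k)
      (circleAverage (fun w => f w * evolutionKernel η q d t (w / z)) 0 ρ) :=
  h.hasSum_multiplier hf hρ hz
    (summable_evolutionKernel hη h0 h1 ht d (by positivity) hs)

lemma norm_coeff_le (h : HasLaurent (fun z => z * deriv f z) fun k => -k * a k)
    {ρ A : ℝ} (hρ : 1 < ρ) (hA : ∀ w : ℂ, ‖w‖ = ρ → ‖deriv f w‖ ≤ A) (k : ℕ) :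
    k * ‖a k‖ ≤ A * ρ * ρ ^ k := by
  have h1 := h.circleAverage_mul_pow hρ k
  have hρ0 : 0 < ρ := by linarith
  have h2 : ‖circleAverage (fun w => w * deriv f w * w ^ k) 0 ρ‖ ≤ A * ρ * ρ ^ k := by
    refine (norm_circleAverage_le (g := fun _ => A * ρ * ρ ^ k) continuous_const fun φ => ?_).trans
      (le_of_eq (Real.circleAverage_const _ _ _))
    have hn := norm_circleMap hρ0.le φ
    rw [norm_mul, norm_mul, norm_pow, hn, mul_comm ρ]
    gcongr
    exact hA _ hn
  rw [h1, norm_mul, norm_neg, Complex.norm_natCast] at h2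
  exact h2

lemma tsum_natCast_pow_mul_geometric_le {r : ℝ} (h0 : 0 ≤ r) (h1 : r < 1) (p : ℕ) :
    (Summable fun k : ℕ => (k:ℝ) ^ p * r ^ k) ∧
    ∑' k : ℕ, (k:ℝ) ^ p * r ^ k ≤ p.factorial * (1 - r)⁻¹ ^ (p + 1) := by
  have hr : ‖r‖ < 1 := by rwa [Real.norm_of_nonneg h0]
  have hs := (summable_choose_mul_geometric_of_norm_lt_one (R := ℝ) p hr).mul_left
    (p.factorial : ℝ)
  have hb : ∀ k : ℕ, (k:ℝ) ^ p * r ^ k ≤ p.factorial * (((k + p).choose p : ℕ) * r ^ k) := by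
    intro k
    rw [← mul_assoc]
    refine mul_le_mul_of_nonneg_right ?_ (by positivity)
    have h3 : k ^ p ≤ p.factorial * (k + p).choose p := by
      rw [← Nat.ascFactorial_eq_factorial_mul_choose]
      exact (Nat.pow_le_pow_left k.le_succ p).trans (Nat.pow_succ_le_ascFactorial _ _)
    exact_mod_cast h3
  have hs' := Summable.of_nonneg_of_le (fun k => by positivity) hb hs
  refine ⟨hs', (hs'.tsum_le_tsum hb hs).trans ?_⟩
  rw [tsum_mul_left, tsum_choose_mul_geometric_of_norm_lt_one p hr, one_div, inv_pow]

lemma abs_one_sub_sub_exp_neg_le {y : ℝ} (hy : 0 ≤ y) : |1 - y - Real.exp (-y)| ≤ y ^ 2 := by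
  have h1 := Real.add_one_le_exp (-y)
  have h2 := Real.add_one_le_exp y
  have h3 : Real.exp (-y) ≤ (1 + y)⁻¹ := by
    rw [Real.exp_neg]
    exact inv_anti₀ (by linarith) (by linarith)
  have h4 : (1 + y)⁻¹ ≤ 1 - y + y ^ 2 := by
    rw [inv_le_iff_one_le_mul₀ (by linarith)]
    nlinarith [mul_nonneg hy (sq_nonneg y)]
  rw [abs_le]
  constructor <;> linarith [sq_nonneg y]

lemma shrink_sq_pow_le (h0 : 0 ≤ q) (h1 : q ≤ 1) (ht : 0 ≤ t) (k : ℕ) :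
    Real.exp (-(t * rate η q k)) ≤ (shrink η t ^ 2) ^ k := by
  rw [shrink, ← pow_mul, ← Real.exp_nat_mul]
  refine Real.exp_le_exp.2 ?_
  have := mul_le_mul_of_nonneg_left (le_rate (η := η) h0 h1 k) ht
  push_cast
  linarith

/-- The discretisation error of one step is quadratic in its length. -/
lemma norm_stepError_le (h : HasLaurent (fun z => z * deriv f z) fun k => -k * a k)
    (hη : η ≤ 1) (h0 : 0 ≤ q) (h1 : q ≤ 1) (ht : 0 ≤ t) {c : ℝ} (hc : 0 ≤ c) (hd : d ≤ 1)
    {ρ A : ℝ} (hρ : 1 < ρ) (hA : ∀ w : ℂ, ‖w‖ = ρ → ‖deriv f w‖ ≤ A) {z : ℂ}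
    (hs : shrink η t * (ρ / ‖z‖) < 1) :
    (Summable fun k : ℕ => (((k:ℝ) ^ d * Real.exp (-(t * rate η q k)) *
      (1 - c * rate η q k - Real.exp (-(c * rate η q k))) : ℝ) : ℂ) * a k * z⁻¹ ^ k) ∧
    ‖stepError η q d t c a z‖
      ≤ 2 * (1 + |η|) ^ 2 * ρ * c ^ 2 * A * (1 - shrink η t * (ρ / ‖z‖))⁻¹ ^ (d + 2) := by
  have hρ0 : 0 < ρ := by linarith
  have hA0 : 0 ≤ A := (norm_nonneg _).trans (hA ρ (by simp [abs_of_pos hρ0]))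
  set s := shrink η t * (ρ / ‖z‖) with hs'
  have hsh := shrink_pos η t
  have hsh1 := shrink_le_one hη ht
  have hs0 : 0 ≤ s := by positivity
  obtain ⟨hg, hgs⟩ := tsum_natCast_pow_mul_geometric_le hs0 hs (d + 1)
  have hb : ∀ k : ℕ, ‖(((k:ℝ) ^ d * Real.exp (-(t * rate η q k)) *
      (1 - c * rate η q k - Real.exp (-(c * rate η q k))) : ℝ) : ℂ) * a k * z⁻¹ ^ k‖
      ≤ (1 + |η|) ^ 2 * ρ * c ^ 2 * A * ((k:ℝ) ^ (d + 1) * s ^ k) := by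
    intro k
    have hk0 : (0:ℝ) ≤ k := k.cast_nonneg
    rw [norm_mul, norm_mul, Complex.norm_real, Real.norm_eq_abs, abs_mul, abs_mul, norm_pow,
      norm_inv, abs_of_nonneg (pow_nonneg hk0 d), abs_of_pos (Real.exp_pos _)]
    have hr0 := rate_nonneg hη h0 h1 k
    have h3 := abs_one_sub_sub_exp_neg_le (mul_nonneg hc hr0)
    have h4 : (c * rate η q k) ^ 2 ≤ c ^ 2 * ((1 + |η|) ^ 2 * (k:ℝ) ^ 2) := by
      rw [mul_pow, ← mul_pow (1 + |η|)]
      gcongr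
      exact rate_le h0 h1 k
    have h5 := shrink_sq_pow_le (η := η) h0 h1 ht k
    have h6 := norm_coeff_le h hρ hA k
    have h7 : (shrink η t ^ 2) ^ k ≤ shrink η t ^ k :=
      pow_le_pow_left₀ (by positivity) (pow_le_of_le_one hsh.le hsh1 two_ne_zero) k
    calc (k:ℝ) ^ d * Real.exp (-(t * rate η q k)) *
          |1 - c * rate η q k - Real.exp (-(c * rate η q k))| * ‖a k‖ * ‖z‖⁻¹ ^ k
        ≤ (k:ℝ) ^ d * shrink η t ^ k * (c ^ 2 * ((1 + |η|) ^ 2 * (k:ℝ) ^ 2)) * ‖a k‖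
            * ‖z‖⁻¹ ^ k := by
          gcongr
          · exact h5.trans h7
          · exact h3.trans h4
      _ = (k:ℝ) ^ (d + 1) * shrink η t ^ k * (c ^ 2 * (1 + |η|) ^ 2) * (k * ‖a k‖)
            * ‖z‖⁻¹ ^ k := by ring
      _ ≤ (k:ℝ) ^ (d + 1) * shrink η t ^ k * (c ^ 2 * (1 + |η|) ^ 2) * (A * ρ * ρ ^ k)
            * ‖z‖⁻¹ ^ k := by gcongr
      _ = _ := by
          rw [hs', mul_pow, div_eq_mul_inv, mul_pow]
          ring
  refine ⟨Summable.of_norm_bounded (hg.mul_left _) hb, ?_⟩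
  refine (tsum_of_norm_bounded (hg.mul_left _).hasSum hb).trans ?_
  rw [tsum_mul_left]
  have hK : 0 ≤ (1 + |η|) ^ 2 * ρ * c ^ 2 * A := by positivity
  refine (mul_le_mul_of_nonneg_left hgs hK).trans ?_
  have hfac : (((d + 1).factorial : ℕ) : ℝ) ≤ 2 := by
    have : (d + 1).factorial ≤ Nat.factorial 2 := Nat.factorial_le (by omega)
    exact_mod_cast this
  have hp : 0 ≤ (1 - s)⁻¹ ^ (d + 1 + 1) := pow_nonneg (inv_nonneg.2 (by linarith)) _
  calc _ ≤ (1 + |η|) ^ 2 * ρ * c ^ 2 * A * (2 * (1 - s)⁻¹ ^ (d + 1 + 1)) := by gcongr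
    _ = _ := by ring

/-- One step of Duhamel's formula. -/
lemma evolved_sub_evolved {f₁ : ℂ → ℂ} {a₁ : ℕ → ℂ} {r c : ℝ} (hr : 1 < r)
    (h : HasLaurent f a) (h' : HasLaurent (fun z => z * deriv f z) fun k => -k * a k)
    (hf : IsExt f) (h₁ : HasLaurent f₁ a₁) (hf₁ : IsExt f₁)
    (hη : η ≤ 1) (ht : 0 ≤ t) (hc : 0 ≤ c) (hd : d ≤ 1) {ρ : ℝ} (hρ : 1 < ρ) {z : ℂ}
    (hz : z ≠ 0) (hs : shrink η t * (ρ / ‖z‖) < 1) :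
    evolved η r⁻¹ d t a₁ z - evolved η r⁻¹ d (t + c) a z
      = circleAverage (fun w => (f₁ w - f w - c * drift η r f w)
          * evolutionKernel η r⁻¹ d t (w / z)) 0 ρ
        + stepError η r⁻¹ d t c a z := by
  have h0 : 0 ≤ r⁻¹ := inv_nonneg.2 (by linarith)
  have h1 : r⁻¹ ≤ 1 := (inv_lt_one_of_one_lt₀ hr).le
  have hlin : HasLaurent (fun w => f₁ w - f w - c * drift η r f w)
      fun k => a₁ k - a k + c * rate η r⁻¹ k * a k := by
    intro w hw
    refine (((h₁ w hw).sub (h w hw)).sub ((hasLaurent_drift (η := η) hr h' w hw).mul_left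
      (c:ℂ))).congr_fun fun k => ?_
    ring
  have hcont : ContinuousOn (fun w => f₁ w - f w - c * drift η r f w) exteriorDisk :=
    (hf₁.differentiableOn.continuousOn.sub hf.differentiableOn.continuousOn).sub
      (continuousOn_const.mul (hf.continuousOn_drift hr))
  have hS := circleAverage_mul_evolutionKernel (d := d) hlin hcont hη h0 h1 ht hρ hz hs
  have hS₁ := (circleAverage_mul_evolutionKernel (d := d) h₁ hf₁.differentiableOn.continuousOn
    hη h0 h1 ht hρ hz hs).summable
  obtain ⟨A, hA⟩ : ∃ A, ∀ w : ℂ, ‖w‖ = ρ → ‖deriv f w‖ ≤ A := by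
    obtain ⟨A, hA⟩ := (isCompact_sphere (0:ℂ) ρ).exists_bound_of_continuousOn
      (hf.deriv.differentiableOn.continuousOn.mono fun w hw => by
        rw [mem_exteriorDisk, mem_sphere_zero_iff_norm.1 hw]
        exact hρ)
    exact ⟨A, fun w hw => hA w (mem_sphere_zero_iff_norm.2 hw)⟩
  have hE := (norm_stepError_le h' hη h0 h1 ht hc hd hρ hA hs).1
  rw [← hS.tsum_eq, stepError, ← hS.summable.tsum_add hE, evolved, evolved]
  have key : ∀ k : ℕ, (((k:ℝ) ^ d * Real.exp (-((t + c) * rate η r⁻¹ k)) : ℝ) : ℂ) * a k * z⁻¹ ^ k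
      = (((k:ℝ) ^ d * Real.exp (-(t * rate η r⁻¹ k)) : ℝ) : ℂ) * a₁ k * z⁻¹ ^ k
        - ((((k:ℝ) ^ d * Real.exp (-(t * rate η r⁻¹ k)) : ℝ) : ℂ)
            * (a₁ k - a k + c * rate η r⁻¹ k * a k) * z⁻¹ ^ k
          + (((k:ℝ) ^ d * Real.exp (-(t * rate η r⁻¹ k)) *
            (1 - c * rate η r⁻¹ k - Real.exp (-(c * rate η r⁻¹ k))) : ℝ) : ℂ)
              * a k * z⁻¹ ^ k) := by
    intro k
    rw [show -((t + c) * rate η r⁻¹ k) = -(t * rate η r⁻¹ k) + -(c * rate η r⁻¹ k) by ring,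
      Real.exp_add]
    push_cast
    ring
  rw [tsum_congr key, hS₁.tsum_sub (hS.summable.add hE), sub_sub_cancel]

end Multiplier

/-! ### The contour of integration -/

/-- The radius of the circle over which the evolution over time `t` is averaged, for a point at
distance `x` from the unit circle. -/
def contourRadius (η x t : ℝ) : ℝ := (1 + x / 2) * Real.exp (min 1 (1 - η) * t / 4)

/-- A lower bound, over the time horizon `T`, for the distance to the unit circle of the contour,
and for its distance to the singularity of the kernel. -/
def contourGap (η T x t : ℝ) : ℝ := (x + min 1 (1 - η) * t) / (5 + T)

section Contour

variable {η T x t : ℝ} (hη : η ≤ 1) (hx : 0 < x) (hx1 : x ≤ 1) (ht : 0 ≤ t) (htT : t ≤ T)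

include hη hx ht htT

lemma contourGap_pos : 0 < contourGap η T x t := by
  have : 0 ≤ min 1 (1 - η) := le_min zero_le_one (by linarith)
  rw [contourGap]
  have : 0 < 5 + T := by linarith
  positivity

include hx1 in
omit hη hx in
lemma contourGap_le_one : contourGap η T x t ≤ 1 := by
  have h1 : min 1 (1 - η) ≤ 1 := min_le_left _ _
  rw [contourGap, div_le_one (by linarith)]
  nlinarith

lemma le_contourRadius : 1 + contourGap η T x t ≤ contourRadius η x t := by
  have ha : 0 ≤ min 1 (1 - η) := le_min zero_le_one (by linarith)
  have h1 := Real.add_one_le_exp (min 1 (1 - η) * t / 4)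
  have hat : 0 ≤ min 1 (1 - η) * t := by positivity
  have h2 : contourGap η T x t ≤ (x + min 1 (1 - η) * t) / 4 := by
    rw [contourGap]
    gcongr
    linarith
  rw [contourRadius]
  nlinarith

lemma contourRadius_pos : 1 < contourRadius η x t := by
  have := le_contourRadius hη hx ht htT
  have := contourGap_pos hη hx ht htT
  linarith

include hx1 in
omit hx in
lemma contourRadius_le : contourRadius η x t ≤ 2 * Real.exp T := by
  have h1 : min 1 (1 - η) ≤ 1 := min_le_left _ _
  have ha : 0 ≤ min 1 (1 - η) := le_min zero_le_one (by linarith)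
  rw [contourRadius]
  gcongr
  · linarith
  · nlinarith

include hx1 in
lemma shrink_mul_contourRadius_le :
    shrink η t * (contourRadius η x t / (1 + x)) ≤ 1 - contourGap η T x t := by
  set a := min 1 (1 - η) with ha'
  have h1 : a ≤ 1 := min_le_left _ _
  have ha : 0 ≤ a := le_min zero_le_one (by linarith)
  set y := (x + a * t) / 4 with hy
  have hy0 : 0 ≤ y := by positivity
  have e1 : shrink η t * (contourRadius η x t / (1 + x))
      = (1 + x / 2) / (1 + x) * Real.exp (-(a * t / 4)) := by
    have : Real.exp (-(a * t / 4)) = Real.exp (-(t * (a / 2))) * Real.exp (a * t / 4) := by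
      rw [← Real.exp_add]; congr 1; ring
    rw [shrink, contourRadius, this]
    ring
  have e2 : (1 + x / 2) / (1 + x) ≤ Real.exp (-(x / 4)) := by
    refine le_trans ?_ (Real.add_one_le_exp _)
    rw [div_le_iff₀ (by linarith)]
    nlinarith
  have e3 : shrink η t * (contourRadius η x t / (1 + x)) ≤ Real.exp (-y) := by
    rw [e1]
    calc _ ≤ Real.exp (-(x / 4)) * Real.exp (-(a * t / 4)) := by gcongr
      _ = Real.exp (-y) := by rw [← Real.exp_add, hy]; congr 1; ring
  refine e3.trans ?_
  have e4 : Real.exp (-y) ≤ (1 + y)⁻¹ := by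
    rw [Real.exp_neg]
    exact inv_anti₀ (by linarith) (by linarith [Real.add_one_le_exp y])
  have e5 : contourGap η T x t ≤ y / (1 + y) := by
    rw [contourGap, ← ha', div_le_div_iff₀ (by linarith) (by linarith)]
    have : (x + a * t) = 4 * y := by rw [hy]; ring
    rw [this]
    have : 4 * (1 + y) ≤ 5 + T := by nlinarith
    nlinarith
  have e6 : (1 + y)⁻¹ = 1 - y / (1 + y) := by
    field_simp
    ring
  linarith

end Contour

/-- The mean over the contour of the absolute value of the kernel, up to a power loss. -/
lemma exists_circleAverage_kernel_le {η : ℝ} (hη : η ≤ 1) {T : ℝ} {δ : ℝ} (hδ : 0 < δ)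
    (hδ1 : δ < 1) :
    ∃ K, 1 ≤ K ∧ ∀ q t x, 0 ≤ q → q < 1 → 0 ≤ t → t ≤ T → 0 < x → x ≤ 1 → ∀ d ≤ 1, ∀ z : ℂ,
      ‖z‖ = 1 + x →
      (Continuous fun φ => evolutionKernel η q d t (circleMap 0 (contourRadius η x t) φ / z)) ∧
      circleAverage (fun w => ‖evolutionKernel η q d t (w / z)‖) 0 (contourRadius η x t)
        ≤ K * contourGap η T x t ^ (-δ) * (contourGap η T x t)⁻¹ ^ d := by
  obtain ⟨V, hV1, hV⟩ := exists_kernel_bound hη T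
  refine ⟨V * cauchyConst δ, ?_, fun q t x h0 h1 ht htT hx hx1 d hd z hz => ?_⟩
  · nlinarith [one_le_cauchyConst hδ hδ1]
  have hz0 : z ≠ 0 := norm_pos_iff.1 (by linarith)
  set ρ := contourRadius η x t with hρ
  have hρ1 : 1 < ρ := contourRadius_pos hη hx ht htT
  have hρ0 : 0 < ρ := by linarith
  set s := shrink η t * (ρ / (1 + x)) with hs
  have hgap := contourGap_pos hη hx ht htT
  have hs1 : s ≤ 1 - contourGap η T x t := shrink_mul_contourRadius_le hη hx hx1 ht htT
  have hsh := shrink_pos η t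
  have hs0 : 0 < s := by positivity
  have hn : ∀ φ, ‖circleMap 0 ρ φ / z‖ = ρ / (1 + x) := fun φ => by
    rw [norm_div, norm_circleMap hρ0.le, hz]
  have hcont : Continuous fun φ => evolutionKernel η q d t (circleMap 0 ρ φ / z) := by
    refine continuous_tsum (fun k => by fun_prop)
      (summable_evolutionKernel hη h0 h1.le ht d (r := ρ / (1 + x)) (by positivity) (by linarith))
      fun k φ => ?_
    rw [norm_mul, norm_pow, hn]
  refine ⟨hcont, ?_⟩
  -- pass to the unit circle
  set v : ℂ := shrink η t * (ρ / z) with hv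
  have hvn : ‖v‖ = s := by
    rw [hv, norm_mul, norm_div, Complex.norm_real, Complex.norm_real, hz,
      Real.norm_of_nonneg hsh.le, Real.norm_of_nonneg hρ0.le]
  have hcm : ∀ φ, circleMap 0 ρ φ = ρ * circleMap 0 1 φ := fun φ => by simp [circleMap]
  have e1 : circleAverage (fun w => ‖evolutionKernel η q d t (w / z)‖) 0 ρ
      = circleAverage (fun ζ => ‖evolutionKernel η q d t (ρ * ζ / z)‖) 0 1 := by
    simp [Real.circleAverage_def, hcm]
  rw [e1]
  have hv1 : ‖v‖ < 1 := by rw [hvn]; linarith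
  have e2 : circleAverage (fun ζ => ‖evolutionKernel η q d t (ρ * ζ / z)‖) 0 1
      ≤ circleAverage (fun ζ => V * (1 - s)⁻¹ ^ d * ‖1 - v * ζ‖⁻¹) 0 1 := by
    refine circleAverage_le_circleAverage ?_
      (continuous_const.mul (continuous_norm_one_sub_inv hv1)) fun φ => ?_
    · exact hcont.norm.congr fun φ => by rw [hcm]
    · have hn' : ‖(ρ:ℂ) * circleMap 0 1 φ / z‖ = ρ / (1 + x) := by rw [← hcm]; exact hn φ
      have h3 := hV q t h0 h1 ht htT d hd (ρ * circleMap 0 1 φ / z) (by rw [hn']; linarith)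
      rw [hn'] at h3
      have e3 : (shrink η t : ℂ) * (ρ * circleMap 0 1 φ / z) = v * circleMap 0 1 φ := by
        rw [hv]
        ring
      rwa [e3] at h3
  refine e2.trans ?_
  rw [circleAverage_const_mul]
  have h4 := circleAverage_inv_le hv1 hδ hδ1
  rw [hvn] at h4
  have h5 : (1 - s) ^ (-δ) ≤ contourGap η T x t ^ (-δ) :=
    Real.rpow_le_rpow_of_nonpos hgap (by linarith) (by linarith)
  have h6 : (1 - s)⁻¹ ≤ (contourGap η T x t)⁻¹ := inv_anti₀ hgap (by linarith)
  have h7 : 0 < 1 - s := by linarith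
  have hcp := cauchyConst_pos hδ hδ1
  calc V * (1 - s)⁻¹ ^ d * circleAverage (fun ζ => ‖1 - v * ζ‖⁻¹) 0 1
      ≤ V * (1 - s)⁻¹ ^ d * (cauchyConst δ * (1 - s) ^ (-δ)) :=
        mul_le_mul_of_nonneg_left h4 (by positivity)
    _ ≤ V * (contourGap η T x t)⁻¹ ^ d * (cauchyConst δ * contourGap η T x t ^ (-δ)) := by
        gcongr
    _ = _ := by ring

/-! ### Dependence on the attachment angles -/

lemma clusterMap_congr (F : ℂ → ℂ) {θ θ' : ℕ → ℝ} {n : ℕ} (h : ∀ i < n, θ i = θ' i) :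
    clusterMap F θ n = clusterMap F θ' n := by
  induction n with
  | zero => rfl
  | succ n ih =>
    ext z
    rw [clusterMap, clusterMap, h n n.lt_succ_self, ih fun i hi => h i (hi.trans n.lt_succ_self)]

lemma exp_mul_I_eq (t : ℝ) : Complex.exp (t * Complex.I) = circleMap 0 1 t := by simp [circleMap]

lemma rotate_eq (F : ℂ → ℂ) (t : ℝ) (z : ℂ) :
    rotate F t z = circleMap 0 1 t * F ((circleMap 0 1 t)⁻¹ * z) := by
  rw [rotate, Complex.exp_neg, exp_mul_I_eq]

section Continuity

variable {F : ℂ → ℂ} {c : ℝ} (hF : IsBasicMap F c)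

include hF

lemma IsBasicMap.hasDerivAt_rotate (t : ℝ) {z : ℂ} (hz : z ∈ exteriorDisk) :
    HasDerivAt (rotate F t) (deriv F (Complex.exp (-(t * Complex.I)) * z)) z := by
  have hz' := rotated_mem_exteriorDisk hz t
  have h1 := (hF.differentiableOn.differentiableAt (isOpen_exteriorDisk.mem_nhds hz')).hasDerivAt
  have h2 : HasDerivAt (fun z => Complex.exp (-(t * Complex.I)) * z)
      (Complex.exp (-(t * Complex.I))) z := by
    simpa using (hasDerivAt_id z).const_mul (Complex.exp (-(t * Complex.I)))
  have h3 := (h1.comp z h2).const_mul (Complex.exp (t * Complex.I))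
  refine h3.congr_deriv ?_
  rw [mul_comm, mul_assoc, ← Complex.exp_add, neg_add_cancel, Complex.exp_zero, mul_one]

lemma IsBasicMap.continuousOn_rotate :
    ContinuousOn (fun p : ℝ × ℂ => rotate F p.1 p.2) (Set.univ ×ˢ exteriorDisk) := by
  have h1 : ContinuousOn (fun p : ℝ × ℂ => F (Complex.exp (-(p.1 * Complex.I)) * p.2))
      (Set.univ ×ˢ exteriorDisk) :=
    hF.differentiableOn.continuousOn.comp (by fun_prop)
      fun p hp => rotated_mem_exteriorDisk hp.2 p.1
  exact ContinuousOn.mul (by fun_prop) h1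

lemma IsBasicMap.continuousOn_clusterMap (n : ℕ) :
    ContinuousOn (fun p : (ℕ → ℝ) × ℂ => clusterMap F p.1 n p.2) (Set.univ ×ˢ exteriorDisk) := by
  induction n with
  | zero => exact continuousOn_snd
  | succ n ih =>
    have h1 : ContinuousOn (fun p : (ℕ → ℝ) × ℂ => rotate F (p.1 n) p.2)
        (Set.univ ×ˢ exteriorDisk) :=
      hF.continuousOn_rotate.comp (f := fun p : (ℕ → ℝ) × ℂ => (p.1 n, p.2)) (by fun_prop)
        fun p hp => ⟨trivial, hp.2⟩
    exact ih.comp (f := fun p : (ℕ → ℝ) × ℂ => (p.1, rotate F (p.1 n) p.2))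
      (continuousOn_fst.prodMk h1) fun p hp => ⟨trivial, hF.mapsTo_rotate (p.1 n) hp.2⟩

lemma IsBasicMap.continuousOn_deriv_clusterMap (n : ℕ) :
    ContinuousOn (fun p : (ℕ → ℝ) × ℂ => deriv (clusterMap F p.1 n) p.2)
      (Set.univ ×ˢ exteriorDisk) := by
  induction n with
  | zero =>
    exact (continuousOn_const (c := (1:ℂ))).congr fun p _ => (hasDerivAt_id p.2).deriv
  | succ n ih =>
    have h1 : ContinuousOn (fun p : (ℕ → ℝ) × ℂ => rotate F (p.1 n) p.2)
        (Set.univ ×ˢ exteriorDisk) :=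
      hF.continuousOn_rotate.comp (f := fun p : (ℕ → ℝ) × ℂ => (p.1 n, p.2)) (by fun_prop)
        fun p hp => ⟨trivial, hp.2⟩
    have h2 := ih.comp (f := fun p : (ℕ → ℝ) × ℂ => (p.1, rotate F (p.1 n) p.2))
      (continuousOn_fst.prodMk h1) fun p hp => ⟨trivial, hF.mapsTo_rotate (p.1 n) hp.2⟩
    have h3 : ContinuousOn (fun p : (ℕ → ℝ) × ℂ =>
        deriv F (Complex.exp (-(p.1 n * Complex.I)) * p.2)) (Set.univ ×ˢ exteriorDisk) :=
      (hF.differentiableOn.deriv isOpen_exteriorDisk).continuousOn.comp (by fun_prop)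
        fun p hp => rotated_mem_exteriorDisk hp.2 (p.1 n)
    refine (h2.mul h3).congr fun p hp => ?_
    have h4 := (((hF.differentiableOn_clusterMap (θ := p.1) n).differentiableAt
      (isOpen_exteriorDisk.mem_nhds (hF.mapsTo_rotate (p.1 n) hp.2))).hasDerivAt).comp p.2
      (hF.hasDerivAt_rotate (p.1 n) hp.2)
    exact h4.deriv

end Continuity

/-- The attachment density as a function on the unit circle, relative to its uniform probability
measure. -/
def attachDensity (F : ℂ → ℂ) (η σ : ℝ) (θ : ℕ → ℝ) (n : ℕ) (ζ : ℂ) : ℝ :=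
  ‖deriv (clusterMap F θ n) ((Real.exp σ : ℝ) * ζ)‖ ^ (-η) /
    circleAverage (fun ζ => ‖deriv (clusterMap F θ n) ((Real.exp σ : ℝ) * ζ)‖ ^ (-η)) 0 1

lemma weight_eq (F : ℂ → ℂ) (η σ : ℝ) (θ : ℕ → ℝ) (n : ℕ) (t : ℝ) :
    weight F η σ θ n t
      = ‖deriv (clusterMap F θ n) ((Real.exp σ : ℝ) * circleMap 0 1 t)‖ ^ (-η) := by
  rw [weight, Complex.exp_add, exp_mul_I_eq, Complex.ofReal_exp]

lemma density_eq (F : ℂ → ℂ) (η σ : ℝ) (θ : ℕ → ℝ) (n : ℕ) (t : ℝ) :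
    density F η σ θ n t = attachDensity F η σ θ n (circleMap 0 1 t) := by
  rw [density, attachDensity, weight_eq, partitionConst, Real.circleAverage_def, smul_eq_mul]
  simp only [weight_eq]

lemma attachDensity_nonneg (F : ℂ → ℂ) (η σ : ℝ) (θ : ℕ → ℝ) (n : ℕ) (ζ : ℂ) :
    0 ≤ attachDensity F η σ θ n ζ := by
  refine div_nonneg (by positivity) ?_
  rw [Real.circleAverage_def, smul_eq_mul]
  exact mul_nonneg (by positivity)
    (intervalIntegral.integral_nonneg (by positivity) fun t _ => by positivity)

lemma attachDensity_congr (F : ℂ → ℂ) (η σ : ℝ) {θ θ' : ℕ → ℝ} {n : ℕ}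
    (h : ∀ i < n, θ i = θ' i) : attachDensity F η σ θ n = attachDensity F η σ θ' n := by
  ext ζ
  rw [attachDensity, attachDensity, clusterMap_congr F h]

lemma continuous_deriv_clusterMap_circle {F : ℂ → ℂ} {c : ℝ} (hF : IsBasicMap F c) {r : ℝ}
    (hr : 1 < r) (n : ℕ) :
    Continuous fun p : (ℕ → ℝ) × ℝ => deriv (clusterMap F p.1 n) (r * circleMap 0 1 p.2) := by
  refine (hF.continuousOn_deriv_clusterMap n).comp_continuous
    (f := fun p : (ℕ → ℝ) × ℝ => (p.1, (r:ℂ) * circleMap 0 1 p.2)) (by fun_prop)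
    fun p => ⟨trivial, ?_⟩
  rw [mem_exteriorDisk, norm_mul, norm_unit_circle, Complex.norm_real,
    Real.norm_of_nonneg (by linarith), mul_one]
  exact hr

lemma measurable_attachDensity {F : ℂ → ℂ} {c : ℝ} (hF : IsBasicMap F c) (η : ℝ) {σ : ℝ}
    (hσ : 0 < σ) (n : ℕ) :
    Measurable fun p : (ℕ → ℝ) × ℝ => attachDensity F η σ p.1 n (circleMap 0 1 p.2) := by
  have h1 : Measurable fun p : (ℕ → ℝ) × ℝ =>
      ‖deriv (clusterMap F p.1 n) ((Real.exp σ : ℝ) * circleMap 0 1 p.2)‖ ^ (-η) :=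
    (continuous_deriv_clusterMap_circle hF (Real.one_lt_exp_iff.2 hσ) n).norm.measurable.pow_const _
  have h2 : Measurable fun θ : ℕ → ℝ =>
      circleAverage (fun ζ => ‖deriv (clusterMap F θ n) ((Real.exp σ : ℝ) * ζ)‖ ^ (-η)) 0 1 := by
    simp only [Real.circleAverage_def,
      intervalIntegral.integral_of_le (by positivity : (0:ℝ) ≤ 2 * Real.pi)]
    exact (StronglyMeasurable.integral_prod_right
      (ν := volume.restrict (Set.Ioc 0 (2 * Real.pi)))
      (f := fun (θ : ℕ → ℝ) (t : ℝ) =>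
        ‖deriv (clusterMap F θ n) ((Real.exp σ : ℝ) * circleMap 0 1 t)‖ ^ (-η)) h1.stronglyMeasurable).measurable.const_smul (2 * Real.pi)⁻¹
  exact h1.div (h2.comp measurable_fst)

/-! ### The conditional law of the next angle -/

/-- The sequence which agrees with `θ` up to index `n`, and vanishes from then on. -/
def truncate (n : ℕ) (θ : ℕ → ℝ) : ℕ → ℝ := fun i => if i < n then θ i else 0

lemma truncate_apply_of_lt {n i : ℕ} (h : i < n) (θ : ℕ → ℝ) : truncate n θ i = θ i := if_pos h

/-- The function `f` of a sequence of angles depends on the first `n` of them only. -/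
def DependsOnFirst {α : Type*} (n : ℕ) (f : (ℕ → ℝ) → α) : Prop :=
  ∀ θ θ' : ℕ → ℝ, (∀ i < n, θ i = θ' i) → f θ = f θ'

lemma DependsOnFirst.truncate_eq {α : Type*} {n : ℕ} {f : (ℕ → ℝ) → α} (h : DependsOnFirst n f)
    (θ : ℕ → ℝ) : f (truncate n θ) = f θ :=
  h _ _ fun _ hi => truncate_apply_of_lt hi θ

section Disintegration

variable {Ω : Type u} [MeasurableSpace Ω] {μ : Measure Ω} [IsProbabilityMeasure μ] {F : ℂ → ℂ}
  {c η σ : ℝ} {Θ : ℕ → Ω → ℝ} (hA : IsALE μ F η σ Θ)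

omit [MeasurableSpace Ω] in
lemma measurable_truncate_pastAngles (Θ : ℕ → Ω → ℝ) (n : ℕ) :
    Measurable[pastAngles Θ n] fun ω => truncate n fun k => Θ k ω := by
  refine @measurable_pi_lambda _ _ _ (pastAngles Θ n) _ _ fun i => ?_
  by_cases hi : i < n
  · have h1 : MeasurableSpace.comap (Θ i) Real.measurableSpace ≤ pastAngles Θ n :=
      le_iSup (fun j : Fin n => MeasurableSpace.comap (Θ j) Real.measurableSpace) ⟨i, hi⟩
    have h2 : Measurable[pastAngles Θ n] (Θ i) := measurable_iff_comap_le.2 h1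
    simpa [truncate, hi] using h2
  · simp only [truncate, hi, if_false]
    exact measurable_const

omit [IsProbabilityMeasure μ] in
include hA in
lemma IsALE.measurable_angles : Measurable fun ω => fun k => Θ k ω :=
  measurable_pi_lambda _ hA.measurable

include hA in
/-- On a set of pasts for which the attachment density is continuous, the joint law of the past and
of the next angle is a mixture of the attachment distributions. -/
theorem IsALE.setLIntegral_eq (hF : IsBasicMap F c) (hσ : 0 < σ) {n : ℕ} {G : Set (ℕ → ℝ)}
    (hG : MeasurableSet G) (hGd : DependsOnFirst n (· ∈ G))
    (hcont : ∀ θ ∈ G, Continuous fun t => attachDensity F η σ θ n (circleMap 0 1 t))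
    {Z : (ℕ → ℝ) → ℝ → ENNReal} (hZ : Measurable (Function.uncurry Z)) (hZd : DependsOnFirst n Z) :
    ∫⁻ ω in {ω | (fun k => Θ k ω) ∈ G}, Z (fun k => Θ k ω) (Θ n ω) ∂μ
      = ∫⁻ ω in {ω | (fun k => Θ k ω) ∈ G}, (∫⁻ t in Set.Ioc (0:ℝ) (2 * Real.pi),
          ENNReal.ofReal ((2 * Real.pi)⁻¹ * attachDensity F η σ (fun k => Θ k ω) n (circleMap 0 1 t))
            * Z (fun k => Θ k ω) t) ∂μ := by
  set P : Ω → ℕ → ℝ := fun ω => truncate n fun k => Θ k ω with hP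
  have hpast : pastAngles Θ n ≤ ‹MeasurableSpace Ω› :=
    iSup_le fun j => (hA.measurable j).comap_le
  have hPm' := measurable_truncate_pastAngles Θ n
  have hPm : Measurable P := hPm'.mono hpast le_rfl
  have hGP : {ω | (fun k => Θ k ω) ∈ G} = P ⁻¹' G := by
    ext ω
    exact (hGd.truncate_eq (fun k => Θ k ω)).symm.to_iff
  rw [hGP]
  set w : (ℕ → ℝ) × ℝ → ENNReal := fun p =>
    ENNReal.ofReal ((2 * Real.pi)⁻¹ * attachDensity F η σ p.1 n (circleMap 0 1 p.2)) with hw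
  have hwm : Measurable w := ((measurable_attachDensity hF η hσ n).const_mul _).ennreal_ofReal
  set ν := (μ.restrict (P ⁻¹' G)).map P with hν
  have hGm : MeasurableSet (P ⁻¹' G) := hPm hG
  -- the two candidate joint laws agree on rectangles
  have key : (μ.restrict (P ⁻¹' G)).map (fun ω => (P ω, Θ n ω))
      = (ν.prod (volume.restrict (Set.Ioc 0 (2 * Real.pi)))).withDensity w := by
    refine Measure.ext_prod fun {D B} hD hB => ?_
    have hDm : MeasurableSet[pastAngles Θ n] (P ⁻¹' (D ∩ G)) := hPm' (hD.inter hG)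
    rw [Measure.map_apply (hPm.prodMk (hA.measurable n)) (hD.prod hB),
      withDensity_apply _ (hD.prod hB), ← Measure.prod_restrict, lintegral_prod _ hwm.aemeasurable,
      hν, setLIntegral_map hD (Measurable.lintegral_prod_right' hwm) hPm,
      Measure.restrict_restrict (hPm hD),
      Measure.restrict_apply ((hPm.prodMk (hA.measurable n)) (hD.prod hB))]
    have hset : (fun ω => (P ω, Θ n ω)) ⁻¹' (D ×ˢ B) ∩ P ⁻¹' G = Θ n ⁻¹' B ∩ P ⁻¹' (D ∩ G) := by
      ext ω
      simp only [Set.mem_inter_iff, Set.mem_preimage, Set.mem_prod]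
      tauto
    have hBm : MeasurableSet (Θ n ⁻¹' B) := hA.measurable n hB
    have h1 := setIntegral_condExp hpast (μ := μ) (f := (Θ n ⁻¹' B).indicator fun _ => (1:ℝ))
      ((integrable_const 1).indicator hBm) hDm
    rw [setIntegral_indicator hBm, setIntegral_const, smul_eq_mul, mul_one] at h1
    have h2 : ∀ ω ∈ P ⁻¹' (D ∩ G), ∫⁻ t, w (P ω, t)
          ∂((volume.restrict (Set.Ioc 0 (2 * Real.pi))).restrict B)
        = ENNReal.ofReal ((2 * Real.pi)⁻¹ *
          ∫ t in (0 : ℝ)..2 * Real.pi, B.indicator (density F η σ (fun k => Θ k ω) n) t) := by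
      intro ω hω
      have hc := hcont _ hω.2
      have hdens : ∀ t, density F η σ (fun k => Θ k ω) n t
          = attachDensity F η σ (P ω) n (circleMap 0 1 t) := fun t => by
        rw [density_eq, hP, attachDensity_congr F η σ (θ := truncate n _)
          fun i hi => truncate_apply_of_lt hi _]
      have hfun : density F η σ (fun k => Θ k ω) n
          = fun t => attachDensity F η σ (P ω) n (circleMap 0 1 t) := funext hdens
      have hi : Integrable (fun t => attachDensity F η σ (P ω) n (circleMap 0 1 t))
          (volume.restrict (Set.Ioc 0 (2 * Real.pi))) :=
        (hc.integrableOn_Icc (a := 0) (b := 2 * Real.pi)).mono_set Set.Ioc_subset_Icc_self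
      rw [hfun, intervalIntegral.integral_of_le (by positivity), integral_indicator hB,
        ← integral_const_mul, ofReal_integral_eq_lintegral_ofReal]
      · exact (hi.mono_measure Measure.restrict_le_self).const_mul _
      · exact .of_forall fun t => mul_nonneg (by positivity) (attachDensity_nonneg ..)
    have hset' : P ⁻¹' D ∩ P ⁻¹' G = P ⁻¹' (D ∩ G) := rfl
    rw [hset, hset', setLIntegral_congr_fun (hpast _ hDm) h2, Set.inter_comm, ← ofReal_measureReal (measure_ne_top _ _),
      ← h1, ofReal_integral_eq_lintegral_ofReal integrable_condExp.integrableOn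
        (ae_restrict_of_ae (condExp_nonneg (.of_forall fun ω => Set.indicator_nonneg
          (fun _ _ => zero_le_one) ω)))]
    refine setLIntegral_congr_fun_ae (hpast _ hDm) ?_
    filter_upwards [hA.condProb n B hB] with ω hω _
    rw [← hω]
  have h3 : ∀ ω, Z (fun k => Θ k ω) (Θ n ω) = Function.uncurry Z (P ω, Θ n ω) := fun ω => by
    rw [Function.uncurry, hP, hZd.truncate_eq]
  simp_rw [h3]
  rw [← lintegral_map hZ (hPm.prodMk (hA.measurable n)), key,
    lintegral_withDensity_eq_lintegral_mul _ hwm hZ, lintegral_prod _ (hwm.mul hZ).aemeasurable, hν,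
    lintegral_map (Measurable.lintegral_prod_right' (hwm.mul hZ)) hPm]
  refine lintegral_congr fun ω => lintegral_congr fun t => ?_
  simp only [Pi.mul_apply, hw, Function.uncurry, hP]
  rw [hZd.truncate_eq, attachDensity_congr F η σ fun i hi => truncate_apply_of_lt hi _]

end Disintegration

/-! ### Exponential concentration -/

/-- The sum over the first `n` steps of `ξ j`, evaluated at the attachment point, over the steps `j`
at which the past is in the good set `G j`. -/
def stoppedSum (G : ℕ → Set (ℕ → ℝ)) (ξ : ℕ → (ℕ → ℝ) → ℂ → ℝ) (n : ℕ) (θ : ℕ → ℝ) : ℝ :=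
  ∑ j ∈ Finset.range n, (G j).indicator (fun θ => ξ j θ (circleMap 0 1 (θ j))) θ

section Concentration

variable {G : ℕ → Set (ℕ → ℝ)} {ξ : ℕ → (ℕ → ℝ) → ℂ → ℝ}

lemma dependsOnFirst_stoppedSum (hG : ∀ j, DependsOnFirst j (· ∈ G j))
    (hξ : ∀ j, DependsOnFirst j (ξ j)) (n : ℕ) : DependsOnFirst n (stoppedSum G ξ n) := by
  intro θ θ' h
  refine Finset.sum_congr rfl fun j hj => ?_
  have hj := Finset.mem_range.1 hj
  have h1 : θ ∈ G j ↔ θ' ∈ G j := (hG j θ θ' fun i hi => h i (hi.trans hj)).to_iff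
  by_cases h2 : θ ∈ G j
  · rw [Set.indicator_of_mem h2, Set.indicator_of_mem (h1.1 h2), h j hj,
      hξ j θ θ' fun i hi => h i (hi.trans hj)]
  · rw [Set.indicator_of_notMem h2, Set.indicator_of_notMem (mt h1.2 h2)]

lemma measurable_stoppedSum (hG : ∀ j, MeasurableSet (G j))
    (hξ : ∀ j, Measurable fun p : (ℕ → ℝ) × ℝ => ξ j p.1 (circleMap 0 1 p.2)) (n : ℕ) :
    Measurable (stoppedSum G ξ n) :=
  Finset.measurable_fun_sum _ fun j _ =>
    ((hξ j).comp (measurable_id.prodMk (measurable_pi_apply j))).indicator (hG j)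

/-- The exponential moment of a centred, bounded function on the circle. -/
lemma setLIntegral_exp_le {h x : ℂ → ℝ} (hh : Continuous fun φ => h (circleMap 0 1 φ))
    (hh0 : ∀ φ, 0 ≤ h (circleMap 0 1 φ)) (hh1 : circleAverage h 0 1 = 1)
    (hx : Continuous fun φ => x (circleMap 0 1 φ)) {s b v : ℝ} (hs : 0 ≤ s) (hsb : s * b ≤ 1)
    (hb : ∀ φ, |x (circleMap 0 1 φ)| ≤ b) (hm : circleAverage (fun ζ => x ζ * h ζ) 0 1 = 0)
    (hv : circleAverage (fun ζ => x ζ ^ 2 * h ζ) 0 1 ≤ v) :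
    ∫⁻ t in Set.Ioc 0 (2 * Real.pi), ENNReal.ofReal ((2 * Real.pi)⁻¹ * h (circleMap 0 1 t))
        * ENNReal.ofReal (Real.exp (s * x (circleMap 0 1 t)))
      ≤ ENNReal.ofReal (Real.exp (s ^ 2 * v)) := by
  have hpi : 0 < 2 * Real.pi := by positivity
  have hexp : Continuous fun t => Real.exp (s * x (circleMap 0 1 t)) * h (circleMap 0 1 t) :=
    (Real.continuous_exp.comp (continuous_const.mul hx)).mul hh
  have hc : Continuous fun t => (2 * Real.pi)⁻¹ *
      (Real.exp (s * x (circleMap 0 1 t)) * h (circleMap 0 1 t)) := continuous_const.mul hexp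
  have c2 : Continuous fun t => s * (x (circleMap 0 1 t) * h (circleMap 0 1 t)) :=
    continuous_const.mul (hx.mul hh)
  have c3 : Continuous fun t => s ^ 2 * (x (circleMap 0 1 t) ^ 2 * h (circleMap 0 1 t)) :=
    continuous_const.mul ((hx.pow 2).mul hh)
  have h1 : ∀ t, ENNReal.ofReal ((2 * Real.pi)⁻¹ * h (circleMap 0 1 t))
        * ENNReal.ofReal (Real.exp (s * x (circleMap 0 1 t)))
      = ENNReal.ofReal ((2 * Real.pi)⁻¹ *
        (Real.exp (s * x (circleMap 0 1 t)) * h (circleMap 0 1 t))) := fun t => by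
    rw [← ENNReal.ofReal_mul (mul_nonneg (by positivity) (hh0 t))]
    congr 1
    ring
  simp_rw [h1]
  rw [← ofReal_integral_eq_lintegral_ofReal
    ((hc.integrableOn_Icc (a := 0) (b := 2 * Real.pi)).mono_set Set.Ioc_subset_Icc_self)
    (.of_forall fun t => mul_nonneg (by positivity) (mul_nonneg (Real.exp_pos _).le (hh0 t))),
    integral_const_mul, ← intervalIntegral.integral_of_le hpi.le]
  refine ENNReal.ofReal_le_ofReal ?_
  have h2 : circleAverage (fun ζ => Real.exp (s * x ζ) * h ζ) 0 1
      ≤ circleAverage (fun ζ => (h ζ + s * (x ζ * h ζ)) + s ^ 2 * (x ζ ^ 2 * h ζ)) 0 1 := by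
    refine circleAverage_le_circleAverage hexp ((hh.add c2).add c3) fun φ => ?_
    have h3 : |s * x (circleMap 0 1 φ)| ≤ 1 := by
      rw [abs_mul, abs_of_nonneg hs]
      exact (mul_le_mul_of_nonneg_left (hb φ) hs).trans hsb
    have h4 := (abs_le.1 (Real.abs_exp_sub_one_sub_id_le h3)).2
    nlinarith [hh0 φ]
  have i1 : CircleIntegrable h 0 1 := circleIntegrable_of_continuous hh
  have i2 : CircleIntegrable (fun ζ => s * (x ζ * h ζ)) 0 1 :=
    circleIntegrable_of_continuous c2
  have i3 : CircleIntegrable (fun ζ => s ^ 2 * (x ζ ^ 2 * h ζ)) 0 1 :=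
    circleIntegrable_of_continuous c3
  have i4 : CircleIntegrable (fun ζ => h ζ + s * (x ζ * h ζ)) 0 1 := i1.add i2
  rw [Real.circleAverage_fun_add i4 i3, Real.circleAverage_fun_add i1 i2,
    circleAverage_const_mul, circleAverage_const_mul, hh1, hm, mul_zero, add_zero] at h2
  have h5 : circleAverage (fun ζ => Real.exp (s * x ζ) * h ζ) 0 1
      = (2 * Real.pi)⁻¹ * ∫ t in (0:ℝ)..2 * Real.pi,
        Real.exp (s * x (circleMap 0 1 t)) * h (circleMap 0 1 t) := by
    rw [Real.circleAverage_def, smul_eq_mul]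
  rw [← h5]
  have h6 := Real.add_one_le_exp (s ^ 2 * v)
  have h7 := mul_le_mul_of_nonneg_left hv (sq_nonneg s)
  linarith

variable {Ω : Type u} [MeasurableSpace Ω] {μ : Measure Ω} [IsProbabilityMeasure μ] {F : ℂ → ℂ}
  {c η σ b : ℝ} {v : ℕ → ℝ} {Θ : ℕ → Ω → ℝ} (hA : IsALE μ F η σ Θ) (hF : IsBasicMap F c)
  (hσ : 0 < σ) (hG : ∀ j, MeasurableSet (G j)) (hGd : ∀ j, DependsOnFirst j (· ∈ G j))
  (hξ : ∀ j, Measurable fun p : (ℕ → ℝ) × ℝ => ξ j p.1 (circleMap 0 1 p.2))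
  (hξd : ∀ j, DependsOnFirst j (ξ j)) {n : ℕ}
  (hdens : ∀ j < n, ∀ θ ∈ G j, (Continuous fun φ => attachDensity F η σ θ j (circleMap 0 1 φ)) ∧
    circleAverage (attachDensity F η σ θ j) 0 1 = 1)
  (hcont : ∀ j < n, ∀ θ ∈ G j, Continuous fun φ => ξ j θ (circleMap 0 1 φ))
  (hbd : ∀ j < n, ∀ θ ∈ G j, ∀ φ, |ξ j θ (circleMap 0 1 φ)| ≤ b)
  (hmean : ∀ j < n, ∀ θ ∈ G j,
    circleAverage (fun ζ => ξ j θ ζ * attachDensity F η σ θ j ζ) 0 1 = 0)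
  (hvar : ∀ j < n, ∀ θ ∈ G j,
    circleAverage (fun ζ => ξ j θ ζ ^ 2 * attachDensity F η σ θ j ζ) 0 1 ≤ v j)

include hA hF hσ hG hGd hξ hξd hdens hcont hbd hmean hvar

lemma lintegral_exp_stoppedSum_le (hv : ∀ j < n, 0 ≤ v j) {s : ℝ} (hs : 0 ≤ s) (hsb : s * b ≤ 1) :
    ∫⁻ ω, ENNReal.ofReal (Real.exp (s * stoppedSum G ξ n fun k => Θ k ω)) ∂μ
      ≤ ENNReal.ofReal (Real.exp (s ^ 2 * ∑ j ∈ Finset.range n, v j)) := by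
  induction n with
  | zero => simp [stoppedSum]
  | succ n ih =>
    have ih := ih (fun j hj => hdens j (hj.trans n.lt_succ_self))
      (fun j hj => hcont j (hj.trans n.lt_succ_self)) (fun j hj => hbd j (hj.trans n.lt_succ_self))
      (fun j hj => hmean j (hj.trans n.lt_succ_self))
      (fun j hj => hvar j (hj.trans n.lt_succ_self)) (fun j hj => hv j (hj.trans n.lt_succ_self))
    set W : (ℕ → ℝ) → ENNReal := fun θ => ENNReal.ofReal (Real.exp (s * stoppedSum G ξ n θ)) with hW
    have hWm : Measurable W :=
      ((measurable_stoppedSum hG hξ n).const_mul s).exp.ennreal_ofReal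
    have hΘ := hA.measurable_angles
    set A : Set Ω := {ω | (fun k => Θ k ω) ∈ G n} with hAdef
    have hAm : MeasurableSet A := hΘ (hG n)
    set e := ENNReal.ofReal (Real.exp (s ^ 2 * v n)) with he
    have he1 : 1 ≤ e := by
      rw [he, ← ENNReal.ofReal_one]
      refine ENNReal.ofReal_le_ofReal (Real.one_le_exp ?_)
      exact mul_nonneg (sq_nonneg s) (hv n n.lt_succ_self)
    set Z : (ℕ → ℝ) → ℝ → ENNReal := fun θ t =>
      W θ * ENNReal.ofReal (Real.exp (s * ξ n θ (circleMap 0 1 t))) with hZ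
    have hZm : Measurable (Function.uncurry Z) :=
      (hWm.comp measurable_fst).mul ((hξ n).const_mul s).exp.ennreal_ofReal
    have hZd : DependsOnFirst n Z := fun θ θ' h => by
      simp only [hZ, hW, dependsOnFirst_stoppedSum hGd hξd n θ θ' h, hξd n θ θ' h]
    have h1 : ∫⁻ ω in A, ENNReal.ofReal (Real.exp (s * stoppedSum G ξ (n + 1) fun k => Θ k ω)) ∂μ
        ≤ e * ∫⁻ ω in A, W (fun k => Θ k ω) ∂μ := by
      have e1 : ∀ ω ∈ A, ENNReal.ofReal (Real.exp (s * stoppedSum G ξ (n + 1) fun k => Θ k ω))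
          = Z (fun k => Θ k ω) (Θ n ω) := fun ω hω => by
        rw [stoppedSum, Finset.sum_range_succ, Set.indicator_of_mem (s := G n) hω, mul_add, Real.exp_add,
          ENNReal.ofReal_mul (Real.exp_pos _).le]
        rfl
      rw [setLIntegral_congr_fun hAm e1, hA.setLIntegral_eq hF hσ (hG n) (hGd n)
        (fun θ hθ => (hdens n n.lt_succ_self θ hθ).1) hZm hZd,
        ← lintegral_const_mul (f := fun ω => W fun k => Θ k ω) _ (hWm.comp hΘ)]
      refine setLIntegral_mono (measurable_const.mul (hWm.comp hΘ)) fun ω hω => ?_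
      have hn := n.lt_succ_self
      have h2 := setLIntegral_exp_le (hdens n hn _ hω).1 (fun φ => attachDensity_nonneg ..)
        (hdens n hn _ hω).2 (hcont n hn _ hω) hs hsb (hbd n hn _ hω) (hmean n hn _ hω)
        (hvar n hn _ hω)
      simp only [hZ]
      simp_rw [mul_left_comm _ (W _)]
      rw [lintegral_const_mul, mul_comm]
      · exact mul_le_mul_left h2 _
      · have hd := (hdens n hn _ hω).1
        have hx := hcont n hn _ hω
        exact (hd.measurable.const_mul _).ennreal_ofReal.mul
          (hx.measurable.const_mul s).exp.ennreal_ofReal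
    have h2 : ∫⁻ ω in Aᶜ, ENNReal.ofReal (Real.exp (s * stoppedSum G ξ (n + 1) fun k => Θ k ω)) ∂μ
        ≤ e * ∫⁻ ω in Aᶜ, W (fun k => Θ k ω) ∂μ := by
      have e1 : ∀ ω ∈ Aᶜ, ENNReal.ofReal (Real.exp (s * stoppedSum G ξ (n + 1) fun k => Θ k ω))
          = W fun k => Θ k ω := fun ω hω => by
        rw [stoppedSum, Finset.sum_range_succ, Set.indicator_of_notMem (s := G n) hω, add_zero]
        rfl
      rw [setLIntegral_congr_fun hAm.compl e1]
      exact le_mul_of_one_le_left zero_le he1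
    calc _ = _ := (lintegral_add_compl _ hAm).symm
      _ ≤ e * ∫⁻ ω in A, W (fun k => Θ k ω) ∂μ + e * ∫⁻ ω in Aᶜ, W (fun k => Θ k ω) ∂μ :=
          add_le_add h1 h2
      _ = e * ∫⁻ ω, W (fun k => Θ k ω) ∂μ := by rw [← mul_add, lintegral_add_compl _ hAm]
      _ ≤ e * ENNReal.ofReal (Real.exp (s ^ 2 * ∑ j ∈ Finset.range n, v j)) := by gcongr
      _ = _ := by
          rw [he, ← ENNReal.ofReal_mul (Real.exp_pos _).le, ← Real.exp_add, Finset.sum_range_succ]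
          congr 2
          ring

/-- A Bernstein-type inequality. -/
theorem measure_stoppedSum_ge_le (hv : ∀ j < n, 0 ≤ v j) (hb : 0 < b) (l : ℝ) :
    μ {ω | l * (b + √(∑ j ∈ Finset.range n, v j)) ≤ stoppedSum G ξ n fun k => Θ k ω}
      ≤ ENNReal.ofReal (Real.exp (1 - l)) := by
  set V := ∑ j ∈ Finset.range n, v j with hV
  have hV0 : 0 ≤ V := Finset.sum_nonneg fun j hj => hv j (Finset.mem_range.1 hj)
  set s := (b + √V)⁻¹ with hs
  have hpos : 0 < b + √V := by positivity
  have hs0 : 0 < s := inv_pos.2 hpos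
  have hsb : s * b ≤ 1 := by
    rw [hs, inv_mul_le_iff₀ hpos]
    linarith [Real.sqrt_nonneg V]
  have hsV : s ^ 2 * V ≤ 1 := by
    have h1 : s * √V ≤ 1 := by
      rw [hs, inv_mul_le_iff₀ hpos]
      linarith
    calc s ^ 2 * V = (s * √V) ^ 2 := by rw [mul_pow, Real.sq_sqrt hV0]
      _ ≤ 1 := pow_le_one₀ (by positivity) h1
  have h1 := lintegral_exp_stoppedSum_le hA hF hσ hG hGd hξ hξd hdens hcont hbd hmean hvar hv
    hs0.le hsb
  have hm : Measurable fun ω =>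
      ENNReal.ofReal (Real.exp (s * stoppedSum G ξ n fun k => Θ k ω)) :=
    (((measurable_stoppedSum hG hξ n).comp hA.measurable_angles).const_mul s).exp.ennreal_ofReal
  have h2 := mul_meas_ge_le_lintegral (μ := μ) hm (ENNReal.ofReal (Real.exp l))
  have hsub : {ω | l * (b + √V) ≤ stoppedSum G ξ n fun k => Θ k ω}
      ⊆ {ω | ENNReal.ofReal (Real.exp l)
        ≤ ENNReal.ofReal (Real.exp (s * stoppedSum G ξ n fun k => Θ k ω))} := by
    intro ω hω
    refine ENNReal.ofReal_le_ofReal (Real.exp_le_exp.2 ?_)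
    have h3 : s * (l * (b + √V)) ≤ s * stoppedSum G ξ n fun k => Θ k ω :=
      mul_le_mul_of_nonneg_left hω hs0.le
    rwa [mul_left_comm, hs, inv_mul_cancel₀ hpos.ne', mul_one] at h3
  refine (measure_mono hsub).trans ?_
  have hl : ENNReal.ofReal (Real.exp l) ≠ 0 := by
    rw [ne_eq, ENNReal.ofReal_eq_zero, not_le]
    exact Real.exp_pos l
  have h4 := (ENNReal.le_div_iff_mul_le (.inl hl) (.inl ENNReal.ofReal_ne_top)).2
    ((mul_comm _ _).trans_le (h2.trans h1))
  refine h4.trans ?_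
  rw [← ENNReal.ofReal_div_of_pos (Real.exp_pos l), ← Real.exp_sub]
  exact ENNReal.ofReal_le_ofReal (Real.exp_le_exp.2 (by linarith))

end Concentration

/-! ### Averaging over the contour -/

lemma circleAverage_swap {E : Type*} [NormedAddCommGroup E] [NormedSpace ℝ E] {f : ℂ → ℂ → E}
    {ρ ρ' : ℝ} (hf : Continuous fun p : ℝ × ℝ => f (circleMap 0 ρ p.1) (circleMap 0 ρ' p.2)) :
    circleAverage (fun w => circleAverage (f w) 0 ρ') 0 ρ
      = circleAverage (fun ζ => circleAverage (fun w => f w ζ) 0 ρ) 0 ρ' := by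
  simp only [Real.circleAverage_def, intervalIntegral.integral_smul]
  congr 2
  refine intervalIntegral_intervalIntegral_swap ?_
  exact (hf.continuousOn.integrableOn_compact (isCompact_uIcc.prod isCompact_uIcc)).mono_set
    (Set.prod_mono Set.uIoc_subset_uIcc Set.uIoc_subset_uIcc)

lemma circleAverage_nonneg {f : ℂ → ℝ} {ρ : ℝ} (h : ∀ z, 0 ≤ f z) : 0 ≤ circleAverage f 0 ρ := by
  rw [Real.circleAverage_def, smul_eq_mul]
  exact mul_nonneg (by positivity)
    (intervalIntegral.integral_nonneg (by positivity) fun t _ => h _)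

lemma continuous_circleAverage {X E : Type*} [TopologicalSpace X] [FirstCountableTopology X]
    [NormedAddCommGroup E] [NormedSpace ℝ E] {f : X → ℂ → E} {ρ : ℝ}
    (hf : Continuous fun p : X × ℝ => f p.1 (circleMap 0 ρ p.2)) :
    Continuous fun x => circleAverage (f x) 0 ρ := by
  simp only [Real.circleAverage_def]
  exact (intervalIntegral.continuous_parametric_intervalIntegral_of_continuous'
    (f := fun x t => f x (circleMap 0 ρ t)) hf _ _).const_smul _

lemma circleAverage_mul_const (a : ℂ) (f : ℂ → ℂ) (ρ : ℝ) :
    circleAverage (fun w => f w * a) 0 ρ = circleAverage f 0 ρ * a := by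
  have := Real.circleAverage_fun_smul (a := a) (f := f) (c := 0) (R := ρ)
  simp only [smul_eq_mul] at this
  rw [mul_comm, ← this]
  exact congrArg (fun g => circleAverage g 0 ρ) (funext fun w => mul_comm _ _)

/-- The Cauchy–Schwarz inequality with weight `‖κ‖`. -/
lemma norm_circleAverage_mul_sq_le {f κ : ℂ → ℂ} {ρ : ℝ}
    (hf : Continuous fun φ => f (circleMap 0 ρ φ)) (hκ : Continuous fun φ => κ (circleMap 0 ρ φ)) :
    ‖circleAverage (fun w => f w * κ w) 0 ρ‖ ^ 2
      ≤ circleAverage (fun w => ‖κ w‖) 0 ρ * circleAverage (fun w => ‖f w‖ ^ 2 * ‖κ w‖) 0 ρ := by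
  set P := circleAverage (fun w => ‖κ w‖) 0 ρ with hP
  set A := circleAverage (fun w => ‖f w‖ ^ 2 * ‖κ w‖) 0 ρ with hA
  set M := circleAverage (fun w => ‖f w‖ * ‖κ w‖) 0 ρ with hM
  have h1 : ‖circleAverage (fun w => f w * κ w) 0 ρ‖ ≤ M :=
    norm_circleAverage_le (hf.norm.mul hκ.norm) fun φ => (norm_mul _ _).le
  have c2 : Continuous fun φ => ‖f (circleMap 0 ρ φ)‖ ^ 2 * ‖κ (circleMap 0 ρ φ)‖ :=
    (hf.norm.pow 2).mul hκ.norm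
  have hquad : ∀ l : ℝ, 0 ≤ P * (l * l) + (-2 * M) * l + A := by
    intro l
    have h2 : 0 ≤ circleAverage (fun w => (l * l) * ‖κ w‖ + (-2 * l) * (‖f w‖ * ‖κ w‖)
        + ‖f w‖ ^ 2 * ‖κ w‖) 0 ρ := by
      rw [Real.circleAverage_def, smul_eq_mul]
      refine mul_nonneg (by positivity)
        (intervalIntegral.integral_nonneg (by positivity) fun t _ => ?_)
      have h3 : (l * l) * ‖κ (circleMap 0 ρ t)‖
          + (-2 * l) * (‖f (circleMap 0 ρ t)‖ * ‖κ (circleMap 0 ρ t)‖)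
          + ‖f (circleMap 0 ρ t)‖ ^ 2 * ‖κ (circleMap 0 ρ t)‖
          = (l - ‖f (circleMap 0 ρ t)‖) ^ 2 * ‖κ (circleMap 0 ρ t)‖ := by ring
      rw [h3]
      positivity
    have i1 : CircleIntegrable (fun w => (l * l) * ‖κ w‖) 0 ρ :=
      circleIntegrable_of_continuous (continuous_const.mul hκ.norm)
    have i2 : CircleIntegrable (fun w => (-2 * l) * (‖f w‖ * ‖κ w‖)) 0 ρ :=
      circleIntegrable_of_continuous (continuous_const.mul (hf.norm.mul hκ.norm))
    have i3 : CircleIntegrable (fun w => ‖f w‖ ^ 2 * ‖κ w‖) 0 ρ := circleIntegrable_of_continuous c2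
    have i4 : CircleIntegrable (fun w => (l * l) * ‖κ w‖ + (-2 * l) * (‖f w‖ * ‖κ w‖)) 0 ρ :=
      i1.add i2
    rw [Real.circleAverage_fun_add i4 i3, Real.circleAverage_fun_add i1 i2,
      circleAverage_const_mul, circleAverage_const_mul, ← hP, ← hM, ← hA] at h2
    linarith
  have h4 := discrim_le_zero hquad
  rw [discrim] at h4
  have h5 := pow_le_pow_left₀ (norm_nonneg _) h1 2
  linarith

section Smear

variable {X : ℂ → ℂ → ℂ} {κ : ℂ → ℂ} {h : ℂ → ℝ} {ρ N M S : ℝ}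
  (hX : Continuous fun p : ℝ × ℝ => X (circleMap 0 ρ p.1) (circleMap 0 1 p.2))
  (hκ : Continuous fun φ => κ (circleMap 0 ρ φ))
  (hN : circleAverage (fun w => ‖κ w‖) 0 ρ ≤ N)
include hX hκ

lemma continuous_smear :
    Continuous fun φ => circleAverage (fun w => X w (circleMap 0 1 φ) * κ w) 0 ρ :=
  continuous_circleAverage (f := fun φ w => X w (circleMap 0 1 φ) * κ w)
    ((hX.comp (continuous_snd.prodMk continuous_fst)).mul (hκ.comp continuous_snd))

include hN in
omit hX in
lemma norm_smear_le (hM : ∀ φ φ', ‖X (circleMap 0 ρ φ) (circleMap 0 1 φ')‖ ≤ M) (φ : ℝ) :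
    ‖circleAverage (fun w => X w (circleMap 0 1 φ) * κ w) 0 ρ‖ ≤ M * N := by
  have hM0 : 0 ≤ M := (norm_nonneg _).trans (hM 0 0)
  refine (norm_circleAverage_le (g := fun w => M * ‖κ w‖) (continuous_const.mul hκ.norm)
    fun φ' => ?_).trans ?_
  · rw [norm_mul]
    exact mul_le_mul_of_nonneg_right (hM _ _) (norm_nonneg _)
  · rw [circleAverage_const_mul]
    gcongr

lemma circleAverage_smear (hh : Continuous fun φ => h (circleMap 0 1 φ)) :
    circleAverage (fun ζ => circleAverage (fun w => X w ζ * κ w) 0 ρ * h ζ) 0 1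
      = circleAverage (fun w => circleAverage (fun ζ => X w ζ * h ζ) 0 1 * κ w) 0 ρ := by
  have hhc : Continuous fun φ => ((h (circleMap 0 1 φ) : ℝ) : ℂ) :=
    Complex.continuous_ofReal.comp hh
  have h1 : ∀ ζ, circleAverage (fun w => X w ζ * κ w) 0 ρ * h ζ
      = circleAverage (fun w => X w ζ * h ζ * κ w) 0 ρ := fun ζ => by
    rw [← circleAverage_mul_const]
    congr 1
    ext w
    ring
  have h2 : ∀ w, circleAverage (fun ζ => X w ζ * h ζ) 0 1 * κ w
      = circleAverage (fun ζ => X w ζ * h ζ * κ w) 0 1 := fun w => by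
    rw [← circleAverage_mul_const]
  simp_rw [h1, h2]
  exact (circleAverage_swap (f := fun w ζ => X w ζ * h ζ * κ w)
    ((hX.mul (hhc.comp continuous_snd)).mul (hκ.comp continuous_fst))).symm

include hN in
lemma circleAverage_smear_sq_le (hh : Continuous fun φ => h (circleMap 0 1 φ))
    (hh0 : ∀ φ, 0 ≤ h (circleMap 0 1 φ)) (hh2 : ∀ φ, h (circleMap 0 1 φ) ≤ 2)
    (hS : ∀ φ, circleAverage (fun ζ => ‖X (circleMap 0 ρ φ) ζ‖ ^ 2) 0 1 ≤ S) :
    circleAverage (fun ζ => ‖circleAverage (fun w => X w ζ * κ w) 0 ρ‖ ^ 2 * h ζ) 0 1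
      ≤ 2 * N ^ 2 * S := by
  have hS1 : 0 ≤ circleAverage (fun ζ => ‖X (circleMap 0 ρ 0) ζ‖ ^ 2) 0 1 :=
    circleAverage_nonneg fun ζ => sq_nonneg ‖X (circleMap 0 ρ 0) ζ‖
  have hS0 : 0 ≤ S := hS1.trans (hS 0)
  have hP0 : 0 ≤ circleAverage (fun w => ‖κ w‖) 0 ρ := circleAverage_nonneg fun _ => norm_nonneg _
  have hN0 : 0 ≤ N := hP0.trans hN
  have hκ₁ : Continuous fun p : ℝ × ℝ => ‖κ (circleMap 0 ρ p.1)‖ := hκ.norm.comp continuous_fst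
  have hX₂ : Continuous fun p : ℝ × ℝ => ‖X (circleMap 0 ρ p.1) (circleMap 0 1 p.2)‖ ^ 2 :=
    hX.norm.pow 2
  have hc : Continuous fun p : ℝ × ℝ =>
      ‖X (circleMap 0 ρ p.1) (circleMap 0 1 p.2)‖ ^ 2 * ‖κ (circleMap 0 ρ p.1)‖ := hX₂.mul hκ₁
  have hcs : Continuous fun p : ℝ × ℝ =>
      ‖X (circleMap 0 ρ p.2) (circleMap 0 1 p.1)‖ ^ 2 * ‖κ (circleMap 0 ρ p.2)‖ :=
    ((hX.comp (continuous_snd.prodMk continuous_fst)).norm.pow 2).mul (hκ.norm.comp continuous_snd)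
  have hc' : Continuous fun φ =>
      circleAverage (fun w => ‖X w (circleMap 0 1 φ)‖ ^ 2 * ‖κ w‖) 0 ρ :=
    continuous_circleAverage (f := fun φ w => ‖X w (circleMap 0 1 φ)‖ ^ 2 * ‖κ w‖) hcs
  have hc'' : Continuous fun φ =>
      circleAverage (fun ζ => ‖X (circleMap 0 ρ φ) ζ‖ ^ 2 * ‖κ (circleMap 0 ρ φ)‖) 0 1 :=
    continuous_circleAverage
      (f := fun φ ζ => ‖X (circleMap 0 ρ φ) ζ‖ ^ 2 * ‖κ (circleMap 0 ρ φ)‖) hc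
  calc circleAverage (fun ζ => ‖circleAverage (fun w => X w ζ * κ w) 0 ρ‖ ^ 2 * h ζ) 0 1
      ≤ circleAverage (fun ζ =>
        (2 * N) * circleAverage (fun w => ‖X w ζ‖ ^ 2 * ‖κ w‖) 0 ρ) 0 1 := by
        refine circleAverage_le_circleAverage (((continuous_smear hX hκ).norm.pow 2).mul hh)
          (continuous_const.mul hc') fun φ => ?_
        have hA0 : 0 ≤ circleAverage (fun w => ‖X w (circleMap 0 1 φ)‖ ^ 2 * ‖κ w‖) 0 ρ :=
          circleAverage_nonneg fun w =>
            mul_nonneg (sq_nonneg ‖X w (circleMap 0 1 φ)‖) (norm_nonneg (κ w))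
        have h1 := norm_circleAverage_mul_sq_le (f := fun w => X w (circleMap 0 1 φ))
          (hX.comp (continuous_id.prodMk continuous_const)) hκ
        calc ‖circleAverage (fun w => X w (circleMap 0 1 φ) * κ w) 0 ρ‖ ^ 2 * h (circleMap 0 1 φ)
            ≤ (N * circleAverage (fun w => ‖X w (circleMap 0 1 φ)‖ ^ 2 * ‖κ w‖) 0 ρ) * 2 := by
              refine mul_le_mul (h1.trans (mul_le_mul_of_nonneg_right hN hA0)) (hh2 φ) (hh0 φ) ?_
              positivity
          _ = _ := by ring
    _ = 2 * N * circleAverage (fun w =>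
          circleAverage (fun ζ => ‖X w ζ‖ ^ 2 * ‖κ w‖) 0 1) 0 ρ := by
        rw [circleAverage_swap (f := fun w ζ => ‖X w ζ‖ ^ 2 * ‖κ w‖) hc]
        exact circleAverage_const_mul (2 * N) (fun ζ => circleAverage (fun w => ‖X w ζ‖ ^ 2 * ‖κ w‖) 0 ρ) 1
    _ ≤ 2 * N * circleAverage (fun w => S * ‖κ w‖) 0 ρ := by
        refine mul_le_mul_of_nonneg_left ?_ (by positivity)
        refine circleAverage_le_circleAverage hc'' (continuous_const.mul hκ.norm) fun φ => ?_
        have h2 := circleAverage_const_mul ‖κ (circleMap 0 ρ φ)‖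
          (fun ζ => ‖X (circleMap 0 ρ φ) ζ‖ ^ 2) 1
        simp only [mul_comm ‖κ (circleMap 0 ρ φ)‖] at h2
        rw [h2]
        exact mul_le_mul_of_nonneg_right (hS φ) (norm_nonneg _)
    _ ≤ 2 * N * (S * N) := by
        rw [circleAverage_const_mul]
        gcongr
    _ = _ := by ring

end Smear

/-- Centring a function with respect to a probability density does not increase its second
moment. -/
lemma circleAverage_centred {Z : ℂ → ℂ} {h : ℂ → ℝ} {α : ℂ} (hα : ‖α‖ = 1)
    (hZ : Continuous fun φ => Z (circleMap 0 1 φ)) (hh : Continuous fun φ => h (circleMap 0 1 φ))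
    (hh0 : ∀ φ, 0 ≤ h (circleMap 0 1 φ)) (hh1 : circleAverage h 0 1 = 1) :
    circleAverage (fun ζ =>
      (α * (Z ζ - circleAverage (fun ζ => Z ζ * h ζ) 0 1)).re * h ζ) 0 1 = 0 ∧
    circleAverage (fun ζ =>
      (α * (Z ζ - circleAverage (fun ζ => Z ζ * h ζ) 0 1)).re ^ 2 * h ζ) 0 1
      ≤ circleAverage (fun ζ => ‖Z ζ‖ ^ 2 * h ζ) 0 1 := by
  set m := circleAverage (fun ζ => Z ζ * h ζ) 0 1 with hm
  have hhc : Continuous fun φ => ((h (circleMap 0 1 φ) : ℝ) : ℂ) :=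
    Complex.continuous_ofReal.comp hh
  have hαZ : Continuous fun φ => (α * Z (circleMap 0 1 φ)).re :=
    Complex.continuous_re.comp (continuous_const.mul hZ)
  have hmean : circleAverage (fun ζ => (α * Z ζ).re * h ζ) 0 1 = (α * m).re := by
    have h1 : ∀ ζ, (α * Z ζ).re * h ζ = (Z ζ * h ζ * α).re := fun ζ => by
      rw [← Complex.re_mul_ofReal]
      congr 1
      ring
    simp_rw [h1]
    rw [circleAverage_re (f := fun ζ => Z ζ * h ζ * α) ((hZ.mul hhc).mul continuous_const),
      circleAverage_mul_const, mul_comm]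
  have i1 : CircleIntegrable (fun ζ => (α * Z ζ).re * h ζ) 0 1 :=
    circleIntegrable_of_continuous (hαZ.mul hh)
  have i0 : CircleIntegrable h 0 1 := circleIntegrable_of_continuous hh
  constructor
  · have h2 : ∀ ζ, (α * (Z ζ - m)).re * h ζ = (α * Z ζ).re * h ζ - (α * m).re * h ζ := fun ζ => by
      rw [mul_sub, Complex.sub_re, sub_mul]
    simp_rw [h2]
    have i2 : CircleIntegrable (fun ζ => (α * m).re * h ζ) 0 1 :=
      circleIntegrable_of_continuous (continuous_const.mul hh)
    rw [Real.circleAverage_fun_sub i1 i2, hmean, circleAverage_const_mul, hh1, mul_one, sub_self]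
  · have c2 : Continuous fun φ => ‖Z (circleMap 0 1 φ)‖ ^ 2 * h (circleMap 0 1 φ) :=
      (hZ.norm.pow 2).mul hh
    have h2 : circleAverage (fun ζ => (α * (Z ζ - m)).re ^ 2 * h ζ) 0 1
        ≤ circleAverage (fun ζ => (‖Z ζ‖ ^ 2 * h ζ + (-2 * (α * m).re) * ((α * Z ζ).re * h ζ))
          + (α * m).re ^ 2 * h ζ) 0 1 := by
      refine circleAverage_le_circleAverage ?_ ?_ fun φ => ?_
      · exact ((Complex.continuous_re.comp
          (continuous_const.mul (hZ.sub continuous_const))).pow 2).mul hh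
      · exact (c2.add (continuous_const.mul (hαZ.mul hh))).add (continuous_const.mul hh)
      · have h3 : (α * Z (circleMap 0 1 φ)).re ^ 2 ≤ ‖Z (circleMap 0 1 φ)‖ ^ 2 := by
          have := Complex.abs_re_le_norm (α * Z (circleMap 0 1 φ))
          rw [norm_mul, hα, one_mul] at this
          exact sq_le_sq' (by linarith [neg_abs_le (α * Z (circleMap 0 1 φ)).re])
            ((le_abs_self _).trans this)
        rw [mul_sub, Complex.sub_re]
        nlinarith [mul_le_mul_of_nonneg_right h3 (hh0 φ)]
    have j1 : CircleIntegrable (fun ζ => ‖Z ζ‖ ^ 2 * h ζ) 0 1 := circleIntegrable_of_continuous c2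
    have j2 : CircleIntegrable (fun ζ => (-2 * (α * m).re) * ((α * Z ζ).re * h ζ)) 0 1 :=
      circleIntegrable_of_continuous (continuous_const.mul (hαZ.mul hh))
    have j3 : CircleIntegrable (fun ζ => (α * m).re ^ 2 * h ζ) 0 1 :=
      circleIntegrable_of_continuous (continuous_const.mul hh)
    have j4 : CircleIntegrable (fun ζ => ‖Z ζ‖ ^ 2 * h ζ
        + (-2 * (α * m).re) * ((α * Z ζ).re * h ζ)) 0 1 := j1.add j2
    rw [Real.circleAverage_fun_add j4 j3, Real.circleAverage_fun_add j1 j2,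
      circleAverage_const_mul, circleAverage_const_mul, hmean, hh1] at h2
    nlinarith [sq_nonneg (α * m).re]

/-! ### One step, seen from a point of evaluation -/

lemma continuous_increment_angles {F : ℂ → ℂ} {c : ℝ} (hF : IsBasicMap F c) {ρ : ℝ} (hρ : 1 < ρ)
    (j : ℕ) : Continuous fun p : ((ℕ → ℝ) × ℝ) × ℝ =>
      increment F (clusterMap F p.1.1 j) (circleMap 0 ρ p.2) (circleMap 0 1 p.1.2) := by
  have h0 : ∀ φ, circleMap 0 1 φ ≠ 0 := fun φ => circleMap_ne_center one_ne_zero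
  have hw : ∀ φ, circleMap 0 ρ φ ∈ exteriorDisk := circleMap_mem_exteriorDisk hρ
  have h1 : Continuous fun p : ((ℕ → ℝ) × ℝ) × ℝ =>
      (circleMap 0 1 p.1.2)⁻¹ * circleMap 0 ρ p.2 :=
    (Continuous.inv₀ (by fun_prop) fun p => h0 _).mul (by fun_prop)
  have h2 : Continuous fun p : ((ℕ → ℝ) × ℝ) × ℝ =>
      F ((circleMap 0 1 p.1.2)⁻¹ * circleMap 0 ρ p.2) :=
    hF.differentiableOn.continuousOn.comp_continuous h1
      fun p => unit_mul_mem_exteriorDisk (norm_unit_circle _) (hw _)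
  have h3 : Continuous fun p : ((ℕ → ℝ) × ℝ) × ℝ =>
      circleMap 0 1 p.1.2 * F ((circleMap 0 1 p.1.2)⁻¹ * circleMap 0 ρ p.2) :=
    Continuous.mul (by fun_prop) h2
  have h4 : ∀ p : ((ℕ → ℝ) × ℝ) × ℝ,
      circleMap 0 1 p.1.2 * F ((circleMap 0 1 p.1.2)⁻¹ * circleMap 0 ρ p.2) ∈ exteriorDisk := by
    intro p
    have := hF.mapsTo (unit_mul_mem_exteriorDisk (norm_unit_circle p.1.2) (hw p.2))
    rw [mem_exteriorDisk, norm_mul, norm_unit_circle, one_mul]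
    exact this
  have hc := hF.continuousOn_clusterMap j
  exact (hc.comp_continuous (continuous_fst.fst.prodMk h3) fun p => ⟨trivial, h4 p⟩).sub
    (hc.comp_continuous (continuous_fst.fst.prodMk
      ((continuous_circleMap 0 ρ).comp continuous_snd)) fun p => ⟨trivial, hw _⟩)

/-- The effect on the value at `z`, after evolution over time `t`, of attaching a particle at `ζ`
to the cluster of size `j`. -/
def effect (F : ℂ → ℂ) (η q : ℝ) (d : ℕ) (x t : ℝ) (z : ℂ) (j : ℕ) (θ : ℕ → ℝ) (ζ : ℂ) : ℂ :=
  circleAverage (fun w => increment F (clusterMap F θ j) w ζ * evolutionKernel η q d t (w / z)) 0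
    (contourRadius η x t)

/-- The mean of `effect` over the attachment point. -/
def meanEffect (F : ℂ → ℂ) (η σ : ℝ) (d : ℕ) (x t : ℝ) (z : ℂ) (j : ℕ) (θ : ℕ → ℝ) : ℂ :=
  circleAverage (fun ζ => effect F η (Real.exp σ)⁻¹ d x t z j θ ζ * attachDensity F η σ θ j ζ) 0 1

/-- The scale of the nonlinear corrections to the mean of one step, on a contour at distance `g`
from the unit circle, when the derivative of the deviation is at most `A` near the contour and at
most `p` near the circle of radius `e^σ`. -/
def stepRate (c g A p : ℝ) : ℝ :=
  (1 + A) * (c * p ^ 2 + c ^ (3 / 2 : ℝ) / g * p) + c * A * p + (1 + A / g) * (c ^ 2 / g)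

lemma IsNearUniform.congr {h h' : ℂ → ℝ} {η q₁ q₂ : ℝ} {ψ : ℂ → ℂ} (H : IsNearUniform h η ψ q₁ q₂)
    (e : ∀ φ, h' (circleMap 0 1 φ) = h (circleMap 0 1 φ)) : IsNearUniform h' η ψ q₁ q₂ where
  continuous := by simpa only [e] using H.continuous
  nonneg := by simpa only [e] using H.nonneg
  le_two := by simpa only [e] using H.le_two
  average := by
    have := H.average
    simp only [Real.circleAverage_def] at this ⊢
    simpa only [e] using this
  abs_sub_one_le := by simpa only [e] using H.abs_sub_one_le
  abs_sub_linear_le := by simpa only [e] using H.abs_sub_linear_le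

section Density

variable {F L : ℂ → ℂ} {c Λ T : ℝ} (hF : IsBasicMap F c) (hc1 : c ≤ 1) (hΛ : 0 ≤ Λ)
  (hL : IsLogBranch F c Λ L) {θ : ℕ → ℝ} {j : ℕ} (hj : c * j ≤ T)
include hF hc1 hΛ hL hj

lemma deriv_clusterMap_eq {z : ℂ} (hz : z ∈ exteriorDisk) :
    deriv (clusterMap F θ j) z = (Real.exp (c * j) : ℝ) + deriv (deviation F c θ j) z := by
  have h1 : HasDerivAt (deviation F c θ j) (deriv (deviation F c θ j) z) z :=
    ((isExt_deviation hF hc1 hΛ hL θ hj).differentiableOn.differentiableAt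
      (isOpen_exteriorDisk.mem_nhds hz)).hasDerivAt
  have h2 : HasDerivAt (fun z : ℂ => ((Real.exp (c * j) : ℝ) : ℂ) * z) (Real.exp (c * j) : ℝ) z := by
    simpa using (hasDerivAt_id z).const_mul ((Real.exp (c * j) : ℝ) : ℂ)
  have h3 : clusterMap F θ j
      = fun z => ((Real.exp (c * j) : ℝ) : ℂ) * z + deviation F c θ j z := by
    ext w
    rw [deviation]
    ring
  rw [h3]
  exact (h2.add h1).deriv

lemma isNearUniform_attachDensity {η K p₀ : ℝ}
    (H : ∀ (ψ : ℂ → ℂ) (p : ℝ), p ≤ p₀ → (Continuous fun φ => ψ (circleMap 0 1 φ)) →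
      (∀ φ, ‖ψ (circleMap 0 1 φ)‖ ≤ p) → circleAverage (fun ζ => (ψ ζ).re) 0 1 = 0 →
      IsNearUniform (fun ζ => ‖1 + ψ ζ‖ ^ (-η) / circleAverage (fun ζ => ‖1 + ψ ζ‖ ^ (-η)) 0 1)
        η ψ (K * p) (K * p ^ 2)) {σ : ℝ} (hσ : 0 < σ) {p : ℝ} (hp₀ : p ≤ p₀)
    (hp : ∀ z : ℂ, Real.exp σ ≤ ‖z‖ → ‖deriv (deviation F c θ j) z‖ ≤ p) :
    IsNearUniform (attachDensity F η σ θ j) η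
      (fun ζ => deriv (deviation F c θ j) ((Real.exp σ : ℝ) * ζ) / (Real.exp (c * j) : ℝ))
      (K * p) (K * p ^ 2) := by
  have hc := hF.capacity_pos
  have hr := Real.one_lt_exp_iff.2 hσ
  set r := Real.exp σ with hrdef
  set b := Real.exp (c * j) with hb
  have hb1 : 1 ≤ b := Real.one_le_exp (by positivity)
  have hb0 : (b:ℂ) ≠ 0 := by exact_mod_cast (by linarith : b ≠ 0)
  have hf := isExt_deviation hF hc1 hΛ hL θ hj
  set f := deviation F c θ j with hfdef
  have hn : ∀ φ, ‖(r:ℂ) * circleMap 0 1 φ‖ = r := fun φ => by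
    rw [norm_mul, norm_unit_circle, mul_one, Complex.norm_real, Real.norm_of_nonneg (by linarith)]
  have hm : ∀ φ, (r:ℂ) * circleMap 0 1 φ ∈ exteriorDisk := fun φ => by
    rw [mem_exteriorDisk, hn]; exact hr
  have hcont : Continuous fun φ => deriv f (r * circleMap 0 1 φ) / b :=
    (hf.deriv.differentiableOn.continuousOn.comp_continuous (by fun_prop) hm).div_const _
  have hbound : ∀ φ, ‖deriv f (r * circleMap 0 1 φ) / b‖ ≤ p := fun φ => by
    rw [norm_div, Complex.norm_real, Real.norm_of_nonneg (by linarith)]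
    exact (div_le_self (norm_nonneg _) hb1).trans (hp _ (hn φ).ge)
  have hmean : circleAverage (fun ζ => (deriv f (r * ζ) / b).re) 0 1 = 0 := by
    have h1 := circleAverage_re_eq_zero hf.deriv hf.tendsto_deriv hr
    have h2 : ∀ ζ : ℂ, (deriv f (r * ζ) / b).re = b⁻¹ * (deriv f (r * ζ)).re := fun ζ => by
      rw [Complex.div_ofReal_re, div_eq_inv_mul]
    simp_rw [h2]
    rw [circleAverage_const_mul, h1, mul_zero]
  have e : ∀ φ, ‖deriv (clusterMap F θ j) (r * circleMap 0 1 φ)‖ ^ (-η)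
      = b ^ (-η) * ‖1 + deriv f (r * circleMap 0 1 φ) / b‖ ^ (-η) := fun φ => by
    have h1 : (b:ℂ) + deriv f (r * circleMap 0 1 φ)
        = b * (1 + deriv f (r * circleMap 0 1 φ) / b) := by
      field_simp
    rw [deriv_clusterMap_eq hF hc1 hΛ hL hj (hm φ), ← hb, h1, norm_mul, Complex.norm_real,
      Real.norm_of_nonneg (by linarith), Real.mul_rpow (by linarith) (norm_nonneg _)]
  refine (H _ p hp₀ hcont hbound hmean).congr fun φ => ?_
  have hbη : b ^ (-η) ≠ 0 := (Real.rpow_pos_of_pos (by linarith) _).ne'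
  have havg : circleAverage (fun ζ => ‖deriv (clusterMap F θ j) (r * ζ)‖ ^ (-η)) 0 1
      = b ^ (-η) * circleAverage (fun ζ => ‖1 + deriv f (r * ζ) / b‖ ^ (-η)) 0 1 := by
    rw [← circleAverage_const_mul]
    simp only [Real.circleAverage_def, e]
  rw [attachDensity, ← hrdef, havg, e, mul_div_mul_left _ _ hbη]

end Density

lemma continuous_smear_angles {F : ℂ → ℂ} {c : ℝ} (hF : IsBasicMap F c) {ρ : ℝ} (hρ : 1 < ρ)
    {κ : ℂ → ℂ} (hκ : Continuous fun φ => κ (circleMap 0 ρ φ)) (j : ℕ) :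
    Continuous fun p : (ℕ → ℝ) × ℝ => circleAverage (fun w =>
      increment F (clusterMap F p.1 j) w (circleMap 0 1 p.2) * κ w) 0 ρ := by
  have h1 : Continuous fun p : ((ℕ → ℝ) × ℝ) × ℝ => κ (circleMap 0 ρ p.2) := hκ.comp continuous_snd
  exact continuous_circleAverage (f := fun (p : (ℕ → ℝ) × ℝ) w =>
    increment F (clusterMap F p.1 j) w (circleMap 0 1 p.2) * κ w)
    (Continuous.mul (continuous_increment_angles hF hρ j) h1)

lemma continuous_effect {F : ℂ → ℂ} {c : ℝ} (hF : IsBasicMap F c) {η q : ℝ} {d : ℕ} {x t : ℝ}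
    {z : ℂ} (hρ : 1 < contourRadius η x t)
    (hκ : Continuous fun φ => evolutionKernel η q d t (circleMap 0 (contourRadius η x t) φ / z))
    (j : ℕ) : Continuous fun p : (ℕ → ℝ) × ℝ => effect F η q d x t z j p.1 (circleMap 0 1 p.2) :=
  continuous_smear_angles hF hρ (κ := fun w => evolutionKernel η q d t (w / z)) hκ j

section Decomposition

variable {F L : ℂ → ℂ} {c Λ T η σ : ℝ} (hF : IsBasicMap F c) (hc1 : c ≤ 1) (hΛ : 0 ≤ Λ)
  (hL : IsLogBranch F c Λ L) {θ : ℕ → ℝ} {j : ℕ} (hj : c * (j + 1 : ℕ) ≤ T)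
include hF hc1 hΛ hL hj

/-- Duhamel's formula for one step of the cluster: the change is the centred effect of the new
particle, up to a drift which the linearisation makes small. -/
lemma evolved_succ_sub (hη : η ≤ 1) (hσ : 0 < σ) {d : ℕ} (hd : d ≤ 1) {x t : ℝ} (ht : 0 ≤ t) {z : ℂ}
    (hz : z ≠ 0) (hρ : 1 < contourRadius η x t)
    (hs : shrink η t * (contourRadius η x t / ‖z‖) < 1)
    (hκ : Continuous fun φ =>
      evolutionKernel η (Real.exp σ)⁻¹ d t (circleMap 0 (contourRadius η x t) φ / z))
    (hh : Continuous fun φ => attachDensity F η σ θ j (circleMap 0 1 φ)) {a a₁ : ℕ → ℂ}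
    (ha : HasLaurent (deviation F c θ j) a)
    (ha' : HasLaurent (fun z => z * deriv (deviation F c θ j) z) fun k => -k * a k)
    (ha₁ : HasLaurent (deviation F c θ (j + 1)) a₁) :
    evolved η (Real.exp σ)⁻¹ d t a₁ z - evolved η (Real.exp σ)⁻¹ d (t + c) a z
      = effect F η (Real.exp σ)⁻¹ d x t z j θ (circleMap 0 1 (θ j)) - meanEffect F η σ d x t z j θ
        + circleAverage (fun w => (circleAverage (fun ζ => increment F (clusterMap F θ j) w ζ
            * attachDensity F η σ θ j ζ) 0 1
            - c * (w * ((Real.exp (c * j) : ℝ) + deriv (deviation F c θ j) w)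
              - η * (w * deriv (deviation F c θ j) ((Real.exp σ : ℝ) * w)))
            - ((Real.exp c - 1 - c) * Real.exp (c * j) : ℝ) * w)
          * evolutionKernel η (Real.exp σ)⁻¹ d t (w / z)) 0 (contourRadius η x t)
        + stepError η (Real.exp σ)⁻¹ d t c a z := by
  have hc := hF.capacity_pos
  have hj0 : c * j ≤ T := by
    push_cast at hj
    nlinarith
  have hf := isExt_deviation hF hc1 hΛ hL θ hj0
  have hf₁ := isExt_deviation hF hc1 hΛ hL θ hj
  have hr := Real.one_lt_exp_iff.2 hσ
  set r := Real.exp σ with hrdef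
  set ρ := contourRadius η x t with hρdef
  rw [evolved_sub_evolved hr ha ha' hf ha₁ hf₁ hη ht hc.le hd hρ hz hs]
  congr 1
  set f := deviation F c θ j with hfdef
  set κ : ℂ → ℂ := fun w => evolutionKernel η r⁻¹ d t (w / z) with hκdef
  set X : ℂ → ℂ → ℂ := fun w ζ => increment F (clusterMap F θ j) w ζ with hX
  set h := attachDensity F η σ θ j with hhdef
  set Xm : ℂ → ℂ := fun w => circleAverage (fun ζ => X w ζ * h ζ) 0 1 with hXm
  set R : ℂ → ℂ := fun w => Xm w - c * (w * ((Real.exp (c * j) : ℝ) + deriv f w)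
    - η * (w * deriv f (r * w))) - ((Real.exp c - 1 - c) * Real.exp (c * j) : ℝ) * w with hR
  have hXθ : Continuous fun p : ℝ × ℝ => X (circleMap 0 ρ p.1) (circleMap 0 1 p.2) :=
    (continuous_increment_angles hF hρ j).comp
      ((continuous_const.prodMk continuous_snd).prodMk continuous_fst)
  have hXc : Continuous fun φ => X (circleMap 0 ρ φ) (circleMap 0 1 (θ j)) :=
    hXθ.comp (f := fun φ : ℝ => (φ, θ j)) (by fun_prop)
  have hhc : Continuous fun φ => ((h (circleMap 0 1 φ) : ℝ) : ℂ) :=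
    Complex.continuous_ofReal.comp hh
  have hXmc : Continuous fun φ => Xm (circleMap 0 ρ φ) :=
    continuous_circleAverage (f := fun φ ζ => X (circleMap 0 ρ φ) ζ * h ζ)
      (hXθ.mul (hhc.comp continuous_snd))
  have hdr : Continuous fun φ => drift η r f (circleMap 0 ρ φ) :=
    HasLaurent.continuous_circle (hf.continuousOn_drift hr) hρ
  have hRc : Continuous fun φ => R (circleMap 0 ρ φ) := by
    have e : ∀ w, R w = Xm w - c * drift η r f w
        - ((Real.exp (c * j) * c + (Real.exp c - 1 - c) * Real.exp (c * j) : ℝ) : ℂ) * w := by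
      intro w
      simp only [hR, drift]
      push_cast
      ring
    simp only [e]
    exact (hXmc.sub (continuous_const.mul hdr)).sub
      (continuous_const.mul (continuous_circleMap 0 ρ))
  have e1 : circleAverage (fun w => (deviation F c θ (j + 1) w - f w - c * drift η r f w)
        * evolutionKernel η r⁻¹ d t (w / z)) 0 ρ
      = circleAverage (fun w => (X w (circleMap 0 1 (θ j)) * κ w - Xm w * κ w) + R w * κ w) 0 ρ := by
    congr 1
    ext w
    have h1 : deviation F c θ (j + 1) w - f w = X w (circleMap 0 1 (θ j))
        - ((Real.exp c - 1) * Real.exp (c * j) : ℝ) * w := by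
      have h2 : Real.exp (c * ((j + 1 : ℕ) : ℝ)) = Real.exp (c * j) * Real.exp c := by
        rw [← Real.exp_add]
        congr 1
        push_cast
        ring
      simp only [hX, hfdef, deviation, increment, clusterMap, rotate_eq, h2]
      push_cast
      ring
    simp only [h1, hR, drift]
    push_cast
    ring
  have i1 : CircleIntegrable (fun w => X w (circleMap 0 1 (θ j)) * κ w) 0 ρ :=
    circleIntegrable_of_continuous (hXc.mul hκ)
  have i2 : CircleIntegrable (fun w => Xm w * κ w) 0 ρ :=
    circleIntegrable_of_continuous (hXmc.mul hκ)
  have i3 : CircleIntegrable (fun w => R w * κ w) 0 ρ :=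
    circleIntegrable_of_continuous (hRc.mul hκ)
  have i4 : CircleIntegrable (fun w => X w (circleMap 0 1 (θ j)) * κ w - Xm w * κ w) 0 ρ :=
    i1.sub i2
  have e2 : meanEffect F η σ d x t z j θ = circleAverage (fun w => Xm w * κ w) 0 ρ :=
    circleAverage_smear hXθ hκ hh
  rw [e1, Real.circleAverage_fun_add i4 i3, Real.circleAverage_fun_sub i1 i2, e2]
  rfl

end Decomposition

/-! ### Quantitative bounds for one step -/

section RateBounds

variable {c g A p : ℝ} (hc : 0 < c) (hg : 0 < g) (hg1 : g ≤ 1) (hA : 0 ≤ A) (hp : 0 ≤ p)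
include hc hg hA hp

lemma stepRate_nonneg : 0 ≤ stepRate c g A p := by
  unfold stepRate
  positivity

lemma le_stepRate₁ : (1 + A) * (c * p ^ 2 + c ^ (3 / 2 : ℝ) / g * p) ≤ stepRate c g A p := by
  have h1 : 0 ≤ c * A * p := by positivity
  have h2 : 0 ≤ (1 + A / g) * (c ^ 2 / g) := by positivity
  unfold stepRate
  linarith

lemma le_stepRate₂ : c * A * p ≤ stepRate c g A p := by
  have h1 : 0 ≤ (1 + A) * (c * p ^ 2 + c ^ (3 / 2 : ℝ) / g * p) := by positivity
  have h2 : 0 ≤ (1 + A / g) * (c ^ 2 / g) := by positivity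
  unfold stepRate
  linarith

lemma le_stepRate₃ : (1 + A / g) * (c ^ 2 / g) ≤ stepRate c g A p := by
  have h1 : 0 ≤ (1 + A) * (c * p ^ 2 + c ^ (3 / 2 : ℝ) / g * p) := by positivity
  have h2 : 0 ≤ c * A * p := by positivity
  unfold stepRate
  linarith

include hg1 in
/-- Collects the error terms of `norm_mean_increment_sub_le`. -/
lemma mean_error_le {R E K k l Λ η : ℝ} (hR : 1 ≤ R) (hE : 1 ≤ E) (hK : 0 ≤ K) (hk : 1 ≤ k)
    (hl : 1 ≤ l) (hΛ : 0 ≤ Λ) :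
    R * (E + A) * (2 * c * (k * l) * (K * p ^ 2) + Λ * R * (c ^ (3 / 2 : ℝ) / g) * (k * l) * (K * p))
        + |η| * c * R * A * p
        + (3 * R * (E + A) + 18 * R ^ 2 * (A / g)) * (2 + Λ * R) ^ 2 * 4 * (c ^ 2 / g)
      ≤ (R * E * k * K * (2 + Λ * R) + |η| * R + (3 * R * E + 18 * R ^ 2) * (2 + Λ * R) ^ 2 * 4)
        * l * stepRate c g A p := by
  have h1 := le_stepRate₁ hc hg hA hp
  have h2 := le_stepRate₂ hc hg hA hp
  have h3 := le_stepRate₃ hc hg hA hp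
  have h0 := stepRate_nonneg hc hg hA hp
  set s := stepRate c g A p
  have hEA : E + A ≤ E * (1 + A) := by nlinarith
  have hAg : A ≤ A / g := le_div_self hA hg hg1
  have c32 : 0 ≤ c ^ (3 / 2 : ℝ) / g := by positivity
  have t1 : R * (E + A) * (2 * c * (k * l) * (K * p ^ 2)
      + Λ * R * (c ^ (3 / 2 : ℝ) / g) * (k * l) * (K * p)) ≤ R * E * k * K * (2 + Λ * R) * l * s := by
    calc _ ≤ R * (E * (1 + A)) * ((2 + Λ * R) * c * (k * l) * (K * p ^ 2)
          + (2 + Λ * R) * (c ^ (3 / 2 : ℝ) / g) * (k * l) * (K * p)) := by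
          have : 0 ≤ Λ * R := by positivity
          gcongr <;> linarith
      _ = R * E * k * K * (2 + Λ * R) * l
          * ((1 + A) * (c * p ^ 2 + c ^ (3 / 2 : ℝ) / g * p)) := by ring
      _ ≤ _ := by gcongr
  have t2 : |η| * c * R * A * p ≤ |η| * R * l * s := by
    calc |η| * c * R * A * p = |η| * R * 1 * (c * A * p) := by ring
      _ ≤ _ := by gcongr
  have t3 : (3 * R * (E + A) + 18 * R ^ 2 * (A / g)) * (2 + Λ * R) ^ 2 * 4 * (c ^ 2 / g)
      ≤ (3 * R * E + 18 * R ^ 2) * (2 + Λ * R) ^ 2 * 4 * l * s := by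
    calc _ ≤ (3 * R * (E * (1 + A / g)) + 18 * R ^ 2 * (1 + A / g)) * (2 + Λ * R) ^ 2 * 4
          * (c ^ 2 / g) := by
          gcongr
          · exact hEA.trans (by gcongr)
          · linarith
      _ = (3 * R * E + 18 * R ^ 2) * (2 + Λ * R) ^ 2 * 4 * 1 * ((1 + A / g) * (c ^ 2 / g)) := by
          ring
      _ ≤ _ := by gcongr
  linarith

end RateBounds

lemma exp_sub_one_sub_le {c : ℝ} (hc : 0 ≤ c) (hc1 : c ≤ 1) :
    |Real.exp c - 1 - c| ≤ c ^ 2 :=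
  Real.abs_exp_sub_one_sub_id_le (by rwa [abs_of_nonneg hc])

/-- The bounds on one step of the dynamics, as seen from a point `z` at distance `x` from the unit
circle after evolution over time `t`: the attachment density is a probability density, the effect
of the new particle is bounded and has small second moment, and Duhamel's formula holds with a
small error. Here `T` is the time horizon, `A` bounds the derivative of the deviation near the
contour, and `p` bounds it near the circle of radius `e^σ`. -/
def StepBound (η Λ T δ C p₀ : ℝ) : Prop :=
  ∀ (F L : ℂ → ℂ) (c σ : ℝ) (θ : ℕ → ℝ) (j d : ℕ) (x t : ℝ) (z : ℂ) (A p : ℝ),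
    IsBasicMap F c → IsLogBranch F c Λ L → c ≤ 1 → 0 < σ → c * (j + 1 : ℕ) ≤ T → d ≤ 1 →
    0 ≤ t → t ≤ T → 0 < x → x ≤ 1 → ‖z‖ = 1 + x →
    c ^ (1 / 2 : ℝ) ≤ contourGap η T x t →
    2 * (2 + Λ * (2 * Real.exp T)) * c ≤ contourGap η T x t →
    (∀ w : ℂ, 1 + contourGap η T x t / 2 ≤ ‖w‖ → ‖deriv (deviation F c θ j) w‖ ≤ A) →
    (∀ w : ℂ, Real.exp σ ≤ ‖w‖ → ‖deriv (deviation F c θ j) w‖ ≤ p) → p ≤ p₀ →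
    ((Continuous fun φ => attachDensity F η σ θ j (circleMap 0 1 φ)) ∧
      circleAverage (attachDensity F η σ θ j) 0 1 = 1) ∧
    (∀ φ, ‖effect F η (Real.exp σ)⁻¹ d x t z j θ (circleMap 0 1 φ)‖
      ≤ C * (c ^ (-δ) * (contourGap η T x t)⁻¹ ^ d) * ((1 + A) * (c / contourGap η T x t))) ∧
    circleAverage (fun ζ => ‖effect F η (Real.exp σ)⁻¹ d x t z j θ ζ‖ ^ 2
        * attachDensity F η σ θ j ζ) 0 1
      ≤ C * (c ^ (-δ) * (contourGap η T x t)⁻¹ ^ d) ^ 2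
        * ((1 + A) ^ 2 * (c ^ 2 / contourGap η T x t)) ∧
    (∀ a a₁ : ℕ → ℂ, HasLaurent (deviation F c θ j) a →
      HasLaurent (fun z => z * deriv (deviation F c θ j) z) (fun k => -k * a k) →
      HasLaurent (deviation F c θ (j + 1)) a₁ →
      ‖evolved η (Real.exp σ)⁻¹ d t a₁ z - evolved η (Real.exp σ)⁻¹ d (t + c) a z
        - (effect F η (Real.exp σ)⁻¹ d x t z j θ (circleMap 0 1 (θ j))
          - meanEffect F η σ d x t z j θ)‖
        ≤ C * (c ^ (-δ)) ^ 2 * (contourGap η T x t)⁻¹ ^ d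
          * stepRate c (contourGap η T x t) A p)

set_option maxHeartbeats 2000000 in
theorem exists_stepBound {η Λ T δ : ℝ} (hη : η ≤ 1) (hΛ : 0 ≤ Λ) (hδ : 0 < δ)
    (hδ1 : δ < 1) : ∃ C p₀, 1 ≤ C ∧ 0 < p₀ ∧ StepBound η Λ T δ C p₀ := by
  obtain ⟨K, p₀, hK, hp₀, -, hnear⟩ := exists_isNearUniform η
  obtain ⟨N, hN1, hN⟩ := exists_circleAverage_kernel_le hη (T := T) hδ hδ1
  have hk1 := one_le_cauchyConst hδ hδ1
  set k := cauchyConst δ with hk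
  obtain ⟨E, hE⟩ : ∃ E, E = max 1 (Real.exp T) := ⟨_, rfl⟩
  have hE1 : 1 ≤ E := hE ▸ le_max_left _ _
  have hET : Real.exp T ≤ E := hE ▸ le_max_right _ _
  obtain ⟨R, hR⟩ : ∃ R, R = 2 * Real.exp T := ⟨_, rfl⟩
  obtain ⟨Q, hQ⟩ : ∃ Q, Q = 1 + |R| := ⟨_, rfl⟩
  obtain ⟨C₁, hC₁⟩ : ∃ C₁, C₁ = Q * E * k * K * (2 + Λ * Q) + |η| * Q
    + (3 * Q * E + 18 * Q ^ 2) * (2 + Λ * Q) ^ 2 * 4 := ⟨_, rfl⟩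
  have hR0 : 0 < R := by rw [hR]; positivity
  have hQ1 : 1 ≤ Q := by rw [hQ]; linarith [abs_nonneg R]
  have hRQ : R ≤ Q := by rw [hQ]; linarith [le_abs_self R]
  have hC₁0 : 0 ≤ C₁ := by rw [hC₁]; positivity
  obtain ⟨C₂, hC₂⟩ : ∃ C₂, C₂ = 6 * R * (2 + Λ * R) * E * N := ⟨_, rfl⟩
  obtain ⟨C₃, hC₃⟩ : ∃ C₃, C₃ = 4 * (3 * R * (2 + Λ * R) * E) ^ 2 * N ^ 2 := ⟨_, rfl⟩
  obtain ⟨C₄, hC₄⟩ : ∃ C₄, C₄ = (C₁ + E * R) * N + 2 * (1 + |η|) ^ 2 * R := ⟨_, rfl⟩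
  have hC₂0 : 0 ≤ C₂ := by rw [hC₂]; positivity
  have hC₃0 : 0 ≤ C₃ := by rw [hC₃]; positivity
  have hC₄0 : 0 ≤ C₄ := by rw [hC₄]; positivity
  refine ⟨1 + C₂ + C₃ + C₄, p₀, by linarith, hp₀, ?_⟩
  intro F L c σ θ j d x t z A p hF hL hc1 hσ hj hd ht htT hx hx1 hz hcg hcg2 hA hp hpp₀
  have hc := hF.capacity_pos
  rw [← hR] at hcg2
  obtain ⟨g, hg⟩ : ∃ g, g = contourGap η T x t := ⟨_, rfl⟩
  rw [← hg] at hcg hcg2 hA ⊢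
  have hg0 : 0 < g := hg ▸ contourGap_pos hη hx ht htT
  have hg1 : g ≤ 1 := hg ▸ contourGap_le_one hx1 ht htT
  set ρ := contourRadius η x t with hρ
  have hρ1 : 1 < ρ := contourRadius_pos hη hx ht htT
  have hρg : 1 + g ≤ ρ := hg ▸ le_contourRadius hη hx ht htT
  have hρR : ρ ≤ R := hR ▸ contourRadius_le hη hx1 ht htT
  have hR1 : 1 ≤ R := by linarith
  have hz0 : z ≠ 0 := norm_pos_iff.1 (by linarith)
  have hq0 : 0 ≤ (Real.exp σ)⁻¹ := by positivity
  have hq1 : (Real.exp σ)⁻¹ < 1 := inv_lt_one_of_one_lt₀ (Real.one_lt_exp_iff.2 hσ)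
  obtain ⟨hκc, hκN⟩ := hN _ t x hq0 hq1 ht htT hx hx1 d hd z hz
  rw [← hρ, ← hg] at hκN
  rw [← hρ] at hκc
  obtain ⟨l, hl⟩ : ∃ l, l = c ^ (-δ) := ⟨_, rfl⟩
  rw [← hl]
  have hl1 : 1 ≤ l := hl ▸ Real.one_le_rpow_of_pos_of_le_one_of_nonpos hc hc1 (by linarith)
  -- a power of the gap costs at most a power of the capacity
  have hcg' : 2 * c ≤ g := by
    have : 0 ≤ Λ * R := by positivity
    exact (mul_le_mul_of_nonneg_right (by linarith) hc.le).trans hcg2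
  have hgl : ∀ y, c ≤ y → y ^ (-δ) ≤ l := fun y hy =>
    hl ▸ Real.rpow_le_rpow_of_nonpos hc hy (by linarith)
  have hκN' : circleAverage (fun w => ‖evolutionKernel η (Real.exp σ)⁻¹ d t (w / z)‖) 0 ρ
      ≤ N * (l * g⁻¹ ^ d) := by
    refine hκN.trans ?_
    rw [mul_assoc]
    have := hgl g (by linarith)
    gcongr
  have hj0 : c * j ≤ T := by
    push_cast at hj
    linarith
  have hf := isExt_deviation hF hc1 hΛ hL θ hj0
  have hA0 : 0 ≤ A := (norm_nonneg _).trans (hA ρ (by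
    rw [Complex.norm_real, Real.norm_of_nonneg (by linarith)]; linarith))
  have hp0 : 0 ≤ p := (norm_nonneg _).trans (hp (Real.exp σ : ℝ) (by
    rw [Complex.norm_real, Real.norm_of_nonneg (by positivity)]))
  have hh := isNearUniform_attachDensity hF hc1 hΛ hL hj0 hnear hσ hpp₀ hp
  set b := Real.exp (c * j) with hb
  have hb1 : 1 ≤ b := Real.one_le_exp (by positivity)
  have hbE : b ≤ E := (Real.exp_le_exp.2 hj0).trans hET
  have hΦ : ∀ w ∈ exteriorDisk, clusterMap F θ j w = b * w + deviation F c θ j w := fun w _ => by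
    rw [deviation]
    ring
  have hEA : E + A ≤ E * (1 + A) := by
    have := mul_le_mul_of_nonneg_right hE1 hA0
    linarith
  have hwn : ∀ φ, ‖circleMap 0 ρ φ‖ = ρ := norm_circleMap (by linarith)
  have hXc : Continuous fun p : ℝ × ℝ =>
      increment F (clusterMap F θ j) (circleMap 0 ρ p.1) (circleMap 0 1 p.2) :=
    (continuous_increment_angles hF hρ1 j).comp
      ((continuous_const.prodMk continuous_snd).prodMk continuous_fst)
  have hlg0 : 0 ≤ l * g⁻¹ ^ d := by positivity
  have hs := shrink_mul_contourRadius_le (T := T) hη hx hx1 ht htT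
  rw [← hρ, ← hg] at hs
  have hst := stepRate_nonneg hc hg0 hA0 hp0
  refine ⟨⟨hh.continuous, hh.average⟩, fun φ => ?_, ?_, ?_⟩
  · have h1 := norm_smear_le (X := increment F (clusterMap F θ j)) hκc hκN'
      (M := 6 * R * (2 + Λ * R) * (E * (1 + A)) * (c / g)) (fun φ φ' => ?_) φ
    · refine h1.trans ?_
      calc _ = C₂ * (l * g⁻¹ ^ d) * ((1 + A) * (c / g)) := by rw [hC₂]; ring
        _ ≤ _ := by gcongr; linarith
    · refine (norm_increment_le hL hc hΛ hΦ hf hb1 hbE hg0 hg1 hcg hcg2 hA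
        (by rw [hwn]; exact hρg) (by rw [hwn]; exact hρR) (norm_unit_circle φ')).trans ?_
      gcongr
  · have h1 := circleAverage_smear_sq_le (X := increment F (clusterMap F θ j)) hXc hκc hκN'
      hh.continuous hh.nonneg hh.le_two
      (S := 2 * (3 * R * (2 + Λ * R) * (E * (1 + A))) ^ 2 * (c ^ 2 / g)) fun φ => ?_
    · refine h1.trans ?_
      calc _ = C₃ * (l * g⁻¹ ^ d) ^ 2 * ((1 + A) ^ 2 * (c ^ 2 / g)) := by rw [hC₃]; ring
        _ ≤ _ := by gcongr; linarith
    · refine (circleAverage_increment_sq_le hL hc hΛ hΦ hf hb1 hbE hg0 hg1 hcg hcg2 hA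
        (by rw [hwn]; exact hρg) (by rw [hwn]; exact hρR) hF).trans ?_
      gcongr
  · intro a a₁ ha ha' ha₁
    rw [evolved_succ_sub hF hc1 hΛ hL hj hη hσ hd ht hz0 hρ1 (by rw [hz]; linarith) hκc
      hh.continuous ha ha' ha₁, add_assoc, add_sub_cancel_left]
    have hErr := (norm_stepError_le (d := d) (A := A) ha' hη hq0 hq1.le ht hc.le hd hρ1
      (fun w hw => hA w (by rw [hw]; linarith)) (z := z) (by rw [hz]; linarith)).2
    have hErr' : ‖stepError η (Real.exp σ)⁻¹ d t c a z‖
        ≤ 2 * (1 + |η|) ^ 2 * R * l ^ 2 * (g⁻¹ ^ d * stepRate c g A p) := by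
      refine hErr.trans ?_
      have h2 : (1 - shrink η t * (ρ / ‖z‖))⁻¹ ≤ g⁻¹ := inv_anti₀ hg0 (by rw [hz]; linarith)
      have h3 : 0 ≤ (1 - shrink η t * (ρ / ‖z‖))⁻¹ := inv_nonneg.2 (by rw [hz]; linarith)
      calc _ ≤ 2 * (1 + |η|) ^ 2 * R * c ^ 2 * A * g⁻¹ ^ (d + 2) := by gcongr
        _ = 2 * (1 + |η|) ^ 2 * R * 1 * (g⁻¹ ^ d * (A / g * (c ^ 2 / g))) := by
            rw [pow_add]
            ring
        _ ≤ 2 * (1 + |η|) ^ 2 * R * l ^ 2 * (g⁻¹ ^ d * stepRate c g A p) := by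
            have h4 : A / g * (c ^ 2 / g) ≤ stepRate c g A p := by
              refine le_trans ?_ (le_stepRate₃ hc hg0 hA0 hp0)
              gcongr
              linarith
            have h5 : 1 ≤ l ^ 2 := one_le_pow₀ hl1
            gcongr
    have hmean : ∀ φ, ‖circleAverage (fun ζ => increment F (clusterMap F θ j) (circleMap 0 ρ φ) ζ
            * attachDensity F η σ θ j ζ) 0 1
            - c * (circleMap 0 ρ φ * (b + deriv (deviation F c θ j) (circleMap 0 ρ φ))
              - η * (circleMap 0 ρ φ
                * deriv (deviation F c θ j) ((Real.exp σ : ℝ) * circleMap 0 ρ φ)))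
            - ((Real.exp c - 1 - c) * b : ℝ) * circleMap 0 ρ φ‖
        ≤ (C₁ + E * R) * l * stepRate c g A p := by
      intro φ
      have hwg : 1 + g ≤ ‖circleMap 0 ρ φ‖ := by rw [hwn]; exact hρg
      have hw1 : ‖(circleMap 0 ρ φ)⁻¹‖ ≤ 1 - g / 2 := norm_inv_le_of_le hg0 hg1 hwg
      have hℓ : circleAverage (fun ζ => ‖1 - (circleMap 0 ρ φ)⁻¹ * ζ‖⁻¹) 0 1 ≤ k * l := by
        refine (circleAverage_inv_le (by linarith) hδ hδ1).trans ?_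
        have := hgl (1 - ‖(circleMap 0 ρ φ)⁻¹‖) (by linarith)
        gcongr
      have hcgQ : R ≤ Q := hRQ
      have h1 := norm_mean_increment_sub_le hL hc hΛ hΦ hf hb1 hbE hg0 hg1 hcg hcg2 hA hwg
        (by rw [hwn]; exact hρR) hF (Real.one_lt_exp_iff.2 hσ) hp hh hℓ
      have h2 := mean_error_le (η := η) hc hg0 hg1 hA0 hp0 hR1 hE1 hK hk1 hl1 hΛ
      have h3 : (R * E * k * K * (2 + Λ * R) + |η| * R
          + (3 * R * E + 18 * R ^ 2) * (2 + Λ * R) ^ 2 * 4) * l * stepRate c g A p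
          ≤ C₁ * l * stepRate c g A p := by
        rw [hC₁]
        gcongr
      have h4 : ‖((((Real.exp c - 1 - c) * b : ℝ) : ℂ)) * circleMap 0 ρ φ‖
          ≤ E * R * l * stepRate c g A p := by
        rw [norm_mul, hwn, Complex.norm_real, Real.norm_eq_abs, abs_mul,
          abs_of_pos (by linarith : 0 < b)]
        have h5 : c ^ 2 ≤ stepRate c g A p := by
          refine le_trans ?_ (le_stepRate₃ hc hg0 hA0 hp0)
          have h6 : c ^ 2 ≤ c ^ 2 / g := le_div_self (by positivity) hg0 hg1
          have h7 : 0 ≤ A / g * (c ^ 2 / g) := by positivity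
          linarith
        calc |Real.exp c - 1 - c| * b * ρ ≤ stepRate c g A p * E * R := by
              gcongr
              exact (exp_sub_one_sub_le hc.le hc1).trans h5
          _ = E * R * 1 * stepRate c g A p := by ring
          _ ≤ E * R * l * stepRate c g A p := by gcongr
      refine (norm_sub_le _ _).trans ?_
      have h5 := h1.trans (h2.trans h3)
      calc _ ≤ C₁ * l * stepRate c g A p + E * R * l * stepRate c g A p := add_le_add h5 h4
        _ = _ := by ring
    refine (norm_add_le _ _).trans ((add_le_add (norm_circleAverage_le
      (g := fun w => (C₁ + E * R) * l * stepRate c g A p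
        * ‖evolutionKernel η (Real.exp σ)⁻¹ d t (w / z)‖)
      (continuous_const.mul hκc.norm) fun φ => ?_) hErr').trans ?_)
    · rw [norm_mul]
      exact mul_le_mul_of_nonneg_right (hmean φ) (norm_nonneg _)
    · rw [circleAverage_const_mul]
      calc _ ≤ (C₁ + E * R) * l * stepRate c g A p * (N * (l * g⁻¹ ^ d))
            + 2 * (1 + |η|) ^ 2 * R * l ^ 2 * (g⁻¹ ^ d * stepRate c g A p) := by gcongr
        _ = C₄ * l ^ 2 * g⁻¹ ^ d * stepRate c g A p := by rw [hC₄]; ring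
        _ ≤ _ := by
            gcongr
            linarith

/-! ### Fluctuations at one point of evaluation -/

/-- The pasts for which the derivative of the deviation obeys the bound `B`, a function of the
distance to the unit circle. -/
def goodSet (F : ℂ → ℂ) (c : ℝ) (B : ℝ → ℝ) (j : ℕ) : Set (ℕ → ℝ) :=
  {θ | ∀ x : ℝ, 0 < x → x ≤ 1 → ∀ z : ℂ, 1 + x ≤ ‖z‖ →
    ‖deriv (clusterMap F θ j) z - (Real.exp (c * j) : ℝ)‖ ≤ B x}

lemma dependsOnFirst_goodSet (F : ℂ → ℂ) (c : ℝ) (B : ℝ → ℝ) (j : ℕ) :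
    DependsOnFirst j (· ∈ goodSet F c B j) := by
  intro θ θ' h
  simp only [goodSet, Set.mem_ofPred_eq, clusterMap_congr F h]

lemma measurableSet_goodSet {F : ℂ → ℂ} {c : ℝ} (hF : IsBasicMap F c) (B : ℝ → ℝ) (j : ℕ) :
    MeasurableSet (goodSet F c B j) := by
  refine IsClosed.measurableSet ?_
  have e : goodSet F c B j = ⋂ x : ℝ, ⋂ _ : 0 < x, ⋂ _ : x ≤ 1, ⋂ z : ℂ, ⋂ _ : 1 + x ≤ ‖z‖,
      {θ | ‖deriv (clusterMap F θ j) z - (Real.exp (c * j) : ℝ)‖ ≤ B x} := by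
    ext θ
    simp only [goodSet, Set.mem_iInter, Set.mem_ofPred_eq]
  rw [e]
  refine isClosed_iInter fun x => isClosed_iInter fun hx => isClosed_iInter fun _ =>
    isClosed_iInter fun z => isClosed_iInter fun hz => ?_
  have hz1 : z ∈ exteriorDisk := by
    rw [mem_exteriorDisk]
    linarith
  have hd : Continuous fun θ : ℕ → ℝ => deriv (clusterMap F θ j) z :=
    (hF.continuousOn_deriv_clusterMap j).comp_continuous (f := fun θ : ℕ → ℝ => (θ, z))
      (by fun_prop) fun θ => ⟨trivial, hz1⟩
  exact isClosed_le (hd.sub continuous_const).norm continuous_const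

/-- The centred effect of the `(j + 1)`-st particle on the cluster of size `n`, in the direction
`α`. -/
def centredEffect (F : ℂ → ℂ) (η σ c : ℝ) (d : ℕ) (x : ℝ) (z : ℂ) (n : ℕ) (α : ℂ) (j : ℕ)
    (θ : ℕ → ℝ) (ζ : ℂ) : ℝ :=
  (α * (effect F η (Real.exp σ)⁻¹ d x (c * (n - 1 - j : ℕ)) z j θ ζ
    - meanEffect F η σ d x (c * (n - 1 - j : ℕ)) z j θ)).re

lemma dependsOnFirst_centredEffect (F : ℂ → ℂ) (η σ c : ℝ) (d : ℕ) (x : ℝ) (z : ℂ) (n : ℕ) (α : ℂ)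
    (j : ℕ) : DependsOnFirst j (centredEffect F η σ c d x z n α j) := by
  intro θ θ' h
  ext ζ
  simp only [centredEffect, effect, meanEffect, clusterMap_congr F h, attachDensity_congr F η σ h]

lemma measurable_centredEffect {F : ℂ → ℂ} {c : ℝ} (hF : IsBasicMap F c) {η σ : ℝ} (hσ : 0 < σ)
    {d n : ℕ} {x : ℝ} {z : ℂ} (hρ : ∀ t, 0 ≤ t → t ≤ c * n → 1 < contourRadius η x t)
    (hκ : ∀ t, 0 ≤ t → t ≤ c * n → Continuous fun φ =>
      evolutionKernel η (Real.exp σ)⁻¹ d t (circleMap 0 (contourRadius η x t) φ / z)) (α : ℂ)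
    (j : ℕ) :
    Measurable fun p : (ℕ → ℝ) × ℝ => centredEffect F η σ c d x z n α j p.1 (circleMap 0 1 p.2) := by
  have hc := hF.capacity_pos
  obtain ⟨t, ht⟩ : ∃ t, t = c * ((n - 1 - j : ℕ) : ℝ) := ⟨_, rfl⟩
  have ht0 : 0 ≤ t := by rw [ht]; positivity
  have htn : t ≤ c * n := by
    rw [ht]
    gcongr
    omega
  have h1 : Measurable fun p : (ℕ → ℝ) × ℝ =>
      effect F η (Real.exp σ)⁻¹ d x t z j p.1 (circleMap 0 1 p.2) :=
    (continuous_effect hF (hρ t ht0 htn) (hκ t ht0 htn) j).measurable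
  have h2 : Measurable fun p : (ℕ → ℝ) × ℝ =>
      effect F η (Real.exp σ)⁻¹ d x t z j p.1 (circleMap 0 1 p.2)
        * (attachDensity F η σ p.1 j (circleMap 0 1 p.2) : ℂ) :=
    h1.mul (Complex.measurable_ofReal.comp (measurable_attachDensity hF η hσ j))
  have h3 : Measurable fun θ : ℕ → ℝ => meanEffect F η σ d x t z j θ := by
    simp only [meanEffect, Real.circleAverage_def,
      intervalIntegral.integral_of_le (by positivity : (0:ℝ) ≤ 2 * Real.pi)]
    exact (h2.stronglyMeasurable.integral_prod_right
      (ν := volume.restrict (Set.Ioc 0 (2 * Real.pi)))).measurable.const_smul _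
  have h4 : Measurable fun p : (ℕ → ℝ) × ℝ => meanEffect F η σ d x t z j p.1 :=
    h3.comp measurable_fst
  simp only [centredEffect, ← ht]
  exact Complex.measurable_re.comp ((h1.sub h4).const_mul α)

/-- A complex number is controlled by its real parts in the four directions of the axes. -/
lemma norm_le_of_re_le {w : ℂ} {M : ℝ} (h1 : (1 * w).re ≤ M) (h2 : (-1 * w).re ≤ M)
    (h3 : (Complex.I * w).re ≤ M) (h4 : (-Complex.I * w).re ≤ M) : ‖w‖ ≤ 2 * M := by
  simp only [one_mul, neg_mul, Complex.neg_re, Complex.I_mul_re, neg_neg] at h1 h2 h3 h4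
  have h5 : |w.re| ≤ M := abs_le.2 ⟨by linarith, h1⟩
  have h6 : |w.im| ≤ M := abs_le.2 ⟨by linarith, h4⟩
  linarith [Complex.norm_le_abs_re_add_abs_im w]

section Point

variable {Ω : Type u} [MeasurableSpace Ω] {μ : Measure Ω} [IsProbabilityMeasure μ]
  {F L : ℂ → ℂ} {c Λ T η σ δ C p₀ : ℝ} {Θ : ℕ → Ω → ℝ} {B : ℝ → ℝ}

lemma contourGap_mono {x t t' : ℝ} (hη : η ≤ 1) (hT : 0 ≤ T) (h : t ≤ t') :
    contourGap η T x t ≤ contourGap η T x t' := by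
  have : 0 ≤ min 1 (1 - η) := le_min zero_le_one (by linarith)
  rw [contourGap, contourGap]
  gcongr

/-- The exceptional event at one point of evaluation. Outside it, as long as the past obeys the
bound `B`, the deviation of the cluster of size `n` is controlled by the concentration level `l`
times the size of the fluctuations plus the accumulated drift. -/
theorem measure_evolved_gt_le (hη : η ≤ 1) (hT : 0 ≤ T) (hΛ : 0 ≤ Λ)
    (hC : 1 ≤ C) (hstep : StepBound η Λ T δ C p₀)
    (hF : IsBasicMap F c) (hc1 : c ≤ 1) (hL : IsLogBranch F c Λ L) (hσ : 0 < σ)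
    (hA : IsALE μ F η σ Θ) (hB : ∀ x y, 0 < x → x ≤ y → B y ≤ B x) (hB0 : ∀ x, 0 < x → 0 ≤ B x)
    {p : ℝ} (hp : B (min (Real.exp σ - 1) 1) ≤ p) (hp₀ : p ≤ p₀) {n d : ℕ} (hn : c * n ≤ T)
    (hd : d ≤ 1) {x : ℝ} (hx : 0 < x) (hx1 : x ≤ 1) (hcx : c ^ (1 / 2 : ℝ) ≤ x / (5 + T))
    (hcx2 : 2 * (2 + Λ * (2 * Real.exp T)) * c ≤ x / (5 + T)) {z : ℂ} (hz : ‖z‖ = 1 + x)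
    {g A : ℕ → ℝ} (hg : ∀ m, g m = contourGap η T x (c * m)) (hAg : ∀ m, A m = B (g m / 2))
    {b V l S : ℝ}
    (hb : b = 2 * (C * (c ^ (-δ) * (g 0)⁻¹ ^ d) * ((1 + A 0) * (c / g 0))))
    (hV : V = ∑ m ∈ Finset.range n,
      C * (c ^ (-δ) * (g m)⁻¹ ^ d) ^ 2 * ((1 + A m) ^ 2 * (c ^ 2 / g m)))
    (hS : S = ∑ m ∈ Finset.range n,
      C * (c ^ (-δ)) ^ 2 * (g m)⁻¹ ^ d * stepRate c (g m) (A m) p) :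
    μ {ω | (∀ j < n, (fun k => Θ k ω) ∈ goodSet F c B j) ∧ ∃ a,
      HasLaurent (deviation F c (fun k => Θ k ω) n) a ∧
      2 * (l * (b + √V)) + S < ‖evolved η (Real.exp σ)⁻¹ d 0 a z‖}
      ≤ 4 * ENNReal.ofReal (Real.exp (1 - l)) := by
  have hc := hF.capacity_pos
  have hcδ : 0 < c ^ (-δ) := Real.rpow_pos_of_pos hc _
  have hg0 : g 0 = x / (5 + T) := by
    rw [hg, contourGap]
    simp
  have hg0pos : 0 < g 0 := by rw [hg0]; positivity
  have hgm : ∀ m, g 0 ≤ g m := fun m => by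
    rw [hg, hg]
    exact contourGap_mono hη hT (by push_cast; nlinarith [mul_nonneg hc.le m.cast_nonneg (α := ℝ)])
  have hgpos : ∀ m, 0 < g m := fun m => hg0pos.trans_le (hgm m)
  have hA0 : ∀ m, 0 ≤ A m := fun m => by
    rw [hAg]; exact hB0 _ (half_pos (hgpos m))
  have hAm : ∀ m, A m ≤ A 0 := fun m => by
    rw [hAg, hAg]; exact hB _ _ (half_pos hg0pos) (by linarith [hgm m])
  -- the time left after step `j`
  have htime : ∀ j < n, c * (j + 1 : ℕ) ≤ T ∧ 0 ≤ c * ((n - 1 - j : ℕ) : ℝ) ∧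
      c * ((n - 1 - j : ℕ) : ℝ) ≤ T := fun j hj => by
    refine ⟨le_trans ?_ hn, by positivity, le_trans ?_ hn⟩ <;> gcongr <;> omega
  have hgood : ∀ j < n, ∀ θ ∈ goodSet F c B j, ∀ y, 0 < y → y ≤ 1 → ∀ w : ℂ, 1 + y ≤ ‖w‖ →
      ‖deriv (deviation F c θ j) w‖ ≤ B y := fun j hj θ hθ y hy hy1 w hw => by
    have hj0 : c * j ≤ T := le_trans (by gcongr) hn
    have h := hθ y hy hy1 w hw
    rwa [deriv_clusterMap_eq hF hc1 hΛ hL hj0 (by rw [mem_exteriorDisk]; linarith),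
      add_sub_cancel_left] at h
  have hS1 : ∀ j < n, ∀ θ ∈ goodSet F c B j, _ := fun j hj θ hθ =>
    hstep F L c σ θ j d x (c * ((n - 1 - j : ℕ) : ℝ)) z (A (n - 1 - j)) p hF hL hc1 hσ
      (htime j hj).1 hd (htime j hj).2.1 (htime j hj).2.2 hx hx1 hz
      (by rw [← hg]; exact (hg0 ▸ hcx).trans (hgm _))
      (by rw [← hg]; exact (hg0 ▸ hcx2).trans (hgm _))
      (fun w hw => by
        rw [← hg] at hw
        rw [hAg]
        refine hgood j hj θ hθ _ (half_pos (hgpos _)) ?_ w hw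
        have : g (n - 1 - j) ≤ 1 := by
          rw [hg]; exact contourGap_le_one hx1 (htime j hj).2.1 (htime j hj).2.2
        linarith)
      (fun w hw => by
        have h1 : 0 < Real.exp σ - 1 := by linarith [Real.one_lt_exp_iff.2 hσ]
        refine (hgood j hj θ hθ _ (lt_min h1 one_pos) (min_le_right _ _) w ?_).trans hp
        linarith [min_le_left (Real.exp σ - 1) 1]) hp₀
  simp only [← hg] at hS1
  have hq0 : 0 ≤ (Real.exp σ)⁻¹ := by positivity
  have hq1 : (Real.exp σ)⁻¹ < 1 := inv_lt_one_of_one_lt₀ (Real.one_lt_exp_iff.2 hσ)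
  obtain ⟨_, -, hN⟩ := exists_circleAverage_kernel_le hη (T := T) (δ := 1 / 2) (by norm_num)
    (by norm_num)
  have hρ : ∀ t, 0 ≤ t → t ≤ c * n → 1 < contourRadius η x t := fun t ht htn =>
    contourRadius_pos hη hx ht (htn.trans hn)
  have hκ : ∀ t, 0 ≤ t → t ≤ c * n → Continuous fun φ =>
      evolutionKernel η (Real.exp σ)⁻¹ d t (circleMap 0 (contourRadius η x t) φ / z) :=
    fun t ht htn => (hN _ t x hq0 hq1 ht (htn.trans hn) hx hx1 d hd z hz).1
  have hb0 : 0 < b := by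
    have h1 := hA0 0
    rw [hb]
    positivity
  have hv0 : ∀ m, 0 ≤ C * (c ^ (-δ) * (g m)⁻¹ ^ d) ^ 2 * ((1 + A m) ^ 2 * (c ^ 2 / g m)) :=
    fun m => by
    have := hgpos m
    positivity
  have hVsum : V = ∑ j ∈ Finset.range n, C * (c ^ (-δ) * (g (n - 1 - j))⁻¹ ^ d) ^ 2
      * ((1 + A (n - 1 - j)) ^ 2 * (c ^ 2 / g (n - 1 - j))) := by
    rw [hV]
    exact (Finset.sum_range_reflect (fun m =>
      C * (c ^ (-δ) * (g m)⁻¹ ^ d) ^ 2 * ((1 + A m) ^ 2 * (c ^ 2 / g m))) n).symm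
  have hSsum : S = ∑ j ∈ Finset.range n, C * (c ^ (-δ)) ^ 2 * (g (n - 1 - j))⁻¹ ^ d
      * stepRate c (g (n - 1 - j)) (A (n - 1 - j)) p := by
    rw [hS]
    exact (Finset.sum_range_reflect (fun m =>
      C * (c ^ (-δ)) ^ 2 * (g m)⁻¹ ^ d * stepRate c (g m) (A m) p) n).symm
  have heffc : ∀ j < n, ∀ θ : ℕ → ℝ, Continuous fun φ =>
      effect F η (Real.exp σ)⁻¹ d x (c * ((n - 1 - j : ℕ) : ℝ)) z j θ (circleMap 0 1 φ) :=
    fun j hj θ => by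
      have htn : c * ((n - 1 - j : ℕ) : ℝ) ≤ c * n := by gcongr; omega
      exact (continuous_effect hF (hρ _ (htime j hj).2.1 htn) (hκ _ (htime j hj).2.1 htn) j).comp
        (f := fun φ : ℝ => (θ, φ)) (by fun_prop)
  have hh0 : ∀ j, ∀ θ : ℕ → ℝ, ∀ φ, 0 ≤ attachDensity F η σ θ j (circleMap 0 1 φ) :=
    fun j θ φ => attachDensity_nonneg _ _ _ _ _ _
  have htail : ∀ α : ℂ, ‖α‖ = 1 → μ {ω | l * (b + √V) ≤ stoppedSum (goodSet F c B)
      (centredEffect F η σ c d x z n α) n fun k => Θ k ω} ≤ ENNReal.ofReal (Real.exp (1 - l)) := by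
    intro α hα
    rw [hVsum]
    refine measure_stoppedSum_ge_le hA hF hσ (measurableSet_goodSet hF B)
      (dependsOnFirst_goodSet F c B) (measurable_centredEffect hF hσ hρ hκ α)
      (dependsOnFirst_centredEffect F η σ c d x z n α) (fun j hj θ hθ => (hS1 j hj θ hθ).1)
      (fun j hj θ hθ => ?_) (fun j hj θ hθ => ?_) (fun j hj θ hθ => ?_) (fun j hj θ hθ => ?_)
      (fun j hj => hv0 _) hb0 l
    · exact Complex.continuous_re.comp (continuous_const.mul
        ((heffc j hj θ).sub continuous_const))
    · intro φ
      obtain ⟨⟨hhc, hh1⟩, hbd, -, -⟩ := hS1 j hj θ hθ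
      obtain ⟨e, he⟩ : ∃ e, e = C * (c ^ (-δ) * (g (n - 1 - j))⁻¹ ^ d)
        * ((1 + A (n - 1 - j)) * (c / g (n - 1 - j))) := ⟨_, rfl⟩
      rw [← he] at hbd
      have hm : ‖meanEffect F η σ d x (c * ((n - 1 - j : ℕ) : ℝ)) z j θ‖ ≤ e := by
        have h1 := norm_circleAverage_le (f := fun ζ =>
            effect F η (Real.exp σ)⁻¹ d x (c * ((n - 1 - j : ℕ) : ℝ)) z j θ ζ
              * (attachDensity F η σ θ j ζ : ℂ))
          (g := fun ζ => e * attachDensity F η σ θ j ζ) (ρ := 1)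
          (continuous_const.mul hhc) fun φ => by
            rw [norm_mul, Complex.norm_real, Real.norm_of_nonneg (hh0 j θ φ)]
            exact mul_le_mul_of_nonneg_right (hbd φ) (hh0 j θ φ)
        rwa [circleAverage_const_mul, hh1, mul_one] at h1
      have he2 : 2 * e ≤ b := by
        have h1 := hgm (n - 1 - j)
        have h2 := hAm (n - 1 - j)
        have h3 := hA0 (n - 1 - j)
        have h4 := hgpos (n - 1 - j)
        have h5 := hA0 0
        rw [hb, he]
        gcongr
      refine (Complex.abs_re_le_norm _).trans ?_
      rw [norm_mul, hα, one_mul]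
      have h2 := norm_sub_le (effect F η (Real.exp σ)⁻¹ d x (c * ((n - 1 - j : ℕ) : ℝ)) z j θ
        (circleMap 0 1 φ)) (meanEffect F η σ d x (c * ((n - 1 - j : ℕ) : ℝ)) z j θ)
      have h3 := hbd φ
      linarith
    · obtain ⟨⟨hhc, hh1⟩, -⟩ := hS1 j hj θ hθ
      exact (circleAverage_centred hα (heffc j hj θ) hhc (hh0 j θ) hh1).1
    · obtain ⟨⟨hhc, hh1⟩, -, hvar, -⟩ := hS1 j hj θ hθ
      exact (circleAverage_centred hα (heffc j hj θ) hhc (hh0 j θ) hh1).2.trans hvar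
  set E : ℂ → Set Ω := fun α => {ω | l * (b + √V) ≤ stoppedSum (goodSet F c B)
      (centredEffect F η σ c d x z n α) n fun k => Θ k ω} with hE
  have hsub : {ω | (∀ j < n, (fun k => Θ k ω) ∈ goodSet F c B j) ∧ ∃ a,
      HasLaurent (deviation F c (fun k => Θ k ω) n) a ∧
      2 * (l * (b + √V)) + S < ‖evolved η (Real.exp σ)⁻¹ d 0 a z‖}
      ⊆ (E 1 ∪ E (-1)) ∪ (E Complex.I ∪ E (-Complex.I)) := by
    rintro ω ⟨hgo, a, ha, hlt⟩
    by_contra hnot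
    simp only [Set.mem_union, not_or, hE, Set.mem_ofPred_eq, not_le] at hnot
    refine absurd hlt (not_lt.2 ?_)
    obtain ⟨θ, hθ⟩ : ∃ θ : ℕ → ℝ, θ = fun k => Θ k ω := ⟨_, rfl⟩
    rw [← hθ] at hgo ha hnot
    have hext : ∀ j ≤ n, IsExt (deviation F c θ j) := fun j hj =>
      isExt_deviation hF hc1 hΛ hL θ (le_trans (by gcongr) hn)
    choose! as has has' using fun j (hj : j ≤ n) => (hext j hj).exists_hasLaurent
    obtain ⟨U, hU⟩ : ∃ U : ℕ → ℂ, U = fun j =>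
      evolved η (Real.exp σ)⁻¹ d (c * ((n - j : ℕ) : ℝ)) (as j) z := ⟨_, rfl⟩
    have hz1 : z ∈ exteriorDisk := by rw [mem_exteriorDisk]; linarith
    have haeq : a = as n := ha.unique (has n le_rfl)
    have hUn : evolved η (Real.exp σ)⁻¹ d 0 a z = U n := by
      rw [hU, haeq]
      simp
    have hU0 : U 0 = 0 := by
      have h0 : deviation F c θ 0 = fun _ => 0 := by
        ext w
        simp [deviation, clusterMap]
      have h1 : as 0 = fun _ => 0 := by
        refine (has 0 (Nat.zero_le _)).unique ?_
        rw [h0]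
        intro w hw
        simp [hasSum_zero]
      rw [hU]
      simp [evolved, h1]
    obtain ⟨W, hW⟩ : ∃ W : ℕ → ℂ, W = fun j =>
      effect F η (Real.exp σ)⁻¹ d x (c * ((n - 1 - j : ℕ) : ℝ)) z j θ (circleMap 0 1 (θ j))
        - meanEffect F η σ d x (c * ((n - 1 - j : ℕ) : ℝ)) z j θ := ⟨_, rfl⟩
    have hstepj : ∀ j ∈ Finset.range n, ‖U (j + 1) - U j - W j‖
        ≤ C * (c ^ (-δ)) ^ 2 * (g (n - 1 - j))⁻¹ ^ d
          * stepRate c (g (n - 1 - j)) (A (n - 1 - j)) p := by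
      intro j hj
      have hj := Finset.mem_range.1 hj
      obtain ⟨-, -, -, h⟩ := hS1 j hj θ (hgo j hj)
      have h1 := h (as j) (as (j + 1)) (has j hj.le) (has' j hj.le) (has (j + 1) hj)
      have e1 : c * ((n - j : ℕ) : ℝ) = c * ((n - 1 - j : ℕ) : ℝ) + c := by
        have : n - j = n - 1 - j + 1 := by omega
        rw [this]
        push_cast
        ring
      have e2 : n - (j + 1) = n - 1 - j := by omega
      rw [hU, hW]
      simp only [e1, e2]
      exact h1
    have htel : U n = ∑ j ∈ Finset.range n, W j
        + ∑ j ∈ Finset.range n, (U (j + 1) - U j - W j) := by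
      rw [Finset.sum_sub_distrib, Finset.sum_range_sub, hU0]
      ring
    have hsum : ∀ α : ℂ, (α * ∑ j ∈ Finset.range n, W j).re = stoppedSum (goodSet F c B)
        (centredEffect F η σ c d x z n α) n θ := by
      intro α
      rw [Finset.mul_sum, Complex.re_sum, stoppedSum]
      refine Finset.sum_congr rfl fun j hj => ?_
      rw [Set.indicator_of_mem (hgo j (Finset.mem_range.1 hj)), hW, centredEffect]
    have hW4 : ‖∑ j ∈ Finset.range n, W j‖ ≤ 2 * (l * (b + √V)) := by
      refine norm_le_of_re_le ?_ ?_ ?_ ?_ <;> rw [hsum]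
      exacts [hnot.1.1.le, hnot.1.2.le, hnot.2.1.le, hnot.2.2.le]
    rw [hUn, htel]
    refine (norm_add_le _ _).trans (add_le_add hW4 ?_)
    rw [hSsum]
    exact (norm_sum_le _ _).trans (Finset.sum_le_sum hstepj)
  have h1 := htail 1 (by simp)
  have h2 := htail (-1) (by simp)
  have h3 := htail Complex.I (by simp)
  have h4 := htail (-Complex.I) (by simp)
  calc _ ≤ μ ((E 1 ∪ E (-1)) ∪ (E Complex.I ∪ E (-Complex.I))) := measure_mono hsub
    _ ≤ (μ (E 1) + μ (E (-1))) + (μ (E Complex.I) + μ (E (-Complex.I))) :=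
        (measure_union_le _ _).trans (add_le_add (measure_union_le _ _) (measure_union_le _ _))
    _ ≤ (ENNReal.ofReal (Real.exp (1 - l)) + ENNReal.ofReal (Real.exp (1 - l)))
        + (ENNReal.ofReal (Real.exp (1 - l)) + ENNReal.ofReal (Real.exp (1 - l))) := by gcongr
    _ = _ := by ring

end Point

/-! ### Summation over the time steps -/

/-- The time for which a fluctuation at distance `x` from the unit circle persists: it is of order
`x` if the linearised dynamics moves it away from the circle, and of order one if not. -/
def timeScale (η x : ℝ) : ℝ := if η = 1 then 1 else x

lemma timeScale_pos (η : ℝ) {x : ℝ} (hx : 0 < x) : 0 < timeScale η x := by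
  unfold timeScale
  split_ifs <;> linarith

lemma le_timeScale (η : ℝ) {x : ℝ} (hx1 : x ≤ 1) : x ≤ timeScale η x := by
  unfold timeScale
  split_ifs <;> linarith

lemma exists_sum_inv_contourGap_le {η T δ : ℝ} (hη : η ≤ 1) (hT : 0 ≤ T) (hδ : 0 < δ) :
    ∃ H, 1 ≤ H ∧ ∀ (c x : ℝ) (n : ℕ), 0 < c → c ≤ 1 → c ≤ x → x ≤ 1 → c * n ≤ T →
      ∑ m ∈ Finset.range n, c * (contourGap η T x (c * m))⁻¹
        ≤ H * c ^ (-δ) * (timeScale η x / x) := by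
  have hℓ : ∀ c : ℝ, 0 < c → c ≤ 1 → 1 ≤ c ^ (-δ) := fun c hc hc1 =>
    Real.one_le_rpow_of_pos_of_le_one_of_nonpos hc hc1 (by linarith)
  rcases hη.lt_or_eq with h | rfl
  · obtain ⟨a, ha⟩ : ∃ a, a = min 1 (1 - η) := ⟨_, rfl⟩
    have ha0 : 0 < a := ha ▸ lt_min one_pos (by linarith)
    have ha1 : a ≤ 1 := ha ▸ min_le_left _ _
    refine ⟨1 + (5 + T) * (2 / a * (T + δ⁻¹)), ?_, fun c x n hc hc1 hcx hx1 hn => ?_⟩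
    · have : 0 ≤ (5 + T) * (2 / a * (T + δ⁻¹)) := by positivity
      linarith
    have hx : 0 < x := hc.trans_le hcx
    have hy : ∀ m : ℕ, 0 < x + a * (c * m) := fun m => by positivity
    -- each term is at most an increment of the logarithm
    have hterm : ∀ m : ℕ, c * (contourGap η T x (c * m))⁻¹ ≤ (5 + T) * (2 / a)
        * (Real.log (x + a * (c * (m + 1 : ℕ))) - Real.log (x + a * (c * m))) := by
      intro m
      have hm := hy m
      have hm1 := hy (m + 1)
      have h1 := Real.one_sub_inv_le_log_of_pos (div_pos hm1 hm)
      rw [Real.log_div hm1.ne' hm.ne', inv_div] at h1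
      have h2 : a * c / (2 * (x + a * (c * m)))
          ≤ 1 - (x + a * (c * m)) / (x + a * (c * (m + 1 : ℕ))) := by
        have e : 1 - (x + a * (c * m)) / (x + a * (c * (m + 1 : ℕ)))
            = a * c / (x + a * (c * (m + 1 : ℕ))) := by
          rw [one_sub_div hm1.ne']
          push_cast
          ring
        rw [e]
        have h3 : 0 ≤ a * (c * m) := by positivity
        have h4 : a * c ≤ 1 * c := by gcongr
        gcongr
        push_cast
        linarith
      calc c * (contourGap η T x (c * m))⁻¹
          = (5 + T) * (2 / a) * (a * c / (2 * (x + a * (c * m)))) := by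
            rw [contourGap, ← ha, inv_div]
            field_simp
        _ ≤ _ := by
            have : 0 ≤ (5 + T) * (2 / a) := by positivity
            exact mul_le_mul_of_nonneg_left (h2.trans h1) this
    have h1 := (Finset.sum_le_sum fun m (_ : m ∈ Finset.range n) => hterm m).trans_eq
      (by rw [← Finset.mul_sum, Finset.sum_range_sub (fun m : ℕ => Real.log (x + a * (c * m)))])
    have h2 : Real.log (x + a * (c * n)) ≤ T := by
      have h3 := Real.log_le_sub_one_of_pos (hy n)
      have h4 : a * (c * n) ≤ 1 * T := by gcongr
      linarith
    have h3 : -Real.log x ≤ c ^ (-δ) / δ := by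
      rw [← Real.log_inv, Real.rpow_neg hc.le, ← Real.inv_rpow hc.le]
      exact (Real.log_le_log (by positivity) (inv_anti₀ hc hcx)).trans
        (Real.log_le_rpow_div (by positivity) hδ)
    have hℓ1 := hℓ c hc hc1
    have h4 : Real.log (x + a * (c * n)) - Real.log (x + a * (c * (0 : ℕ)))
        ≤ (T + δ⁻¹) * c ^ (-δ) := by
      have h5 : T * 1 ≤ T * c ^ (-δ) := by gcongr
      have e : x + a * (c * (0 : ℕ)) = x := by simp
      have e2 : c ^ (-δ) / δ = δ⁻¹ * c ^ (-δ) := by ring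
      rw [e]
      linarith
    have e : timeScale η x / x = 1 := by
      rw [timeScale, if_neg h.ne, div_self hx.ne']
    rw [e, mul_one]
    refine h1.trans ?_
    calc _ ≤ (5 + T) * (2 / a) * ((T + δ⁻¹) * c ^ (-δ)) := by gcongr
      _ = (5 + T) * (2 / a * (T + δ⁻¹)) * c ^ (-δ) := by ring
      _ ≤ _ := by
          gcongr
          linarith
  · refine ⟨1 + (5 + T) * T, ?_, fun c x n hc hc1 hcx hx1 hn => ?_⟩
    · have : 0 ≤ (5 + T) * T := by positivity
      linarith
    have hx : 0 < x := hc.trans_le hcx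
    have hℓ1 := hℓ c hc hc1
    have e : ∀ m : ℕ, contourGap 1 T x (c * m) = x / (5 + T) := fun m => by
      simp [contourGap]
    simp only [e, Finset.sum_const, Finset.card_range, nsmul_eq_mul, timeScale, if_true]
    calc n * (c * (x / (5 + T))⁻¹) = (5 + T) * (c * n) * 1 * (1 / x) := by
          rw [inv_div]
          ring
      _ ≤ (5 + T) * T * c ^ (-δ) * (1 / x) := by gcongr
      _ ≤ _ := by
          gcongr
          linarith

/-- The size of the deviation predicted by one pass through Duhamel's formula, at distance `x` from
the unit circle. Here `τ` is the time scale, `A` bounds the derivative of the deviation down to a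
distance comparable with `x`, `p` bounds it near the circle of radius `e^σ`, and `κ` and `W` are
bounds for the integrals over time of `1` and of the derivative. -/
def errorScale (c x τ A p κ W : ℝ) : ℝ :=
  (1 + A) * (c / x + √(c * τ / x) + κ * p ^ 2 + √c * p * τ / x) + p * W + c * τ / x
    + c * A * τ / x ^ 2

lemma fluctuation_add_drift_le {c x l C G H τ κ W p : ℝ} {g A : ℕ → ℝ} {n d : ℕ} (hc : 0 < c)
    (hx : 0 < x) (hl : 1 ≤ l) (hC : 1 ≤ C) (hG : 1 ≤ G) (hH : 1 ≤ H)
    (hτ : 0 ≤ τ) (hκ : 0 ≤ κ) (hW : 0 ≤ W) (hp : 0 ≤ p) (hg0 : g 0 = x / G)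
    (hg : ∀ m, g 0 ≤ g m) (hA0 : ∀ m, 0 ≤ A m) (hA : ∀ m, A m ≤ A 0) (hd : d ≤ 1)
    (h1 : ∑ m ∈ Finset.range n, c * (g m)⁻¹ ≤ H * l * (τ / x))
    (h2 : ∑ m ∈ Finset.range n, c * (g m)⁻¹ ^ d ≤ H * l * κ * x⁻¹ ^ d)
    (h3 : ∑ m ∈ Finset.range n, c * A m * (g m)⁻¹ ^ d ≤ H * l * W * x⁻¹ ^ d) :
    2 * (l * (2 * (C * (l * (g 0)⁻¹ ^ d) * ((1 + A 0) * (c / g 0)))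
        + √(∑ m ∈ Finset.range n, C * (l * (g m)⁻¹ ^ d) ^ 2 * ((1 + A m) ^ 2 * (c ^ 2 / g m)))))
      + ∑ m ∈ Finset.range n, C * l ^ 2 * (g m)⁻¹ ^ d * stepRate c (g m) (A m) p
      ≤ 7 * (C * H * G ^ 2) * l ^ 3 * (x⁻¹ ^ d * errorScale c x τ (A 0) p κ W) := by
  have hg0pos : 0 < g 0 := by rw [hg0]; positivity
  have hgpos : ∀ m, 0 < g m := fun m => hg0pos.trans_le (hg m)
  have hginv : ∀ m, (g m)⁻¹ ≤ G / x := fun m => by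
    rw [← inv_div, ← hg0]
    exact inv_anti₀ hg0pos (hg m)
  obtain ⟨u, hu⟩ : ∃ u, u = x⁻¹ ^ d := ⟨_, rfl⟩
  have hu0 : 0 < u := by rw [hu]; positivity
  have hgu : ∀ m, (g m)⁻¹ ^ d ≤ G * u := fun m => by
    have h4 : 0 ≤ (g m)⁻¹ := (inv_pos.2 (hgpos m)).le
    calc (g m)⁻¹ ^ d ≤ (G / x) ^ d := by
          gcongr
          exact hginv m
      _ = G ^ d * u := by rw [hu, div_eq_mul_inv, mul_pow]
      _ ≤ G ^ 1 * u := by gcongr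
      _ = G * u := by rw [pow_one]
  have hgd0 : ∀ m, 0 ≤ (g m)⁻¹ ^ d := fun m => pow_nonneg (inv_pos.2 (hgpos m)).le _
  obtain ⟨a, ha⟩ : ∃ a, a = A 0 := ⟨_, rfl⟩
  have ha0 : 0 ≤ a := ha ▸ hA0 0
  simp only [← ha] at hA ⊢
  rw [← hu] at h2 h3 ⊢
  have hH0 : 0 < H := by linarith
  have hl0 : 0 < l := by linarith
  have hC0 : 0 < C := by linarith
  have hG0 : 0 < G := by linarith
  have hτx : 0 ≤ τ / x := by positivity
  have t0 : 0 ≤ c / x := by positivity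
  have t1 : 0 ≤ √(c * τ / x) := Real.sqrt_nonneg _
  have t2 : 0 ≤ κ * p ^ 2 := by positivity
  have t3 : 0 ≤ √c * p * τ / x := by positivity
  have t4 : 0 ≤ p * W := by positivity
  have t5 : 0 ≤ c * τ / x := by positivity
  have t6 : 0 ≤ c * a * τ / x ^ 2 := by positivity
  obtain ⟨E, hE⟩ : ∃ E, E = errorScale c x τ a p κ W := ⟨_, rfl⟩
  have hE' : E = (1 + a) * (c / x) + (1 + a) * √(c * τ / x) + (1 + a) * (κ * p ^ 2)
      + (1 + a) * (√c * p * τ / x) + p * W + c * τ / x + c * a * τ / x ^ 2 := by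
    rw [hE, errorScale]
    ring
  rw [← hE]
  have s0 : 0 ≤ (1 + a) * (c / x) := by positivity
  have s1 : 0 ≤ (1 + a) * √(c * τ / x) := by positivity
  have s2 : 0 ≤ (1 + a) * (κ * p ^ 2) := by positivity
  have s3 : 0 ≤ (1 + a) * (√c * p * τ / x) := by positivity
  have hE0 : 0 ≤ E := by linarith
  have b1 : l * (2 * (C * (l * (g 0)⁻¹ ^ d) * ((1 + a) * (c / g 0))))
      ≤ 2 * (C * H * G ^ 2) * l ^ 3 * (u * E) := by
    have h4 : c / g 0 ≤ G * (c / x) := by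
      rw [hg0]
      apply le_of_eq
      field_simp
    calc _ ≤ l * (2 * (C * (l * (G * u)) * ((1 + a) * (G * (c / x))))) := by
          have := hgu 0
          gcongr
      _ = 2 * (C * 1 * G ^ 2) * (l ^ 2 * 1) * (u * ((1 + a) * (c / x))) := by ring
      _ ≤ 2 * (C * H * G ^ 2) * (l ^ 2 * l) * (u * E) := by
          gcongr
          linarith
      _ = _ := by ring
  have b2 : l * √(∑ m ∈ Finset.range n, C * (l * (g m)⁻¹ ^ d) ^ 2
      * ((1 + A m) ^ 2 * (c ^ 2 / g m))) ≤ (C * H * G ^ 2) * l ^ 3 * (u * E) := by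
    have h4 : ∑ m ∈ Finset.range n, C * (l * (g m)⁻¹ ^ d) ^ 2 * ((1 + A m) ^ 2 * (c ^ 2 / g m))
        ≤ (C * H * G * l ^ 2 * (u * (1 + a))) ^ 2 * (c * τ / x) := by
      calc _ ≤ ∑ m ∈ Finset.range n, C * (l * (G * u)) ^ 2 * ((1 + a) ^ 2 * c) * (c * (g m)⁻¹) := by
            refine Finset.sum_le_sum fun m _ => ?_
            have h5 := hgu m
            have h6 := hA m
            have h7 := hgd0 m
            have h8 := hA0 m
            have h9 := hgpos m
            calc _ ≤ C * (l * (G * u)) ^ 2 * ((1 + a) ^ 2 * (c ^ 2 / g m)) := by gcongr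
              _ = _ := by ring
        _ ≤ C * (l * (G * u)) ^ 2 * ((1 + a) ^ 2 * c) * (H * l * (τ / x)) := by
            rw [← Finset.mul_sum]
            gcongr
        _ = (C * 1) * (H * 1) * G ^ 2 * (l ^ 3 * 1) * (u ^ 2 * (1 + a) ^ 2) * (c * τ / x) := by ring
        _ ≤ (C * C) * (H * H) * G ^ 2 * (l ^ 3 * l) * (u ^ 2 * (1 + a) ^ 2) * (c * τ / x) := by
            gcongr
        _ = _ := by ring
    calc _ ≤ l * √((C * H * G * l ^ 2 * (u * (1 + a))) ^ 2 * (c * τ / x)) := by gcongr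
      _ = C * H * (G * 1) * l ^ 3 * (u * ((1 + a) * √(c * τ / x))) := by
          rw [Real.sqrt_mul (by positivity), Real.sqrt_sq (by positivity)]
          ring
      _ ≤ C * H * (G * G) * l ^ 3 * (u * E) := by
          gcongr
          linarith
      _ = _ := by ring
  have c32 : c ^ (3 / 2 : ℝ) = c * √c := by
    rw [Real.sqrt_eq_rpow, show (3 / 2 : ℝ) = 1 + 1 / 2 by norm_num, Real.rpow_add hc,
      Real.rpow_one]
  have b3 : ∑ m ∈ Finset.range n, C * l ^ 2 * (g m)⁻¹ ^ d * stepRate c (g m) (A m) p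
      ≤ (C * H * G ^ 2) * l ^ 3 * (u * E) := by
    calc _ ≤ ∑ m ∈ Finset.range n, C * l ^ 2 * ((1 + a) * p ^ 2 * (c * (g m)⁻¹ ^ d)
          + ((1 + a) * √c * p * (G * u) + (1 + a * (G / x)) * c * (G * u)) * (c * (g m)⁻¹)
          + p * (c * A m * (g m)⁻¹ ^ d)) := by
          refine Finset.sum_le_sum fun m _ => ?_
          have h5 := hgu m
          have h6 := hA m
          have h7 := hgd0 m
          have h8 := hA0 m
          have h9 := inv_pos.2 (hgpos m)
          have h10 := hginv m
          rw [stepRate, c32]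
          calc _ = C * l ^ 2 * ((1 + A m) * p ^ 2 * (c * (g m)⁻¹ ^ d)
              + ((1 + A m) * √c * p * (g m)⁻¹ ^ d
                + (1 + A m * (g m)⁻¹) * c * (g m)⁻¹ ^ d) * (c * (g m)⁻¹)
              + p * (c * A m * (g m)⁻¹ ^ d)) := by ring
            _ ≤ _ := by gcongr
      _ ≤ C * l ^ 2 * ((1 + a) * p ^ 2 * (H * l * κ * u)
          + ((1 + a) * √c * p * (G * u) + (1 + a * (G / x)) * c * (G * u)) * (H * l * (τ / x))
          + p * (H * l * W * u)) := by
          refine le_trans (le_of_eq (b := C * l ^ 2 * ((1 + a) * p ^ 2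
            * ∑ m ∈ Finset.range n, c * (g m)⁻¹ ^ d
            + ((1 + a) * √c * p * (G * u) + (1 + a * (G / x)) * c * (G * u))
              * ∑ m ∈ Finset.range n, c * (g m)⁻¹
            + p * ∑ m ∈ Finset.range n, c * A m * (g m)⁻¹ ^ d)) ?_) ?_
          · simp only [Finset.mul_sum, ← Finset.sum_add_distrib]
          · gcongr
      _ = C * H * l ^ 3 * u * (1 * 1 * ((1 + a) * (κ * p ^ 2)) + G * 1 * ((1 + a) * (√c * p * τ / x))
          + 1 * 1 * (p * W) + G * 1 * (c * τ / x) + G * G * (c * a * τ / x ^ 2)) := by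
          ring
      _ ≤ C * H * l ^ 3 * u * (G * G * ((1 + a) * (κ * p ^ 2))
          + G * G * ((1 + a) * (√c * p * τ / x))
          + G * G * (p * W) + G * G * (c * τ / x) + G * G * (c * a * τ / x ^ 2)) := by
          gcongr
      _ = C * H * G ^ 2 * l ^ 3 * (u * (E - (1 + a) * (c / x) - (1 + a) * √(c * τ / x))) := by
          rw [hE']
          ring
      _ ≤ _ := by
          gcongr
          linarith
  have h0 : 0 ≤ (C * H * G ^ 2) * l ^ 3 * (u * E) := by positivity
  linarith

/-! ### The exceptional events -/

/-- The size of the derivative of the deviation at distance `x` from the unit circle, as predicted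
by Duhamel's formula from the bound `B`. -/
def derivScale (η T : ℝ) (B : ℝ → ℝ) (c p x : ℝ) : ℝ :=
  x⁻¹ * errorScale c x (timeScale η x) (B (x / (2 * (5 + T)))) p (timeScale η x)
    (B (x / (2 * (5 + T))) * timeScale η x)

/-- The size of the deviation after `n` steps at distance `x` from the unit circle, as predicted by
Duhamel's formula from the bound `B` on its derivative. -/
def valueScale (η T : ℝ) (B : ℝ → ℝ) (c p : ℝ) (n : ℕ) (x : ℝ) : ℝ :=
  errorScale c x (timeScale η x) (B (x / (2 * (5 + T)))) p 1
    (∑ m ∈ Finset.range n, c * B (contourGap η T x (c * m) / 2))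

lemma le_errorScale {c x τ A p κ W : ℝ} (hc : 0 ≤ c) (hx : 0 < x) (hτ : x ≤ τ) (hA : 0 ≤ A)
    (hp : 0 ≤ p) (hκ : 0 ≤ κ) (hW : 0 ≤ W) : c ≤ errorScale c x τ A p κ W := by
  have hτ0 : 0 < τ := hx.trans_le hτ
  have h1 : c ≤ c * τ / x := by
    rw [mul_div_assoc]
    exact le_mul_of_one_le_right hc ((one_le_div hx).2 hτ)
  have h2 : 0 ≤ (1 + A) * (c / x + √(c * τ / x) + κ * p ^ 2 + √c * p * τ / x) := by positivity
  have h3 : 0 ≤ p * W := by positivity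
  have h4 : 0 ≤ c * A * τ / x ^ 2 := by positivity
  rw [errorScale]
  linarith

section Point

variable {η Λ T δ : ℝ}

/-- The exceptional event at one point of evaluation, with the bound in closed form. -/
theorem exists_measure_gt_le (hη : η ≤ 1) (hΛ : 0 ≤ Λ) (hT : 0 ≤ T) (hδ : 0 < δ) (hδ1 : δ < 1) :
    ∃ K p₀, 1 ≤ K ∧ 0 < p₀ ∧ ∀ {Ω : Type u} [MeasurableSpace Ω] {μ : Measure Ω}
      [IsProbabilityMeasure μ] {F L : ℂ → ℂ} {c σ : ℝ} {Θ : ℕ → Ω → ℝ} {B : ℝ → ℝ},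
      IsBasicMap F c → c ≤ 1 → IsLogBranch F c Λ L → 0 < σ → IsALE μ F η σ Θ →
      (∀ x y, 0 < x → x ≤ y → B y ≤ B x) → (∀ x, 0 < x → 0 ≤ B x) →
      B (min (Real.exp σ - 1) 1) ≤ p₀ → ∀ (n : ℕ) (x : ℝ) (z : ℂ), c * n ≤ T →
      K * √c ≤ x → x ≤ 1 → ‖z‖ = 1 + x →
      μ {ω | (∀ j < n, (fun k => Θ k ω) ∈ goodSet F c B j) ∧
        (K * (c ^ (-δ)) ^ 3 * derivScale η T B c (B (min (Real.exp σ - 1) 1)) x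
            < ‖z * deriv (deviation F c (fun k => Θ k ω) n) z‖ ∨
          K * (c ^ (-δ)) ^ 3 * valueScale η T B c (B (min (Real.exp σ - 1) 1)) n x
            < ‖deviation F c (fun k => Θ k ω) n z‖)}
        ≤ 8 * ENNReal.ofReal (Real.exp (1 - c ^ (-δ))) := by
  obtain ⟨C, p₀, hC, hp₀, hstep⟩ := exists_stepBound (T := T) hη hΛ hδ hδ1
  obtain ⟨H, hH, hsum⟩ := exists_sum_inv_contourGap_le hη hT hδ
  obtain ⟨K₁, hK₁⟩ : ∃ K₁, K₁ = 7 * (C * (H + T) * (5 + T) ^ 2) := ⟨_, rfl⟩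
  have hK₁0 : 0 ≤ K₁ := by rw [hK₁]; positivity
  obtain ⟨K, hK⟩ : ∃ K, K = K₁ + (5 + T) * (1 + 2 * (2 + Λ * (2 * Real.exp T))) := ⟨_, rfl⟩
  have hΛT : 0 ≤ Λ * (2 * Real.exp T) := by positivity
  have hK1 : 5 + T ≤ K := by
    have : 0 ≤ (5 + T) * (2 * (2 + Λ * (2 * Real.exp T))) := by positivity
    rw [hK]
    linarith
  have hK2 : 2 * (2 + Λ * (2 * Real.exp T)) * (5 + T) ≤ K := by
    rw [hK]
    linarith
  have hKK₁ : K₁ ≤ K := by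
    have : 0 ≤ (5 + T) * (1 + 2 * (2 + Λ * (2 * Real.exp T))) := by positivity
    linarith
  refine ⟨K, p₀, by linarith, hp₀, ?_⟩
  intro Ω _ μ _ F L c σ Θ B hF hc1 hL hσ hA hB hB0 hp n x z hn hcx hx1 hz
  have hc := hF.capacity_pos
  have hsc : 0 < √c := Real.sqrt_pos.2 hc
  have hcs : c ≤ √c := Real.le_sqrt_of_sq_le (by nlinarith)
  have hT5 : 0 < 5 + T := by linarith
  have hxs : √c ≤ x / (5 + T) := by
    rw [le_div_iff₀ hT5, mul_comm]
    exact (mul_le_mul_of_nonneg_right hK1 hsc.le).trans hcx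
  have hcx' : c ^ (1 / 2 : ℝ) ≤ x / (5 + T) := by rwa [← Real.sqrt_eq_rpow]
  have hcx2 : 2 * (2 + Λ * (2 * Real.exp T)) * c ≤ x / (5 + T) := by
    rw [le_div_iff₀ hT5]
    calc _ = 2 * (2 + Λ * (2 * Real.exp T)) * (5 + T) * c := by ring
      _ ≤ K * √c := mul_le_mul hK2 hcs hc.le (by linarith)
      _ ≤ x := hcx
  have hcx3 : c ≤ x := by
    refine hcs.trans (le_trans ?_ hcx)
    exact le_mul_of_one_le_left hsc.le (by linarith)
  have hx : 0 < x := hc.trans_le hcx3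
  have hs : 0 < min (Real.exp σ - 1) 1 := lt_min (by linarith [Real.one_lt_exp_iff.2 hσ]) one_pos
  obtain ⟨p, hpdef⟩ : ∃ p, p = B (min (Real.exp σ - 1) 1) := ⟨_, rfl⟩
  rw [← hpdef] at hp ⊢
  have hp0 : 0 ≤ p := hpdef ▸ hB0 _ hs
  obtain ⟨l, hl⟩ : ∃ l, l = c ^ (-δ) := ⟨_, rfl⟩
  have hl1 : 1 ≤ l := hl ▸ Real.one_le_rpow_of_pos_of_le_one_of_nonpos hc hc1 (by linarith)
  obtain ⟨g, hg⟩ : ∃ g : ℕ → ℝ, ∀ m : ℕ, g m = contourGap η T x (c * m) := ⟨_, fun _ => rfl⟩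
  obtain ⟨A, hAg⟩ : ∃ A : ℕ → ℝ, ∀ m, A m = B (g m / 2) := ⟨_, fun _ => rfl⟩
  have hg0 : g 0 = x / (5 + T) := by
    rw [hg, contourGap]
    simp
  have hg0pos : 0 < g 0 := by rw [hg0]; positivity
  have hgm : ∀ m, g 0 ≤ g m := fun m => by
    rw [hg, hg]
    exact contourGap_mono hη hT (by push_cast; nlinarith [mul_nonneg hc.le m.cast_nonneg (α := ℝ)])
  have hgpos : ∀ m, 0 < g m := fun m => hg0pos.trans_le (hgm m)
  have hA0 : ∀ m, 0 ≤ A m := fun m => by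
    rw [hAg]; exact hB0 _ (half_pos (hgpos m))
  have hAm : ∀ m, A m ≤ A 0 := fun m => by
    rw [hAg, hAg]; exact hB _ _ (half_pos hg0pos) (by linarith [hgm m])
  have hA0' : A 0 = B (x / (2 * (5 + T))) := by
    rw [hAg, hg0]
    congr 1
    field_simp
  obtain ⟨τ, hτ⟩ : ∃ τ, τ = timeScale η x := ⟨_, rfl⟩
  have hτ0 : 0 < τ := hτ ▸ timeScale_pos η hx
  have hsum1 : ∑ m ∈ Finset.range n, c * (g m)⁻¹ ≤ (H + T) * l * (τ / x) := by
    have h1 := hsum c x n hc hc1 hcx3 hx1 hn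
    simp only [← hg, ← hl, ← hτ] at h1
    refine h1.trans ?_
    gcongr
    linarith
  have hkey : ∀ d ≤ 1, ∀ κ W : ℝ, 0 ≤ κ → 0 ≤ W →
      ∑ m ∈ Finset.range n, c * (g m)⁻¹ ^ d ≤ (H + T) * l * κ * x⁻¹ ^ d →
      ∑ m ∈ Finset.range n, c * A m * (g m)⁻¹ ^ d ≤ (H + T) * l * W * x⁻¹ ^ d →
      μ {ω | (∀ j < n, (fun k => Θ k ω) ∈ goodSet F c B j) ∧ ∃ a,
        HasLaurent (deviation F c (fun k => Θ k ω) n) a ∧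
        K * l ^ 3 * (x⁻¹ ^ d * errorScale c x τ (A 0) p κ W)
          < ‖evolved η (Real.exp σ)⁻¹ d 0 a z‖} ≤ 4 * ENNReal.ofReal (Real.exp (1 - l)) := by
    intro d hd κ W hκ hW h2 h3
    have h4 := fluctuation_add_drift_le hc hx hl1 hC (by linarith : 1 ≤ 5 + T)
      (by linarith : 1 ≤ H + T) hτ0.le hκ hW hp0 hg0 hgm hA0 hAm hd hsum1 h2 h3
    refine le_trans (measure_mono ?_) (measure_evolved_gt_le hη hT hΛ hC hstep hF hc1 hL hσ hA hB
      hB0 hpdef.ge hp hn hd hx hx1 hcx' hcx2 hz hg hAg (l := l) rfl rfl rfl)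
    rintro ω ⟨hgo, a, ha, hlt⟩
    refine ⟨hgo, a, ha, lt_of_le_of_lt ?_ hlt⟩
    rw [← hl]
    refine h4.trans ?_
    rw [← hK₁]
    have hE : 0 ≤ errorScale c x τ (A 0) p κ W := by
      have := hA0 0
      rw [errorScale]
      positivity
    gcongr
  have hsub : {ω | (∀ j < n, (fun k => Θ k ω) ∈ goodSet F c B j) ∧
        (K * l ^ 3 * derivScale η T B c p x
            < ‖z * deriv (deviation F c (fun k => Θ k ω) n) z‖ ∨
          K * l ^ 3 * valueScale η T B c p n x
            < ‖deviation F c (fun k => Θ k ω) n z‖)}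
      ⊆ {ω | (∀ j < n, (fun k => Θ k ω) ∈ goodSet F c B j) ∧ ∃ a,
        HasLaurent (deviation F c (fun k => Θ k ω) n) a ∧
        K * l ^ 3 * (x⁻¹ ^ 1 * errorScale c x τ (A 0) p τ (A 0 * τ))
          < ‖evolved η (Real.exp σ)⁻¹ 1 0 a z‖} ∪
        {ω | (∀ j < n, (fun k => Θ k ω) ∈ goodSet F c B j) ∧ ∃ a,
        HasLaurent (deviation F c (fun k => Θ k ω) n) a ∧
        K * l ^ 3 * (x⁻¹ ^ 0 * errorScale c x τ (A 0) p 1 (∑ m ∈ Finset.range n, c * A m))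
          < ‖evolved η (Real.exp σ)⁻¹ 0 0 a z‖} := by
    have hz1 : z ∈ exteriorDisk := by rw [mem_exteriorDisk]; linarith
    rintro ω ⟨hgo, h⟩
    obtain ⟨a, ha, ha'⟩ := (isExt_deviation hF hc1 hΛ hL (fun k => Θ k ω) hn).exists_hasLaurent
    rcases h with h | h
    · refine Or.inl ⟨hgo, a, ha, ?_⟩
      rw [evolved_one_zero ha' _ _ hz1, norm_neg, pow_one, hA0', hτ]
      exact h
    · refine Or.inr ⟨hgo, a, ha, ?_⟩
      rw [evolved_zero_zero ha _ _ hz1, pow_zero, one_mul, hA0', hτ]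
      simp only [hAg, hg]
      exact h
  rw [← hl]
  refine (measure_mono hsub).trans ((measure_union_le _ _).trans ?_)
  have h1 := hkey 1 le_rfl τ (A 0 * τ) hτ0.le (mul_nonneg (hA0 0) hτ0.le)
    (by
      simp only [pow_one]
      exact hsum1.trans_eq (by ring))
    (by
      simp only [pow_one]
      calc _ ≤ ∑ m ∈ Finset.range n, A 0 * (c * (g m)⁻¹) := by
            refine Finset.sum_le_sum fun m _ => ?_
            have h2 := hAm m
            have h3 := inv_pos.2 (hgpos m)
            calc c * A m * (g m)⁻¹ ≤ c * A 0 * (g m)⁻¹ := by gcongr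
              _ = _ := by ring
        _ ≤ A 0 * ((H + T) * l * (τ / x)) := by
            rw [← Finset.mul_sum]
            exact mul_le_mul_of_nonneg_left hsum1 (hA0 0)
        _ = _ := by ring)
  have hHl : 1 ≤ H * l := by nlinarith
  have h2 := hkey 0 zero_le_one 1 (∑ m ∈ Finset.range n, c * A m) zero_le_one
    (Finset.sum_nonneg fun m _ => mul_nonneg hc.le (hA0 m))
    (by
      simp only [pow_zero, mul_one, Finset.sum_const, Finset.card_range, nsmul_eq_mul]
      have h3 : 0 ≤ H * l := by linarith
      have h4 : T * 1 ≤ T * l := by gcongr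
      linarith)
    (by
      simp only [pow_zero, mul_one]
      have h3 : 0 ≤ ∑ m ∈ Finset.range n, c * A m :=
        Finset.sum_nonneg fun m _ => mul_nonneg hc.le (hA0 m)
      have h4 : 0 ≤ T * l := by positivity
      exact le_mul_of_one_le_left h3 (by linarith))
  calc _ ≤ 4 * ENNReal.ofReal (Real.exp (1 - l)) + 4 * ENNReal.ofReal (Real.exp (1 - l)) :=
        add_le_add h1 h2
    _ = _ := by
      rw [← add_mul]
      norm_num

end Point

section Mesh

/-- A bound at sufficiently many points of a circle gives a bound outside of it. -/
lemma IsExt.norm_le_of_mesh {f : ℂ → ℂ} (hf : IsExt f) {r D Q e : ℝ} {N : ℕ} (hr : 0 < r)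
    (hN : 0 < N) (he : (1 + r) * (2 * Real.pi / N) ≤ e) (her : e ≤ r / 2)
    (hD : ∀ w : ℂ, 1 + r / 2 ≤ ‖w‖ → ‖_root_.deriv f w‖ ≤ D)
    (hQ : ∀ k < N, ‖f (circleMap 0 (1 + r) (k * (2 * Real.pi / N)))‖ ≤ Q) {z : ℂ}
    (hz : 1 + r ≤ ‖z‖) : ‖f z‖ ≤ Q + D * e := by
  refine hf.norm_le (by linarith) (fun w hw => ?_) hz
  have hpi : 0 < 2 * Real.pi := by positivity
  have hN0 : (0:ℝ) < N := by exact_mod_cast hN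
  obtain ⟨φ, hφ0, hφ1, rfl⟩ : ∃ φ, 0 ≤ φ ∧ φ < 2 * Real.pi ∧ circleMap 0 (1 + r) φ = w := by
    refine ⟨toIcoMod hpi 0 (Complex.arg w), (toIcoMod_mem_Ico' hpi _).1,
      (toIcoMod_mem_Ico' hpi _).2, ?_⟩
    have h1 : circleMap 0 (1 + r) (Complex.arg w) = w := by
      have := Complex.norm_mul_exp_arg_mul_I w
      rw [hw] at this
      simpa [circleMap] using this
    rw [toIcoMod, (periodic_circleMap 0 (1 + r)).sub_zsmul_eq, h1]
  obtain ⟨k, hk⟩ : ∃ k : ℕ, k = ⌊φ / (2 * Real.pi / N)⌋₊ := ⟨_, rfl⟩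
  have hstep : 0 < 2 * Real.pi / N := by positivity
  have hkN : k < N := by
    rw [hk, Nat.floor_lt (by positivity), div_lt_iff₀ hstep]
    calc φ < 2 * Real.pi := hφ1
      _ = N * (2 * Real.pi / N) := by field_simp
  have h1 : k * (2 * Real.pi / N) ≤ φ := by
    rw [← le_div_iff₀ hstep, hk]
    exact Nat.floor_le (by positivity)
  have h2 : φ < (k + 1) * (2 * Real.pi / N) := by
    rw [← div_lt_iff₀ hstep, hk]
    exact Nat.lt_floor_add_one _
  set w₀ := circleMap 0 (1 + r) (k * (2 * Real.pi / N)) with hw₀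
  have hd : ‖circleMap 0 (1 + r) φ - w₀‖ ≤ e := by
    have h3 := (lipschitzWith_circleMap 0 (1 + r)).norm_sub_le φ (k * (2 * Real.pi / N))
    rw [Real.coe_nnabs, abs_of_pos (by linarith), Real.norm_of_nonneg (by linarith)] at h3
    refine h3.trans (le_trans ?_ he)
    gcongr
    linarith
  have hball : ∀ y ∈ Metric.closedBall w₀ e, 1 + r / 2 ≤ ‖y‖ := fun y hy => by
    have h3 : ‖y - w₀‖ ≤ e := by simpa [dist_eq_norm] using hy
    have h4 := norm_sub_norm_le w₀ y
    rw [norm_sub_rev, hw₀, norm_circleMap (by linarith)] at h4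
    linarith
  have h3 := (convex_closedBall w₀ e).norm_image_sub_le_of_norm_deriv_le (𝕜 := ℂ) (f := f)
    (fun y hy => hf.differentiableOn.differentiableAt (isOpen_exteriorDisk.mem_nhds
      (by rw [mem_exteriorDisk]; linarith [hball y hy]))) (fun y hy => hD y (hball y hy))
    (Metric.mem_closedBall_self ((norm_nonneg _).trans hd)) (by simpa [dist_eq_norm] using hd)
  have h4 : 0 ≤ D := (norm_nonneg _).trans (hD w₀ (hball _
    (Metric.mem_closedBall_self ((norm_nonneg _).trans hd))))
  have h5 := norm_sub_norm_le (f (circleMap 0 (1 + r) φ)) (f w₀)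
  have h6 : D * ‖circleMap 0 (1 + r) φ - w₀‖ ≤ D * e := by gcongr
  linarith [hQ k hkN]

/-- For an analytic function with a global bound, a mesh of size `N` resolves the function and its
derivative. -/
lemma IsExt.norm_le_of_mesh_of_bounded {f : ℂ → ℂ} (hf : IsExt f) {M c r Q Q' : ℝ} {N : ℕ}
    (hM : ∀ z ∈ exteriorDisk, ‖f z‖ ≤ M) (hc : 0 < c) (hc1 : c ≤ 1) (hr : 26 * √c ≤ r)
    (hr1 : r ≤ 1) (hN : (c ^ 3)⁻¹ ≤ N)
    (hQ : ∀ k < N, ‖f (circleMap 0 (1 + r) (k * (2 * Real.pi / N)))‖ ≤ Q)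
    (hQ' : ∀ k < N, ‖circleMap 0 (1 + r) (k * (2 * Real.pi / N))
      * _root_.deriv f (circleMap 0 (1 + r) (k * (2 * Real.pi / N)))‖ ≤ Q') {z : ℂ}
    (hz : 1 + r ≤ ‖z‖) :
    ‖f z‖ ≤ Q + 416 * M * c ∧ ‖_root_.deriv f z‖ ≤ Q' + 416 * M * c := by
  have hs : 0 < √c := Real.sqrt_pos.2 hc
  have hcs : c ≤ √c := Real.le_sqrt_of_sq_le (by nlinarith)
  have hr0 : 0 < r := by linarith
  have hN0 : (0:ℝ) < N := lt_of_lt_of_le (by positivity) hN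
  have hM0 : 0 ≤ M := (norm_nonneg _).trans (hM z (by rw [mem_exteriorDisk]; linarith))
  have hNinv : 1 / (N:ℝ) ≤ c ^ 3 := by
    rw [one_div]
    exact inv_le_of_inv_le₀ (by positivity) hN
  have he : (1 + r) * (2 * Real.pi / N) ≤ 13 * c ^ 3 := by
    have hpi := Real.pi_lt_d2
    calc (1 + r) * (2 * Real.pi / N) = (1 + r) * (2 * Real.pi) * (1 / N) := by ring
      _ ≤ (1 + 1) * (2 * 3.15) * c ^ 3 := by gcongr
      _ ≤ _ := by
        have : 0 ≤ c ^ 3 := by positivity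
        linarith
  have her : 13 * c ^ 3 ≤ r / 2 := by
    have : c ^ 3 ≤ c := by
      calc c ^ 3 ≤ c ^ 1 := pow_le_pow_of_le_one hc.le hc1 (by norm_num)
        _ = c := pow_one c
    linarith
  have hcr : c ≤ r ^ 2 := by
    have h1 : √c ≤ r := by linarith
    calc c = √c ^ 2 := (Real.sq_sqrt hc.le).symm
      _ ≤ r ^ 2 := by gcongr
  have hd1 : ∀ w : ℂ, 1 + r / 4 ≤ ‖w‖ → ‖_root_.deriv f w‖ ≤ 8 * M / r := fun w hw => by
    have := norm_deriv_le_of_norm_le hf.differentiableOn (by linarith : 0 < r / 8)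
      (by linarith : 0 < r / 8)
      (fun z hz => hM z (by rw [mem_exteriorDisk]; linarith)) (z := w) (by linarith)
    refine this.trans (le_of_eq ?_)
    field_simp
  have hd2 : ∀ w : ℂ, 1 + r / 2 ≤ ‖w‖ → ‖_root_.deriv (_root_.deriv f) w‖ ≤ 32 * M / r ^ 2 :=
    fun w hw => by
    have := norm_deriv_le_of_norm_le hf.deriv.differentiableOn (by linarith : 0 < r / 4)
      (by linarith : 0 < r / 4) hd1 (z := w) (by linarith)
    refine this.trans (le_of_eq ?_)
    field_simp
    ring
  have hd1' : ∀ w : ℂ, 1 + r / 2 ≤ ‖w‖ → ‖_root_.deriv f w‖ ≤ 32 * M / r ^ 2 := fun w hw => by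
    refine (hd1 w (by linarith)).trans ?_
    rw [div_le_div_iff₀ hr0 (by positivity)]
    have : M * r * r ≤ M * r * 1 := by gcongr
    nlinarith [mul_nonneg hM0 hr0.le]
  have herr : 32 * M / r ^ 2 * (13 * c ^ 3) ≤ 416 * M * c := by
    calc 32 * M / r ^ 2 * (13 * c ^ 3) = 416 * M * (c / r ^ 2) * c * c := by ring
      _ ≤ 416 * M * 1 * c * 1 := by
          gcongr
          exact (div_le_one (by positivity)).2 hcr
      _ = _ := by ring
  have hN0' : 0 < N := by exact_mod_cast hN0
  refine ⟨(hf.norm_le_of_mesh hr0 hN0' he her hd1' hQ hz).trans (by linarith),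
    (hf.deriv.norm_le_of_mesh hr0 hN0' he her hd2 (fun k hk => ?_) hz).trans
      (by linarith : Q' + 32 * M / r ^ 2 * (13 * c ^ 3) ≤ _)⟩
  refine le_trans ?_ (hQ' k hk)
  rw [norm_mul, norm_circleMap (by linarith)]
  exact le_mul_of_one_le_left (norm_nonneg _) (by linarith)

end Mesh

/-- The total probability of polynomially many exceptional events is smaller than any power. -/
lemma exists_tail_lt (T : ℝ) (hT : 0 ≤ T) {δ : ℝ} (hδ : 0 < δ) (m : ℕ) :
    ∃ c₀ > 0, ∀ c : ℝ, 0 < c → c ≤ c₀ → c ≤ 1 →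
      48 * (T + 1) * (c ^ 5)⁻¹ * Real.exp (1 - c ^ (-δ)) < c ^ m := by
  obtain ⟨k, hk⟩ := exists_nat_ge ((6 + m) / δ)
  obtain ⟨Q, hQ⟩ : ∃ Q, Q = 48 * (T + 1) * Real.exp 1 * k.factorial := ⟨_, rfl⟩
  have hQ0 : 0 < Q := by
    have : (0:ℝ) < k.factorial := by exact_mod_cast k.factorial_pos
    rw [hQ]
    positivity
  refine ⟨(Q + 1)⁻¹, by positivity, fun c hc hcc hc1 => ?_⟩
  obtain ⟨l, hl⟩ : ∃ l, l = c ^ (-δ) := ⟨_, rfl⟩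
  have hl0 : 0 < l := hl ▸ Real.rpow_pos_of_pos hc _
  have hlk : (l ^ k)⁻¹ ≤ c ^ (6 + m) := by
    rw [hl, ← Real.rpow_natCast, ← Real.rpow_mul hc.le, ← Real.rpow_neg hc.le,
      ← Real.rpow_natCast c (6 + m)]
    refine Real.rpow_le_rpow_of_exponent_ge hc hc1 ?_
    rw [div_le_iff₀ hδ] at hk
    push_cast
    linarith
  have hexp : Real.exp (1 - l) ≤ Real.exp 1 * k.factorial * c ^ (6 + m) := by
    have h1 := Real.pow_div_factorial_le_exp l hl0.le k
    rw [Real.exp_sub, div_le_iff₀ (Real.exp_pos _)]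
    have hf : (0:ℝ) < k.factorial := by exact_mod_cast k.factorial_pos
    have h2 : 1 ≤ k.factorial * c ^ (6 + m) * Real.exp l := by
      calc (1:ℝ) = k.factorial * (l ^ k)⁻¹ * (l ^ k / k.factorial) := by field_simp
        _ ≤ _ := by gcongr
    calc Real.exp 1 = Real.exp 1 * 1 := (mul_one _).symm
      _ ≤ Real.exp 1 * (k.factorial * c ^ (6 + m) * Real.exp l) := by gcongr
      _ = _ := by ring
  rw [← hl]
  calc _ ≤ 48 * (T + 1) * (c ^ 5)⁻¹ * (Real.exp 1 * k.factorial * c ^ (6 + m)) := by gcongr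
    _ = Q * c * c ^ m := by
        rw [hQ, pow_add]
        field_simp
    _ < 1 * c ^ m := by
        have h1 : c * (Q + 1) ≤ 1 := by
          have := mul_le_mul_of_nonneg_right hcc (by linarith : 0 ≤ Q + 1)
          rwa [inv_mul_cancel₀ (by linarith)] at this
        have : Q * c < 1 := by linarith
        gcongr
    _ = _ := one_mul _

/-! ### The bootstrap -/

/-- If the bound `B` on the derivative of the deviation reproduces itself under Duhamel's formula at
all distances in `[r₁, 1]`, and follows from the deterministic bound at smaller distances, then it
holds at all times with high probability, and so does the resulting bound on the deviation. -/
theorem exists_event {η Λ T δ : ℝ} (hη : η ≤ 1) (hΛ : 0 ≤ Λ) (hT : 0 ≤ T) (hδ : 0 < δ)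
    (hδ1 : δ < 1) (m : ℕ) :
    ∃ K p₀ c₀, 1 ≤ K ∧ 0 < p₀ ∧ 0 < c₀ ∧ ∀ {Ω : Type u} [MeasurableSpace Ω] {μ : Measure Ω}
      [IsProbabilityMeasure μ] {F : ℂ → ℂ} {c σ r₁ : ℝ} {Θ : ℕ → Ω → ℝ} {B : ℝ → ℝ},
      IsBasicMap F c → c ≤ 1 → HasRegularity F c Λ → 0 < σ → IsALE μ F η σ Θ → c ≤ c₀ →
      (∀ x y, 0 < x → x ≤ y → B y ≤ B x) → (∀ x, 0 < x → 0 ≤ B x) →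
      B (min (Real.exp σ - 1) 1) ≤ p₀ → K * √c ≤ r₁ → r₁ ≤ 1 →
      (∀ x, 0 < x → x < r₁ → K / x ≤ B x) →
      (∀ x, r₁ ≤ x → x ≤ 1 → K * (c ^ (-δ)) ^ 3
        * derivScale η T B c (B (min (Real.exp σ - 1) 1)) x ≤ B (2 * x)) →
      ∃ Ω₁ : Set Ω, MeasurableSet Ω₁ ∧ 1 - c ^ m < μ.real Ω₁ ∧ ∀ ω ∈ Ω₁, ∀ n : ℕ, c * n ≤ T →
        ∀ x, r₁ ≤ x → x ≤ 1 → ∃ x', r₁ ≤ x' ∧ x' ≤ x ∧ x ≤ 2 * x' ∧ ∀ z : ℂ, 1 + x ≤ ‖z‖ →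
          ‖deviation F c (fun k => Θ k ω) n z‖ ≤ K * (c ^ (-δ)) ^ 3
            * valueScale η T B c (B (min (Real.exp σ - 1) 1)) n x' := by
  obtain ⟨K₀, p₀, hK₀, hp₀, hpt⟩ := exists_measure_gt_le.{u} hη hΛ hT hδ hδ1
  obtain ⟨c₀, hc₀, htail⟩ := exists_tail_lt T hT hδ m
  obtain ⟨M, hM⟩ : ∃ M, M = |aprioriConst Λ T| := ⟨_, rfl⟩
  have hM0 : 0 ≤ M := hM ▸ abs_nonneg _
  obtain ⟨K, hK⟩ : ∃ K, K = K₀ + 26 + 416 * M := ⟨_, rfl⟩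
  refine ⟨K, p₀, c₀, by linarith, hp₀, hc₀, ?_⟩
  intro Ω _ μ _ F c σ r₁ Θ B hF hc1 hreg hσ hA hcc hB hB0 hp hr₁ hr₁1 hsmall hself
  have hc := hF.capacity_pos
  obtain ⟨L, hL⟩ := hreg.exists_logBranch hF hc1 hΛ
  have hsc : 0 < √c := Real.sqrt_pos.2 hc
  have hcs : c ≤ √c := Real.le_sqrt_of_sq_le (by nlinarith)
  have hKs : ∀ k ≤ K, k * √c ≤ r₁ := fun k hk => (mul_le_mul_of_nonneg_right hk hsc.le).trans hr₁
  have hcr : c ≤ r₁ := hcs.trans ((one_mul √c).ge.trans (hKs 1 (by linarith)))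
  have hr0 : 0 < r₁ := hc.trans_le hcr
  obtain ⟨p, hpdef⟩ : ∃ p, p = B (min (Real.exp σ - 1) 1) := ⟨_, rfl⟩
  rw [← hpdef] at hself ⊢
  have hp0 : 0 ≤ p :=
    hpdef ▸ hB0 _ (lt_min (by linarith [Real.one_lt_exp_iff.2 hσ]) one_pos)
  obtain ⟨l, hl⟩ : ∃ l, l = c ^ (-δ) := ⟨_, rfl⟩
  have hl1 : 1 ≤ l := hl ▸ Real.one_le_rpow_of_pos_of_le_one_of_nonpos hc hc1 (by linarith)
  obtain ⟨N, hN⟩ : ∃ N, N = ⌈(c ^ 3)⁻¹⌉₊ := ⟨_, rfl⟩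
  have hdisk : ∀ θ : ℕ → ℝ, ∀ n : ℕ, c * n ≤ T → ∀ z ∈ exteriorDisk,
      ‖deviation F c θ n z‖ ≤ M := fun θ n hn z hz =>
    (norm_deviation_le hF hc1 hΛ hL θ hn hz).trans (hM ▸ le_abs_self _)
  -- the exceptional event at time `n`, distance `r₁ 2^i` and the `k`-th point of the mesh
  set E : ℕ × ℕ × ℕ → Set Ω := fun q => {ω | c * q.1 ≤ T ∧ r₁ * 2 ^ q.2.1 ≤ 1 ∧
    (∀ j < q.1, (fun k => Θ k ω) ∈ goodSet F c B j) ∧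
    (K₀ * l ^ 3 * derivScale η T B c p (r₁ * 2 ^ q.2.1)
        < ‖circleMap 0 (1 + r₁ * 2 ^ q.2.1) (q.2.2 * (2 * Real.pi / N))
          * deriv (deviation F c (fun k => Θ k ω) q.1)
            (circleMap 0 (1 + r₁ * 2 ^ q.2.1) (q.2.2 * (2 * Real.pi / N)))‖ ∨
      K₀ * l ^ 3 * valueScale η T B c p q.1 (r₁ * 2 ^ q.2.1)
        < ‖deviation F c (fun k => Θ k ω) q.1
          (circleMap 0 (1 + r₁ * 2 ^ q.2.1) (q.2.2 * (2 * Real.pi / N)))‖)} with hE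
  have hr2 : ∀ i : ℕ, r₁ ≤ r₁ * 2 ^ i := fun i =>
    le_mul_of_one_le_right hr0.le (one_le_pow₀ one_le_two)
  have hEle : ∀ q, μ (E q) ≤ 8 * ENNReal.ofReal (Real.exp (1 - l)) := by
    rintro ⟨n, i, k⟩
    by_cases h : c * n ≤ T ∧ r₁ * 2 ^ i ≤ 1
    · have h1 := hpt hF hc1 hL hσ hA hB hB0 hp n (r₁ * 2 ^ i)
        (circleMap 0 (1 + r₁ * 2 ^ i) (k * (2 * Real.pi / N))) h.1
        ((hKs K₀ (by linarith)).trans (hr2 i)) h.2 (norm_circleMap (by linarith [hr2 i]) _)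
      rw [← hpdef, ← hl] at h1
      refine le_trans (measure_mono ?_) h1
      exact fun ω hω => ⟨hω.2.2.1, hω.2.2.2⟩
    · have : E (n, i, k) = ∅ := Set.eq_empty_of_forall_notMem fun ω hω => h ⟨hω.1, hω.2.1⟩
      rw [this, measure_empty]
      exact zero_le
  set S : Finset (ℕ × ℕ × ℕ) :=
    Finset.range (⌊T / c⌋₊ + 1) ×ˢ Finset.range (⌈1 / c⌉₊ + 1) ×ˢ Finset.range N with hS
  have hcard : (S.card : ℝ) ≤ 6 * (T + 1) * (c ^ 5)⁻¹ := by
    have hc' : 1 ≤ 1 / c := (one_le_div hc).2 hc1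
    have hc3 : 1 ≤ (c ^ 3)⁻¹ := (one_le_inv₀ (by positivity)).2 (pow_le_one₀ hc.le hc1)
    have h1 : ((⌊T / c⌋₊ + 1 : ℕ) : ℝ) ≤ (T + 1) * (1 / c) := by
      have := Nat.floor_le (by positivity : 0 ≤ T / c)
      push_cast
      have e : T / c = T * (1 / c) := by ring
      linarith
    have h2 : ((⌈1 / c⌉₊ + 1 : ℕ) : ℝ) ≤ 3 * (1 / c) := by
      have := Nat.ceil_lt_add_one (by positivity : 0 ≤ 1 / c)
      push_cast
      linarith
    have h3 : (N : ℝ) ≤ 2 * (c ^ 3)⁻¹ := by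
      have := Nat.ceil_lt_add_one (by positivity : 0 ≤ (c ^ 3)⁻¹)
      rw [hN]
      linarith
    rw [hS, Finset.card_product, Finset.card_product, Finset.card_range, Finset.card_range,
      Finset.card_range, Nat.cast_mul, Nat.cast_mul]
    calc _ ≤ (T + 1) * (1 / c) * (3 * (1 / c) * (2 * (c ^ 3)⁻¹)) := by gcongr
      _ = _ := by
        field_simp
        norm_num
  set bad : Set Ω := ⋃ q ∈ S, E q with hbad
  have hμbad : μ bad < ENNReal.ofReal (c ^ m) := by
    calc μ bad ≤ ∑ q ∈ S, μ (E q) := measure_biUnion_finset_le _ _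
      _ ≤ ∑ _q ∈ S, 8 * ENNReal.ofReal (Real.exp (1 - l)) := Finset.sum_le_sum fun q _ => hEle q
      _ = ENNReal.ofReal (S.card * (8 * Real.exp (1 - l))) := by
          rw [Finset.sum_const, nsmul_eq_mul, ENNReal.ofReal_mul (by positivity),
            ENNReal.ofReal_mul (by norm_num), ENNReal.ofReal_natCast, ENNReal.ofReal_ofNat]
      _ < _ := by
          rw [ENNReal.ofReal_lt_ofReal_iff (by positivity)]
          refine lt_of_le_of_lt ?_ (htail c hc hcc hc1)
          rw [← hl]
          calc S.card * (8 * Real.exp (1 - l))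
              ≤ 6 * (T + 1) * (c ^ 5)⁻¹ * (8 * Real.exp (1 - l)) := by gcongr
            _ = _ := by ring
  refine ⟨(toMeasurable μ bad)ᶜ, (measurableSet_toMeasurable μ bad).compl, ?_, ?_⟩
  · rw [probReal_compl_eq_one_sub (measurableSet_toMeasurable μ bad), measureReal_def,
      measure_toMeasurable]
    have : (μ bad).toReal < c ^ m := by
      rw [ENNReal.lt_ofReal_iff_toReal_lt (measure_ne_top μ bad)] at hμbad
      exact hμbad
    linarith
  intro ω hω
  have hω' : ω ∉ bad := fun h => hω (subset_toMeasurable μ bad h)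
  obtain ⟨θ, hθ⟩ : ∃ θ : ℕ → ℝ, θ = fun k => Θ k ω := ⟨_, rfl⟩
  rw [← hθ]
  -- outside the exceptional events, a good past gives bounds on the dyadic circles
  have hdyad : ∀ n : ℕ, c * n ≤ T → (∀ j < n, θ ∈ goodSet F c B j) → ∀ x, r₁ ≤ x → x ≤ 1 →
      ∃ x', r₁ ≤ x' ∧ x' ≤ x ∧ x ≤ 2 * x' ∧ ∀ z : ℂ, 1 + x ≤ ‖z‖ →
        ‖deviation F c θ n z‖ ≤ K * l ^ 3 * valueScale η T B c p n x' ∧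
        ‖deriv (deviation F c θ n) z‖ ≤ K * l ^ 3 * derivScale η T B c p x' := by
    intro n hn hgo x hx hx1
    obtain ⟨i, hi1, hi2⟩ := exists_nat_pow_near ((one_le_div hr0).2 hx) one_lt_two
    rw [le_div_iff₀ hr0, mul_comm] at hi1
    rw [div_lt_iff₀ hr0] at hi2
    have hi3 : r₁ * 2 ^ i ≤ 1 := hi1.trans hx1
    refine ⟨r₁ * 2 ^ i, hr2 i, hi1, ?_, fun z hz => ?_⟩
    · calc x ≤ 2 ^ (i + 1) * r₁ := hi2.le
        _ = _ := by ring
    have hq : ∀ k < N, ω ∉ E (n, i, k) := by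
      intro k hk hmem
      refine hω' (Set.mem_iUnion₂.2 ⟨(n, i, k), ?_, hmem⟩)
      simp only [hS, Finset.mem_product, Finset.mem_range]
      refine ⟨Nat.lt_succ_of_le (Nat.le_floor ?_), ?_, hk⟩
      · rw [le_div_iff₀ hc]
        linarith
      · have h1 : (i : ℝ) ≤ 1 / c := by
          have h2 : (i : ℝ) < 2 ^ i := by exact_mod_cast Nat.lt_two_pow_self
          have h3 : (2 : ℝ) ^ i ≤ 1 / c := by
            rw [le_div_iff₀ hc]
            calc (2 : ℝ) ^ i * c ≤ 2 ^ i * r₁ := by gcongr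
              _ = r₁ * 2 ^ i := mul_comm _ _
              _ ≤ 1 := hi3
          linarith
        have h2 : i ≤ ⌈1 / c⌉₊ := by exact_mod_cast h1.trans (Nat.le_ceil _)
        omega
    have hq' : ∀ k < N,
        ‖circleMap 0 (1 + r₁ * 2 ^ i) (k * (2 * Real.pi / N))
          * deriv (deviation F c θ n) (circleMap 0 (1 + r₁ * 2 ^ i) (k * (2 * Real.pi / N)))‖
          ≤ K₀ * l ^ 3 * derivScale η T B c p (r₁ * 2 ^ i) ∧
        ‖deviation F c θ n (circleMap 0 (1 + r₁ * 2 ^ i) (k * (2 * Real.pi / N)))‖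
          ≤ K₀ * l ^ 3 * valueScale η T B c p n (r₁ * 2 ^ i) := by
      intro k hk
      have h1 := hq k hk
      by_contra h2
      refine h1 ⟨hn, hi3, fun j hj => hθ ▸ hgo j hj, ?_⟩
      rw [← hθ]
      rw [not_and_or, not_le, not_le] at h2
      exact h2
    have hmesh := (isExt_deviation hF hc1 hΛ hL θ hn).norm_le_of_mesh_of_bounded
      (hdisk θ n hn) hc hc1 ((hKs 26 (by linarith)).trans (hr2 i)) hi3 (hN ▸ Nat.le_ceil _)
      (fun k hk => (hq' k hk).2) (fun k hk => (hq' k hk).1) (z := z) (by linarith)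
    have hx' : 0 < r₁ * 2 ^ i := hr0.trans_le (hr2 i)
    have hBx := hB0 (r₁ * 2 ^ i / (2 * (5 + T))) (by positivity)
    have hτ := timeScale_pos η hx'
    have hv : c ≤ valueScale η T B c p n (r₁ * 2 ^ i) := by
      refine le_errorScale hc.le hx' (le_timeScale η hi3) hBx hp0 zero_le_one
        (Finset.sum_nonneg fun m _ => mul_nonneg hc.le (hB0 _ ?_))
      exact half_pos ((contourGap_pos hη hx' (t := 0) le_rfl hT).trans_le
        (contourGap_mono hη hT (by positivity)))
    have hd : c ≤ derivScale η T B c p (r₁ * 2 ^ i) := by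
      have h1 := le_errorScale hc.le hx' (le_timeScale η hi3) hBx hp0 hτ.le
        (mul_nonneg hBx hτ.le)
      refine h1.trans (le_mul_of_one_le_left (hc.le.trans h1) ((one_le_inv₀ hx').2 hi3))
    have hadd : ∀ s, c ≤ s → K₀ * l ^ 3 * s + 416 * M * c ≤ K * l ^ 3 * s := fun s hs => by
      have h1 : 416 * M * c ≤ 416 * M * (l ^ 3 * s) := by
        have h2 : 1 * s ≤ l ^ 3 * s :=
          mul_le_mul_of_nonneg_right (one_le_pow₀ hl1) (hc.le.trans hs)
        exact mul_le_mul_of_nonneg_left (by linarith) (by positivity)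
      have h3 : 0 ≤ 26 * (l ^ 3 * s) := by
        have := hc.le.trans hs
        positivity
      calc _ ≤ K₀ * l ^ 3 * s + 416 * M * (l ^ 3 * s) + 26 * (l ^ 3 * s) := by linarith
        _ = _ := by
          rw [hK]
          ring
    exact ⟨hmesh.1.trans (hadd _ hv), hmesh.2.trans (hadd _ hd)⟩
  have hgood : ∀ n : ℕ, c * n ≤ T → θ ∈ goodSet F c B n := by
    intro n
    induction n using Nat.strong_induction_on with
    | _ n ih =>
      intro hn x hx hx1 z hz
      have hgo : ∀ j < n, θ ∈ goodSet F c B j := fun j hj => ih j hj (le_trans (by gcongr) hn)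
      rw [deriv_clusterMap_eq hF hc1 hΛ hL hn (by rw [mem_exteriorDisk]; linarith),
        add_sub_cancel_left]
      rcases lt_or_ge x r₁ with h | h
      · have h1 := norm_deriv_le_of_norm_le (isExt_deviation hF hc1 hΛ hL θ hn).differentiableOn
          (half_pos hx) (half_pos hx)
          (fun z hz => hdisk θ n hn z (by rw [mem_exteriorDisk]; linarith)) (z := z) (by linarith)
        refine h1.trans (le_trans ?_ (hsmall x hx h))
        calc M / (x / 2) = 2 * M / x := by field_simp
          _ ≤ K / x := by
            gcongr
            linarith
      · obtain ⟨x', h1, h2, h3, h4⟩ := hdyad n hn hgo x h hx1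
        have h5 := hself x' h1 (h2.trans hx1)
        rw [← hl] at h5
        exact (h4 z hz).2.trans (h5.trans (hB _ _ hx h3))
  intro n hn x hx hx1
  obtain ⟨x', h1, h2, h3, h4⟩ := hdyad n hn
    (fun j hj => hgood j (le_trans (by gcongr) hn)) x hx hx1
  exact ⟨x', h1, h2, h3, fun z hz => hl ▸ (h4 z hz).1⟩

/-! ### The self-reproducing bound -/

/-- The bound on the derivative of the deviation at distance `x` from the unit circle. The first
factor is the expected size: the fluctuations are of order `x^(-α)` and the drift caused by the
feedback through the attachment density is of order `x^(2 - 2α)`. The second factor interpolates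
between the distance `r₀` and the smaller distances, at which only a deterministic bound is
available. -/
def boundProfile (a b α r₀ : ℝ) (P : ℕ) (x : ℝ) : ℝ :=
  (a * x ^ (-α) + b * x ^ (2 - 2 * α)) * max 1 ((r₀ / x) ^ P)

section Profile

variable {a b α r₀ x : ℝ} {P : ℕ} (ha : 0 ≤ a) (hb : 0 ≤ b) (hα : 1 ≤ α)

include ha hb

lemma boundProfile_nonneg (hx : 0 < x) : 0 ≤ boundProfile a b α r₀ P x := by
  have : 0 ≤ max 1 ((r₀ / x) ^ P) := zero_le_one.trans (le_max_left _ _)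
  unfold boundProfile
  positivity

lemma le_boundProfile (hx : 0 < x) :
    a * x ^ (-α) + b * x ^ (2 - 2 * α) ≤ boundProfile a b α r₀ P x :=
  le_mul_of_one_le_right (by positivity) (le_max_left _ _)

omit ha hb in
lemma boundProfile_eq (hr : 0 ≤ r₀) (hx : 0 < x) (hrx : r₀ ≤ x) :
    boundProfile a b α r₀ P x = a * x ^ (-α) + b * x ^ (2 - 2 * α) := by
  rw [boundProfile, max_eq_left (pow_le_one₀ (by positivity) ((div_le_one hx).2 hrx)), mul_one]

include hα

lemma boundProfile_anti (hr : 0 ≤ r₀) {y : ℝ} (hx : 0 < x) (hxy : x ≤ y) :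
    boundProfile a b α r₀ P y ≤ boundProfile a b α r₀ P x := by
  have hy : 0 < y := hx.trans_le hxy
  have h1 : y ^ (-α) ≤ x ^ (-α) := Real.rpow_le_rpow_of_nonpos hx hxy (by linarith)
  have h2 : y ^ (2 - 2 * α) ≤ x ^ (2 - 2 * α) :=
    Real.rpow_le_rpow_of_nonpos hx hxy (by linarith)
  have h3 : 0 ≤ max 1 ((r₀ / y) ^ P) := zero_le_one.trans (le_max_left _ _)
  unfold boundProfile
  gcongr

variable (hα' : α ≤ 3 / 2)
include hα'

omit hα in
lemma boundProfile_div_le (hx : 0 < x) {k : ℝ} (hk : 1 ≤ k) :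
    boundProfile a b α r₀ P (x / k) ≤ k ^ (P + 2) * boundProfile a b α r₀ P x := by
  have hk0 : 0 < k := by linarith
  have h0 : ∀ e : ℝ, -2 ≤ e → (x / k) ^ e ≤ k ^ 2 * x ^ e := fun e he => by
    rw [Real.div_rpow hx.le hk0.le, div_eq_mul_inv, ← Real.rpow_neg hk0.le, mul_comm]
    have : k ^ (-e) ≤ k ^ 2 := by
      rw [← Real.rpow_natCast k 2]
      exact Real.rpow_le_rpow_of_exponent_le hk (by push_cast; linarith)
    gcongr
  have h1 := h0 (-α) (by linarith)
  have h2 := h0 (2 - 2 * α) (by linarith)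
  have h3 : max 1 ((r₀ / (x / k)) ^ P) ≤ k ^ P * max 1 ((r₀ / x) ^ P) := by
    refine max_le ?_ ?_
    · exact one_le_mul_of_one_le_of_one_le (one_le_pow₀ hk) (le_max_left _ _)
    · calc (r₀ / (x / k)) ^ P = k ^ P * (r₀ / x) ^ P := by
            rw [← mul_pow]
            congr 1
            field_simp
        _ ≤ _ := by
            gcongr
            exact le_max_right _ _
  unfold boundProfile
  calc _ ≤ (a * (k ^ 2 * x ^ (-α)) + b * (k ^ 2 * x ^ (2 - 2 * α)))
        * (k ^ P * max 1 ((r₀ / x) ^ P)) := by gcongr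
    _ = _ := by ring

omit hα in
lemma le_four_mul_boundProfile (hx : 0 < x) :
    a * x ^ (-α) + b * x ^ (2 - 2 * α) ≤ 4 * boundProfile a b α r₀ P (2 * x) := by
  have h0 : ∀ e : ℝ, -2 ≤ e → x ^ e ≤ 4 * (2 * x) ^ e := fun e he => by
    rw [Real.mul_rpow zero_le_two hx.le, ← mul_assoc]
    refine le_mul_of_one_le_left (by positivity) ?_
    have : (2:ℝ) ^ (-2 : ℝ) ≤ 2 ^ e := Real.rpow_le_rpow_of_exponent_le one_le_two he
    have h2 : (2:ℝ) ^ (-2 : ℝ) = 1 / 4 := by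
      rw [Real.rpow_neg zero_le_two]
      norm_num
    rw [h2] at this
    linarith
  have h1 := h0 (-α) (by linarith)
  have h2 := h0 (2 - 2 * α) (by linarith)
  refine le_trans ?_ (mul_le_mul_of_nonneg_left
    (le_boundProfile (r₀ := r₀) (P := P) ha hb (by positivity : 0 < 2 * x)) (by norm_num))
  calc _ ≤ a * (4 * (2 * x) ^ (-α)) + b * (4 * (2 * x) ^ (2 - 2 * α)) := by gcongr
    _ = _ := by ring

end Profile

/-- In terms of the size `S` of the fluctuations of the derivative and of the strength `τ p / x` of
the feedback, both at most `k`. -/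
lemma inv_mul_errorScale_le {c x τ A p S k : ℝ} (hc : 0 < c) (hcx : √c ≤ x) (hx1 : x ≤ 1)
    (hτ : x ≤ τ) (hA : 0 ≤ A) (hp : 0 ≤ p) (hp1 : p ≤ 1) (hS : √(c * τ / x) = x * S)
    (hSk : S ≤ k) (hQ : τ * p / x ≤ k) (hk : k ≤ 1) :
    x⁻¹ * errorScale c x τ A p τ (A * τ) ≤ 4 * S + τ * p / x * p + 6 * k * A := by
  have hsc : 0 < √c := Real.sqrt_pos.2 hc
  have hx : 0 < x := hsc.trans_le hcx
  have hτ0 : 0 < τ := hx.trans_le hτ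
  have hxS : √c ≤ x * S := by
    rw [← hS, mul_div_assoc]
    exact Real.sqrt_le_sqrt (le_mul_of_one_le_right hc.le ((one_le_div hx).2 hτ))
  have hS0 : 0 < S := by
    have := hsc.trans_le hxS
    exact (mul_pos_iff_of_pos_left hx).1 this
  obtain ⟨Q, hQdef⟩ : ∃ Q, Q = τ * p / x := ⟨_, rfl⟩
  have hQ0 : 0 ≤ Q := by rw [hQdef]; positivity
  rw [← hQdef] at hQ ⊢
  have e1 : c = √c * √c := (Real.mul_self_sqrt hc.le).symm
  have e2 : c * τ / x = (x * S) * (x * S) := by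
    rw [← hS, Real.mul_self_sqrt (by positivity)]
  have h1 : x⁻¹ * (c / x) ≤ S := by
    rw [inv_mul_le_iff₀ hx, div_le_iff₀ hx, e1]
    exact mul_le_mul hxS hcx hsc.le (by positivity)
  have h2 : x⁻¹ * (√c * p * τ / x) ≤ Q * S := by
    calc x⁻¹ * (√c * p * τ / x) = Q * (x⁻¹ * √c) := by rw [hQdef]; ring
      _ ≤ Q * S := by
        gcongr
        rwa [inv_mul_le_iff₀ hx]
  have h3 : x⁻¹ * (c * τ / x) ≤ S := by
    rw [e2]
    calc x⁻¹ * (x * S * (x * S)) = x * S * S := by field_simp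
      _ ≤ 1 * 1 * S := by
        gcongr
        linarith
      _ = S := by ring
  have h4 : x⁻¹ * (c * A * τ / x ^ 2) = A * (S * S) := by
    calc x⁻¹ * (c * A * τ / x ^ 2) = x⁻¹ * A * (c * τ / x) * x⁻¹ := by
          field_simp
      _ = A * (S * S) := by
        rw [e2]
        field_simp
  have hk0 : 0 ≤ k := hQ0.trans hQ
  have q1 : Q * p ≤ k := (mul_le_of_le_one_right hQ0 hp1).trans hQ
  have q2 : Q * S ≤ k := (mul_le_of_le_one_right hQ0 (hSk.trans hk)).trans hQ
  have q3 : S * S ≤ k := (mul_le_of_le_one_right hS0.le (hSk.trans hk)).trans hSk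
  have q4 : Q * S ≤ S := mul_le_of_le_one_left hS0.le (hQ.trans hk)
  calc x⁻¹ * errorScale c x τ A p τ (A * τ)
      = (1 + A) * (x⁻¹ * (c / x) + S + Q * p + x⁻¹ * (√c * p * τ / x)) + Q * A
          + x⁻¹ * (c * τ / x) + x⁻¹ * (c * A * τ / x ^ 2) := by
        rw [errorScale, hS, hQdef]
        field_simp
    _ ≤ (1 + A) * (S + S + Q * p + Q * S) + Q * A + S + A * (S * S) := by
        rw [h4]
        gcongr
    _ = 3 * S + Q * S + Q * p + A * (S + S + Q * p + Q * S + Q + S * S) := by ring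
    _ ≤ 3 * S + S + Q * p + A * (k + k + k + k + k + k) := by gcongr
    _ = _ := by ring

/-- The same for the deviation itself, at distances at which the derivative is at most one. -/
lemma errorScale_one_le {c x τ A p W S : ℝ} (hc : 0 < c) (hcx : √c ≤ x) (hx1 : x ≤ 1)
    (hτ : x ≤ τ) (hA : 0 ≤ A) (hA1 : A ≤ 1) (hp : 0 ≤ p) (hS : √(c * τ / x) = x * S)
    (hS1 : S ≤ 1) (hQ : τ * p / x ≤ 1) :
    errorScale c x τ A p 1 W ≤ 8 * (x * S) + 2 * p ^ 2 + p * W := by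
  have hsc : 0 < √c := Real.sqrt_pos.2 hc
  have hx : 0 < x := hsc.trans_le hcx
  have hτ0 : 0 < τ := hx.trans_le hτ
  have hxS : √c ≤ x * S := by
    rw [← hS, mul_div_assoc]
    exact Real.sqrt_le_sqrt (le_mul_of_one_le_right hc.le ((one_le_div hx).2 hτ))
  have hS0 : 0 < S := by
    have := hsc.trans_le hxS
    exact (mul_pos_iff_of_pos_left hx).1 this
  have e1 : c = √c * √c := (Real.mul_self_sqrt hc.le).symm
  have e2 : c * τ / x = (x * S) * (x * S) := by
    rw [← hS, Real.mul_self_sqrt (by positivity)]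
  have h1 : c / x ≤ x * S := by
    rw [div_le_iff₀ hx, e1]
    gcongr
  have h2 : √c * p * τ / x ≤ x * S := by
    calc √c * p * τ / x = √c * (τ * p / x) := by ring
      _ ≤ x * S * 1 := by gcongr
      _ = _ := mul_one _
  have h3 : c * τ / x ≤ x * S := by
    rw [e2]
    exact mul_le_of_le_one_left (by positivity) (mul_le_one₀ hx1 hS0.le hS1)
  have h4 : c * A * τ / x ^ 2 ≤ x * S := by
    calc c * A * τ / x ^ 2 = A * (c * τ / x) * x⁻¹ := by
          field_simp
      _ = A * (x * S * S) := by
        rw [e2]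
        field_simp
      _ ≤ 1 * (x * S * 1) := by gcongr
      _ = _ := by ring
  have hxS0 : 0 ≤ x * S := by positivity
  calc errorScale c x τ A p 1 W
      ≤ (1 + 1) * (x * S + x * S + 1 * p ^ 2 + x * S) + p * W + x * S + x * S := by
        rw [errorScale, hS]
        gcongr
    _ = _ := by ring

section Exponents

lemma rpow_neg_le_of_rpow_le {c e y γ : ℝ} (hc : 0 < c) (hy : c ^ e ≤ y) (hγ : 0 ≤ γ) :
    y ^ (-γ) ≤ c ^ (-(e * γ)) := by
  calc y ^ (-γ) ≤ (c ^ e) ^ (-γ) :=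
        Real.rpow_le_rpow_of_nonpos (Real.rpow_pos_of_pos hc _) hy (by linarith)
    _ = _ := by rw [← Real.rpow_mul hc.le]; ring_nf

variable {c ε α ρ s x : ℝ} (hc : 0 < c) (hc1 : c ≤ 1) (hε : 0 < ε) (hα : 1 ≤ α)
  (hρ : ρ * (3 * α - 2) = 1 / 2)

include hc hc1 hε hα hρ

lemma drift_le_fluctuation (hs : c ^ (ρ - ε) ≤ s) :
    c ^ (1 - 3 * ε / 8) * s ^ (-(2 * α)) * s ^ (2 - 2 * α) ≤ c ^ (1 / 2 - ε / 8) * s ^ (-α) := by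
  have hs0 : 0 < s := (Real.rpow_pos_of_pos hc _).trans_le hs
  have h1 := rpow_neg_le_of_rpow_le hc hs (by linarith : 0 ≤ 3 * α - 2)
  calc _ = c ^ (1 - 3 * ε / 8) * (s ^ (-α) * s ^ (-(3 * α - 2))) := by
        rw [mul_assoc, ← Real.rpow_add hs0, ← Real.rpow_add hs0]
        ring_nf
    _ ≤ c ^ (1 - 3 * ε / 8) * (s ^ (-α) * c ^ (-((ρ - ε) * (3 * α - 2)))) := by gcongr
    _ = c ^ (1 - 3 * ε / 8 + -((ρ - ε) * (3 * α - 2))) * s ^ (-α) := by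
        rw [Real.rpow_add hc]
        ring
    _ ≤ _ := by
        refine mul_le_mul_of_nonneg_right ?_ (by positivity)
        refine Real.rpow_le_rpow_of_exponent_ge hc hc1 ?_
        nlinarith

lemma feedback_le (hs : c ^ (ρ - ε) ≤ s) (hx : c ^ (ρ - ε / 2) ≤ x) :
    c ^ (1 / 2 - ε / 8) * s ^ (-α) * x ^ (2 - 2 * α) ≤ c ^ (ε / 2) := by
  have h1 := rpow_neg_le_of_rpow_le hc hs (by linarith : 0 ≤ α)
  have h2 := rpow_neg_le_of_rpow_le hc hx (by linarith : 0 ≤ 2 * α - 2)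
  have e : x ^ (2 - 2 * α) = x ^ (-(2 * α - 2)) := by ring_nf
  have hx0 : 0 < x := (Real.rpow_pos_of_pos hc _).trans_le hx
  rw [e]
  calc _ ≤ c ^ (1 / 2 - ε / 8) * c ^ (-((ρ - ε) * α)) * c ^ (-((ρ - ε / 2) * (2 * α - 2))) := by
        gcongr
    _ = c ^ (1 / 2 - ε / 8 + -((ρ - ε) * α) + -((ρ - ε / 2) * (2 * α - 2))) := by
        rw [Real.rpow_add hc, Real.rpow_add hc]
    _ ≤ _ := by
        refine Real.rpow_le_rpow_of_exponent_ge hc hc1 ?_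
        nlinarith

lemma sqrt_mul_rpow_le (hx : c ^ (ρ - ε / 2) ≤ x) : √c * x ^ (-α) ≤ c ^ (ε / 2) := by
  have h1 := rpow_neg_le_of_rpow_le hc hx (by linarith : 0 ≤ α)
  have hρ0 : 0 ≤ ρ := by
    by_contra h
    nlinarith
  calc _ ≤ c ^ (1 / 2 : ℝ) * c ^ (-((ρ - ε / 2) * α)) := by
        rw [Real.sqrt_eq_rpow]
        gcongr
    _ = c ^ (1 / 2 + -((ρ - ε / 2) * α)) := (Real.rpow_add hc _ _).symm
    _ ≤ _ := by
        refine Real.rpow_le_rpow_of_exponent_ge hc hc1 ?_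
        nlinarith

lemma profile_le (hs : c ^ (ρ - ε) ≤ s) (hx : c ^ (ρ - ε) ≤ x) :
    c ^ (1 / 2 - ε / 8) * x ^ (-α) + c ^ (1 - 3 * ε / 8) * s ^ (-(2 * α)) * x ^ (2 - 2 * α)
      ≤ 2 * c ^ (ε / 2) := by
  have hs0 : 0 < s := (Real.rpow_pos_of_pos hc _).trans_le hs
  have hρ0 : 0 ≤ ρ := by
    by_contra h
    nlinarith
  have h1 := rpow_neg_le_of_rpow_le hc hx (by linarith : 0 ≤ α)
  have h2 := rpow_neg_le_of_rpow_le hc hs (by linarith : 0 ≤ 2 * α)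
  have h3 := rpow_neg_le_of_rpow_le hc hx (by linarith : 0 ≤ 2 * α - 2)
  have e : x ^ (2 - 2 * α) = x ^ (-(2 * α - 2)) := by ring_nf
  have hx0 : 0 < x := (Real.rpow_pos_of_pos hc _).trans_le hx
  have t1 : c ^ (1 / 2 - ε / 8) * x ^ (-α) ≤ c ^ (ε / 2) := by
    calc _ ≤ c ^ (1 / 2 - ε / 8) * c ^ (-((ρ - ε) * α)) := by gcongr
      _ = c ^ (1 / 2 - ε / 8 + -((ρ - ε) * α)) := (Real.rpow_add hc _ _).symm
      _ ≤ _ := by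
        refine Real.rpow_le_rpow_of_exponent_ge hc hc1 ?_
        nlinarith
  have t2 : c ^ (1 - 3 * ε / 8) * s ^ (-(2 * α)) * x ^ (2 - 2 * α) ≤ c ^ (ε / 2) := by
    rw [e]
    calc _ ≤ c ^ (1 - 3 * ε / 8) * c ^ (-((ρ - ε) * (2 * α)))
          * c ^ (-((ρ - ε) * (2 * α - 2))) := by gcongr
      _ = c ^ (1 - 3 * ε / 8 + -((ρ - ε) * (2 * α)) + -((ρ - ε) * (2 * α - 2))) := by
          rw [Real.rpow_add hc, Real.rpow_add hc]
      _ ≤ _ := by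
        refine Real.rpow_le_rpow_of_exponent_ge hc hc1 ?_
        nlinarith
  linarith

end Exponents

/-- A power of the capacity absorbs constants. -/
lemma exists_mul_rpow_le_one (M : ℝ) {e : ℝ} (he : 0 < e) :
    ∃ c₀ > 0, ∀ c : ℝ, 0 < c → c ≤ c₀ → M * c ^ e ≤ 1 := by
  have h : Tendsto (fun c : ℝ => M * c ^ e) (𝓝 0) (𝓝 (M * 0 ^ e)) :=
    ((Real.continuousAt_rpow_const 0 e (Or.inr he.le)).tendsto).const_mul M
  rw [Real.zero_rpow he.ne', mul_zero] at h
  obtain ⟨r, hr, hr'⟩ := Metric.eventually_nhds_iff.1 (h.eventually_le_const one_pos)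
  refine ⟨r / 2, by positivity, fun c hc hcr => hr' ?_⟩
  rw [Real.dist_eq, sub_zero, abs_of_pos hc]
  linarith

/-! ### The choice of the bound -/

/-- The bound on the derivative, integrated over time along the contours. The increasing gaps
remove one power of the distance if the linearised dynamics is transporting. -/
lemma sum_boundProfile_le {η T a b α r₀ c x H l : ℝ} {P n : ℕ} (hη : η ≤ 1) (hT : 0 ≤ T)
    (hα : 1 ≤ α) (hα' : α ≤ 3 / 2) (ha0 : 0 ≤ a) (hb0 : 0 ≤ b) (hr0 : 0 < r₀) (hc : 0 < c)
    (hx0 : 0 < x) (hrx : r₀ ≤ 2 * x) (hn : c * n ≤ T) (hH : 1 ≤ H) (hl1 : 1 ≤ l)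
    (hsum : ∑ i ∈ Finset.range n, c * (contourGap η T x (c * i))⁻¹ ≤ H * l * x ^ (2 - 2 * α)) :
    ∑ i ∈ Finset.range n, c * boundProfile a b α r₀ P (contourGap η T x (c * i) / 2)
      ≤ (2 * (2 * (5 + T))) ^ P * (2 * (5 + T) * (2 * (5 + T))) * (H + T) * l
        * (a * x ^ (3 - 3 * α) + b * x ^ (2 - 2 * α)) := by
  obtain ⟨G, hG⟩ : ∃ G, G = 2 * (5 + T) := ⟨_, rfl⟩
  rw [← hG]
  have hG1 : 1 ≤ G := by rw [hG]; linarith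
  have hG0 : 0 < G := by linarith
  have hg0 : contourGap η T x 0 / 2 = x / G := by
    rw [contourGap, hG]
    simp only [mul_zero, add_zero]
    field_simp
  have hterm : ∀ i ∈ Finset.range n, c * boundProfile a b α r₀ P (contourGap η T x (c * i) / 2)
      ≤ (2 * G) ^ P * (G * G) * (a * x ^ (1 - α) * (c * (contourGap η T x (c * i))⁻¹)
        + b * x ^ (2 - 2 * α) * c) := by
    intro i _
    have hg : x / G ≤ contourGap η T x (c * i) / 2 := by
      rw [← hg0]
      have := contourGap_mono (x := x) (t' := c * i) hη hT (by positivity : (0:ℝ) ≤ c * i)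
      linarith
    obtain ⟨g, hgdef⟩ : ∃ g, g = contourGap η T x (c * i) := ⟨_, rfl⟩
    rw [← hgdef] at hg ⊢
    have hxG0 : 0 < x / G := by positivity
    have hg2 : 0 < g / 2 := hxG0.trans_le hg
    have hg0 : 0 < g := by linarith
    have hdiv : ∀ e : ℝ, 0 ≤ e → e ≤ 1 → (g / 2) ^ (-e) ≤ G * x ^ (-e) := fun e he he1 => by
      calc (g / 2) ^ (-e) ≤ (x / G) ^ (-e) :=
            Real.rpow_le_rpow_of_nonpos hxG0 hg (by linarith)
        _ = G ^ e * x ^ (-e) := by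
            rw [Real.div_rpow hx0.le hG0.le, div_eq_mul_inv, ← Real.rpow_neg hG0.le, neg_neg,
              mul_comm]
        _ ≤ G ^ (1:ℝ) * x ^ (-e) := by gcongr
        _ = _ := by rw [Real.rpow_one]
    have h1 : (g / 2) ^ (-α) ≤ G * G * (x ^ (1 - α) * g⁻¹) := by
      have h2 := hdiv (α - 1) (by linarith) (by linarith)
      calc (g / 2) ^ (-α) = (g / 2) ^ (-(α - 1)) * (g / 2) ^ (-1 : ℝ) := by
            rw [← Real.rpow_add hg2]
            ring_nf
        _ = (g / 2) ^ (-(α - 1)) * (2 * g⁻¹) := by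
            rw [Real.rpow_neg_one, inv_div]
            ring
        _ ≤ G * x ^ (-(α - 1)) * (G * g⁻¹) := by
            gcongr
            rw [hG]
            linarith
        _ = G * G * (x ^ (1 - α) * g⁻¹) := by
            rw [neg_sub]
            ring
    have h2 : (g / 2) ^ (2 - 2 * α) ≤ G * G * x ^ (2 - 2 * α) := by
      have h3 := hdiv (2 * α - 2) (by linarith) (by linarith)
      rw [neg_sub] at h3
      refine h3.trans ?_
      rw [mul_assoc]
      exact le_mul_of_one_le_left (by positivity) hG1
    have h3 : max 1 ((r₀ / (g / 2)) ^ P) ≤ (2 * G) ^ P := by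
      refine max_le (one_le_pow₀ (by linarith)) ?_
      refine pow_le_pow_left₀ (by positivity) ?_ P
      rw [div_le_iff₀ hg2]
      rw [div_le_iff₀ hG0] at hg
      linarith
    calc c * boundProfile a b α r₀ P (g / 2) ≤ c * ((a * (G * G * (x ^ (1 - α) * g⁻¹))
          + b * (G * G * x ^ (2 - 2 * α))) * (2 * G) ^ P) := by
          rw [boundProfile]
          gcongr
      _ = _ := by ring
  have hxx : x ^ (1 - α) * x ^ (2 - 2 * α) = x ^ (3 - 3 * α) := by
    rw [← Real.rpow_add hx0]
    ring_nf
  calc _ ≤ (2 * G) ^ P * (G * G) * (a * x ^ (1 - α) * (H * l * x ^ (2 - 2 * α))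
        + b * x ^ (2 - 2 * α) * (c * n)) := by
        refine (Finset.sum_le_sum hterm).trans ?_
        rw [← Finset.mul_sum, Finset.sum_add_distrib, ← Finset.mul_sum, Finset.sum_const,
          Finset.card_range, nsmul_eq_mul]
        have e : (n:ℝ) * (b * x ^ (2 - 2 * α) * c) = b * x ^ (2 - 2 * α) * (c * n) := by ring
        rw [e]
        gcongr
    _ ≤ (2 * G) ^ P * (G * G) * (a * x ^ (1 - α) * ((H + T) * l * x ^ (2 - 2 * α))
        + b * x ^ (2 - 2 * α) * ((H + T) * l)) := by
        have h5 : H ≤ H + T := by linarith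
        have h6 : c * n ≤ (H + T) * l :=
          (by linarith : c * n ≤ H + T).trans (le_mul_of_one_le_right (by linarith) hl1)
        gcongr
    _ = (2 * G) ^ P * (G * G) * (H + T) * l
        * (a * (x ^ (1 - α) * x ^ (2 - 2 * α)) + b * x ^ (2 - 2 * α)) := by
        ring
    _ = _ := by rw [hxx]

set_option maxHeartbeats 2000000 in
/-- The bound on the deviation with high probability for small capacity. The exponent `α` of the
size of the fluctuations is `1` if the linearised dynamics transports them away from the unit
circle, and `3 / 2` if not; `ρ` is the resulting critical exponent for the distance. -/
theorem exists_event_norm_le {η Λ T α ρ ε : ℝ} (hη : η ≤ 1) (hΛ : 0 ≤ Λ) (hT : 0 ≤ T) (m : ℕ)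
    (hα : 1 ≤ α) (hα' : α ≤ 3 / 2) (hρ : ρ * (3 * α - 2) = 1 / 2) (hε : 0 < ε) (hερ : ε < ρ)
    (hτ : ∀ x : ℝ, 0 < x → timeScale η x = x ^ (3 - 2 * α)) :
    ∃ C c₁, 0 < c₁ ∧ ∀ {Ω : Type u} [MeasurableSpace Ω] {μ : Measure Ω}
      [IsProbabilityMeasure μ] {F : ℂ → ℂ} {c σ : ℝ} {Θ : ℕ → Ω → ℝ},
      IsBasicMap F c → c ≤ 1 → HasRegularity F c Λ → 1 + c ^ (ρ - ε) ≤ Real.exp σ →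
      IsALE μ F η σ Θ → c ≤ c₁ →
      ∃ Ω₁ : Set Ω, MeasurableSet Ω₁ ∧ 1 - c ^ m < μ.real Ω₁ ∧ ∀ ω ∈ Ω₁, ∀ n : ℕ, c * n ≤ T →
        ∀ x, c ^ (ρ - ε) ≤ x → x ≤ 1 → ∀ z : ℂ, 1 + x ≤ ‖z‖ →
          ‖deviation F c (fun k => Θ k ω) n z‖ ≤ C * (c ^ (1 / 2 - ε) * x ^ (1 - α)
            + c ^ (1 - ε) * min (Real.exp σ - 1) 1 ^ (-(2 * α))) := by
  have hρ2 : ρ ≤ 1 / 2 := by nlinarith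
  have hε2 : ε < 1 / 2 := by linarith
  obtain ⟨δ, hδ⟩ : ∃ δ, δ = ε / 64 := ⟨_, rfl⟩
  have hδ0 : 0 < δ := by rw [hδ]; linarith
  obtain ⟨K, p₀, c₀, hK, hp₀, hc₀, hev⟩ := exists_event.{u} hη hΛ hT hδ0 (by linarith : δ < 1) m
  obtain ⟨H, hH, hsum⟩ := exists_sum_inv_contourGap_le hη hT hδ0
  obtain ⟨G, hG⟩ : ∃ G, G = 2 * (5 + T) := ⟨_, rfl⟩
  have hG1 : 1 ≤ G := by rw [hG]; linarith
  have hG0 : 0 < G := by linarith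
  obtain ⟨P, hP⟩ : ∃ P, P = ⌈2 / ε⌉₊ := ⟨_, rfl⟩
  have hPε : 1 ≤ ε / 2 * P := by
    have h1 : 2 / ε ≤ P := hP ▸ Nat.le_ceil _
    rw [div_le_iff₀ hε] at h1
    linarith
  obtain ⟨D, hD⟩ : ∃ D, D = (2 * G) ^ (P + 2) := ⟨_, rfl⟩
  have hD1 : 1 ≤ D := hD ▸ one_le_pow₀ (by linarith)
  obtain ⟨M, hM⟩ : ∃ M, M = 64 * K * D * (1 + p₀⁻¹) := ⟨_, rfl⟩
  have hp₀' : 0 < p₀⁻¹ := inv_pos.2 hp₀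
  have hKD : 1 ≤ K * D := one_le_mul_of_one_le_of_one_le hK hD1
  have hM0 : 0 < M := by rw [hM]; positivity
  obtain ⟨c₂, hc₂, hsmall⟩ := exists_mul_rpow_le_one M (by linarith : 0 < ε / 16)
  obtain ⟨N, hN⟩ : ∃ N, N = (2 * G) ^ P * (G * G) * (H + T) := ⟨_, rfl⟩
  have hN0 : 0 ≤ N := by rw [hN]; positivity
  refine ⟨2 * (K * (16 + N)), min c₀ c₂, lt_min hc₀ hc₂, ?_⟩
  intro Ω _ μ _ F c σ Θ hF hc1 hreg hσ hA hcc
  have hc := hF.capacity_pos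
  have hMc := hsmall c hc (hcc.trans (min_le_right _ _))
  -- the smallness of the capacity is only used through these bounds
  have hpow : ∀ e : ℝ, ε / 16 ≤ e → ∀ k : ℝ, 0 ≤ k → k ≤ M → k * c ^ e ≤ 1 :=
    fun e he k hk0 hk => by
    refine le_trans ?_ hMc
    have := Real.rpow_le_rpow_of_exponent_ge hc hc1 he
    gcongr
  have hM1 : 64 * (K * D) ≤ M := by
    rw [hM]
    nlinarith [mul_pos (by linarith : 0 < K * D) hp₀']
  have hM2 : 64 * p₀⁻¹ ≤ M := by
    rw [hM]
    calc 64 * p₀⁻¹ = 64 * 1 * (0 + p₀⁻¹) := by ring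
      _ ≤ 64 * (K * D) * (1 + p₀⁻¹) := by gcongr; norm_num
      _ = _ := by ring
  have hMK : 64 * K ≤ M := by nlinarith
  have hMD : 64 * D ≤ M := by nlinarith
  obtain ⟨l, hl⟩ : ∃ l, l = c ^ (-δ) := ⟨_, rfl⟩
  have hl1 : 1 ≤ l := hl ▸ Real.one_le_rpow_of_pos_of_le_one_of_nonpos hc hc1 (by linarith)
  have hlp : ∀ k : ℕ, ∀ e : ℝ, l ^ k * c ^ e = c ^ (e - k * δ) := fun k e => by
    rw [hl, ← Real.rpow_natCast, ← Real.rpow_mul hc.le, ← Real.rpow_add hc]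
    ring_nf
  obtain ⟨r₀, hr₀⟩ : ∃ r₀, r₀ = c ^ (ρ - ε) := ⟨_, rfl⟩
  obtain ⟨r₁, hr₁⟩ : ∃ r₁, r₁ = c ^ (ρ - ε / 2) := ⟨_, rfl⟩
  have hr0 : 0 < r₀ := hr₀ ▸ Real.rpow_pos_of_pos hc _
  have hr1 : 0 < r₁ := hr₁ ▸ Real.rpow_pos_of_pos hc _
  have hr10 : r₁ ≤ r₀ := by
    rw [hr₀, hr₁]
    exact Real.rpow_le_rpow_of_exponent_ge hc hc1 (by linarith)
  have hr11 : r₁ ≤ 1 := hr₁ ▸ Real.rpow_le_one hc.le hc1 (by linarith)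
  have hr01 : r₀ ≤ 1 := hr₀ ▸ Real.rpow_le_one hc.le hc1 (by linarith)
  rw [← hr₀] at hσ ⊢
  have hσ0 : 0 < σ := Real.one_lt_exp_iff.1 (by linarith)
  obtain ⟨s, hs⟩ : ∃ s, s = min (Real.exp σ - 1) 1 := ⟨_, rfl⟩
  have hrs : r₀ ≤ s := hs ▸ le_min (by linarith) hr01
  have hs0 : 0 < s := hr0.trans_le hrs
  obtain ⟨a, ha⟩ : ∃ a, a = c ^ (1 / 2 - ε / 8) := ⟨_, rfl⟩
  have ha0 : 0 ≤ a := by rw [ha]; positivity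
  obtain ⟨b, hb⟩ : ∃ b, b = c ^ (1 - 3 * ε / 8) * s ^ (-(2 * α)) := ⟨_, rfl⟩
  have hb0 : 0 ≤ b := by rw [hb]; positivity
  obtain ⟨B, hB⟩ : ∃ B, B = boundProfile a b α r₀ P := ⟨_, rfl⟩
  have hBanti : ∀ x y, 0 < x → x ≤ y → B y ≤ B x := fun x y hx hxy =>
    hB ▸ boundProfile_anti ha0 hb0 hα hr0.le hx hxy
  have hBnn : ∀ x, 0 < x → 0 ≤ B x := fun x hx => hB ▸ boundProfile_nonneg ha0 hb0 hx
  have hBdiv : ∀ x k, 0 < x → 1 ≤ k → B (x / k) ≤ k ^ (P + 2) * B x := fun x k hx hk =>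
    hB ▸ boundProfile_div_le ha0 hb0 hα' hx hk
  -- the size of the derivative near the circle of radius `e^σ`
  obtain ⟨p, hp⟩ : ∃ p, p = B s := ⟨_, rfl⟩
  have hp0 : 0 ≤ p := hp ▸ hBnn s hs0
  have hps : p ≤ 2 * (a * s ^ (-α)) := by
    have h1 := drift_le_fluctuation hc hc1 hε hα hρ (hr₀ ▸ hrs)
    rw [← ha, ← hb] at h1
    rw [hp, hB, boundProfile_eq hr0.le hs0 hrs]
    linarith
  have hQ : ∀ x, r₁ ≤ x → p * x ^ (2 - 2 * α) ≤ 2 * c ^ (ε / 2) := fun x hx => by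
    have h1 := feedback_le hc hc1 hε hα hρ (hr₀ ▸ hrs) (hr₁ ▸ hx)
    rw [← ha] at h1
    have hx0 : 0 < x := hr1.trans_le hx
    calc p * x ^ (2 - 2 * α) ≤ 2 * (a * s ^ (-α)) * x ^ (2 - 2 * α) := by gcongr
      _ ≤ _ := by linarith
  have hp1 : p ≤ 2 * c ^ (ε / 2) := by
    have := hQ 1 hr11
    rwa [Real.one_rpow, mul_one] at this
  have hcε0 : 0 < c ^ (ε / 2) := Real.rpow_pos_of_pos hc _
  have hk1 : 2 * c ^ (ε / 2) ≤ 1 := hpow _ (by linarith) 2 (by norm_num) (by linarith)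
  have hpp₀ : p ≤ p₀ := by
    refine hp1.trans ?_
    have h1 := hpow (ε / 2) (by linarith) (2 * p₀⁻¹) (by positivity) (by linarith)
    calc 2 * c ^ (ε / 2) = p₀ * (2 * p₀⁻¹ * c ^ (ε / 2)) := by field_simp
      _ ≤ p₀ * 1 := by gcongr
      _ = p₀ := mul_one _
  have hp2 : p ^ 2 ≤ 4 * (c ^ (ε / 8) * b) := by
    calc p ^ 2 ≤ (2 * (a * s ^ (-α))) ^ 2 := by gcongr
      _ = 4 * (c ^ (1 / 2 - ε / 8) * c ^ (1 / 2 - ε / 8) * (s ^ (-α) * s ^ (-α))) := by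
          rw [ha]
          ring
      _ = 4 * (c ^ (ε / 8) * b) := by
          rw [hb, ← Real.rpow_add hc, ← Real.rpow_add hs0, ← mul_assoc (c ^ (ε / 8)),
            ← Real.rpow_add hc]
          ring_nf
  have hsc0 : 0 < √c := Real.sqrt_pos.2 hc
  have hcs : c ≤ √c := Real.le_sqrt_of_sq_le (by rw [sq]; exact mul_le_of_le_one_left hc.le hc1)
  have hsr : K * √c ≤ r₁ := by
    have h1 := hpow (ε / 2) (by linarith) K (by linarith) (by linarith)
    have h2 : √c ≤ c ^ (ε / 2) * r₁ := by
      rw [hr₁, ← Real.rpow_add hc, Real.sqrt_eq_rpow]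
      exact Real.rpow_le_rpow_of_exponent_ge hc hc1 (by linarith)
    calc K * √c ≤ K * (c ^ (ε / 2) * r₁) := by gcongr
      _ = K * c ^ (ε / 2) * r₁ := by ring
      _ ≤ 1 * r₁ := by gcongr
      _ = r₁ := one_mul _
  have hscx : ∀ x, r₁ ≤ x → √c ≤ x := fun x hx =>
    ((le_mul_of_one_le_left hsc0.le hK).trans hsr).trans hx
  have hτx : ∀ x, 0 < x → timeScale η x / x = x ^ (2 - 2 * α) := fun x hx => by
    rw [hτ x hx, div_eq_mul_inv, ← Real.rpow_neg_one x, ← Real.rpow_add hx]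
    ring_nf
  have hsq : ∀ x, 0 < x → √(c * timeScale η x / x) = x * (√c * x ^ (-α)) := fun x hx => by
    rw [mul_div_assoc, hτx x hx, Real.sqrt_mul hc.le, Real.sqrt_eq_rpow (x ^ _),
      ← Real.rpow_mul hx.le]
    have : x ^ ((2 - 2 * α) * (1 / 2)) = x * x ^ (-α) := by
      rw [show (2 - 2 * α) * (1 / 2) = 1 + -α by ring, Real.rpow_add hx, Real.rpow_one]
    rw [this]
    ring
  have hQ' : ∀ x, 0 < x → timeScale η x * p / x = p * x ^ (2 - 2 * α) := fun x hx => by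
    rw [← hτx x hx]
    ring
  -- at small distances the weight makes the bound weaker than the deterministic one
  have hsmallB : ∀ x, 0 < x → x < r₁ → K / x ≤ B x := by
    intro x hx hxr
    have h1 : r₀ / r₁ ≤ r₀ / x := by gcongr
    have h2 : c⁻¹ ≤ (r₀ / x) ^ P := by
      calc c⁻¹ ≤ (r₀ / r₁) ^ P := by
            rw [hr₀, hr₁, ← Real.rpow_sub hc, ← Real.rpow_natCast, ← Real.rpow_mul hc.le,
              ← Real.rpow_neg_one c]
            exact Real.rpow_le_rpow_of_exponent_ge hc hc1 (by linarith)
        _ ≤ _ := by gcongr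
    have h3 : x⁻¹ ≤ x ^ (-α) := by
      rw [← Real.rpow_neg_one]
      exact Real.rpow_le_rpow_of_exponent_ge hx (hxr.le.trans hr11) (by linarith)
    have h4 : K ≤ a * c⁻¹ := by
      have h5 := hpow (1 / 2) (by linarith) K (by linarith) (by linarith)
      have h6 : c ^ (1 / 2 : ℝ) * a ≥ c := by
        rw [ha, ← Real.rpow_add hc]
        calc c = c ^ (1:ℝ) := (Real.rpow_one c).symm
          _ ≤ _ := Real.rpow_le_rpow_of_exponent_ge hc hc1 (by linarith)
      rw [← div_eq_mul_inv, le_div_iff₀ hc]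
      calc K * c ≤ K * (c ^ (1 / 2 : ℝ) * a) := by gcongr
        _ = K * c ^ (1 / 2 : ℝ) * a := by ring
        _ ≤ 1 * a := by gcongr
        _ = a := one_mul _
    calc K / x = K * x⁻¹ := div_eq_mul_inv _ _
      _ ≤ a * c⁻¹ * x ^ (-α) := by gcongr
      _ = (a * x ^ (-α) + 0) * c⁻¹ := by ring
      _ ≤ (a * x ^ (-α) + b * x ^ (2 - 2 * α)) * max 1 ((r₀ / x) ^ P) := by
          have h5 : 0 ≤ b * x ^ (2 - 2 * α) := by positivity
          gcongr
          exact h2.trans (le_max_right _ _)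
      _ = B x := by rw [hB, boundProfile]
  -- the bound reproduces itself
  have hself : ∀ x, r₁ ≤ x → x ≤ 1 → K * (c ^ (-δ)) ^ 3
      * derivScale η T B c (B (min (Real.exp σ - 1) 1)) x ≤ B (2 * x) := by
    intro x hxr hx1
    rw [← hs, ← hp, ← hl]
    have hx0 : 0 < x := hr1.trans_le hxr
    have hS := sqrt_mul_rpow_le hc hc1 hε hα hρ (hr₁ ▸ hxr)
    have hAnn := hBnn (x / G) (by positivity)
    have h1 := inv_mul_errorScale_le (k := 2 * c ^ (ε / 2)) hc (hscx x hxr) hx1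
      (le_timeScale η hx1) hAnn hp0 (hp1.trans hk1) (hsq x hx0) (hS.trans (by linarith))
      (by rw [hQ' x hx0]; exact hQ x hxr) hk1
    rw [hQ' x hx0] at h1
    have hA2 : B (x / G) ≤ D * B (2 * x) := by
      have h2 := hBdiv (2 * x) (2 * G) (by positivity) (by linarith)
      rwa [← hD, mul_div_mul_left _ _ two_ne_zero] at h2
    have h4 : a * x ^ (-α) + b * x ^ (2 - 2 * α) ≤ 4 * B (2 * x) :=
      hB ▸ le_four_mul_boundProfile ha0 hb0 hα' hx0
    have hB2 : 0 ≤ B (2 * x) := hBnn _ (by positivity)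
    have hl8 : 64 * (K * D) * (l ^ 3 * c ^ (ε / 8)) ≤ 1 := by
      rw [hlp]
      exact hpow _ (by rw [hδ]; push_cast; linarith) _ (by positivity) hM1
    have hl3 : 0 < l ^ 3 := by positivity
    have hKl : 64 * K * l ^ 3 * c ^ (ε / 8) ≤ 1 := by
      refine le_trans ?_ hl8
      calc 64 * K * l ^ 3 * c ^ (ε / 8) = 64 * (K * 1) * (l ^ 3 * c ^ (ε / 8)) := by ring
        _ ≤ 64 * (K * D) * (l ^ 3 * c ^ (ε / 8)) := by gcongr
    have t1 : K * l ^ 3 * (4 * (√c * x ^ (-α))) ≤ 1 / 16 * (a * x ^ (-α)) := by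
      have e : √c = c ^ (ε / 8) * a := by
        rw [ha, ← Real.rpow_add hc, Real.sqrt_eq_rpow]
        ring_nf
      have h5 : 0 ≤ a * x ^ (-α) := by positivity
      calc K * l ^ 3 * (4 * (√c * x ^ (-α)))
          = 1 / 16 * (64 * K * l ^ 3 * c ^ (ε / 8)) * (a * x ^ (-α)) := by
            rw [e]
            ring
        _ ≤ 1 / 16 * 1 * (a * x ^ (-α)) := by gcongr
        _ = _ := by ring
    have t2 : K * l ^ 3 * (p * x ^ (2 - 2 * α) * p) ≤ 1 / 16 * (b * x ^ (2 - 2 * α)) := by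
      calc K * l ^ 3 * (p * x ^ (2 - 2 * α) * p) = K * l ^ 3 * p ^ 2 * x ^ (2 - 2 * α) := by ring
        _ ≤ K * l ^ 3 * (4 * (c ^ (ε / 8) * b)) * x ^ (2 - 2 * α) := by gcongr
        _ = 1 / 16 * (64 * K * l ^ 3 * c ^ (ε / 8)) * (b * x ^ (2 - 2 * α)) := by ring
        _ ≤ 1 / 16 * 1 * (b * x ^ (2 - 2 * α)) := by gcongr
        _ = _ := by ring
    have t3 : K * l ^ 3 * (6 * (2 * c ^ (ε / 2)) * B (x / G)) ≤ 12 / 64 * B (2 * x) := by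
      have h5 : c ^ (ε / 2) ≤ c ^ (ε / 8) :=
        Real.rpow_le_rpow_of_exponent_ge hc hc1 (by linarith)
      calc K * l ^ 3 * (6 * (2 * c ^ (ε / 2)) * B (x / G))
          ≤ K * l ^ 3 * (6 * (2 * c ^ (ε / 8)) * (D * B (2 * x))) := by gcongr
        _ = 12 / 64 * (64 * (K * D) * (l ^ 3 * c ^ (ε / 8))) * B (2 * x) := by ring
        _ ≤ 12 / 64 * 1 * B (2 * x) := by gcongr
        _ = _ := by ring
    calc K * l ^ 3 * derivScale η T B c p x
        ≤ K * l ^ 3 * (4 * (√c * x ^ (-α)) + p * x ^ (2 - 2 * α) * p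
          + 6 * (2 * c ^ (ε / 2)) * B (x / G)) := by
          rw [derivScale, ← hG]
          gcongr
      _ = K * l ^ 3 * (4 * (√c * x ^ (-α))) + K * l ^ 3 * (p * x ^ (2 - 2 * α) * p)
          + K * l ^ 3 * (6 * (2 * c ^ (ε / 2)) * B (x / G)) := by ring
      _ ≤ 1 / 16 * (a * x ^ (-α)) + 1 / 16 * (b * x ^ (2 - 2 * α)) + 12 / 64 * B (2 * x) := by
          linarith
      _ ≤ B (2 * x) := by linarith
  obtain ⟨Ω₁, hΩm, hΩ, hb1⟩ := hev (r₁ := r₁) (B := B) hF hc1 hreg hσ0 hA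
    (hcc.trans (min_le_left _ _)) hBanti hBnn (by rw [← hs, ← hp]; exact hpp₀) hsr hr11
    hsmallB hself
  refine ⟨Ω₁, hΩm, hΩ, fun ω hω n hn x hx hx1 z hz => ?_⟩
  obtain ⟨x', hx'1, hx'2, hx'3, hdev⟩ := hb1 ω hω n hn x (hr10.trans hx) hx1
  refine (hdev z hz).trans ?_
  rw [← hs, ← hp, ← hl]
  have hx0 : 0 < x := hr0.trans_le hx
  have hx'0 : 0 < x' := hr1.trans_le hx'1
  have hx'11 : x' ≤ 1 := hx'2.trans hx1
  have hBx : B x = a * x ^ (-α) + b * x ^ (2 - 2 * α) := by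
    rw [hB, boundProfile_eq hr0.le hx0 hx]
  have hx'G : x / (2 * G) ≤ x' / G := by
    rw [div_le_div_iff₀ (by positivity) hG0]
    calc x * G ≤ 2 * x' * G := by gcongr
      _ = _ := by ring
  have hA1 : B (x' / G) ≤ 1 := by
    have h1 : B x ≤ 2 * c ^ (ε / 2) := by
      rw [hBx, ha, hb]
      exact profile_le hc hc1 hε hα hρ (hr₀ ▸ hrs) (hr₀ ▸ hx)
    calc B (x' / G) ≤ B (x / (2 * G)) := hBanti _ _ (by positivity) hx'G
      _ ≤ D * B x := hD ▸ hBdiv _ _ hx0 (by linarith)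
      _ ≤ D * (2 * c ^ (ε / 2)) := by gcongr
      _ = 2 * D * c ^ (ε / 2) := by ring
      _ ≤ 1 := hpow _ (by linarith) _ (by positivity) (by linarith)
  have hS1 : √c * x' ^ (-α) ≤ 1 :=
    (sqrt_mul_rpow_le hc hc1 hε hα hρ (hr₁ ▸ hx'1)).trans (by linarith)
  have hxα : x' ^ (1 - α) ≤ 2 * x ^ (1 - α) := by
    calc x' ^ (1 - α) ≤ (x / 2) ^ (1 - α) :=
          Real.rpow_le_rpow_of_nonpos (by positivity) (by linarith) (by linarith)
      _ = 2 ^ (α - 1) * x ^ (1 - α) := by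
          rw [Real.div_rpow hx0.le zero_le_two, div_eq_mul_inv, ← Real.rpow_neg zero_le_two,
            mul_comm]
          ring_nf
      _ ≤ 2 ^ (1:ℝ) * x ^ (1 - α) := by
          gcongr
          · norm_num
          · linarith
      _ = _ := by rw [Real.rpow_one]
  -- the bound on `f'`, summed over the contours, multiplies `p` in the drift
  have hW : ∑ i ∈ Finset.range n, c * B (contourGap η T x' (c * i) / 2)
      ≤ N * l * (a * x' ^ (3 - 3 * α) + b * x' ^ (2 - 2 * α)) := by
    have hsum' := hsum c x' n hc hc1 (hcs.trans (hscx x' hx'1)) hx'11 hn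
    rw [hτx x' hx'0, ← hl] at hsum'
    rw [hN, hB, hG]
    exact sum_boundProfile_le hη hT hα hα' ha0 hb0 hr0 hc hx'0 (hx.trans hx'3) hn hH hl1 hsum'
  obtain ⟨W, hWdef⟩ : ∃ W, W = ∑ i ∈ Finset.range n, c * B (contourGap η T x' (c * i) / 2) :=
    ⟨_, rfl⟩
  rw [← hWdef] at hW
  have hpW : p * W ≤ N * l * (a * x' ^ (1 - α) + b) := by
    have h1 := (hQ x' hx'1).trans hk1
    have hxx : x' ^ (1 - α) * x' ^ (2 - 2 * α) = x' ^ (3 - 3 * α) := by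
      rw [← Real.rpow_add hx'0]
      ring_nf
    calc p * W ≤ p * (N * l * (a * x' ^ (3 - 3 * α) + b * x' ^ (2 - 2 * α))) := by gcongr
      _ = N * l * (a * x' ^ (1 - α) + b) * (p * x' ^ (2 - 2 * α)) := by
          rw [← hxx]
          ring
      _ ≤ N * l * (a * x' ^ (1 - α) + b) * 1 := by gcongr
      _ = _ := mul_one _
  have hval := errorScale_one_le (W := W) hc (hscx x' hx'1) hx'11 (le_timeScale η hx'11)
    (hBnn (x' / G) (by positivity)) hA1 hp0 (hsq x' hx'0) hS1
    (by rw [hQ' x' hx'0]; exact (hQ x' hx'1).trans hk1)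
  have hca : √c ≤ a := by
    rw [ha, Real.sqrt_eq_rpow]
    exact Real.rpow_le_rpow_of_exponent_ge hc hc1 (by linarith)
  have hxS : x' * (√c * x' ^ (-α)) ≤ a * x' ^ (1 - α) := by
    have e : x' * (√c * x' ^ (-α)) = √c * x' ^ (1 - α) := by
      rw [sub_eq_add_neg, Real.rpow_add hx'0, Real.rpow_one]
      ring
    rw [e]
    gcongr
  have hc81 : c ^ (ε / 8) ≤ 1 := Real.rpow_le_one hc.le hc1 (by linarith)
  have hp2' : p ^ 2 ≤ 4 * b := hp2.trans (by linarith [mul_le_of_le_one_left hb0 hc81])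
  have htot : valueScale η T B c p n x' ≤ (16 + N) * l * (a * x' ^ (1 - α) + b) := by
    have h1 : 16 * (a * x' ^ (1 - α) + b) ≤ 16 * l * (a * x' ^ (1 - α) + b) := by
      have : 0 ≤ a * x' ^ (1 - α) + b := by positivity
      exact mul_le_mul_of_nonneg_right (by linarith) this
    have h2 : 0 ≤ a * x' ^ (1 - α) := by positivity
    rw [valueScale, ← hG, ← hWdef]
    calc _ ≤ 8 * (a * x' ^ (1 - α)) + 2 * (4 * b) + N * l * (a * x' ^ (1 - α) + b) := by
          refine hval.trans ?_
          gcongr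
      _ ≤ 16 * l * (a * x' ^ (1 - α) + b) + N * l * (a * x' ^ (1 - α) + b) := by linarith
      _ = _ := by ring
  have hla : l ^ 4 * a ≤ c ^ (1 / 2 - ε) := by
    rw [ha, hlp]
    exact Real.rpow_le_rpow_of_exponent_ge hc hc1 (by rw [hδ]; push_cast; linarith)
  have hlb : l ^ 4 * b ≤ c ^ (1 - ε) * s ^ (-(2 * α)) := by
    rw [hb, ← mul_assoc, hlp]
    refine mul_le_mul_of_nonneg_right ?_ (by positivity)
    exact Real.rpow_le_rpow_of_exponent_ge hc hc1 (by rw [hδ]; push_cast; linarith)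
  calc K * l ^ 3 * valueScale η T B c p n x'
      ≤ K * l ^ 3 * ((16 + N) * l * (a * x' ^ (1 - α) + b)) := by gcongr
    _ = K * (16 + N) * (l ^ 4 * a * x' ^ (1 - α) + l ^ 4 * b) := by ring
    _ ≤ K * (16 + N) * (c ^ (1 / 2 - ε) * (2 * x ^ (1 - α))
          + 2 * (c ^ (1 - ε) * s ^ (-(2 * α)))) := by
        have h0 : 0 ≤ c ^ (1 - ε) * s ^ (-(2 * α)) := by positivity
        have h1 : l ^ 4 * b ≤ 2 * (c ^ (1 - ε) * s ^ (-(2 * α))) := by linarith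
        gcongr
    _ = _ := by ring

/-- The bound on the deviation for all capacities. If the capacity is bounded below, the
deterministic bound suffices. -/
theorem exists_forall_norm_deviation_le {η Λ T α ρ ε : ℝ} (hη : η ≤ 1) (hΛ : 0 ≤ Λ) (hT : 0 ≤ T)
    (m : ℕ) (hα : 1 ≤ α) (hα' : α ≤ 3 / 2) (hρ : ρ * (3 * α - 2) = 1 / 2) (hε : 0 < ε)
    (hερ : ε < ρ) (hτ : ∀ x : ℝ, 0 < x → timeScale η x = x ^ (3 - 2 * α)) :
    ∃ C, ∀ {Ω : Type u} [MeasurableSpace Ω] {μ : Measure Ω} [IsProbabilityMeasure μ]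
      {F : ℂ → ℂ} {c σ : ℝ} {Θ : ℕ → Ω → ℝ},
      IsBasicMap F c → c ≤ 1 → HasRegularity F c Λ → 1 + c ^ (ρ - ε) ≤ Real.exp σ →
      IsALE μ F η σ Θ →
      ∃ Ω₁ : Set Ω, MeasurableSet Ω₁ ∧ 1 - c ^ m < μ.real Ω₁ ∧ ∀ ω ∈ Ω₁, ∀ n : ℕ,
        (n : ℝ) ≤ T / c → ∀ z : ℂ, 1 + c ^ (ρ - ε) ≤ ‖z‖ →
          ‖deviation F c (fun k => Θ k ω) n z‖ ≤ C * (c ^ (1 / 2 - ε)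
            * (‖z‖ / (‖z‖ - 1)) ^ (α - 1) + c ^ (1 - ε) * (Real.exp σ - 1) ^ (-(2 * α))) := by
  obtain ⟨C, c₁, hc₁, hev⟩ :=
    exists_event_norm_le.{u} hη hΛ hT m hα hα' hρ hε hερ hτ
  obtain ⟨M, hM⟩ : ∃ M, M = |aprioriConst Λ T| := ⟨_, rfl⟩
  have hM0 : 0 ≤ M := hM ▸ abs_nonneg _
  refine ⟨2 * |C| + M / c₁, ?_⟩
  intro Ω _ μ _ F c σ Θ hF hc1 hreg hσ hA
  have hc := hF.capacity_pos
  have hr : 0 < c ^ (ρ - ε) := Real.rpow_pos_of_pos hc _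
  have hs : 0 < Real.exp σ - 1 := by linarith
  have hn' : ∀ n : ℕ, (n : ℝ) ≤ T / c → c * n ≤ T := fun n hn => by
    rw [le_div_iff₀ hc] at hn
    linarith
  have hratio : ∀ z : ℂ, 1 + c ^ (ρ - ε) ≤ ‖z‖ → 1 ≤ ‖z‖ / (‖z‖ - 1) := fun z hz =>
    (one_le_div (by linarith)).2 (by linarith)
  rcases le_total c c₁ with hcc | hcc
  · obtain ⟨Ω₁, hΩm, hΩ, h⟩ := hev hF hc1 hreg hσ hA hcc
    refine ⟨Ω₁, hΩm, hΩ, fun ω hω n hn z hz => ?_⟩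
    have hr1 : c ^ (ρ - ε) ≤ 1 := Real.rpow_le_one hc.le hc1 (by linarith)
    obtain ⟨x, hx⟩ : ∃ x, x = min (‖z‖ - 1) 1 := ⟨_, rfl⟩
    have hrx : c ^ (ρ - ε) ≤ x := hx ▸ le_min (by linarith) hr1
    have hx0 : 0 < x := hr.trans_le hrx
    have h1 := h ω hω n (hn' n hn) x hrx (hx ▸ min_le_right _ _) z
      (by linarith [hx ▸ min_le_left (‖z‖ - 1) 1])
    have hz1 : 0 < ‖z‖ - 1 := by linarith
    have h2 : x ^ (1 - α) ≤ (‖z‖ / (‖z‖ - 1)) ^ (α - 1) := by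
      have h3 : x⁻¹ ≤ ‖z‖ / (‖z‖ - 1) := by
        rcases min_choice (‖z‖ - 1) 1 with h4 | h4
        · rw [hx, h4, inv_eq_one_div]
          gcongr
          linarith
        · rw [hx, h4, inv_one]
          exact hratio z hz
      calc x ^ (1 - α) = x⁻¹ ^ (α - 1) := by
            rw [Real.inv_rpow hx0.le, ← Real.rpow_neg hx0.le, neg_sub]
        _ ≤ _ := by gcongr
    have h5 : min (Real.exp σ - 1) 1 ^ (-(2 * α)) ≤ (Real.exp σ - 1) ^ (-(2 * α)) + 1 := by
      have h6 : 0 ≤ (Real.exp σ - 1) ^ (-(2 * α)) := by positivity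
      rcases min_choice (Real.exp σ - 1) 1 with h4 | h4
      · rw [h4]
        linarith
      · rw [h4, Real.one_rpow]
        linarith
    have h7 : c ^ (1 - ε) ≤ c ^ (1 / 2 - ε) * (‖z‖ / (‖z‖ - 1)) ^ (α - 1) := by
      refine (Real.rpow_le_rpow_of_exponent_ge hc hc1 (by linarith : 1 / 2 - ε ≤ 1 - ε)).trans ?_
      exact le_mul_of_one_le_right (by positivity)
        (Real.one_le_rpow (hratio z hz) (by linarith))
    have h8 : 0 ≤ c ^ (1 - ε) * (Real.exp σ - 1) ^ (-(2 * α)) := by positivity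
    have h9 : 0 ≤ c ^ (1 / 2 - ε) * (‖z‖ / (‖z‖ - 1)) ^ (α - 1) := by
      have := zero_le_one.trans (hratio z hz)
      positivity
    refine h1.trans ?_
    calc _ ≤ |C| * (c ^ (1 / 2 - ε) * (‖z‖ / (‖z‖ - 1)) ^ (α - 1)
          + c ^ (1 - ε) * ((Real.exp σ - 1) ^ (-(2 * α)) + 1)) := by
          gcongr
          exact le_abs_self C
      _ ≤ |C| * (2 * (c ^ (1 / 2 - ε) * (‖z‖ / (‖z‖ - 1)) ^ (α - 1)
          + c ^ (1 - ε) * (Real.exp σ - 1) ^ (-(2 * α)))) := by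
          refine mul_le_mul_of_nonneg_left ?_ (abs_nonneg C)
          linarith
      _ ≤ _ := by
          have : 0 ≤ M / c₁ := by positivity
          rw [← mul_assoc, mul_comm |C| 2]
          exact mul_le_mul_of_nonneg_right (by linarith) (by linarith)
  · refine ⟨Set.univ, MeasurableSet.univ, ?_, fun ω _ n hn z hz => ?_⟩
    · rw [probReal_univ]
      linarith [pow_pos hc m]
    obtain ⟨L, hL⟩ := hreg.exists_logBranch hF hc1 hΛ
    have h1 := norm_deviation_le hF hc1 hΛ hL (fun k => Θ k ω) (hn' n hn) (z := z)
      (by rw [mem_exteriorDisk]; linarith)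
    have h2 : c₁ ≤ c ^ (1 / 2 - ε) * (‖z‖ / (‖z‖ - 1)) ^ (α - 1) := by
      have h3 : c ≤ c ^ (1 / 2 - ε) := by
        calc c = c ^ (1:ℝ) := (Real.rpow_one c).symm
          _ ≤ _ := Real.rpow_le_rpow_of_exponent_ge hc hc1 (by linarith)
      exact (hcc.trans h3).trans (le_mul_of_one_le_right (by positivity)
        (Real.one_le_rpow (hratio z hz) (by linarith)))
    have h4 : 0 ≤ c ^ (1 - ε) * (Real.exp σ - 1) ^ (-(2 * α)) := by positivity
    calc _ ≤ M := h1.trans (hM ▸ le_abs_self _)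
      _ = M / c₁ * c₁ := by field_simp
      _ ≤ (2 * |C| + M / c₁) * (c ^ (1 / 2 - ε) * (‖z‖ / (‖z‖ - 1)) ^ (α - 1)
          + c ^ (1 - ε) * (Real.exp σ - 1) ^ (-(2 * α))) := by
          have h5 : 0 ≤ |C| := abs_nonneg C
          gcongr <;> linarith

end ALE

end

theorem theorem1p1 (Λ : ℝ) (hΛ : 0 ≤ Λ) (m : ℕ) (T : ℝ) (hT : 0 ≤ T) :
    (∀ η : ℝ, η < 1 → ∀ ε : ℝ, 0 < ε → ε < 1 / 2 →
      ∃ C : ℝ, ∀ (Ω : Type u) [MeasurableSpace Ω] (μ : Measure Ω) [IsProbabilityMeasure μ]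
        (F : ℂ → ℂ) (c σ : ℝ) (Θ : ℕ → Ω → ℝ),
        ALE.IsBasicMap F c → c ≤ 1 → ALE.HasRegularity F c Λ →
        0 ≤ σ → 1 + c ^ (1 / 2 - ε) ≤ Real.exp σ →
        ALE.IsALE μ F η σ Θ →
        ∃ Ω₁ : Set Ω, MeasurableSet Ω₁ ∧ 1 - c ^ m < μ.real Ω₁ ∧
          ∀ ω ∈ Ω₁, ∀ n : ℕ, (n : ℝ) ≤ T / c → ∀ z : ℂ, 1 + c ^ (1 / 2 - ε) ≤ ‖z‖ →
            ‖ALE.clusterMap F (fun k => Θ k ω) n z - (Real.exp (c * n) : ℝ) * z‖ ≤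
              C * (c ^ (1 / 2 - ε) + c ^ (1 - ε) / (Real.exp σ - 1) ^ 2)) ∧
    (∀ ε : ℝ, 0 < ε → ε < 1 / 5 →
      ∃ C : ℝ, ∀ (Ω : Type u) [MeasurableSpace Ω] (μ : Measure Ω) [IsProbabilityMeasure μ]
        (F : ℂ → ℂ) (c σ : ℝ) (Θ : ℕ → Ω → ℝ),
        ALE.IsBasicMap F c → c ≤ 1 → ALE.HasRegularity F c Λ →
        0 ≤ σ → 1 + c ^ (1 / 5 - ε) ≤ Real.exp σ →
        ALE.IsALE μ F 1 σ Θ →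
        ∃ Ω₁ : Set Ω, MeasurableSet Ω₁ ∧ 1 - c ^ m < μ.real Ω₁ ∧
          ∀ ω ∈ Ω₁, ∀ n : ℕ, (n : ℝ) ≤ T / c → ∀ z : ℂ, 1 + c ^ (1 / 5 - ε) ≤ ‖z‖ →
            ‖ALE.clusterMap F (fun k => Θ k ω) n z - (Real.exp (c * n) : ℝ) * z‖ ≤
              C * (c ^ (1 / 2 - ε) * (‖z‖ / (‖z‖ - 1)) ^ (1 / 2 : ℝ)
                + c ^ (1 - ε) / (Real.exp σ - 1) ^ 3)) := by
  refine ⟨fun η hη ε hε hε2 => ?_, fun ε hε hε5 => ?_⟩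
  · obtain ⟨C, hC⟩ := ALE.exists_forall_norm_deviation_le.{u} (α := 1) (ρ := 1 / 2) hη.le hΛ hT m
      le_rfl (by norm_num) (by norm_num) hε hε2 fun x _ => by
        rw [ALE.timeScale, if_neg hη.ne]
        norm_num
    refine ⟨C, fun Ω _ μ _ F c σ Θ hF hc1 hreg _ hσ hA => ?_⟩
    obtain ⟨Ω₁, hm, hp, h⟩ := hC hF hc1 hreg hσ hA
    refine ⟨Ω₁, hm, hp, fun ω hω n hn z hz => (h ω hω n hn z hz).trans_eq ?_⟩
    have hs : 0 ≤ Real.exp σ - 1 := by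
      linarith [Real.rpow_nonneg hF.capacity_pos.le (1 / 2 - ε)]
    have e : (Real.exp σ - 1) ^ (-(2 * 1 : ℝ)) = ((Real.exp σ - 1) ^ 2)⁻¹ := by
      rw [Real.rpow_neg hs, mul_one, Real.rpow_two]
    rw [e, sub_self, Real.rpow_zero, mul_one, div_eq_mul_inv (c ^ (1 - ε))]
  · obtain ⟨C, hC⟩ := ALE.exists_forall_norm_deviation_le.{u} (η := 1) (α := 3 / 2) (ρ := 1 / 5)
      le_rfl hΛ hT m (by norm_num) le_rfl (by norm_num) hε hε5 fun x _ => by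
        rw [ALE.timeScale, if_pos rfl]
        norm_num
    refine ⟨C, fun Ω _ μ _ F c σ Θ hF hc1 hreg _ hσ hA => ?_⟩
    obtain ⟨Ω₁, hm, hp, h⟩ := hC hF hc1 hreg hσ hA
    refine ⟨Ω₁, hm, hp, fun ω hω n hn z hz => (h ω hω n hn z hz).trans_eq ?_⟩
    have hs : 0 ≤ Real.exp σ - 1 := by
      linarith [Real.rpow_nonneg hF.capacity_pos.le (1 / 5 - ε)]
    have e : (Real.exp σ - 1) ^ (-(2 * (3 / 2) : ℝ)) = ((Real.exp σ - 1) ^ 3)⁻¹ := by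
      rw [Real.rpow_neg hs, ← Real.rpow_natCast (Real.exp σ - 1) 3]
      norm_num
    have e2 : (3 / 2 - 1 : ℝ) = 1 / 2 := by norm_num
    rw [e, e2, div_eq_mul_inv (c ^ (1 - ε))]
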